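/- Throughout $k$ is a field of characteristic $3$; superspaces are $\mathbb{Z}/2$-graded vector spaces, $|x|\in\{\bar 0,\bar 1\}$ is the parity of a homogeneous element, and all formulas below are for homogeneous elements and extended (multi)linearly. A Lie superalgebra is a superspace with an even superanticommutative bracket that satisfies the graded Jacobi identity and (as $\operatorname{char} k=3$) $[x,[x,x]]=0$ for odd $x$. **Composition superalgebras.** A quadratic superform on $A=A_{\bar 0}\oplus A_{\bar 1}$ is a pair $(q_{\bar 0},b)$, where $q_{\bar 0}$ is a quadratic form on $A_{\bar 0}$ and $b$ is an even supersymmetric bilinear form on $A$ whose restriction to $A_{\bar 0}$ is the polar form of $q_{\bar 0}$; it is regular if $b$ is nondegenerate on $A_{\bar 0}$ and on $A_{\bar 1}$. A composition superalgebra is a superalgebra with a regular quadratic superform such that, for $x\in A_{\bar 0}$, $q_{\bar 0}(xy)=q_{\bar 0}(x)q_{\bar 0}(y)$ ($y\in A_{\bar 0}$), $b(xy,xz)=q_{\bar 0}(x)b(y,z)=b(yx,zx)$, and $$b(xy,zt)+(-1)^{|x||y|+|x||z|+|y||z|}b(zy,xt)=(-1)^{|y||z|}b(x,z)b(y,t)$$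 in general. A Hurwitz superalgebra is a nonzero unital composition superalgebra $C$; put $\bar x=b(x,1)1-x$. Its para-Hurwitz superalgebra is $C$ with the same norm and the product $x\bullet y=\bar x\bar y$. Let $V$ be a two-dimensional vector space with a nonzero alternating form $\langle\cdot|\cdot\rangle$, considered as an odd superspace. Then $B(1,2)=k1\oplus V$, with $uv=\langle u|v\rangle 1$ for $u,v\in V$, $q_{\bar 0}(1)=1$ and $b(u,v)=\langle u|v\rangle$, is a Hurwitz superalgebra, and $S_{1,2}$ denotes its para-Hurwitz superalgebra. **The Lie superalgebra $\mathfrak g(S,S')$.** For a para-Hurwitz superalgebra $S$, let $\mathfrak{tri}(S)$ be the space spanned by the homogeneous triples $(d_0,d_1,d_2)\in\mathfrak{osp}(S,b)^3$ with $d_0(x\bullet y)=d_1(x)\bullet y+(-1)^{|d||x|}x\bullet d_2(y)$, with componentwise supercommutator, and let $\theta(d_0,d_1,d_2)=(d_2,d_0,d_1)$ and $$t_{x,y}=\bigl(\sigma_{x,y},\ \tfrac12 b(x,y)\mathrm{id}-r_xl_y,\ \tfrac12 b(x,y)\mathrm{id}-l_xr_y\bigr),$$ where $\sigma_{x,y}(z)=(-1)^{|y||z|}b(x,z)y-(-1)^{|x|(|y|+|z|)}b(y,z)x$,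 $l_x(y)=x\bullet y$ and $r_x(y)=(-1)^{|x||y|}y\bullet x$. For para-Hurwitz superalgebras $S,S'$ set $$\mathfrak g(S,S')=(\mathfrak{tri}(S)\oplus\mathfrak{tri}(S'))\oplus\bigoplus_{i=0}^2\iota_i(S\otimes S'),$$ with the superanticommutative bracket such that $\mathfrak{tri}(S)\oplus\mathfrak{tri}(S')$ is a direct sum of subalgebras, and, with indices modulo $3$, * $[(d_0,d_1,d_2),\iota_i(x\otimes x')]=\iota_i(d_i(x)\otimes x')$ and $[(d_0',d_1',d_2'),\iota_i(x\otimes x')]=(-1)^{|d'||x|}\iota_i(x\otimes d_i'(x'))$, * $[\iota_i(x\otimes x'),\iota_{i+1}(y\otimes y')]=(-1)^{|x'||y|}\iota_{i+2}((x\bullet y)\otimes(x'\bullet y'))$, * $[\iota_i(x\otimes x'),\iota_i(y\otimes y')]=(-1)^{|x||x'|+|x||y'|+|y||y'|}b'(x',y')\,\theta^i(t_{x,y})+(-1)^{|y||x'|}b(x,y)\,\theta'^i(t'_{x',y'})$. **Orthosymplectic triple systems.** An orthosymplectic triple system is a superspace $T$ with a nonzero even supersymmetric bilinear form $(\cdot|\cdot)$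 and an even trilinear product $[xyz]$ such that $$[xyz]+(-1)^{|x||y|}[yxz]=0,$$ $$[xyz]+(-1)^{|y||z|}[xzy]=(x|y)z+(-1)^{|y||z|}(x|z)y-2(y|z)x,$$ $$[xy[uvw]]=[[xyu]vw]+(-1)^{(|x|+|y|)|u|}[u[xyv]w]+(-1)^{(|x|+|y|)(|u|+|v|)}[uv[xyw]],$$ $$([xyu]|v)+(-1)^{(|x|+|y|)|u|}(u|[xyv])=0.$$ It is simple if $[TTT]\neq0$ and its only graded ideals are $0$ and $T$. For a Lie subsuperalgebra $\mathfrak s$ of the superalgebra $\mathfrak{der}\,T\subseteq\mathfrak{gl}(T)$ of superderivations that contains all $d_{x,y}=[xy\,\cdot]$, let $\mathfrak g(T,\mathfrak s)=\mathfrak g(0)\oplus\mathfrak g(1)$ with $\mathfrak g(0)=\mathfrak{sp}(V)\oplus\mathfrak s$ and $\mathfrak g(1)=V\otimes T$ ($V$ is odd), with the superanticommutative bracket for which $\mathfrak g(0)$ is the direct sum of its two subalgebras, and $[s,v\otimes x]=s(v)\otimes x$ for $s\in\mathfrak{sp}(V)$, $[d,v\otimes x]=(-1)^{|d|}v\otimes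 d(x)$ for $d\in\mathfrak s$, and $$[u\otimes x,v\otimes y]=(-1)^{|x|}\bigl(-(x|y)\gamma_{u,v}+\langle u|v\rangle d_{x,y}\bigr),\qquad \gamma_{u,v}=\langle u|\cdot\rangle v+\langle v|\cdot\rangle u.$$ **Theorem.** Let $S$ be a para-Hurwitz superalgebra over a field $k$ of characteristic $3$, let $C$ be the associated Hurwitz superalgebra, and let $J=H_3(C,*)$ be the superspace of hermitian $3\times3$ matrices over $C$, where $(a_{ij})^*=(\bar a_{ji})$, with the product $x\circ y=\frac12(xy+(-1)^{|x||y|}yx)$. Put $L_x(y)=x\circ y$, let $t$ be the trace, let $J_0=\{x\in J: t(x)=0\}$ (which contains $1$), let $\mathfrak{der}\,J$ be the Lie superalgebra of superderivations of $J$, and let $T_J^{os}=J_0/k1$, with the form and the triple product $$(\hat x|\hat y)=t(x\circ y),\qquad [\hat x\hat y\hat z]=\widehat{[L_x,L_y](z)},$$ where $\hat x=x+k1$. Then: 1. $T_J^{os}$ is a simple orthosymplectic triple system. 2. Every element of $\mathfrak{der}\,J$ induces a linear map on $T_J^{os}$; this identifies $\mathfrak{der}\,J$ with a Lie subsuperalgebra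 of $\mathfrak{der}\,T_J^{os}$ that contains all $[\hat x\hat y\,\cdot]$. 3. $\mathfrak g(S_{1,2},S)$ is a Lie superalgebra, and $\mathfrak g(J)=\mathfrak g(T_J^{os},\mathfrak{der}\,J)=(\mathfrak{sp}(V)\oplus\mathfrak{der}\,J)\oplus(V\otimes T_J^{os})$ is a $\mathbb{Z}_2$-graded Lie superalgebra. 4. The Lie superalgebras $\mathfrak g(S_{1,2},S)$ and $\mathfrak g(J)$ are isomorphic. -/

import Mathlib

open scoped TensorProduct

noncomputable section

namespace Supersquare

/-! ### Superspaces -/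

/-- A vector superspace: a `ℤ/2`-graded vector space, the grading being given by its two
complementary projections. The homogeneous components are `part k A 0` and `part k A 1`. -/
class Superspace (k : Type*) (A : Type*) [Field k] [AddCommGroup A] [Module k A] where
  /-- the projection onto the component of parity `i` -/
  proj : ZMod 2 → A →ₗ[k] A
  proj_proj : ∀ (i j : ZMod 2) (x : A), proj i (proj j x) = if i = j then proj j x else 0
  sum_proj : ∀ x : A, proj 0 x + proj 1 x = x

/-- The sign `(-1)^i`. -/
def sgn (k : Type*) [Field k] (i : ZMod 2) : k := if i = 0 then 1 else -1

/-- The component of parity `i` of an element. -/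
def pr (k : Type*) {A : Type*} [Field k] [AddCommGroup A] [Module k A] [Superspace k A]
    (i : ZMod 2) : A →ₗ[k] A := Superspace.proj i

/-- The subspace of homogeneous elements of parity `i`. -/
def part (k : Type*) (A : Type*) [Field k] [AddCommGroup A] [Module k A] [Superspace k A]
    (i : ZMod 2) : Submodule k A := LinearMap.eqLocus (pr k i) LinearMap.id

section Superspaces

variable {k : Type*} [Field k]
variable {A : Type*} [AddCommGroup A] [Module k A] [Superspace k A]
variable {B : Type*} [AddCommGroup B] [Module k B] [Superspace k B]
variable {M : Type*} [AddCommGroup M] [Module k M]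

@[simp] theorem sgn_zero : sgn k 0 = 1 := rfl

@[simp] theorem sgn_one : sgn k 1 = -1 := by simp [sgn]

theorem parity_cases (i : ZMod 2) : i = 0 ∨ i = 1 := by revert i; decide

@[simp] theorem one_add_one : (1 + 1 : ZMod 2) = 0 := by decide

theorem sum_parity (f : ZMod 2 → M) : ∑ i : ZMod 2, f i = f 0 + f 1 := Fin.sum_univ_two f

theorem mem_part {i : ZMod 2} {x : A} : x ∈ part k A i ↔ pr k i x = x := Iff.rfl

theorem pr_pr (i j : ZMod 2) (x : A) : pr k i (pr k j x) = if i = j then pr k j x else 0 :=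
  Superspace.proj_proj i j x

theorem pr_add (x : A) : pr k 0 x + pr k 1 x = x := Superspace.sum_proj x

theorem pr_mem (i : ZMod 2) (x : A) : pr k i x ∈ part k A i := by
  simp [mem_part, pr_pr]

theorem pr_of_mem {j : ZMod 2} {x : A} (hx : x ∈ part k A j) (i : ZMod 2) :
    pr k i x = if i = j then x else 0 := by
  rw [← mem_part.1 hx, pr_pr]

theorem isInternal_part : DirectSum.IsInternal (part k A) := by
  rw [DirectSum.isInternal_submodule_iff_isCompl (i := 0) (j := 1) _ (by decide)
    (by ext i; rcases parity_cases i with rfl | rfl <;> simp)]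
  constructor
  · rw [Submodule.disjoint_def]
    intro x h0 h1
    rw [← mem_part.1 h0, pr_of_mem h1]
    simp
  · rw [codisjoint_iff, eq_top_iff]
    intro x _
    rw [← pr_add (k := k) x]
    exact Submodule.add_mem_sup (pr_mem 0 x) (pr_mem 1 x)

/-- The field itself, purely even. -/
instance instSuperspaceSelf : Superspace k k where
  proj i := if i = 0 then LinearMap.id else 0
  proj_proj i j x := by
    rcases parity_cases i with rfl | rfl <;> rcases parity_cases j with rfl | rfl <;> simp
  sum_proj x := by simp

instance instSuperspaceProd : Superspace k (A × B) where
  proj i := (pr k i).prodMap (pr k i)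
  proj_proj i j x := by ext <;> simp [pr_pr] <;> split_ifs <;> simp
  sum_proj x := by ext <;> simp [pr_add]

instance instSuperspacePi {n : Type*} : Superspace k (n → A) where
  proj i := LinearMap.pi fun m => (pr k i).comp (LinearMap.proj m)
  proj_proj i j x := by ext m; simp [pr_pr]; split_ifs <;> simp
  sum_proj x := by ext m; simp [pr_add]

instance instSuperspaceMatrix {m n : Type*} : Superspace k (Matrix m n A) where
  proj i := (pr k i).mapMatrix
  proj_proj i j x := by ext; simp [pr_pr]; split_ifs <;> simp
  sum_proj x := by ext; simp [pr_add]

/-- The component of parity `i` of a linear map `f` sends each `x` of parity `j` to the component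
of parity `j + i` of `f x`. -/
instance instSuperspaceHom : Superspace k (A →ₗ[k] B) where
  proj i :=
    { toFun := fun f => ∑ j : ZMod 2, pr k (j + i) ∘ₗ f ∘ₗ pr k j
      map_add' := fun f g => by ext x; simp [sum_parity]; abel
      map_smul' := fun c f => by ext x; simp [sum_parity] }
  proj_proj i j f := by
    ext x
    rcases parity_cases i with rfl | rfl <;> rcases parity_cases j with rfl | rfl <;>
      simp [sum_parity, pr_pr]
  sum_proj f := by
    ext x
    have h := congrArg f (pr_add (k := k) x)
    have h0 := pr_add (k := k) (f (pr k 0 x))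
    have h1 := pr_add (k := k) (f (pr k 1 x))
    simp only [map_add] at h
    simp only [LinearMap.coe_mk, AddHom.coe_mk, sum_parity, LinearMap.add_apply,
      LinearMap.comp_apply, add_zero, zero_add, one_add_one]
    rw [← h, ← h0, ← h1]
    simp [pr_pr]
    abel

/-- On `A ⊗ B` parities add up. -/
instance instSuperspaceTensor : Superspace k (A ⊗[k] B) where
  proj i := ∑ j : ZMod 2, TensorProduct.map (pr k j) (pr k (j + i))
  proj_proj i j x := by
    induction x using TensorProduct.induction_on with
    | zero => simp
    | add x y hx hy => rw [map_add, map_add, hx, hy]; split_ifs <;> simp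
    | tmul a b =>
      rcases parity_cases i with rfl | rfl <;> rcases parity_cases j with rfl | rfl <;>
        simp [sum_parity, pr_pr]
  sum_proj x := by
    induction x using TensorProduct.induction_on with
    | zero => simp
    | add x y hx hy => rw [map_add, map_add, add_add_add_comm, hx, hy]
    | tmul a b =>
      conv_rhs => rw [← pr_add (k := k) a, ← pr_add (k := k) b]
      simp [sum_parity, TensorProduct.add_tmul, TensorProduct.tmul_add]
      abel

/-- The grading induced on a graded subspace. -/
@[reducible] def Superspace.restrict (p : Submodule k A) (h : ∀ i, ∀ x ∈ p, pr k i x ∈ p) :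
    Superspace k p where
  proj i := (pr k i).restrict (h i)
  proj_proj i j x := by
    ext
    rcases parity_cases i with rfl | rfl <;> rcases parity_cases j with rfl | rfl <;>
      simp [pr_pr]
  sum_proj x := by ext; simp [pr_add]

/-- The grading induced on the quotient by a graded subspace. -/
@[reducible] def Superspace.quotient (p : Submodule k A) (h : ∀ i, ∀ x ∈ p, pr k i x ∈ p) :
    Superspace k (A ⧸ p) where
  proj i := p.mapQ p (pr k i) (h i)
  proj_proj i j x := by
    obtain ⟨x, rfl⟩ := p.mkQ_surjective x
    rcases parity_cases i with rfl | rfl <;> rcases parity_cases j with rfl | rfl <;>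
      simp [pr_pr]
  sum_proj x := by
    obtain ⟨x, rfl⟩ := p.mkQ_surjective x
    simp [← Submodule.Quotient.mk_add, pr_add]

/-- For a bilinear map `β`, the bilinear map `(y, x) ↦ (-1)^{|x||y|} β(x, y)`. -/
def sflip (β : A →ₗ[k] B →ₗ[k] M) : B →ₗ[k] A →ₗ[k] M :=
  ∑ i : ZMod 2, ∑ j : ZMod 2, sgn k (i * j) • β.flip.compl₁₂ (pr k i) (pr k j)

/-- The supercommutator of linear maps, `[f, g] = fg - (-1)^{|f||g|} gf`. -/
def superComm : (A →ₗ[k] A) →ₗ[k] (A →ₗ[k] A) →ₗ[k] (A →ₗ[k] A) :=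
  LinearMap.mul k (Module.End k A) - sflip (LinearMap.mul k (Module.End k A))

theorem sflip_apply (β : A →ₗ[k] B →ₗ[k] M) {i j : ZMod 2} {x : A} {y : B}
    (hx : x ∈ part k A i) (hy : y ∈ part k B j) : sflip β y x = sgn k (i * j) • β x y := by
  rcases parity_cases i with rfl | rfl <;> rcases parity_cases j with rfl | rfl <;>
    simp [sflip, sum_parity, pr_of_mem hx, pr_of_mem hy]

theorem hom_mem_part {i : ZMod 2} {f : A →ₗ[k] B}
    (h : ∀ j, ∀ x ∈ part k A j, f x ∈ part k B (j + i)) : f ∈ part k (A →ₗ[k] B) i := by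
  rw [mem_part]
  ext x
  change (∑ j : ZMod 2, pr k (j + i) ∘ₗ f ∘ₗ pr k j) x = f x
  rw [sum_parity]
  simp only [LinearMap.add_apply, LinearMap.comp_apply, mem_part.1 (h 0 _ (pr_mem 0 x)),
    mem_part.1 (h 1 _ (pr_mem 1 x)), ← map_add, pr_add]

theorem superComm_apply {i j : ZMod 2} {f g : A →ₗ[k] A} (hf : f ∈ part k (A →ₗ[k] A) i)
    (hg : g ∈ part k (A →ₗ[k] A) j) (x : A) :
    superComm f g x = f (g x) - sgn k (i * j) • g (f x) := by
  rw [superComm, LinearMap.sub_apply, LinearMap.sub_apply, sflip_apply _ hg hf, mul_comm j i]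
  rfl

end Superspaces

/-! ### Lie superalgebras

`L` is a superspace with a bilinear bracket `br`, and `g` is a subspace of `L`. -/

section Lie

variable {k : Type*} [Field k]
variable {L : Type*} [AddCommGroup L] [Module k L] [Superspace k L]
variable {L' : Type*} [AddCommGroup L'] [Module k L'] [Superspace k L']

/-- The graded subspace `g` is a Lie superalgebra under the restriction of the bracket `br`
(over a field of characteristic `3`: the last condition follows from the Jacobi identity only
where `3` is invertible). -/
structure IsLieSuperalgebra (br : L →ₗ[k] L →ₗ[k] L) (g : Submodule k L) : Prop where
  graded : ∀ i, ∀ x ∈ g, pr k i x ∈ g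
  closed : ∀ x ∈ g, ∀ y ∈ g, br x y ∈ g
  parity : ∀ i j, ∀ x ∈ g ⊓ part k L i, ∀ y ∈ g ⊓ part k L j, br x y ∈ part k L (i + j)
  skew : ∀ i j, ∀ x ∈ g ⊓ part k L i, ∀ y ∈ g ⊓ part k L j,
    br x y = -(sgn k (i * j) • br y x)
  jacobi : ∀ i j, ∀ x ∈ g ⊓ part k L i, ∀ y ∈ g ⊓ part k L j, ∀ z ∈ g,
    br x (br y z) = br (br x y) z + sgn k (i * j) • br y (br x z)
  cube : ∀ x ∈ g ⊓ part k L 1, br x (br x x) = 0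

/-- `g` is the direct sum of its graded subspaces `g0` and `g1`, and `g = g0 ⊕ g1` is a
`ℤ/2`-grading of `g` as a Lie superalgebra (a second grading, independent of the parity). -/
structure IsZ2GradedLieSuperalgebra (br : L →ₗ[k] L →ₗ[k] L) (g g0 g1 : Submodule k L) : Prop
    extends IsLieSuperalgebra br g where
  sup_eq : g0 ⊔ g1 = g
  disjoint : Disjoint g0 g1
  graded_zero : ∀ i, ∀ x ∈ g0, pr k i x ∈ g0
  graded_one : ∀ i, ∀ x ∈ g1, pr k i x ∈ g1
  zero_zero : ∀ x ∈ g0, ∀ y ∈ g0, br x y ∈ g0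
  zero_one : ∀ x ∈ g0, ∀ y ∈ g1, br x y ∈ g1
  one_one : ∀ x ∈ g1, ∀ y ∈ g1, br x y ∈ g0

/-- Isomorphisms of Lie superalgebras: bijective even linear maps that preserve the bracket. -/
structure LieSuperIso (br : L →ₗ[k] L →ₗ[k] L) (g : Submodule k L)
    (br' : L' →ₗ[k] L' →ₗ[k] L') (g' : Submodule k L') where
  toEquiv : g ≃ₗ[k] g'
  map_pr : ∀ (i : ZMod 2) (x y : g), (y : L) = pr k i (x : L) →
    (toEquiv y : L') = pr k i (toEquiv x : L')
  map_br : ∀ x y z : g, (z : L) = br x y → (toEquiv z : L') = br' (toEquiv x) (toEquiv y)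

/-- A Lie subsuperalgebra of `𝔤𝔩(A)`: a graded subspace closed under the supercommutator. -/
structure IsLieSubsuperalgebra {A : Type*} [AddCommGroup A] [Module k A] [Superspace k A]
    (s : Submodule k (A →ₗ[k] A)) : Prop where
  graded : ∀ i, ∀ d ∈ s, pr k i d ∈ s
  closed : ∀ d ∈ s, ∀ d' ∈ s, superComm d d' ∈ s

end Lie

/-! ### Composition superalgebras -/

section Composition

variable {k : Type*} [Field k]

/-- A quadratic superform `(q₀, b)`. -/
structure QuadraticSuperform (k A : Type*) [Field k] [AddCommGroup A] [Module k A]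
    [Superspace k A] where
  q0 : QuadraticForm k (part k A 0)
  b : LinearMap.BilinForm k A
  b_even : ∀ i j, i ≠ j → ∀ x ∈ part k A i, ∀ y ∈ part k A j, b x y = 0
  b_supersymm : ∀ i j, ∀ x ∈ part k A i, ∀ y ∈ part k A j, b x y = sgn k (i * j) * b y x
  b_polar : ∀ x y : part k A 0, b x y = q0 (x + y) - q0 x - q0 y

/-- Regularity (characteristic different from `2`): the polar form of `q₀` and the restriction of
`b` to the odd part are nondegenerate. -/
def QuadraticSuperform.Regular {A : Type*} [AddCommGroup A] [Module k A] [Superspace k A]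
    (q : QuadraticSuperform k A) : Prop :=
  ∀ i, ∀ x ∈ part k A i, (∀ y ∈ part k A i, q.b x y = 0) → x = 0

/-- A composition superalgebra: a superalgebra with a regular quadratic superform (its norm) that
permits composition. -/
structure CompositionSuperalgebra (k A : Type*) [Field k] [AddCommGroup A] [Module k A]
    [Superspace k A] extends QuadraticSuperform k A where
  regular : toQuadraticSuperform.Regular
  mul : A →ₗ[k] A →ₗ[k] A
  mul_mem : ∀ i j, ∀ x ∈ part k A i, ∀ y ∈ part k A j, mul x y ∈ part k A (i + j)
  q0_mul : ∀ x y : part k A 0, q0 ⟨mul x y, mul_mem 0 0 x x.2 y y.2⟩ = q0 x * q0 y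
  b_mul_left : ∀ (x : part k A 0) (y z : A), b (mul x y) (mul x z) = q0 x * b y z
  b_mul_right : ∀ (x : part k A 0) (y z : A), b (mul y x) (mul z x) = q0 x * b y z
  b_mul_mul : ∀ i j l, ∀ x ∈ part k A i, ∀ y ∈ part k A j, ∀ z ∈ part k A l, ∀ t : A,
    b (mul x y) (mul z t) + sgn k (i * j + i * l + j * l) * b (mul z y) (mul x t) =
      sgn k (j * l) * (b x z * b y t)

/-- A Hurwitz superalgebra: a (nonzero) unital composition superalgebra. -/
structure HurwitzSuperalgebra (k A : Type*) [Field k] [AddCommGroup A] [Module k A]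
    [Superspace k A] extends CompositionSuperalgebra k A where
  one : A
  one_mul : ∀ x, mul one x = x
  mul_one : ∀ x, mul x one = x
  one_ne_zero : one ≠ 0

variable {A : Type*} [AddCommGroup A] [Module k A] [Superspace k A]

/-- The standard involution `x̄ = b(x, 1) 1 - x`. -/
def HurwitzSuperalgebra.conj (C : HurwitzSuperalgebra k A) : A →ₗ[k] A :=
  (C.b.flip C.one).smulRight C.one - LinearMap.id

namespace HurwitzSuperalgebra

variable (C : HurwitzSuperalgebra k A)

theorem conj_apply (x : A) : C.conj x = C.b x C.one • C.one - x := rfl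

theorem b_ext {x y : A} (h : ∀ z, C.b x z = C.b y z) : x = y := by
  suffices H : ∀ x, (∀ z, C.b x z = 0) → x = 0 by
    rw [← sub_eq_zero]; exact H _ fun z => by simp [h]
  intro x h
  have key : ∀ i, pr k i x = 0 := fun i => C.regular i _ (pr_mem i x) fun y hy => by
    have := h y
    rw [← pr_add (k := k) x, map_add, LinearMap.add_apply] at this
    rcases parity_cases i with rfl | rfl
    · rwa [C.b_even 1 0 (by decide) _ (pr_mem 1 x) y hy, add_zero] at this
    · rwa [C.b_even 0 1 (by decide) _ (pr_mem 0 x) y hy, zero_add] at this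
  rw [← pr_add (k := k) x, key, key, add_zero]

theorem one_mem : C.one ∈ part k A 0 := by
  have h := C.one_mul (pr k 0 C.one)
  have h1 : C.mul (pr k 1 C.one) (pr k 0 C.one) = 0 := by
    have e := congrArg (pr k 1) h
    nth_rewrite 1 [← pr_add (k := k) C.one] at e
    rw [map_add, LinearMap.add_apply, map_add,
      pr_of_mem (C.mul_mem 0 0 _ (pr_mem 0 _) _ (pr_mem 0 _)),
      pr_of_mem (C.mul_mem 1 0 _ (pr_mem 1 _) _ (pr_mem 0 _)), pr_pr] at e
    simpa using e
  have h2 : C.mul (pr k 1 C.one) (pr k 1 C.one) = 0 := by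
    have e := congrArg (pr k 0) (C.one_mul (pr k 1 C.one))
    nth_rewrite 1 [← pr_add (k := k) C.one] at e
    rw [map_add, LinearMap.add_apply, map_add,
      pr_of_mem (C.mul_mem 0 1 _ (pr_mem 0 _) _ (pr_mem 1 _)),
      pr_of_mem (C.mul_mem 1 1 _ (pr_mem 1 _) _ (pr_mem 1 _)), pr_pr] at e
    simpa using e
  have h3 : pr k 1 C.one = 0 := by
    rw [← C.mul_one (pr k 1 C.one)]
    nth_rewrite 2 [← pr_add (k := k) C.one]
    rw [map_add, h1, h2, add_zero]
  have := pr_add (k := k) C.one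
  rwa [h3, add_zero] at this

theorem b_symm_one (x : A) : C.b C.one x = C.b x C.one := by
  have : ∀ i, C.b C.one (pr k i x) = C.b (pr k i x) C.one := fun i => by
    rw [C.b_supersymm 0 i _ C.one_mem _ (pr_mem i x)]; simp
  rw [← pr_add (k := k) x, map_add, map_add, LinearMap.add_apply, this, this]

theorem q0_one : C.q0 ⟨C.one, C.one_mem⟩ = 1 := by
  have h := fun y z => C.b_mul_left ⟨C.one, C.one_mem⟩ y z
  simp only [C.one_mul] at h
  by_contra hne
  have : ∀ y z, C.b y z = 0 := fun y z => by
    have : (C.q0 ⟨C.one, C.one_mem⟩ - 1) * C.b y z = 0 := by linear_combination -(h y z)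
    rcases mul_eq_zero.1 this with h | h
    · exact absurd (sub_eq_zero.1 h) hne
    · exact h
  exact C.one_ne_zero (C.b_ext fun z => by simp [this])

theorem b_one_one : C.b C.one C.one = 2 := by
  have h := C.b_polar ⟨C.one, C.one_mem⟩ ⟨C.one, C.one_mem⟩
  have h2 : C.q0 (⟨C.one, C.one_mem⟩ + ⟨C.one, C.one_mem⟩) =
      4 * C.q0 ⟨C.one, C.one_mem⟩ := by
    rw [← two_smul k, QuadraticMap.map_smul, smul_eq_mul]; norm_num
  rw [h2, q0_one] at h
  rw [h]; norm_num

theorem b_one_odd {i : ZMod 2} {x : A} (hx : x ∈ part k A i) (hi : i ≠ 0) :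
    C.b x C.one = 0 := C.b_even i 0 hi x hx _ C.one_mem

theorem conj_mem {i : ZMod 2} {x : A} (hx : x ∈ part k A i) : C.conj x ∈ part k A i := by
  rw [conj_apply]
  rcases parity_cases i with rfl | rfl
  · exact sub_mem (Submodule.smul_mem _ _ C.one_mem) hx
  · rw [C.b_one_odd hx _root_.one_ne_zero]
    simpa using hx

theorem conj_one : C.conj C.one = C.one := by
  rw [conj_apply, b_one_one, two_smul, add_sub_cancel_right]

theorem b_conj_one (x : A) : C.b (C.conj x) C.one = C.b x C.one := by
  simp [conj_apply, b_one_one]; ring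

theorem conj_conj (x : A) : C.conj (C.conj x) = x := by
  rw [C.conj_apply (C.conj x), b_conj_one, conj_apply, sub_sub_cancel]

theorem b_conj_conj (x y : A) : C.b (C.conj x) (C.conj y) = C.b x y := by
  simp [conj_apply, b_one_one, b_symm_one]; ring

theorem pr_conj (i : ZMod 2) (x : A) : pr k i (C.conj x) = C.conj (pr k i x) := by
  conv_lhs => rw [← pr_add (k := k) x, map_add, map_add,
    pr_of_mem (C.conj_mem (pr_mem 0 x)), pr_of_mem (C.conj_mem (pr_mem 1 x))]
  rcases parity_cases i with rfl | rfl <;> simp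

/-- the adjoint of a left multiplication -/
theorem b_mul_left_adj {i j : ZMod 2} {x y : A} (hx : x ∈ part k A i) (hy : y ∈ part k A j)
    (t : A) : C.b (C.mul x y) t = sgn k (i * j) * C.b y (C.mul (C.conj x) t) := by
  have h := C.b_mul_mul i j 0 x hx y hy C.one C.one_mem t
  simp only [C.one_mul, mul_zero, add_zero, sgn_zero, _root_.one_mul] at h
  rw [conj_apply, map_sub, LinearMap.sub_apply, map_sub, map_smul, LinearMap.smul_apply, map_smul,
    C.one_mul, smul_eq_mul]
  rcases parity_cases i with rfl | rfl
  · simp only [zero_mul, sgn_zero, _root_.one_mul] at h ⊢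
    linear_combination h
  · rw [C.b_one_odd hx _root_.one_ne_zero] at h ⊢
    linear_combination h

/-- the adjoint of a right multiplication -/
theorem b_mul_right_adj {i j l : ZMod 2} {x y z : A} (hx : x ∈ part k A i)
    (hy : y ∈ part k A j) (hz : z ∈ part k A l) :
    C.b (C.mul x y) z = sgn k (j * l) * C.b x (C.mul z (C.conj y)) := by
  have h := C.b_mul_mul i j l x hx y hy z hz C.one
  simp only [C.mul_one] at h
  have h2 := C.b_supersymm (l + j) i _ (C.mul_mem _ _ _ hz _ hy) _ hx
  rw [h2] at h
  rw [conj_apply, map_sub, map_sub, map_smul, map_smul, C.mul_one, smul_eq_mul]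
  rcases parity_cases i with rfl | rfl <;> rcases parity_cases j with rfl | rfl <;>
    rcases parity_cases l with rfl | rfl <;> simp at h ⊢ <;> linear_combination h

theorem conj_mul {i j : ZMod 2} {x y : A} (hx : x ∈ part k A i) (hy : y ∈ part k A j) :
    C.conj (C.mul x y) = sgn k (i * j) • C.mul (C.conj y) (C.conj x) := by
  refine C.b_ext fun t => ?_
  have h1 := fun t => C.b_mul_mul i j 0 x hx y hy C.one C.one_mem t
  have h2 := C.b_mul_mul j i 0 y hy x hx C.one C.one_mem t
  have h3 := C.b_mul_mul i 0 j x hx C.one C.one_mem y hy t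
  have h4 := C.b_supersymm i j x hx y hy
  have h1' := h1 C.one
  have h1 := h1 t
  simp only [C.one_mul, C.mul_one, mul_zero, zero_mul, add_zero, zero_add, sgn_zero,
    _root_.one_mul] at h1 h1' h2 h3
  simp only [conj_apply, map_sub, map_smul, LinearMap.sub_apply, LinearMap.smul_apply,
    C.one_mul, C.mul_one, smul_eq_mul]
  rw [h4] at h3
  rcases parity_cases i with rfl | rfl <;> rcases parity_cases j with rfl | rfl
  all_goals
    first
    | rw [C.b_one_odd hx _root_.one_ne_zero] at *
    | skip
  all_goals
    first
    | rw [C.b_one_odd hy _root_.one_ne_zero] at *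
    | skip
  all_goals
    simp only [mul_zero, zero_mul, sgn_zero, sgn_one, _root_.one_mul, _root_.mul_one,
      zero_sub, neg_mul, C.b_symm_one] at h1 h1' h2 h3 ⊢
    first
    | linear_combination (C.b t C.one) * h1' - h1 - h2 + h3
    | linear_combination (C.b t C.one) * h1' - h1 + h2 + h3

theorem q0_conj (x : part k A 0) : C.q0 ⟨C.conj x, C.conj_mem x.2⟩ = C.q0 x := by
  have e : (⟨C.conj x, C.conj_mem x.2⟩ : part k A 0) =
      C.b x C.one • ⟨C.one, C.one_mem⟩ + -x :=
    Subtype.ext (by simp [conj_apply, sub_eq_add_neg])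
  have h := C.b_polar (C.b x C.one • ⟨C.one, C.one_mem⟩) (-x)
  have h2 : C.q0 (C.b x C.one • ⟨C.one, C.one_mem⟩) = C.b x C.one * C.b x C.one := by
    rw [QuadraticMap.map_smul, q0_one, smul_eq_mul, _root_.mul_one]
  rw [e]
  rw [h2, QuadraticMap.map_neg] at h
  simp [C.b_symm_one] at h
  linear_combination -h

end HurwitzSuperalgebra

/-- The para-Hurwitz superalgebra `C̄`: the same superspace and norm, with the product
`x • y = x̄ ȳ`. -/
def HurwitzSuperalgebra.paraHurwitz (C : HurwitzSuperalgebra k A) :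
    CompositionSuperalgebra k A where
  toQuadraticSuperform := C.toQuadraticSuperform
  regular := C.regular
  mul := C.mul.compl₁₂ C.conj C.conj
  mul_mem i j x hx y hy := C.mul_mem i j _ (C.conj_mem hx) _ (C.conj_mem hy)
  q0_mul x y := by
    rw [← C.q0_conj x, ← C.q0_conj y]
    exact C.q0_mul ⟨_, C.conj_mem x.2⟩ ⟨_, C.conj_mem y.2⟩
  b_mul_left x y z := by
    rw [← C.q0_conj x, ← C.b_conj_conj y z]
    exact C.b_mul_left ⟨_, C.conj_mem x.2⟩ _ _
  b_mul_right x y z := by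
    rw [← C.q0_conj x, ← C.b_conj_conj y z]
    exact C.b_mul_right ⟨_, C.conj_mem x.2⟩ _ _
  b_mul_mul i j l x hx y hy z hz t := by
    have := C.b_mul_mul i j l _ (C.conj_mem hx) _ (C.conj_mem hy) _ (C.conj_mem hz) (C.conj t)
    simpa [C.b_conj_conj] using this

end Composition

/-! ### The superalgebra `B(1,2)` -/

section B12

/-- The vector space `V`, considered as a purely odd superspace. -/
def OddSpace (V : Type*) : Type _ := V

instance instAddCommGroupOddSpace {V : Type*} [AddCommGroup V] : AddCommGroup (OddSpace V) :=
  inferInstanceAs (AddCommGroup V)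

variable {k : Type*} [Field k] {V : Type*} [AddCommGroup V] [Module k V]

instance instModuleOddSpace : Module k (OddSpace V) := inferInstanceAs (Module k V)

instance instSuperspaceOddSpace : Superspace k (OddSpace V) where
  proj i := if i = 1 then LinearMap.id else 0
  proj_proj i j x := by
    rcases parity_cases i with rfl | rfl <;> rcases parity_cases j with rfl | rfl <;> simp
  sum_proj x := by simp

/-- A nonzero alternating bilinear form on a two-dimensional vector space. -/
structure SymplecticPlane (k V : Type*) [Field k] [AddCommGroup V] [Module k V] where
  form : LinearMap.BilinForm k (OddSpace V)
  alt : ∀ u, form u u = 0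
  ne_zero : form ≠ 0
  finrank_eq : Module.finrank k V = 2

namespace SymplecticPlane

variable (P : SymplecticPlane k V)

theorem neg (u v : OddSpace V) : P.form u v = -P.form v u := by
  have h := P.alt (u + v)
  simp only [map_add, LinearMap.add_apply, P.alt] at h
  linear_combination h

theorem exists_coords : ∃ (e f : OddSpace V) (c d : OddSpace V → k), P.form e f ≠ 0 ∧
    ∀ u, u = c u • e + d u • f := by
  have : Module.Finite k V := Module.finite_of_finrank_eq_succ P.finrank_eq
  let β : Module.Basis (Fin 2) k (OddSpace V) := Module.finBasisOfFinrankEq k V P.finrank_eq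
  have hβ : ∀ u : OddSpace V, u = β.repr u 0 • β 0 + β.repr u 1 • β 1 :=
    fun u => by
      have := β.sum_repr u
      rw [Fin.sum_univ_two] at this
      exact this.symm
  refine ⟨β 0, β 1, fun u => β.repr u 0, fun u => β.repr u 1, fun h => P.ne_zero ?_, hβ⟩
  ext u v
  have h' := P.neg (β 1) (β 0)
  rw [h] at h'
  rw [hβ u, hβ v]
  simp only [map_add, map_smul, LinearMap.add_apply, LinearMap.smul_apply, P.alt, h, h']
  simp

theorem pluecker (u v w z : OddSpace V) :
    P.form u v * P.form w z - P.form u w * P.form v z + P.form u z * P.form v w = 0 := by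
  obtain ⟨e, f, c, d, -, h⟩ := P.exists_coords
  rw [h u, h v, h w, h z]
  simp only [map_add, map_smul, LinearMap.add_apply, LinearMap.smul_apply, P.alt, smul_eq_mul,
    P.neg f e]
  ring

theorem nondegenerate {u : OddSpace V} (hu : ∀ v, P.form u v = 0) : u = 0 := by
  obtain ⟨e, f, c, d, hef, h⟩ := P.exists_coords
  have h1 := hu e
  have h2 := hu f
  rw [h u] at h1 h2 ⊢
  simp only [map_add, map_smul, LinearMap.add_apply, LinearMap.smul_apply, P.alt, smul_eq_mul,
    P.neg f e, mul_zero, zero_add, add_zero, mul_neg, neg_eq_zero, mul_eq_zero, hef, or_false]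
    at h1 h2
  simp [h1, h2]

/-- The product of `B(1,2)`: `(α, u) (β, v) = (α β + ⟨u|v⟩, α v + β u)`. -/
def mulB12 : (k × OddSpace V) →ₗ[k] (k × OddSpace V) →ₗ[k] (k × OddSpace V) :=
  LinearMap.mk₂ k (fun x y => (x.1 * y.1 + P.form x.2 y.2, x.1 • y.2 + y.1 • x.2))
    (fun x x' y => Prod.ext (by simp; ring) (by simp [add_smul]; abel))
    (fun c x y => Prod.ext (by simp; ring) (by simp [mul_smul, smul_comm y.1 c]))
    (fun x y y' => Prod.ext (by simp; ring) (by simp [add_smul]; abel))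
    (fun c x y => Prod.ext (by simp; ring) (by simp [mul_smul, smul_comm x.1 c]))

/-- The bilinear form of `B(1,2)`: `b((α, u), (β, v)) = 2 α β + ⟨u|v⟩`. -/
def bB12 : LinearMap.BilinForm k (k × OddSpace V) :=
  LinearMap.mk₂ k (fun x y => 2 * (x.1 * y.1) + P.form x.2 y.2)
    (fun x x' y => by simp; ring) (fun c x y => by simp; ring)
    (fun x y y' => by simp; ring) (fun c x y => by simp; ring)

theorem mem_part_zero {x : k × OddSpace V} : x ∈ part k (k × OddSpace V) 0 ↔ x.2 = 0 := by
  change ((x.1, (0 : OddSpace V)) : k × OddSpace V) = x ↔ _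
  rw [Prod.ext_iff]
  simp [eq_comm]

theorem mem_part_one {x : k × OddSpace V} : x ∈ part k (k × OddSpace V) 1 ↔ x.1 = 0 := by
  change (((0 : k), x.2) : k × OddSpace V) = x ↔ _
  rw [Prod.ext_iff]
  simp [eq_comm]

theorem mulB12_apply (x y : k × OddSpace V) :
    P.mulB12 x y = (x.1 * y.1 + P.form x.2 y.2, x.1 • y.2 + y.1 • x.2) := rfl

theorem bB12_apply (x y : k × OddSpace V) :
    P.bB12 x y = 2 * (x.1 * y.1) + P.form x.2 y.2 := rfl

/-- In characteristic `3`, `B(1,2) = k1 ⊕ V` is a Hurwitz superalgebra, with norm given by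
`q₀(1) = 1` and `b(u, v) = ⟨u|v⟩`. -/
def B12 [CharP k 3] : HurwitzSuperalgebra k (k × OddSpace V) where
  q0 := QuadraticMap.sq.comp
    ((LinearMap.fst k k (OddSpace V)).comp (part k (k × OddSpace V) 0).subtype)
  b := P.bB12
  b_even i j hij x hx y hy := by
    rcases parity_cases i with rfl | rfl <;> rcases parity_cases j with rfl | rfl <;>
      simp_all [mem_part_zero, mem_part_one, bB12_apply]
  b_supersymm i j x hx y hy := by
    rcases parity_cases i with rfl | rfl <;> rcases parity_cases j with rfl | rfl <;>
      simp_all [mem_part_zero, mem_part_one, bB12_apply, mul_comm x.1]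
    exact P.neg _ _
  b_polar x y := by
    have hx := mem_part_zero.1 x.2
    simp [bB12_apply, hx]
    ring
  regular i x hx h := by
    have h2 : (2 : k) ≠ 0 := by
      have : ((2 : ℕ) : k) ≠ 0 := by rw [Ne, CharP.cast_eq_zero_iff k 3]; decide
      exact_mod_cast this
    rcases parity_cases i with rfl | rfl
    · have := h (1, 0) (mem_part_zero.2 rfl)
      rw [mem_part_zero] at hx
      simp [bB12_apply, h2] at this
      exact Prod.ext this hx
    · rw [mem_part_one] at hx
      refine Prod.ext hx (P.nondegenerate fun v => ?_)
      simpa [bB12_apply] using h (0, v) (mem_part_one.2 rfl)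
  mul := P.mulB12
  mul_mem i j x hx y hy := by
    rcases parity_cases i with rfl | rfl <;> rcases parity_cases j with rfl | rfl <;>
      simp_all [mem_part_zero, mem_part_one, mulB12_apply]
  q0_mul x y := by
    have hx := mem_part_zero.1 x.2
    simp [mulB12_apply, hx]
    ring
  b_mul_left x y z := by
    have hx := mem_part_zero.1 x.2
    simp [mulB12_apply, bB12_apply, hx]
    ring
  b_mul_right x y z := by
    have hx := mem_part_zero.1 x.2
    simp [mulB12_apply, bB12_apply, hx]
    ring
  b_mul_mul i j l x hx y hy z hz t := by
    have h3 : (3 : k) = 0 := by exact_mod_cast CharP.cast_eq_zero k 3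
    obtain ⟨a, u⟩ := x
    obtain ⟨b, v⟩ := y
    obtain ⟨c, w⟩ := z
    obtain ⟨d, s⟩ := t
    have hp := P.pluecker u v w s
    rcases parity_cases i with rfl | rfl <;> rcases parity_cases j with rfl | rfl <;>
      rcases parity_cases l with rfl | rfl <;>
      simp only [mem_part_zero, mem_part_one] at hx hy hz <;> subst hx hy hz <;>
      simp [mulB12_apply, bB12_apply] <;>
      first
      | ring1
      | linear_combination a * b * P.form w s * h3
      | linear_combination a * d * P.form v w * h3 - 2 * a * d * P.neg w v
      | linear_combination b * c * P.form u s * h3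
      | linear_combination -(b * d) * P.neg w u
      | linear_combination c * d * P.form u v * h3 - c * d * P.neg v u
      | linear_combination 2 * hp + P.form u w * P.form v s * h3 - 2 * P.form u s * P.neg w v
  one := (1, 0)
  one_mul x := by ext <;> simp [mulB12_apply]
  mul_one x := by ext <;> simp [mulB12_apply]
  one_ne_zero h := one_ne_zero (congrArg Prod.fst h)

/-- The para-Hurwitz superalgebra `S_{1,2}` attached to `B(1,2)`. -/
def S12 [CharP k 3] : CompositionSuperalgebra k (k × OddSpace V) := P.B12.paraHurwitz

end SymplecticPlane

end B12

/-! ### The Lie superalgebra `𝔤(S, S')` -/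

section MagicSquare

variable {k : Type*} [Field k]
variable {A : Type*} [AddCommGroup A] [Module k A] [Superspace k A]
variable {A' : Type*} [AddCommGroup A'] [Module k A'] [Superspace k A']

namespace CompositionSuperalgebra

variable (S : CompositionSuperalgebra k A) (S' : CompositionSuperalgebra k A')

/-- The orthosymplectic Lie superalgebra `𝔬𝔰𝔭(S, q)`. -/
def osp : Submodule k (A →ₗ[k] A) where
  carrier := {d | ∀ i j, ∀ x ∈ part k A j, ∀ y,
    S.b (pr k i d x) y + sgn k (i * j) * S.b x (pr k i d y) = 0}
  add_mem' {d d'} h h' i j x hx y := by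
    simp only [map_add, LinearMap.add_apply]
    linear_combination h i j x hx y + h' i j x hx y
  zero_mem' i j x hx y := by simp
  smul_mem' c d h i j x hx y := by
    simp only [map_smul, LinearMap.smul_apply, smul_eq_mul]
    linear_combination c * h i j x hx y

/-- The triality Lie superalgebra `𝔱𝔯𝔦(S)`, consisting of triples `(d 0, d 1, d 2)`. -/
def tri : Submodule k (Fin 3 → (A →ₗ[k] A)) where
  carrier := {d | (∀ n, d n ∈ S.osp) ∧ ∀ i j, ∀ x ∈ part k A j, ∀ y,
    pr k i (d 0) (S.mul x y) =
      S.mul (pr k i (d 1) x) y + sgn k (i * j) • S.mul x (pr k i (d 2) y)}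
  add_mem' {d d'} h h' := ⟨fun n => add_mem (h.1 n) (h'.1 n), fun i j x hx y => by
    simp only [Pi.add_apply, map_add, LinearMap.add_apply, h.2 i j x hx y, h'.2 i j x hx y]
    module⟩
  zero_mem' := ⟨fun n => zero_mem _, fun i j x hx y => by simp⟩
  smul_mem' c d h := ⟨fun n => Submodule.smul_mem _ _ (h.1 n), fun i j x hx y => by
    simp only [Pi.smul_apply, map_smul, LinearMap.smul_apply, h.2 i j x hx y]
    module⟩

/-- `l_x(y) = x • y`. -/
def l : A →ₗ[k] (A →ₗ[k] A) := S.mul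

/-- `r_x(y) = (-1)^{|x||y|} y • x`. -/
def r : A →ₗ[k] (A →ₗ[k] A) := sflip S.mul

/-- `σ_{x,y}(z) = (-1)^{|y||z|} b(x, z) y - (-1)^{|x|(|y| + |z|)} b(y, z) x`. -/
def sigma : A →ₗ[k] A →ₗ[k] (A →ₗ[k] A) :=
  LinearMap.mk₂ k
    (fun x y => ∑ a : ZMod 2, ∑ c : ZMod 2, ∑ e : ZMod 2,
      (sgn k (c * e) • (S.b (pr k a x)).smulRight (pr k c y) ∘ₗ pr k e -
        sgn k (a * (c + e)) • (S.b (pr k c y)).smulRight (pr k a x) ∘ₗ pr k e))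
    (fun x x' y => by
      ext z
      simp only [sum_parity, map_add, LinearMap.add_apply, LinearMap.sub_apply,
        LinearMap.smul_apply, LinearMap.comp_apply, LinearMap.smulRight_apply]
      module)
    (fun t x y => by
      ext z
      simp only [sum_parity, map_smul, LinearMap.add_apply, LinearMap.sub_apply,
        LinearMap.smul_apply, LinearMap.comp_apply, LinearMap.smulRight_apply, smul_eq_mul]
      module)
    (fun x y y' => by
      ext z
      simp only [sum_parity, map_add, LinearMap.add_apply, LinearMap.sub_apply,
        LinearMap.smul_apply, LinearMap.comp_apply, LinearMap.smulRight_apply]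
      module)
    (fun t x y => by
      ext z
      simp only [sum_parity, map_smul, LinearMap.add_apply, LinearMap.sub_apply,
        LinearMap.smul_apply, LinearMap.comp_apply, LinearMap.smulRight_apply, smul_eq_mul]
      module)

/-- `t_{x,y} = (σ_{x,y}, ½ b(x,y) 1 - r_x l_y, ½ b(x,y) 1 - l_x r_y)`. -/
def t : A →ₗ[k] A →ₗ[k] (Fin 3 → (A →ₗ[k] A)) :=
  LinearMap.mk₂ k
    (fun x y => ![S.sigma x y,
      ((2 : k)⁻¹ * S.b x y) • LinearMap.id - S.r x ∘ₗ S.l y,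
      ((2 : k)⁻¹ * S.b x y) • LinearMap.id - S.l x ∘ₗ S.r y])
    (fun x x' y => by
      ext n z; fin_cases n <;> simp [mul_add, add_smul] <;> abel)
    (fun c x y => by
      ext n z; fin_cases n <;> simp [smul_sub, mul_smul, smul_comm c])
    (fun x y y' => by
      ext n z; fin_cases n <;> simp [mul_add, add_smul] <;> abel)
    (fun c x y => by
      ext n z; fin_cases n <;> simp [smul_sub, mul_smul, smul_comm c])

/-- `θ^i`, where `θ (d₀, d₁, d₂) = (d₂, d₀, d₁)`. -/
def theta (k A : Type*) [Field k] [AddCommGroup A] [Module k A] (i : Fin 3) :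
    (Fin 3 → (A →ₗ[k] A)) →ₗ[k] (Fin 3 → (A →ₗ[k] A)) :=
  LinearMap.funLeft k (A →ₗ[k] A) (fun n => n - i)

end CompositionSuperalgebra

/-- Linear maps on the left factor: `d · (x ⊗ x') = d(x) ⊗ x'`. -/
def actLeft (k A A' : Type*) [Field k] [AddCommGroup A] [Module k A] [AddCommGroup A']
    [Module k A'] : (A →ₗ[k] A) →ₗ[k] (A ⊗[k] A') →ₗ[k] (A ⊗[k] A') :=
  LinearMap.rTensorHom A'

/-- Linear maps on the right factor: `d · (x ⊗ x') = (-1)^{|d||x|} x ⊗ d(x')`. -/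
def actRight (k A A' : Type*) [Field k] [AddCommGroup A] [Module k A] [Superspace k A]
    [AddCommGroup A'] [Module k A'] [Superspace k A'] :
    (A' →ₗ[k] A') →ₗ[k] (A ⊗[k] A') →ₗ[k] (A ⊗[k] A') :=
  ∑ i : ZMod 2, ∑ j : ZMod 2, sgn k (i * j) •
    (LinearMap.lTensorHom A).compl₁₂ (pr k i) (LinearMap.rTensor A' (pr k j))

namespace CompositionSuperalgebra

variable (S : CompositionSuperalgebra k A) (S' : CompositionSuperalgebra k A')

/-- `(x ⊗ x', y ⊗ y') ↦ (-1)^{|x'||y|} (x • y) ⊗ (x' • y')`. -/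
def tensorMul : (A ⊗[k] A') →ₗ[k] (A ⊗[k] A') →ₗ[k] (A ⊗[k] A') :=
  ∑ i : ZMod 2, ∑ j : ZMod 2, sgn k (i * j) •
    (TensorProduct.map₂ S.mul S'.mul).compl₁₂
      (LinearMap.lTensor A (pr k i)) (LinearMap.rTensor A' (pr k j))

/-- `(x ⊗ x', y ⊗ y') ↦ (-1)^{|x||x'| + |x||y'| + |y||y'|} b'(x', y') t_{x,y}`. -/
def tensorT : (A ⊗[k] A') →ₗ[k] (A ⊗[k] A') →ₗ[k] (Fin 3 → (A →ₗ[k] A)) :=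
  ∑ a : ZMod 2, ∑ a' : ZMod 2, ∑ c : ZMod 2, ∑ c' : ZMod 2,
    sgn k (a * a' + a * c' + c * c') •
    ((TensorProduct.map₂ S.t S'.b).compr₂
      (TensorProduct.rid k (Fin 3 → (A →ₗ[k] A))).toLinearMap).compl₁₂
      (TensorProduct.map (pr k a) (pr k a')) (TensorProduct.map (pr k c) (pr k c'))

/-- `(x ⊗ x', y ⊗ y') ↦ (-1)^{|y||x'|} b(x, y) t'_{x',y'}`. -/
def tensorT' : (A ⊗[k] A') →ₗ[k] (A ⊗[k] A') →ₗ[k] (Fin 3 → (A' →ₗ[k] A')) :=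
  ∑ a' : ZMod 2, ∑ c : ZMod 2, sgn k (c * a') •
    ((TensorProduct.map₂ S.b S'.t).compr₂
      (TensorProduct.lid k (Fin 3 → (A' →ₗ[k] A'))).toLinearMap).compl₁₂
      (LinearMap.lTensor A (pr k a')) (LinearMap.rTensor A' (pr k c))

/-- The superspace that contains `𝔤(S, S')`: an element is `(d, d', w)`, where `d` and `d'` are
triples of linear maps and `w = (w₀, w₁, w₂)` stands for `ι₀(w₀) + ι₁(w₁) + ι₂(w₂)`. -/
abbrev Ambient (k A A' : Type*) [Field k] [AddCommGroup A] [Module k A] [AddCommGroup A']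
    [Module k A'] : Type _ :=
  (Fin 3 → (A →ₗ[k] A)) × (Fin 3 → (A' →ₗ[k] A')) × (Fin 3 → (A ⊗[k] A'))

/-- The bracket of `𝔤(S, S')`. For `[X, ι_i(w)]` with `X` in `𝔱𝔯𝔦(S) ⊕ 𝔱𝔯𝔦(S')`, for
`[ι_i(w), ι_{i+1}(w')]` and for `[ι_i(w), ι_i(w')]` the defining formulas are used; the remaining
products are given by superanticommutativity. -/
def bracketFun (X Y : Ambient k A A') : Ambient k A A' :=
  (fun n => superComm (X.1 n) (Y.1 n) +
      (∑ i, theta k A i (tensorT S S' (X.2.2 i) (Y.2.2 i))) n,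
    fun n => superComm (X.2.1 n) (Y.2.1 n) +
      (∑ i, theta k A' i (tensorT' S S' (X.2.2 i) (Y.2.2 i))) n,
    fun i =>
      actLeft k A A' (X.1 i) (Y.2.2 i) + actRight k A A' (X.2.1 i) (Y.2.2 i) -
      sflip (actLeft k A A') (X.2.2 i) (Y.1 i) - sflip (actRight k A A') (X.2.2 i) (Y.2.1 i) +
      tensorMul S S' (X.2.2 (i + 1)) (Y.2.2 (i + 2)) -
      sflip (tensorMul S S') (X.2.2 (i + 2)) (Y.2.2 (i + 1)))

/-- The bracket of `𝔤(S, S')` as a bilinear map. -/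
def bracket : Ambient k A A' →ₗ[k] Ambient k A A' →ₗ[k] Ambient k A A' :=
  LinearMap.mk₂ k (bracketFun S S')
    (fun X X' Y => by
      refine Prod.ext ?_ (Prod.ext ?_ ?_) <;> funext i <;>
        simp [bracketFun, Finset.sum_add_distrib, -Finset.sum_apply] <;> abel)
    (fun c X Y => by
      refine Prod.ext ?_ (Prod.ext ?_ ?_) <;> funext i <;>
        simp [bracketFun, ← Finset.smul_sum, smul_sub, smul_add, -Finset.sum_apply])
    (fun X Y Y' => by
      refine Prod.ext ?_ (Prod.ext ?_ ?_) <;> funext i <;>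
        simp [bracketFun, Finset.sum_add_distrib, -Finset.sum_apply] <;> abel)
    (fun c X Y => by
      refine Prod.ext ?_ (Prod.ext ?_ ?_) <;> funext i <;>
        simp [bracketFun, ← Finset.smul_sum, smul_sub, smul_add, -Finset.sum_apply])

/-- The space `𝔤(S, S') = (𝔱𝔯𝔦(S) ⊕ 𝔱𝔯𝔦(S')) ⊕ (⊕ᵢ ι_i(S ⊗ S'))`. -/
def g : Submodule k (Ambient k A A') := S.tri.prod (S'.tri.prod ⊤)

end CompositionSuperalgebra

end MagicSquare

/-! ### Orthosymplectic triple systems -/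

section TripleSystems

variable {k : Type*} [Field k]
variable {T : Type*} [AddCommGroup T] [Module k T] [Superspace k T]

/-- A superspace with a bilinear form `(x|y)` and a triple product `[xyz] = d x y z`. -/
structure SuperTriple (k T : Type*) [Field k] [AddCommGroup T] [Module k T] where
  form : LinearMap.BilinForm k T
  d : T →ₗ[k] T →ₗ[k] T →ₗ[k] T

namespace SuperTriple

variable (P : SuperTriple k T)

/-- The axioms of an orthosymplectic triple system. -/
structure IsOrthosymplectic : Prop where
  form_ne_zero : P.form ≠ 0
  form_even : ∀ i j, i ≠ j → ∀ x ∈ part k T i, ∀ y ∈ part k T j, P.form x y = 0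
  form_symm : ∀ x ∈ part k T 0, ∀ y ∈ part k T 0, P.form x y = P.form y x
  form_alt : ∀ x ∈ part k T 1, P.form x x = 0
  parity : ∀ i j l, ∀ x ∈ part k T i, ∀ y ∈ part k T j, ∀ z ∈ part k T l,
    P.d x y z ∈ part k T (i + j + l)
  skew : ∀ i j, ∀ x ∈ part k T i, ∀ y ∈ part k T j, ∀ z,
    P.d x y z + sgn k (i * j) • P.d y x z = 0
  symm : ∀ j l, ∀ x, ∀ y ∈ part k T j, ∀ z ∈ part k T l,
    P.d x y z + sgn k (j * l) • P.d x z y =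
      P.form x y • z + sgn k (j * l) • P.form x z • y - (2 : k) • P.form y z • x
  derivation : ∀ i j l m, ∀ x ∈ part k T i, ∀ y ∈ part k T j, ∀ u ∈ part k T l,
    ∀ v ∈ part k T m, ∀ w,
    P.d x y (P.d u v w) = P.d (P.d x y u) v w + sgn k ((i + j) * l) • P.d u (P.d x y v) w +
      sgn k ((i + j) * (l + m)) • P.d u v (P.d x y w)
  form_d : ∀ i j l, ∀ x ∈ part k T i, ∀ y ∈ part k T j, ∀ u ∈ part k T l, ∀ v,
    P.form (P.d x y u) v + sgn k ((i + j) * l) * P.form u (P.d x y v) = 0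

/-- Graded ideals of a triple system. -/
def IsIdeal (I : Submodule k T) : Prop :=
  (∀ i, ∀ x ∈ I, pr k i x ∈ I) ∧
    ∀ x ∈ I, ∀ y z, P.d x y z ∈ I ∧ P.d y x z ∈ I ∧ P.d y z x ∈ I

/-- Simplicity: the triple product is nonzero and there are no proper nonzero graded ideals. -/
def IsSimple : Prop := P.d ≠ 0 ∧ ∀ I, P.IsIdeal I → I = ⊥ ∨ I = ⊤

/-- The superderivations of a triple system. -/
def der : Submodule k (T →ₗ[k] T) where
  carrier := {δ | ∀ i j l, ∀ x ∈ part k T j, ∀ y ∈ part k T l, ∀ z,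
    pr k i δ (P.d x y z) = P.d (pr k i δ x) y z + sgn k (i * j) • P.d x (pr k i δ y) z +
      sgn k (i * (j + l)) • P.d x y (pr k i δ z)}
  add_mem' {δ δ'} h h' i j l x hx y hy z := by
    simp only [map_add, LinearMap.add_apply, h i j l x hx y hy z, h' i j l x hx y hy z]
    module
  zero_mem' i j l x hx y hy z := by simp
  smul_mem' c δ h i j l x hx y hy z := by
    simp only [map_smul, LinearMap.smul_apply, h i j l x hx y hy z]
    module

/-- `𝔰` is a Lie subsuperalgebra of `𝔡𝔢𝔯 T` that contains the inner derivations `[xy·]`. -/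
structure IsAdmissible (s : Submodule k (T →ₗ[k] T)) : Prop
    extends IsLieSubsuperalgebra s where
  le_der : s ≤ P.der
  inder_le : ∀ x y, P.d x y ∈ s

variable {V : Type*} [AddCommGroup V] [Module k V] (ω : SymplecticPlane k V)

/-- `γ_{u,v} = ⟨u|·⟩ v + ⟨v|·⟩ u`. -/
def _root_.Supersquare.SymplecticPlane.gamma :
    OddSpace V →ₗ[k] OddSpace V →ₗ[k] (OddSpace V →ₗ[k] OddSpace V) :=
  LinearMap.smulRightₗ.comp ω.form + (LinearMap.smulRightₗ.comp ω.form).flip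

/-- The symplectic Lie algebra `𝔰𝔭(V)`. -/
def _root_.Supersquare.SymplecticPlane.sp : Submodule k (OddSpace V →ₗ[k] OddSpace V) where
  carrier := {s | ∀ u v, ω.form (s u) v + ω.form u (s v) = 0}
  add_mem' {s s'} h h' u v := by
    simp only [map_add, LinearMap.add_apply]
    linear_combination h u v + h' u v
  zero_mem' u v := by simp
  smul_mem' c s h u v := by
    simp only [map_smul, LinearMap.smul_apply, smul_eq_mul]
    linear_combination c * h u v

/-- The superspace that contains `𝔤(T, 𝔰)`. As `V` is odd, `V ⊗ T₁` is even and `V ⊗ T₀` is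
odd. -/
abbrev Ambient (k V T : Type*) [Field k] [AddCommGroup V] [Module k V] [AddCommGroup T]
    [Module k T] : Type _ :=
  (OddSpace V →ₗ[k] OddSpace V) × (T →ₗ[k] T) × (OddSpace V ⊗[k] T)

/-- `(u ⊗ x, v ⊗ y) ↦ (-1)^{|x|} (x|y) γ_{u,v}`. -/
def tensorGamma : (OddSpace V ⊗[k] T) →ₗ[k] (OddSpace V ⊗[k] T) →ₗ[k]
    (OddSpace V →ₗ[k] OddSpace V) :=
  ∑ i : ZMod 2, sgn k i •
    ((TensorProduct.map₂ ω.gamma P.form).compr₂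
      (TensorProduct.rid k (OddSpace V →ₗ[k] OddSpace V)).toLinearMap).comp
      (LinearMap.lTensor (OddSpace V) (pr k i))

/-- `(u ⊗ x, v ⊗ y) ↦ (-1)^{|x|} ⟨u|v⟩ d_{x,y}`. -/
def tensorD : (OddSpace V ⊗[k] T) →ₗ[k] (OddSpace V ⊗[k] T) →ₗ[k] (T →ₗ[k] T) :=
  ∑ i : ZMod 2, sgn k i •
    ((TensorProduct.map₂ ω.form P.d).compr₂
      (TensorProduct.lid k (T →ₗ[k] T)).toLinearMap).comp
      (LinearMap.lTensor (OddSpace V) (pr k i))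

/-- The bracket of `𝔤(T, 𝔰)`: `[s, v ⊗ x] = s(v) ⊗ x`, `[d, v ⊗ x] = (-1)^{|d|} v ⊗ d(x)`, and
`[u ⊗ x, v ⊗ y] = (-1)^{|x|} (-(x|y) γ_{u,v} + ⟨u|v⟩ d_{x,y})`; the remaining products are given by
superanticommutativity. -/
def bracketFun (X Y : Ambient k V T) : Ambient k V T :=
  (superComm X.1 Y.1 - tensorGamma P ω X.2.2 Y.2.2,
    superComm X.2.1 Y.2.1 + tensorD P ω X.2.2 Y.2.2,
    actLeft k (OddSpace V) T X.1 Y.2.2 + actRight k (OddSpace V) T X.2.1 Y.2.2 -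
      sflip (actLeft k (OddSpace V) T) X.2.2 Y.1 - sflip (actRight k (OddSpace V) T) X.2.2 Y.2.1)

/-- The bracket of `𝔤(T, 𝔰)` as a bilinear map. -/
def bracket : Ambient k V T →ₗ[k] Ambient k V T →ₗ[k] Ambient k V T :=
  LinearMap.mk₂ k (bracketFun P ω)
    (fun X X' Y => by
      refine Prod.ext ?_ (Prod.ext ?_ ?_) <;> simp [bracketFun] <;> abel)
    (fun c X Y => by
      refine Prod.ext ?_ (Prod.ext ?_ ?_) <;> simp [bracketFun, smul_sub])
    (fun X Y Y' => by
      refine Prod.ext ?_ (Prod.ext ?_ ?_) <;> simp [bracketFun] <;> abel)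
    (fun c X Y => by
      refine Prod.ext ?_ (Prod.ext ?_ ?_) <;> simp [bracketFun, smul_sub])

/-- `𝔤(T, 𝔰)(0) = 𝔰𝔭(V) ⊕ 𝔰`. -/
def gZero (s : Submodule k (T →ₗ[k] T)) : Submodule k (Ambient k V T) :=
  ω.sp.prod (s.prod ⊥)

/-- `𝔤(T, 𝔰)(1) = V ⊗ T`. -/
def gOne (k V T : Type*) [Field k] [AddCommGroup V] [Module k V] [AddCommGroup T]
    [Module k T] : Submodule k (Ambient k V T) :=
  Submodule.prod ⊥ (Submodule.prod ⊥ ⊤)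

/-- `𝔤(T, 𝔰) = (𝔰𝔭(V) ⊕ 𝔰) ⊕ (V ⊗ T)`. -/
def g (s : Submodule k (T →ₗ[k] T)) : Submodule k (Ambient k V T) :=
  ω.sp.prod (s.prod ⊤)

end SuperTriple

end TripleSystems

/-! ### Bilinear maps on quotients -/

section Descend

variable {k M P : Type*} [Field k] [AddCommGroup M] [Module k M] [AddCommGroup P] [Module k P]

/-- The bilinear map on `M/N` induced by a bilinear map on `M`. -/
def descend (N : Submodule k M) (f : M →ₗ[k] M →ₗ[k] P) (h : ∀ x ∈ N, ∀ y, f x y = 0)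
    (h' : ∀ x, ∀ y ∈ N, f x y = 0) : (M ⧸ N) →ₗ[k] (M ⧸ N) →ₗ[k] P :=
  N.liftQ (LinearMap.flip (N.liftQ f.flip fun y hy => LinearMap.ext fun x => h' x y hy))
    fun x hx => LinearMap.ext fun y => by
      obtain ⟨y, rfl⟩ := N.mkQ_surjective y
      exact h x hx y

theorem descend_mk (N : Submodule k M) (f : M →ₗ[k] M →ₗ[k] P) (h : ∀ x ∈ N, ∀ y, f x y = 0)
    (h' : ∀ x, ∀ y ∈ N, f x y = 0) (x y : M) :
    descend N f h h' (N.mkQ x) (N.mkQ y) = f x y := rfl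

end Descend

/-! ### The Jordan superalgebra `J = H₃(C, *)` and the triple system `J₀/k1` -/

section Jordan

variable {k : Type*} [Field k]
variable {A : Type*} [AddCommGroup A] [Module k A] [Superspace k A]

namespace HurwitzSuperalgebra

variable (C : HurwitzSuperalgebra k A)

/-- The product of `3 × 3` matrices over `C`. -/
def matMul : Matrix (Fin 3) (Fin 3) A →ₗ[k] Matrix (Fin 3) (Fin 3) A →ₗ[k]
    Matrix (Fin 3) (Fin 3) A :=
  LinearMap.mk₂ k (fun X Y => Matrix.of fun i j => ∑ l, C.mul (X i l) (Y l j))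
    (fun X X' Y => by ext; simp [Finset.sum_add_distrib])
    (fun c X Y => by ext; simp [Finset.smul_sum])
    (fun X Y Y' => by ext; simp [Finset.sum_add_distrib])
    (fun c X Y => by ext; simp [Finset.smul_sum])

/-- The symmetrized product `x ∘ y = ½ (x y + (-1)^{|x||y|} y x)`. -/
def matCirc : Matrix (Fin 3) (Fin 3) A →ₗ[k] Matrix (Fin 3) (Fin 3) A →ₗ[k]
    Matrix (Fin 3) (Fin 3) A :=
  (2 : k)⁻¹ • (C.matMul + sflip C.matMul)

theorem matMul_apply (X Y : Matrix (Fin 3) (Fin 3) A) (i j : Fin 3) :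
    C.matMul X Y i j = ∑ l, C.mul (X i l) (Y l j) := rfl

theorem matCirc_apply {i j : ZMod 2} {X Y : Matrix (Fin 3) (Fin 3) A} (hX : X ∈ part k _ i)
    (hY : Y ∈ part k _ j) :
    C.matCirc X Y = (2 : k)⁻¹ • (C.matMul X Y + sgn k (i * j) • C.matMul Y X) := by
  simp [matCirc, sflip_apply C.matMul hY hX, mul_comm j i]

theorem matrix_mem_part {i : ZMod 2} {X : Matrix (Fin 3) (Fin 3) A} :
    X ∈ part k _ i ↔ ∀ p q, X p q ∈ part k A i := by
  rw [mem_part, ← Matrix.ext_iff]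
  rfl

/-- The space `H₃(C, *)` of hermitian matrices, `(a_{ij})^* = (ā_{ji})`. -/
def H3 : Submodule k (Matrix (Fin 3) (Fin 3) A) where
  carrier := {X | ∀ i j, X i j = C.conj (X j i)}
  add_mem' {X Y} hX hY i j := by simp only [Matrix.add_apply, map_add, ← hX i j, ← hY i j]
  zero_mem' i j := by simp
  smul_mem' c X hX i j := by simp only [Matrix.smul_apply, map_smul, ← hX i j]

theorem pr_mem_H3 (i : ZMod 2) (X : Matrix (Fin 3) (Fin 3) A) (hX : X ∈ C.H3) :
    pr k i X ∈ C.H3 := fun p q => by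
  change pr k i (X p q) = C.conj (pr k i (X q p))
  rw [hX p q, C.pr_conj]

theorem matCirc_mem {X Y : Matrix (Fin 3) (Fin 3) A} (hX : X ∈ C.H3) (hY : Y ∈ C.H3) :
    C.matCirc X Y ∈ C.H3 := by
  have key : ∀ i j, ∀ X ∈ C.H3 ⊓ part k _ i, ∀ Y ∈ C.H3 ⊓ part k _ j,
      C.matCirc X Y ∈ C.H3 := fun i j X hX Y hY => by
    have h : ∀ i j, ∀ X ∈ C.H3 ⊓ part k _ i, ∀ Y ∈ C.H3 ⊓ part k _ j, ∀ p q,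
        C.conj (C.matMul X Y q p) = sgn k (i * j) • C.matMul Y X p q := by
      intro i j X hX Y hY p q
      simp only [matMul_apply, map_sum, Finset.smul_sum]
      refine Finset.sum_congr rfl fun l _ => ?_
      rw [C.conj_mul (matrix_mem_part.1 hX.2 q l) (matrix_mem_part.1 hY.2 l p),
        ← hX.1 l q, ← hY.1 p l]
    intro p q
    rw [matCirc_apply C hX.2 hY.2]
    simp only [Matrix.smul_apply, Matrix.add_apply, map_smul, map_add, h i j X hX Y hY,
      h j i Y hY X hX]
    rcases parity_cases i with rfl | rfl <;> rcases parity_cases j with rfl | rfl <;>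
      simp [add_comm]
  rw [← pr_add (k := k) X, ← pr_add (k := k) Y]
  simp only [map_add, LinearMap.add_apply]
  have hm : ∀ (i : ZMod 2) (X : Matrix (Fin 3) (Fin 3) A), X ∈ C.H3 →
      pr k i X ∈ C.H3 ⊓ part k _ i := fun i X hX => ⟨C.pr_mem_H3 i X hX, pr_mem i X⟩
  exact add_mem (add_mem (key _ _ _ (hm _ _ hX) _ (hm _ _ hY)) (key _ _ _ (hm _ _ hX) _ (hm _ _ hY)))
    (add_mem (key _ _ _ (hm _ _ hX) _ (hm _ _ hY)) (key _ _ _ (hm _ _ hX) _ (hm _ _ hY)))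

/-- The underlying superspace of the Jordan superalgebra `J = H₃(C, *)`: hermitian matrices. -/
structure J (C : HurwitzSuperalgebra k A) where
  mat : Matrix (Fin 3) (Fin 3) A
  mat_mem : mat ∈ C.H3

/-- `J` is the space `H₃(C, *)`. -/
def equivH3 : C.J ≃ C.H3 where
  toFun x := ⟨x.mat, x.mat_mem⟩
  invFun x := ⟨x, x.2⟩

instance instAddCommGroupJ : AddCommGroup C.J := C.equivH3.addCommGroup

instance instModuleJ : Module k C.J := C.equivH3.module k

/-- The inclusion of `J` in the space of all matrices. -/
def toMat : C.J →ₗ[k] Matrix (Fin 3) (Fin 3) A where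
  toFun := J.mat
  map_add' _ _ := rfl
  map_smul' _ _ := rfl

/-- A hermitian matrix, as an element of `J`. -/
def ofMat (X : Matrix (Fin 3) (Fin 3) A) (h : X ∈ C.H3) : C.J := ⟨X, h⟩

theorem toMat_ofMat (X : Matrix (Fin 3) (Fin 3) A) (h : X ∈ C.H3) :
    C.toMat (C.ofMat X h) = X := rfl

theorem toMat_injective : Function.Injective C.toMat := fun ⟨_, _⟩ ⟨_, _⟩ h => by
  cases h; rfl

theorem toMat_mem (x : C.J) : C.toMat x ∈ C.H3 := x.mat_mem

instance instSuperspaceJ : Superspace k C.J where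
  proj i :=
    { toFun := fun x => C.ofMat (pr k i (C.toMat x)) (C.pr_mem_H3 i _ (C.toMat_mem x))
      map_add' := fun x y => C.toMat_injective (by simp [toMat_ofMat])
      map_smul' := fun c x => C.toMat_injective (by simp [toMat_ofMat]) }
  proj_proj i j x := C.toMat_injective (by
    simp only [LinearMap.coe_mk, AddHom.coe_mk, toMat_ofMat, pr_pr]
    split_ifs <;> simp [toMat_ofMat])
  sum_proj x := C.toMat_injective (by
    simp only [LinearMap.coe_mk, AddHom.coe_mk, map_add, toMat_ofMat, pr_add])

theorem toMat_pr (i : ZMod 2) (x : C.J) : C.toMat (pr k i x) = pr k i (C.toMat x) := rfl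

theorem toMat_mem_part {i : ZMod 2} {x : C.J} (hx : x ∈ part k C.J i) :
    C.toMat x ∈ part k _ i := by
  rw [mem_part, ← toMat_pr, mem_part.1 hx]

/-- The product of the Jordan superalgebra `J = H₃(C, *)`; `C.circ x` is the multiplication
operator `L_x`. -/
def circ : C.J →ₗ[k] C.J →ₗ[k] C.J :=
  LinearMap.mk₂ k
    (fun x y => C.ofMat (C.matCirc (C.toMat x) (C.toMat y))
      (C.matCirc_mem (C.toMat_mem x) (C.toMat_mem y)))
    (fun x x' y => C.toMat_injective (by simp [toMat_ofMat]))
    (fun c x y => C.toMat_injective (by simp [toMat_ofMat]))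
    (fun x y y' => C.toMat_injective (by simp [toMat_ofMat]))
    (fun c x y => C.toMat_injective (by simp [toMat_ofMat]))

theorem toMat_circ (x y : C.J) : C.toMat (C.circ x y) = C.matCirc (C.toMat x) (C.toMat y) := rfl

/-- The trace of a matrix over `C`, `½ ∑ᵢ b(x_{ii}, 1)`. -/
def matTrace : Matrix (Fin 3) (Fin 3) A →ₗ[k] k :=
  ∑ i : Fin 3, (2 : k)⁻¹ • (C.b.flip C.one) ∘ₗ Matrix.entryLinearMap k A i i

/-- The trace `t` on `J`: the sum of the diagonal entries, where `α 1` is identified with the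
scalar `α = ½ b(α 1, 1)`. -/
def trace : C.J →ₗ[k] k := C.matTrace ∘ₗ C.toMat

/-- The identity matrix `1`, as an element of `J`. -/
def oneJ : C.J := C.ofMat (Matrix.diagonal fun _ => C.one) fun i j => by
  by_cases h : i = j
  · subst h; simp [C.conj_one]
  · simp [Matrix.diagonal_apply_ne _ h, Matrix.diagonal_apply_ne _ (Ne.symm h)]

theorem toMat_oneJ : C.toMat C.oneJ = Matrix.diagonal fun _ => C.one := rfl

/-- The Lie superalgebra `𝔡𝔢𝔯 J` of superderivations of `J`. -/
def derJ : Submodule k (C.J →ₗ[k] C.J) where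
  carrier := {d | ∀ i j, ∀ x ∈ part k C.J j, ∀ y,
    pr k i d (C.circ x y) = C.circ (pr k i d x) y + sgn k (i * j) • C.circ x (pr k i d y)}
  add_mem' {d d'} h h' i j x hx y := by
    simp only [map_add, LinearMap.add_apply, h i j x hx y, h' i j x hx y]
    module
  zero_mem' i j x hx y := by simp
  smul_mem' c d h i j x hx y := by
    simp only [map_smul, LinearMap.smul_apply, h i j x hx y]
    module

/-- The space `J₀` of trace zero elements. -/
def J0 : Submodule k C.J := LinearMap.ker C.trace

/-- The subspace `k1` of `J₀` (in characteristic `3`, the trace of `1` is `0`). -/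
def k1 : Submodule k C.J0 := (Submodule.span k {C.oneJ}).comap C.J0.subtype

/-- The quotient `J₀ / k1`. -/
abbrev TJ : Type _ := C.J0 ⧸ C.k1

theorem mem_k1 {x : C.J0} : x ∈ C.k1 ↔ ∃ c : k, c • C.oneJ = x := by
  rw [k1, Submodule.mem_comap, Submodule.mem_span_singleton]
  rfl

theorem oneJ_mem : C.oneJ ∈ part k C.J 0 := by
  apply C.toMat_injective
  rw [toMat_pr, toMat_oneJ]
  apply mem_part.1
  rw [matrix_mem_part]
  intro p q
  by_cases h : p = q
  · subst h; simpa using C.one_mem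
  · simp [Matrix.diagonal_apply_ne _ h]

theorem matTrace_pr_one (X : Matrix (Fin 3) (Fin 3) A) : C.matTrace (pr k 1 X) = 0 := by
  simp only [matTrace, LinearMap.sum_apply]
  refine Finset.sum_eq_zero fun i _ => ?_
  have : C.b (pr k 1 (X i i)) C.one = 0 := C.b_one_odd (pr_mem 1 _) (by decide)
  change (2 : k)⁻¹ • C.b (pr k 1 (X i i)) C.one = 0
  rw [this, smul_zero]

theorem matTrace_odd {X : Matrix (Fin 3) (Fin 3) A} (h : X ∈ part k _ 1) : C.matTrace X = 0 := by
  rw [← mem_part.1 h, matTrace_pr_one]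

theorem pr_mem_J0 (i : ZMod 2) (x : C.J) (hx : x ∈ C.J0) : pr k i x ∈ C.J0 := by
  have h1 : C.trace (pr k 1 x) = 0 := C.matTrace_pr_one (C.toMat x)
  have hx : C.trace x = 0 := hx
  have h := congrArg C.trace (pr_add (k := k) x)
  rw [map_add, h1, hx, add_zero] at h
  rcases parity_cases i with rfl | rfl
  · exact h
  · exact h1

instance instSuperspaceJ0 : Superspace k C.J0 := Superspace.restrict _ C.pr_mem_J0

theorem pr_mem_k1 (i : ZMod 2) (x : C.J0) (hx : x ∈ C.k1) : pr k i x ∈ C.k1 := by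
  rw [mem_k1] at hx ⊢
  obtain ⟨c, hc⟩ := hx
  have h : ((pr k i x : C.J0) : C.J) = pr k i (x : C.J) := rfl
  rw [h, ← hc, map_smul, pr_of_mem C.oneJ_mem]
  split_ifs
  · exact ⟨c, rfl⟩
  · exact ⟨0, by simp⟩

instance instSuperspaceTJ : Superspace k C.TJ := Superspace.quotient _ C.pr_mem_k1

theorem matMul_mem {i j : ZMod 2} {X Y : Matrix (Fin 3) (Fin 3) A} (hX : X ∈ part k _ i)
    (hY : Y ∈ part k _ j) : C.matMul X Y ∈ part k _ (i + j) := by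
  rw [matrix_mem_part] at *
  intro p q
  rw [matMul_apply]
  exact sum_mem fun l _ => C.mul_mem i j _ (hX p l) _ (hY l q)

theorem b_mul_one_assoc (x y z : A) :
    C.b (C.mul (C.mul x y) z) C.one = C.b (C.mul x (C.mul y z)) C.one := by
  have key : ∀ i j l, C.b (C.mul (C.mul (pr k i x) (pr k j y)) (pr k l z)) C.one =
      C.b (C.mul (pr k i x) (C.mul (pr k j y) (pr k l z))) C.one := fun i j l => by
    rw [C.b_mul_right_adj (C.mul_mem _ _ _ (pr_mem i x) _ (pr_mem j y)) (pr_mem l z) C.one_mem,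
      C.one_mul, C.b_mul_right_adj (pr_mem i x) (pr_mem j y) (C.conj_mem (pr_mem l z)),
      C.b_mul_right_adj (pr_mem i x) (C.mul_mem _ _ _ (pr_mem j y) _ (pr_mem l z)) C.one_mem,
      C.one_mul, C.conj_mul (pr_mem j y) (pr_mem l z)]
    simp
  rw [← pr_add (k := k) x, ← pr_add (k := k) y, ← pr_add (k := k) z]
  simp only [map_add, LinearMap.add_apply, key]

theorem b_mul_one_comm {i j : ZMod 2} {x y : A} (hx : x ∈ part k A i) (hy : y ∈ part k A j) :
    C.b (C.mul x y) C.one = sgn k (i * j) * C.b (C.mul y x) C.one := by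
  rw [C.b_mul_right_adj hx hy C.one_mem, C.b_mul_right_adj hy hx C.one_mem, C.one_mul, C.one_mul,
    C.b_supersymm j i y hy _ (C.conj_mem hx), ← C.b_conj_conj (C.conj x) y, C.conj_conj]
  rcases parity_cases i with rfl | rfl <;> rcases parity_cases j with rfl | rfl <;> simp

theorem matTrace_apply (X : Matrix (Fin 3) (Fin 3) A) :
    C.matTrace X = (2 : k)⁻¹ * ∑ i, C.b (X i i) C.one := by
  simp [matTrace, Finset.mul_sum]

theorem matTrace_assoc (X Y Z : Matrix (Fin 3) (Fin 3) A) :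
    C.matTrace (C.matMul (C.matMul X Y) Z) = C.matTrace (C.matMul X (C.matMul Y Z)) := by
  simp only [matTrace_apply, matMul_apply, map_sum, LinearMap.sum_apply, C.b_mul_one_assoc]
  congr 1
  exact Finset.sum_congr rfl fun i _ => Finset.sum_comm

theorem matTrace_comm {i j : ZMod 2} {X Y : Matrix (Fin 3) (Fin 3) A} (hX : X ∈ part k _ i)
    (hY : Y ∈ part k _ j) :
    C.matTrace (C.matMul X Y) = sgn k (i * j) * C.matTrace (C.matMul Y X) := by
  rw [matrix_mem_part] at hX hY
  simp only [matTrace_apply, matMul_apply, map_sum, LinearMap.sum_apply]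
  rw [mul_left_comm, Finset.mul_sum, Finset.sum_comm]
  simp only [Finset.mul_sum]
  refine Finset.sum_congr rfl fun p _ => Finset.sum_congr rfl fun q _ => ?_
  rw [C.b_mul_one_comm (hX p q) (hY q p)]

theorem matCirc_mem_part {i j : ZMod 2} {X Y : Matrix (Fin 3) (Fin 3) A} (hX : X ∈ part k _ i)
    (hY : Y ∈ part k _ j) : C.matCirc X Y ∈ part k _ (i + j) := by
  rw [C.matCirc_apply hX hY]
  exact Submodule.smul_mem _ _ (add_mem (C.matMul_mem hX hY)
    (Submodule.smul_mem _ _ (add_comm i j ▸ C.matMul_mem hY hX)))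

theorem matTrace_circ {i j : ZMod 2} {X Y : Matrix (Fin 3) (Fin 3) A} (hX : X ∈ part k _ i)
    (hY : Y ∈ part k _ j) :
    C.matTrace (C.matCirc X Y) = (2 : k)⁻¹ * 2 * C.matTrace (C.matMul X Y) := by
  rw [C.matCirc_apply hX hY, map_smul, map_add, map_smul, C.matTrace_comm hX hY, smul_eq_mul,
    smul_eq_mul]
  ring

theorem matTrace_circ_assoc {i j l : ZMod 2} {X Y Z : Matrix (Fin 3) (Fin 3) A}
    (hX : X ∈ part k _ i) (hY : Y ∈ part k _ j) (hZ : Z ∈ part k _ l) :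
    C.matTrace (C.matCirc (C.matCirc X Y) Z) = C.matTrace (C.matCirc X (C.matCirc Y Z)) := by
  rw [C.matTrace_circ (C.matCirc_mem_part hX hY) hZ, C.matTrace_circ hX (C.matCirc_mem_part hY hZ),
    C.matCirc_apply hX hY, C.matCirc_apply hY hZ]
  have h := C.matTrace_comm (C.matMul_mem hX hZ) hY
  rw [matTrace_assoc, ← C.matTrace_assoc Y X Z] at h
  simp only [map_smul, map_add, LinearMap.smul_apply, LinearMap.add_apply, smul_eq_mul,
    matTrace_assoc C X Y Z, h]
  rcases parity_cases i with rfl | rfl <;> rcases parity_cases j with rfl | rfl <;>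
    rcases parity_cases l with rfl | rfl <;> simp

theorem circ_comm {i j : ZMod 2} {x y : C.J} (hx : x ∈ part k C.J i) (hy : y ∈ part k C.J j) :
    C.circ x y = sgn k (i * j) • C.circ y x := by
  apply C.toMat_injective
  rw [map_smul, toMat_circ, toMat_circ, C.matCirc_apply (C.toMat_mem_part hx) (C.toMat_mem_part hy),
    C.matCirc_apply (C.toMat_mem_part hy) (C.toMat_mem_part hx)]
  rcases parity_cases i with rfl | rfl <;> rcases parity_cases j with rfl | rfl <;>
    simp [add_comm, ← smul_neg]

theorem circ_mem {i : ZMod 2} {x : C.J} (hx : x ∈ part k C.J i) :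
    C.circ x ∈ part k (C.J →ₗ[k] C.J) i :=
  hom_mem_part fun j y hy => C.toMat_injective (by
    rw [toMat_pr, toMat_circ]
    have := C.matCirc_mem_part (C.toMat_mem_part hx) (C.toMat_mem_part hy)
    rw [add_comm i j] at this
    exact this)

/-- The operators `[L_x, L_y]`, where `x, y ∈ J`. -/
def innerJ : C.J →ₗ[k] C.J →ₗ[k] (C.J →ₗ[k] C.J) := superComm.compl₁₂ C.circ C.circ

/-- For homogeneous `x` and `y`, `[L_x, L_y](z) = x ∘ (y ∘ z) - (-1)^{|x||y|} y ∘ (x ∘ z)`. -/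
theorem innerJ_apply {i j : ZMod 2} {x y : C.J} (hx : x ∈ part k C.J i) (hy : y ∈ part k C.J j)
    (z : C.J) :
    C.innerJ x y z = C.circ x (C.circ y z) - sgn k (i * j) • C.circ y (C.circ x z) := by
  rw [innerJ, LinearMap.compl₁₂_apply, superComm_apply (C.circ_mem hx) (C.circ_mem hy)]

theorem innerJ_mem_J0 (x y z : C.J) : C.innerJ x y z ∈ C.J0 := by
  have key : ∀ i j l, C.innerJ (pr k i x) (pr k j y) (pr k l z) ∈ C.J0 := fun i j l => by
    have hx := pr_mem (k := k) i x
    have hy := pr_mem (k := k) j y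
    have hz := pr_mem (k := k) l z
    have h := congrArg (fun w => C.trace (C.circ w (pr k l z))) (C.circ_comm hx hy)
    have h1 : ∀ {a b c} {u v w : C.J}, u ∈ part k C.J a → v ∈ part k C.J b → w ∈ part k C.J c →
        C.trace (C.circ (C.circ u v) w) = C.trace (C.circ u (C.circ v w)) := fun hu hv hw =>
      C.matTrace_circ_assoc (C.toMat_mem_part hu) (C.toMat_mem_part hv) (C.toMat_mem_part hw)
    change C.trace _ = 0
    simp only [map_smul, LinearMap.smul_apply, h1 hx hy hz, h1 hy hx hz] at h
    rw [C.innerJ_apply hx hy, map_sub, map_smul, h, sub_self]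
  rw [← pr_add (k := k) x, ← pr_add (k := k) y, ← pr_add (k := k) z]
  simp only [map_add, LinearMap.add_apply]
  exact add_mem (add_mem (add_mem (key _ _ _) (key _ _ _)) (add_mem (key _ _ _) (key _ _ _)))
    (add_mem (add_mem (key _ _ _) (key _ _ _)) (add_mem (key _ _ _) (key _ _ _)))

/-- The operator `[L_x, L_y]` on `J₀`. -/
def innerJ0Op (x y : C.J0) : C.J0 →ₗ[k] C.J0 :=
  (C.innerJ (C.J0.subtype x) (C.J0.subtype y)).restrict
    fun z _ => C.innerJ_mem_J0 (C.J0.subtype x) (C.J0.subtype y) z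

theorem innerJ0Op_apply (x y z : C.J0) :
    C.J0.subtype (C.innerJ0Op x y z) =
      C.innerJ (C.J0.subtype x) (C.J0.subtype y) (C.J0.subtype z) := rfl

/-- The operators `[L_x, L_y]` on `J₀`, where `x, y ∈ J₀`. -/
def innerJ0 : C.J0 →ₗ[k] C.J0 →ₗ[k] (C.J0 →ₗ[k] C.J0) :=
  LinearMap.mk₂ k C.innerJ0Op
    (fun x x' y => LinearMap.ext fun z => Subtype.ext (by simp [innerJ0Op]))
    (fun c x y => LinearMap.ext fun z => Subtype.ext (by simp [innerJ0Op]))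
    (fun x y y' => LinearMap.ext fun z => Subtype.ext (by simp [innerJ0Op]))
    (fun c x y => LinearMap.ext fun z => Subtype.ext (by simp [innerJ0Op]))

theorem innerJ0_apply (x y z : C.J0) : (C.innerJ0 x y z : C.J) = C.innerJ x y z := rfl

/-- The trace form `t(x ∘ y)` on `J₀`. -/
def formJ0 : LinearMap.BilinForm k C.J0 :=
  (C.circ.compr₂ C.trace).compl₁₂ C.J0.subtype C.J0.subtype

theorem formJ0_apply (x y : C.J0) : C.formJ0 x y = C.trace (C.circ x y) := rfl

theorem hom_TJ_ext {M : Type*} [AddCommGroup M] [Module k M] {f g : C.TJ →ₗ[k] M}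
    (h : ∀ z, f (C.k1.mkQ z) = g (C.k1.mkQ z)) : f = g :=
  LinearMap.ext fun z => by
    obtain ⟨z, rfl⟩ := C.k1.mkQ_surjective z
    exact h z

section Char3

variable [CharP k 3]

theorem two_ne_zero_of_char (k : Type*) [Field k] [CharP k 3] : (2 : k) ≠ 0 := by
  have : ((2 : ℕ) : k) ≠ 0 := by rw [Ne, CharP.cast_eq_zero_iff k 3]; decide
  exact_mod_cast this

theorem circ_one_left (x : C.J) : C.circ C.oneJ x = x := by
  have h1 : ∀ X, C.matMul (C.toMat C.oneJ) X = X := fun X => by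
    ext p q
    rw [matMul_apply, toMat_oneJ, Finset.sum_eq_single p]
    · simp [C.one_mul]
    · intro b _ hb; simp [Matrix.diagonal_apply_ne _ (Ne.symm hb)]
    · simp
  have h2 : ∀ X, C.matMul X (C.toMat C.oneJ) = X := fun X => by
    ext p q
    rw [matMul_apply, toMat_oneJ, Finset.sum_eq_single q]
    · simp [C.mul_one]
    · intro b _ hb; simp [Matrix.diagonal_apply_ne _ hb]
    · simp
  have key : ∀ i, C.circ C.oneJ (pr k i x) = pr k i x := fun i => C.toMat_injective (by
    rw [toMat_circ, C.matCirc_apply (C.toMat_mem_part C.oneJ_mem) (C.toMat_mem_part (pr_mem i x)),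
      h1, h2, zero_mul, sgn_zero, one_smul, ← two_smul k, inv_smul_smul₀ (two_ne_zero_of_char k)])
  rw [← pr_add (k := k) x, map_add, key, key]

theorem circ_one_right (x : C.J) : C.circ x C.oneJ = x := by
  have key : ∀ i, C.circ (pr k i x) C.oneJ = pr k i x := fun i => by
    rw [C.circ_comm (pr_mem i x) C.oneJ_mem, circ_one_left, mul_zero, sgn_zero, one_smul]
  rw [← pr_add (k := k) x, map_add, LinearMap.add_apply, key, key]

theorem innerJ_one_left (y : C.J) : C.innerJ C.oneJ y = 0 := by
  have key : ∀ j, C.innerJ C.oneJ (pr k j y) = 0 := fun j => by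
    ext z
    rw [C.innerJ_apply C.oneJ_mem (pr_mem j y), circ_one_left, circ_one_left]
    simp
  rw [← pr_add (k := k) y, map_add, key, key, add_zero]

theorem innerJ_one_right (x : C.J) : C.innerJ x C.oneJ = 0 := by
  have key : ∀ i, C.innerJ (pr k i x) C.oneJ = 0 := fun i => by
    ext z
    rw [C.innerJ_apply (pr_mem i x) C.oneJ_mem, circ_one_left, circ_one_left]
    simp
  rw [← pr_add (k := k) x, map_add, LinearMap.add_apply, key, key, add_zero]

theorem innerJ_one (x y : C.J) : C.innerJ x y C.oneJ = 0 := by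
  have key : ∀ i j, C.innerJ (pr k i x) (pr k j y) C.oneJ = 0 := fun i j => by
    rw [C.innerJ_apply (pr_mem i x) (pr_mem j y), circ_one_right, circ_one_right,
      C.circ_comm (pr_mem i x) (pr_mem j y), sub_self]
  rw [← pr_add (k := k) x, ← pr_add (k := k) y]
  simp only [map_add, LinearMap.add_apply, key, add_zero]

/-- The operator on `J₀/k1` induced by `[L_x, L_y]`. -/
def innerTJOp (x y : C.J0) : C.TJ →ₗ[k] C.TJ :=
  C.k1.mapQ C.k1 (C.innerJ0 x y) fun z hz => by
    obtain ⟨c, hc⟩ := C.mem_k1.1 hz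
    refine C.mem_k1.2 ⟨0, ?_⟩
    rw [innerJ0_apply, ← hc, map_smul, innerJ_one, smul_zero, zero_smul]

theorem innerTJOp_apply (x y z : C.J0) :
    C.innerTJOp x y (C.k1.mkQ z) = C.k1.mkQ (C.innerJ0 x y z) := rfl

/-- The operators on `J₀/k1` induced by the `[L_x, L_y]`, where `x, y ∈ J₀`. -/
def innerTJ : C.J0 →ₗ[k] C.J0 →ₗ[k] (C.TJ →ₗ[k] C.TJ) :=
  LinearMap.mk₂ k C.innerTJOp
    (fun x x' y => C.hom_TJ_ext fun z => by
      simp only [LinearMap.add_apply, innerTJOp_apply, map_add])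
    (fun c x y => C.hom_TJ_ext fun z => by
      simp only [LinearMap.smul_apply, innerTJOp_apply, map_smul])
    (fun x y y' => C.hom_TJ_ext fun z => by
      simp only [LinearMap.add_apply, innerTJOp_apply, map_add])
    (fun c x y => C.hom_TJ_ext fun z => by
      simp only [LinearMap.smul_apply, innerTJOp_apply, map_smul])

theorem innerTJ_apply (x y z : C.J0) :
    C.innerTJ x y (C.k1.mkQ z) = C.k1.mkQ (C.innerJ0 x y z) := rfl

theorem innerTJ_left (x : C.J0) (hx : x ∈ C.k1) (y : C.J0) : C.innerTJ x y = 0 := by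
  obtain ⟨c, hc⟩ := C.mem_k1.1 hx
  refine C.hom_TJ_ext fun z => ?_
  have : C.innerJ0 x y z = 0 := Subtype.ext (by
    rw [innerJ0_apply, ← hc, map_smul, LinearMap.smul_apply, innerJ_one_left]; simp)
  rw [innerTJ_apply, this, map_zero, LinearMap.zero_apply]

theorem innerTJ_right (x y : C.J0) (hy : y ∈ C.k1) : C.innerTJ x y = 0 := by
  obtain ⟨c, hc⟩ := C.mem_k1.1 hy
  refine C.hom_TJ_ext fun z => ?_
  have : C.innerJ0 x y z = 0 := Subtype.ext (by
    rw [innerJ0_apply, ← hc, map_smul, innerJ_one_right]; simp)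
  rw [innerTJ_apply, this, map_zero, LinearMap.zero_apply]

theorem formJ0_left (x : C.J0) (hx : x ∈ C.k1) (y : C.J0) : C.formJ0 x y = 0 := by
  obtain ⟨c, hc⟩ := C.mem_k1.1 hx
  have hy : C.trace y = 0 := y.2
  rw [formJ0_apply, ← hc, map_smul, LinearMap.smul_apply, circ_one_left, map_smul, hy, smul_zero]

theorem formJ0_right (x y : C.J0) (hy : y ∈ C.k1) : C.formJ0 x y = 0 := by
  obtain ⟨c, hc⟩ := C.mem_k1.1 hy
  have hx : C.trace x = 0 := x.2
  rw [formJ0_apply, ← hc, map_smul, circ_one_right, map_smul, hx, smul_zero]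

/-- The triple system `T_J = J₀/k1`, with `(x̂|ŷ) = t(x ∘ y)` and `[x̂ŷẑ]` the class of
`[L_x, L_y](z)`. -/
def tripleTJ : SuperTriple k C.TJ where
  form := descend C.k1 C.formJ0 C.formJ0_left C.formJ0_right
  d := descend C.k1 C.innerTJ C.innerTJ_left C.innerTJ_right

theorem tripleTJ_form (x y : C.J0) :
    C.tripleTJ.form (C.k1.mkQ x) (C.k1.mkQ y) = C.trace (C.circ x y) :=
  descend_mk C.k1 C.formJ0 C.formJ0_left C.formJ0_right x y

theorem tripleTJ_d (x y z : C.J0) :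
    C.tripleTJ.d (C.k1.mkQ x) (C.k1.mkQ y) (C.k1.mkQ z) = C.k1.mkQ (C.innerJ0 x y z) :=
  congrArg (fun f => f (C.k1.mkQ z))
    (descend_mk C.k1 C.innerTJ C.innerTJ_left C.innerTJ_right x y)

end Char3

/-- The linear map `δ` on `J₀/k1` is induced by the linear map `d` on `J`. -/
def Induces (d : C.J →ₗ[k] C.J) (δ : C.TJ →ₗ[k] C.TJ) : Prop :=
  ∀ x : C.J0, ∃ y : C.J0, (y : C.J) = d x ∧ δ (C.k1.mkQ x) = C.k1.mkQ y

/-- `𝔡𝔢𝔯 J` as a subspace of `𝔤𝔩(J₀/k1)`: the linear maps induced by superderivations of `J`. -/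
def derTJ : Submodule k (C.TJ →ₗ[k] C.TJ) where
  carrier := {δ | ∃ d ∈ C.derJ, C.Induces d δ}
  add_mem' := by
    rintro δ δ' ⟨d, hd, h⟩ ⟨d', hd', h'⟩
    refine ⟨d + d', add_mem hd hd', fun x => ?_⟩
    obtain ⟨y, hy, hy2⟩ := h x
    obtain ⟨y', hy', hy2'⟩ := h' x
    exact ⟨y + y', by simp [hy, hy'], by simp only [LinearMap.add_apply, hy2, hy2', map_add]⟩
  zero_mem' := ⟨0, zero_mem _, fun x => ⟨0, by simp, by simp⟩⟩
  smul_mem' := by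
    rintro c δ ⟨d, hd, h⟩
    refine ⟨c • d, Submodule.smul_mem _ _ hd, fun x => ?_⟩
    obtain ⟨y, hy, hy2⟩ := h x
    exact ⟨c • y, by simp [hy], by simp only [LinearMap.smul_apply, hy2, map_smul]⟩

end HurwitzSuperalgebra

end Jordan

end Supersquare

end

/-! ### Symmetric composition superalgebras: associative norm, local triality, the triples t_{x,y}.
-/

noncomputable section

namespace Supersquare

section Homogeneous

variable {k : Type*} [Field k]
variable {A : Type*} [AddCommGroup A] [Module k A] [Superspace k A]
variable {B : Type*} [AddCommGroup B] [Module k B] [Superspace k B]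

/-! Indices n are taken modulo 3 and signs are up to the Koszul rule. Write J = ⨁ k e_n ⊕ ⨁ ι_n(S),
where ι_n(a) is normalised by the factor 2 = -1. The Jordan product then reads ι_n(a) ∘ ι_{n+1}(c) =
ι_{n+2}(a • c) and ι_n(a) ∘ ι_n(c) = -b(a,c)(e_{n+1} + e_{n+2}), so it is cyclically symmetric and
depends only on the para-Hurwitz algebra S (`dg_circ`, `co_circ`). About S only three facts are
needed: the norm is associative, b(x • y, z) = b(x, y • z), and consequently both (x • y) • z ± (z •
y) • x and x • (y • z) ± z • (y • x) equal ± b(x,z) y (`mul_mul_left`, `mul_mul_right`).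

From these facts, t_{x,y} lies in 𝔱𝔯𝔦(S), and a triple d in 𝔱𝔯𝔦(S) together with s in S³ defines a
superderivation `opJ (d, s)` of J (`opJ_circ`). Conversely, a Peirce argument with the idempotents
e_n shows that every superderivation is of this form. Thus 𝔡𝔢𝔯 J is 𝔱𝔯𝔦(S) ⊕ S³ as a vector space,
and [L_x, L_y] has the explicit parameters `innerParam x y`.

In characteristic 3 the diagonal of a trace zero element has the same difference between all
cyclically consecutive entries. This common difference is the coordinate of ε in J₀/k1 = kε ⊕ ⨁
ι_n(S). The form is -1 on ε and b on each ι_n(S), hence nondegenerate, and 𝔡𝔢𝔯 J acts faithfully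
through the operators `opT`. The second axiom of an orthosymplectic triple system is checked in
these coordinates. The derivation axiom and the invariance of the form hold because superderivations
of J respect [L_x, L_y] and have image in the kernel of the trace. Simplicity comes from the second
axiom and nondegeneracy: for x in an ideal I, the element (x|y)z ± (x|z)y is again in I.

For a general orthosymplectic T whose form is 𝔰-invariant, 𝔤(T, 𝔰) is a Lie superalgebra. The only
substantial Jacobi identity is the one on three factors V ⊗ T; the second axiom turns it into ⟨v|w⟩u
+ ⟨w|u⟩v + ⟨u|v⟩w = 0, which holds in a plane.

For the isomorphism, 𝔱𝔯𝔦(S_{1,2}) consists of the constant triples (δ, δ, δ) with δ = δ_{σ,p}, σ in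
𝔰𝔭(V), p in V. The map `isoMap` sends δ_{σ,p} to σ - p ⊗ ε, a triple d of 𝔱𝔯𝔦(S) to `opD d`, ι_n(1 ⊗
a) to `opN n a` = -[ε, ι_n(a), ·], and ι_n(v ⊗ a) to v ⊗ ι_n(a). So 1 ⊗ S supplies the S³ part of
𝔡𝔢𝔯 J, V ⊗ S supplies ⨁ V ⊗ ι_n(S), and the odd part of 𝔱𝔯𝔦(S_{1,2}) supplies V ⊗ ε. The brackets
are compared on homogeneous generators. As the map is bijective, the Lie superalgebra axioms for
𝔤(S_{1,2}, S) are pulled back from 𝔤(J) instead of being verified. -/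

theorem homogeneous_induction {p : A → Prop} (hadd : ∀ x y, p x → p y → p (x + y))
    (h : ∀ i, ∀ x ∈ part k A i, p x) (x : A) : p x := by
  rw [← pr_add (k := k) x]
  exact hadd _ _ (h 0 _ (pr_mem 0 x)) (h 1 _ (pr_mem 1 x))

theorem hom_apply_mem {i j : ZMod 2} {f : A →ₗ[k] B} (hf : f ∈ part k (A →ₗ[k] B) i) {x : A}
    (hx : x ∈ part k A j) : f x ∈ part k B (j + i) := by
  have h : (∑ l : ZMod 2, pr k (l + i) ∘ₗ f ∘ₗ pr k l) x = f x := congrArg (fun g => g x) hf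
  rw [← h, sum_parity]
  simp only [LinearMap.add_apply, LinearMap.comp_apply, pr_of_mem hx]
  rcases parity_cases j with rfl | rfl <;> simp [pr_mem]

theorem pr_of_mem_self {j : ZMod 2} {x : A} (hx : x ∈ part k A j) : pr k j x = x := hx

theorem pr_of_mem_ne {j i : ZMod 2} {x : A} (hx : x ∈ part k A j) (h : i ≠ j) :
    pr k i x = 0 := by rw [pr_of_mem hx, if_neg h]

theorem inv_two_of_char (k : Type*) [Field k] [CharP k 3] : (2 : k)⁻¹ = -1 := by
  have h3 : (3 : k) = 0 := by exact_mod_cast CharP.cast_eq_zero k 3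
  rw [inv_eq_iff_eq_inv, inv_neg, inv_one]
  linear_combination h3

theorem three_eq_zero_of_char (k : Type*) [Field k] [CharP k 3] : (3 : k) = 0 := by
  exact_mod_cast CharP.cast_eq_zero k 3

end Homogeneous

namespace CompositionSuperalgebra

variable {k : Type*} [Field k] {A : Type*} [AddCommGroup A] [Module k A] [Superspace k A]
variable (S : CompositionSuperalgebra k A)

theorem b_ext {x y : A} (h : ∀ i, ∀ z ∈ part k A i, S.b x z = S.b y z) : x = y := by
  suffices H : ∀ x, (∀ i, ∀ z ∈ part k A i, S.b x z = 0) → x = 0 by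
    rw [← sub_eq_zero]; exact H _ fun i z hz => by simp [h i z hz]
  intro x h
  have key : ∀ i, pr k i x = 0 := fun i => S.regular i _ (pr_mem i x) fun y hy => by
    have := h i y hy
    rw [← pr_add (k := k) x, map_add, LinearMap.add_apply] at this
    rcases parity_cases i with rfl | rfl
    · rwa [S.b_even 1 0 (by decide) _ (pr_mem 1 x) y hy, add_zero] at this
    · rwa [S.b_even 0 1 (by decide) _ (pr_mem 0 x) y hy, zero_add] at this
  rw [← pr_add (k := k) x, key, key, add_zero]

/-- The norm of a symmetric composition superalgebra is associative. -/
def IsAssociative : Prop := ∀ x y z, S.b (S.mul x y) z = S.b x (S.mul y z)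

theorem r_apply {i j : ZMod 2} {x y : A} (hx : x ∈ part k A i) (hy : y ∈ part k A j) :
    S.r x y = sgn k (i * j) • S.mul y x := by
  rw [r, sflip_apply S.mul hy hx, mul_comm]

theorem sigma_apply {i j l : ZMod 2} {x y z : A} (hx : x ∈ part k A i) (hy : y ∈ part k A j)
    (hz : z ∈ part k A l) : S.sigma x y z =
      (sgn k (j * l) * S.b x z) • y - (sgn k (i * (j + l)) * S.b y z) • x := by
  change (∑ a : ZMod 2, ∑ c : ZMod 2, ∑ e : ZMod 2,
      (sgn k (c * e) • (S.b (pr k a x)).smulRight (pr k c y) ∘ₗ pr k e -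
        sgn k (a * (c + e)) • (S.b (pr k c y)).smulRight (pr k a x) ∘ₗ pr k e)) z = _
  rcases parity_cases i with rfl | rfl <;> rcases parity_cases j with rfl | rfl <;>
    rcases parity_cases l with rfl | rfl <;>
    simp [sum_parity, pr_of_mem hx, pr_of_mem hy, pr_of_mem hz]

theorem mul_mem' {i j l : ZMod 2} {x y : A} (hx : x ∈ part k A i) (hy : y ∈ part k A j)
    (h : i + j = l) : S.mul x y ∈ part k A l := h ▸ S.mul_mem i j x hx y hy

variable {S}

/-- Pairing with t, associativity turns b((x • y) • z, t) into b(x • y, z • t), so the claim is the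
linearised composition law read through the nondegenerate form. -/
theorem IsAssociative.mul_mul_left (hS : S.IsAssociative) {i j l : ZMod 2} {x y z : A}
    (hx : x ∈ part k A i) (hy : y ∈ part k A j) (hz : z ∈ part k A l) :
    S.mul (S.mul x y) z + sgn k (i * j + i * l + j * l) • S.mul (S.mul z y) x =
      (sgn k (j * l) * S.b x z) • y := by
  refine S.b_ext fun m t _ => ?_
  have h := S.b_mul_mul i j l x hx y hy z hz t
  rw [← hS, ← hS] at h
  simp only [map_add, map_smul, LinearMap.add_apply, LinearMap.smul_apply, smul_eq_mul]
  rw [h, mul_assoc]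

/-- The mirror image of `mul_mul_left`: the composition law is applied to (y, z, t) and x, and
supersymmetry with associativity moves b(x • (y • z), t) to ± b(y • z, t • x). -/
theorem IsAssociative.mul_mul_right (hS : S.IsAssociative) {i j l : ZMod 2} {x y z : A}
    (hx : x ∈ part k A i) (hy : y ∈ part k A j) (hz : z ∈ part k A l) :
    S.mul x (S.mul y z) + sgn k (i * j + i * l + j * l) • S.mul z (S.mul y x) =
      (sgn k (j * l) * S.b x z) • y := by
  refine S.b_ext fun m t ht => ?_
  have h := S.b_mul_mul j l m y hy z hz t ht x
  have e1 := hS x (S.mul y z) t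
  have e2 := hS z (S.mul y x) t
  have e3 := S.b_supersymm i _ x hx _ (S.mul_mem _ _ _ (S.mul_mem _ _ _ hy _ hz) _ ht)
  have e4 := S.b_supersymm l _ z hz _ (S.mul_mem _ _ _ (S.mul_mem _ _ _ hy _ hx) _ ht)
  have e5 := hS (S.mul y z) t x
  have e6 := hS (S.mul y x) t z
  have e7 := S.b_supersymm (m + l) _ _ (S.mul_mem _ _ _ ht _ hz) _ (S.mul_mem _ _ _ hy _ hx)
  have e8 := S.b_supersymm l i z hz x hx
  have e0 := S.b_even i l
  have e9 := S.b_even j m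
  simp only [map_add, map_smul, LinearMap.add_apply, LinearMap.smul_apply, smul_eq_mul]
  rw [e1, e2, e3, e4, e5, e6]
  rw [e7, e8] at h
  rcases parity_cases i with rfl | rfl <;> rcases parity_cases j with rfl | rfl <;>
    rcases parity_cases l with rfl | rfl <;> rcases parity_cases m with rfl | rfl <;>
    simp [e0, e9, hx, hy, hz, ht] at h ⊢ <;>
    first | linear_combination h | linear_combination -h

theorem b_ext_left {x y : A} (h : ∀ i, ∀ z ∈ part k A i, S.b z x = S.b z y) : x = y := by
  have hx : ∀ i j, ∀ x : A, ∀ z ∈ part k A i, S.b (pr k j x) z = sgn k (j * i) * S.b z (pr k j x) :=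
    fun i j x z hz => S.b_supersymm _ _ _ (pr_mem _ _) _ hz
  have key : ∀ j, pr k j x = pr k j y := fun j => S.b_ext fun i z hz => by
    rw [hx i j x z hz, hx i j y z hz]
    congr 1
    by_cases hij : i = j
    · subst hij
      have h' := h i z hz
      rw [← pr_add (k := k) x, ← pr_add (k := k) y, map_add, map_add] at h'
      rcases parity_cases i with rfl | rfl
      · simpa [S.b_even 0 1 (by decide) z hz _ (pr_mem _ _)] using h'
      · simpa [S.b_even 1 0 (by decide) z hz _ (pr_mem _ _)] using h'
    · rw [S.b_even i j hij z hz _ (pr_mem _ _), S.b_even i j hij z hz _ (pr_mem _ _)]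
  rw [← pr_add (k := k) x, ← pr_add (k := k) y, key, key]

theorem mem_osp {i : ZMod 2} {d : A →ₗ[k] A} (hd : d ∈ part k (A →ₗ[k] A) i) :
    d ∈ S.osp ↔ ∀ j, ∀ x ∈ part k A j, ∀ y, S.b (d x) y + sgn k (i * j) * S.b x (d y) = 0 := by
  refine ⟨fun h j x hx y => by simpa only [pr_of_mem_self hd] using h i j x hx y,
    fun h i' j x hx y => ?_⟩
  by_cases hi : i' = i
  · subst hi; simpa only [pr_of_mem_self hd] using h j x hx y
  · simp [pr_of_mem_ne hd hi]

/-- The defining conditions quantify over both homogeneous components of d; for a homogeneous triple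
the condition on the other component is vacuous. -/
theorem mem_tri {i : ZMod 2} {d : Fin 3 → (A →ₗ[k] A)}
    (hd : ∀ n, d n ∈ part k (A →ₗ[k] A) i) :
    d ∈ S.tri ↔ (∀ n, ∀ j, ∀ x ∈ part k A j, ∀ y,
        S.b (d n x) y + sgn k (i * j) * S.b x (d n y) = 0) ∧
      ∀ j, ∀ x ∈ part k A j, ∀ y,
        d 0 (S.mul x y) = S.mul (d 1 x) y + sgn k (i * j) • S.mul x (d 2 y) := by
  refine ⟨fun h => ⟨fun n => (mem_osp (hd n)).1 (h.1 n),
      fun j x hx y => by simpa only [pr_of_mem_self (hd _)] using h.2 i j x hx y⟩,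
    fun h => ⟨fun n => (mem_osp (hd n)).2 (h.1 n), fun i' j x hx y => ?_⟩⟩
  by_cases hi : i' = i
  · subst hi; simpa only [pr_of_mem_self (hd _)] using h.2 j x hx y
  · simp [pr_of_mem_ne (hd _) hi]

/-- Local triality. Pair with z: skewness of d_{n+1} and associativity give b(z, d_{n+1}(x • y)) = ±
b(d_{n+1}(z) • x, y); the relation at n replaces d_{n+1}(z) • x by d_n(z • x) ∓ z • d_{n+2}(x), and
skewness of d_n moves it back. Hence θ preserves 𝔱𝔯𝔦(S). -/
theorem IsAssociative.triality_rotate (hS : S.IsAssociative) {i : ZMod 2}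
    {d : Fin 3 → (A →ₗ[k] A)}
    (hosp : ∀ n, ∀ j, ∀ x ∈ part k A j, ∀ y,
        S.b (d n x) y + sgn k (i * j) * S.b x (d n y) = 0) {n : Fin 3}
    (h : ∀ j, ∀ x ∈ part k A j, ∀ y,
        d n (S.mul x y) = S.mul (d (n + 1) x) y + sgn k (i * j) • S.mul x (d (n + 2) y))
    {j : ZMod 2} {x : A} (hx : x ∈ part k A j) (y : A) :
    d (n + 1) (S.mul x y) = S.mul (d (n + 2) x) y + sgn k (i * j) • S.mul x (d n y) := by
  refine b_ext_left (S := S) fun m z hz => ?_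
  have h1 := hosp (n + 1) m z hz (S.mul x y)
  have h2 := hosp n (m + j) _ (S.mul_mem _ _ _ hz _ hx) y
  rw [h m z hz x] at h2
  rw [← hS] at h1
  have h3 := hS z (d (n + 2) x) y
  have h4 := hS z x (d n y)
  simp only [map_add, map_smul, LinearMap.add_apply, LinearMap.smul_apply, smul_eq_mul] at *
  rw [h3, h4] at h2
  rcases parity_cases i with rfl | rfl <;> rcases parity_cases j with rfl | rfl <;>
    rcases parity_cases m with rfl | rfl <;> simp at h1 h2 ⊢ <;>
    first | linear_combination h1 - h2 | linear_combination h2 - h1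

theorem IsAssociative.triality (hS : S.IsAssociative) {i : ZMod 2} {d : Fin 3 → (A →ₗ[k] A)}
    (hd : ∀ n, d n ∈ part k (A →ₗ[k] A) i) (h : d ∈ S.tri) (n : Fin 3) {j : ZMod 2} {x : A}
    (hx : x ∈ part k A j) (y : A) :
    d n (S.mul x y) = S.mul (d (n + 1) x) y + sgn k (i * j) • S.mul x (d (n + 2) y) := by
  obtain ⟨h1, h2⟩ := (mem_tri hd).1 h
  have h3 : ∀ j, ∀ x ∈ part k A j, ∀ y, d 1 (S.mul x y) =
      S.mul (d 2 x) y + sgn k (i * j) • S.mul x (d 0 y) :=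
    fun j x hx y => hS.triality_rotate h1 (n := 0) h2 hx y
  have h4 : ∀ j, ∀ x ∈ part k A j, ∀ y, d 2 (S.mul x y) =
      S.mul (d 0 x) y + sgn k (i * j) • S.mul x (d 1 y) :=
    fun j x hx y => hS.triality_rotate h1 (n := 1) h3 hx y
  fin_cases n
  · exact h2 j x hx y
  · exact h3 j x hx y
  · exact h4 j x hx y

theorem theta_mem_part {i : ZMod 2} {d : Fin 3 → (A →ₗ[k] A)}
    (hd : ∀ n, d n ∈ part k (A →ₗ[k] A) i) (m n : Fin 3) :
    theta k A m d n ∈ part k (A →ₗ[k] A) i := hd (n - m)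

theorem IsAssociative.theta_mem_tri (hS : S.IsAssociative) {i : ZMod 2}
    {d : Fin 3 → (A →ₗ[k] A)} (hd : ∀ n, d n ∈ part k (A →ₗ[k] A) i) (h : d ∈ S.tri)
    (m : Fin 3) : theta k A m d ∈ S.tri := by
  refine (mem_tri (theta_mem_part hd m)).2 ⟨fun n => ((mem_tri hd).1 h).1 (n - m),
    fun j x hx y => ?_⟩
  have e1 : ∀ m : Fin 3, 0 - m + 1 = 1 - m := by decide
  have e2 : ∀ m : Fin 3, 0 - m + 2 = 2 - m := by decide
  have := hS.triality hd h (0 - m) hx y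
  rwa [e1, e2] at this

variable (S) in
theorem t_apply_zero (x y : A) : S.t x y 0 = S.sigma x y := rfl

variable (S) in
theorem t_apply_one (x y z : A) :
    S.t x y 1 z = ((2 : k)⁻¹ * S.b x y) • z - S.r x (S.mul y z) := rfl

variable (S) in
theorem t_apply_two (x y z : A) :
    S.t x y 2 z = ((2 : k)⁻¹ * S.b x y) • z - S.mul x (S.r y z) := rfl

variable (S) in
theorem sigma_mem_part {i j : ZMod 2} {x y : A} (hx : x ∈ part k A i) (hy : y ∈ part k A j) :
    S.sigma x y ∈ part k (A →ₗ[k] A) (i + j) := by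
  refine hom_mem_part fun l z hz => ?_
  rw [S.sigma_apply hx hy hz]
  refine sub_mem ?_ ?_
  · by_cases h : i = l
    · subst h
      have e : i + (i + j) = j := by
        rcases parity_cases i with rfl | rfl <;> rcases parity_cases j with rfl | rfl <;> decide
      exact Submodule.smul_mem _ _ (e.symm ▸ hy)
    · simp [S.b_even i l h x hx z hz]
  · by_cases h : j = l
    · subst h
      have e : j + (i + j) = i := by
        rcases parity_cases i with rfl | rfl <;> rcases parity_cases j with rfl | rfl <;> decide
      exact Submodule.smul_mem _ _ (e.symm ▸ hx)
    · simp [S.b_even j l h y hy z hz]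

variable (S) in
theorem r_mem {i j l : ZMod 2} {x y : A} (hx : x ∈ part k A i) (hy : y ∈ part k A j)
    (h : i + j = l) : S.r x y ∈ part k A l := by
  rw [S.r_apply hx hy]
  exact Submodule.smul_mem _ _ (S.mul_mem' hy hx (by rw [add_comm, h]))

variable (S) in
theorem t_mem_part {i j : ZMod 2} {x y : A} (hx : x ∈ part k A i) (hy : y ∈ part k A j)
    (n : Fin 3) : S.t x y n ∈ part k (A →ₗ[k] A) (i + j) := by
  have key : ∀ l, ∀ z ∈ part k A l, ((2 : k)⁻¹ * S.b x y) • z ∈ part k A (l + (i + j)) := by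
    intro l z hz
    by_cases h : i = j
    · subst h
      have e : l + (i + i) = l := by
        rcases parity_cases i with rfl | rfl <;> simp
      rw [e]
      exact Submodule.smul_mem _ _ hz
    · simp [S.b_even i j h x hx y hy]
  fin_cases n
  · exact S.sigma_mem_part hx hy
  · exact hom_mem_part fun l z hz => sub_mem (key l z hz)
      (S.r_mem hx (S.mul_mem _ _ _ hy _ hz) (by ring))
  · exact hom_mem_part fun l z hz => sub_mem (key l z hz)
      (S.mul_mem' hx (S.r_mem hy hz rfl) (by ring))

/-- For σ_{x,y} this is supersymmetry of b. For the other two components the quartic terms, brought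
to the form b(y • z, x • w) by associativity, add up to b(x,y) b(z,w) by the composition law, and
this cancels the two halves ½ b(x,y) b(z,w). -/
theorem IsAssociative.t_osp (hS : S.IsAssociative) (h2 : (2 : k) ≠ 0) {i j l m : ZMod 2}
    {x y z w : A} (hx : x ∈ part k A i) (hy : y ∈ part k A j) (hz : z ∈ part k A l)
    (hw : w ∈ part k A m) (n : Fin 3) :
    S.b (S.t x y n z) w + sgn k ((i + j) * l) * S.b z (S.t x y n w) = 0 := by
  have hh : (2 : k)⁻¹ + 2⁻¹ = 1 := by rw [← two_mul, mul_inv_cancel₀ h2]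
  have d0 := S.b_even i j
  have d1 := S.b_even l m
  have d2 := S.b_even i l
  have d3 := S.b_even j m
  have d4 := S.b_even i m
  have d5 := S.b_even j l
  fin_cases n
  · have c1 := S.b_supersymm l i z hz x hx
    have c2 := S.b_supersymm l j z hz y hy
    change S.b (S.sigma x y z) w + sgn k ((i + j) * l) * S.b z (S.sigma x y w) = 0
    rw [S.sigma_apply hx hy hz, S.sigma_apply hx hy hw]
    simp only [map_sub, map_smul, LinearMap.sub_apply, LinearMap.smul_apply, smul_eq_mul, c1, c2]
    rcases parity_cases i with rfl | rfl <;> rcases parity_cases j with rfl | rfl <;>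
      rcases parity_cases l with rfl | rfl <;> rcases parity_cases m with rfl | rfl <;>
      simp [d2, d3, d4, d5, hx, hy, hz, hw] <;> ring1
  · have h := congrArg (sgn k (i * (j + l)) * ·) (S.b_mul_mul j l i y hy z hz x hx w)
    have e1 := hS (S.mul y z) x w
    have e2 := hS (S.mul y w) x z
    have c1 := S.b_supersymm l _ z hz _ (S.mul_mem _ _ _ (S.mul_mem _ _ _ hy _ hw) _ hx)
    have c2 := S.b_supersymm _ _ _ (S.mul_mem _ _ _ hy _ hw) _ (S.mul_mem _ _ _ hx _ hz)
    have c3 := S.b_supersymm j i y hy x hx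
    change S.b (S.t x y 1 z) w + sgn k ((i + j) * l) * S.b z (S.t x y 1 w) = 0
    rw [t_apply_one, t_apply_one, S.r_apply hx (S.mul_mem _ _ _ hy _ hz),
      S.r_apply hx (S.mul_mem _ _ _ hy _ hw)]
    simp only [map_sub, map_smul, LinearMap.sub_apply, LinearMap.smul_apply, smul_eq_mul, c1, e1,
      e2, c2, c3] at h ⊢
    rcases parity_cases i with rfl | rfl <;> rcases parity_cases j with rfl | rfl <;>
      rcases parity_cases l with rfl | rfl <;> rcases parity_cases m with rfl | rfl <;>
      simp [d0, d1, hx, hy, hz, hw] at h ⊢ <;>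
      first
      | linear_combination S.b x y * S.b z w * hh - h
      | linear_combination -h
  · have h := congrArg (sgn k (j * l + m * (i + j + l)) * ·)
      (S.b_mul_mul m i l w hw x hx z hz y)
    have e1 := hS w x (S.mul z y)
    have e2 := hS z x (S.mul w y)
    have c1 := S.b_supersymm _ m _ (S.mul_mem _ _ _ hx _ (S.mul_mem _ _ _ hz _ hy)) w hw
    have c3 := S.b_supersymm m l w hw z hz
    change S.b (S.t x y 2 z) w + sgn k ((i + j) * l) * S.b z (S.t x y 2 w) = 0
    rw [t_apply_two, t_apply_two, S.r_apply hy hz, S.r_apply hy hw]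
    simp only [map_sub, map_smul, LinearMap.sub_apply, LinearMap.smul_apply, smul_eq_mul, c1, ← e1,
      ← e2, c3] at h ⊢
    rcases parity_cases i with rfl | rfl <;> rcases parity_cases j with rfl | rfl <;>
      rcases parity_cases l with rfl | rfl <;> rcases parity_cases m with rfl | rfl <;>
      simp [d0, d1, hx, hy, hz, hw] at h ⊢ <;>
      first
      | linear_combination S.b x y * S.b z w * hh - h
      | linear_combination -h

/-- Three instances of the degree three identities connect ((y • u) • x) • v with u • (x • (v • y));
the scalar terms that they leave are exactly σ_{x,y}(u • v) and b(x,y) u • v. -/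
theorem IsAssociative.t_triality (hS : S.IsAssociative) (h2 : (2 : k) ≠ 0) {i j l m : ZMod 2}
    {x y u v : A} (hx : x ∈ part k A i) (hy : y ∈ part k A j) (hu : u ∈ part k A l)
    (hv : v ∈ part k A m) :
    S.t x y 0 (S.mul u v) = S.mul (S.t x y 1 u) v + sgn k ((i + j) * l) • S.mul u (S.t x y 2 v) := by
  have a1 := congrArg (sgn k (i * (j + l)) • ·)
    (hS.mul_mul_left (S.mul_mem _ _ _ hy _ hu) hx hv)
  have a3 := congrArg (sgn k ((i + j) * l + j * m + (i * m + i * j + m * j)) • ·)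
    (hS.mul_mul_right hu hy (S.mul_mem _ _ _ hv _ hx))
  have a4 := congrArg (fun w => sgn k ((i + j) * l + j * m) • S.mul u w)
    (hS.mul_mul_right hx hv hy)
  have b1 := hS y u v
  have b3 := hS u v x
  have c1 := S.b_supersymm _ _ _ (S.mul_mem _ _ _ hu _ hv) _ hx
  have d0 := S.b_even i (l + m)
  have d1 := S.b_even j (l + m)
  have d2 := S.b_even i j
  have hh : ((2 : k)⁻¹ * S.b x y) • S.mul u v + ((2 : k)⁻¹ * S.b x y) • S.mul u v =
      S.b x y • S.mul u v := by
    rw [← add_smul, ← add_mul, ← two_mul, mul_inv_cancel₀ h2, one_mul]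
  rw [b1] at a1
  rw [← b3, c1] at a3
  rw [t_apply_zero, S.sigma_apply hx hy (S.mul_mem _ _ _ hu _ hv), t_apply_one, t_apply_two,
    S.r_apply hx (S.mul_mem _ _ _ hy _ hu), S.r_apply hy hv]
  simp only [map_sub, map_add, map_smul, LinearMap.sub_apply, LinearMap.smul_apply] at a1 a3 a4 ⊢
  have hxx := S.mul_mem _ _ _ hu _ hv
  rcases parity_cases i with rfl | rfl <;> rcases parity_cases j with rfl | rfl <;>
    rcases parity_cases l with rfl | rfl <;> rcases parity_cases m with rfl | rfl <;>
    simp [d0, d2, hx, hy, -mul_eq_zero] at a1 a3 a4 ⊢ <;>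
    first
    | linear_combination (norm := module) a1 + a4 - a3 - hh
    | linear_combination (norm := module) a1 + a4 - a3

theorem IsAssociative.t_mem_tri_of_mem (hS : S.IsAssociative) (h2 : (2 : k) ≠ 0) {i j : ZMod 2}
    {x y : A} (hx : x ∈ part k A i) (hy : y ∈ part k A j) : S.t x y ∈ S.tri := by
  refine (mem_tri (S.t_mem_part hx hy)).2 ⟨fun n l z hz w => ?_, fun l z hz w => ?_⟩
  · induction w using homogeneous_induction (k := k) (A := A) with
    | hadd w w' h h' => simp only [map_add]; linear_combination h + h'
    | h m w hw => exact hS.t_osp h2 hx hy hz hw n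
  · induction w using homogeneous_induction (k := k) (A := A) with
    | hadd w w' h h' => simp only [map_add, h, h', smul_add]; abel
    | h m w hw => exact hS.t_triality h2 hx hy hz hw

end CompositionSuperalgebra

/-- The adjoint of right multiplication by ȳ is right multiplication by y, so b(x̄ ȳ, z) = ± b(x̄, z
y). The involution is an isometry and reverses products, which turns this into b(x, ȳ z̄). -/
theorem HurwitzSuperalgebra.paraHurwitz_isAssociative {k : Type*} [Field k] {A : Type*}
    [AddCommGroup A] [Module k A] [Superspace k A] (C : HurwitzSuperalgebra k A) :
    C.paraHurwitz.IsAssociative := by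
  intro x y z
  change C.b (C.mul (C.conj x) (C.conj y)) z = C.b x (C.mul (C.conj y) (C.conj z))
  induction x using homogeneous_induction (k := k) (A := A) with
  | hadd x x' h h' => simp only [map_add, LinearMap.add_apply, h, h']
  | h i x hx =>
  induction y using homogeneous_induction (k := k) (A := A) with
  | hadd y y' h h' => simp only [map_add, LinearMap.add_apply, h, h']
  | h j y hy =>
  induction z using homogeneous_induction (k := k) (A := A) with
  | hadd z z' h h' => simp only [map_add, h, h']
  | h l z hz =>
  rw [C.b_mul_right_adj (C.conj_mem hx) (C.conj_mem hy) hz, C.conj_conj,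
    ← C.b_conj_conj x, C.conj_mul (C.conj_mem hy) (C.conj_mem hz), C.conj_conj, C.conj_conj,
    map_smul, smul_eq_mul]

end Supersquare
end

/-! ### Coordinates on J = H₃(C, *) and the Jordan product in these coordinates. -/

noncomputable section

namespace Supersquare

theorem sum_fin_three_rotate {M : Type*} [AddCommMonoid M] (f : Fin 3 → M) (n : Fin 3) :
    ∑ l, f l = f n + f (n + 1) + f (n + 2) := by
  rw [Fin.sum_univ_three]
  fin_cases n
  · rfl
  · change f 0 + f 1 + f 2 = f 1 + f 2 + f 0
    abel
  · change f 0 + f 1 + f 2 = f 2 + f 0 + f 1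
    abel

/-- These normal forms keep the cyclic index n symbolic, so one computation serves all three
positions. -/
theorem fin_three_add_one_one (n : Fin 3) : n + 1 + 1 = n + 2 := by revert n; decide

theorem fin_three_add_one_two (n : Fin 3) : n + 1 + 2 = n := by revert n; decide

theorem fin_three_add_two_one (n : Fin 3) : n + 2 + 1 = n := by revert n; decide

theorem fin_three_add_two_two (n : Fin 3) : n + 2 + 2 = n + 1 := by revert n; decide

theorem fin_three_cases (p q : Fin 3) : p = q ∨ (∃ n : Fin 3, p = n + 2 ∧ q = n + 1) ∨
    ∃ n : Fin 3, p = n + 1 ∧ q = n + 2 := by revert p q; decide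

namespace HurwitzSuperalgebra

variable {k : Type*} [Field k] {A : Type*} [AddCommGroup A] [Module k A] [Superspace k A]
variable (C : HurwitzSuperalgebra k A)

/-- The diagonal entries of an element of `J`, as scalars. -/
def dg (n : Fin 3) : C.J →ₗ[k] k :=
  -((C.b.flip C.one) ∘ₗ Matrix.entryLinearMap k A n n ∘ₗ C.toMat)

/-- The off-diagonal coordinates of an element of `J`: the entry `(n + 2, n + 1)` is `- co n`. -/
def co (n : Fin 3) : C.J →ₗ[k] A := -(Matrix.entryLinearMap k A (n + 2) (n + 1) ∘ₗ C.toMat)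

/-- The matrix with given coordinates. -/
def coordMat (x : (Fin 3 → k) × (Fin 3 → A)) (p q : Fin 3) : A :=
  if p = q then x.1 p • C.one else if p = q + 1 then -x.2 (q + 2) else -C.conj (x.2 (p + 2))

/-- The element of `J` with given coordinates. -/
def mkJ : ((Fin 3 → k) × (Fin 3 → A)) →ₗ[k] C.J where
  toFun x := C.ofMat (C.coordMat x) (by
    intro p q
    rcases fin_three_cases p q with rfl | ⟨n, rfl, rfl⟩ | ⟨n, rfl, rfl⟩
    · simp [coordMat, C.conj_one]
    · simp [coordMat, fin_three_add_one_one, fin_three_add_one_two, C.conj_conj]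
    · simp [coordMat, fin_three_add_one_one, fin_three_add_one_two])
  map_add' x y := C.toMat_injective (by
    rw [map_add]
    ext p q
    change C.coordMat _ p q = C.coordMat _ p q + C.coordMat _ p q
    simp only [coordMat]
    split_ifs <;> simp [add_smul] <;> abel)
  map_smul' c x := C.toMat_injective (by
    rw [map_smul]
    ext p q
    change C.coordMat _ p q = c • C.coordMat _ p q
    simp only [coordMat]
    split_ifs <;> simp [mul_smul])

theorem toMat_mkJ (x) (p q : Fin 3) : C.toMat (C.mkJ x) p q = C.coordMat x p q := rfl

theorem dg_apply (n : Fin 3) (x : C.J) : C.dg n x = -C.b (C.toMat x n n) C.one := rfl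

theorem co_apply (n : Fin 3) (x : C.J) : C.co n x = -C.toMat x (n + 2) (n + 1) := rfl

theorem toMat_lower (n : Fin 3) (x : C.J) : C.toMat x (n + 2) (n + 1) = -C.co n x := by
  rw [co_apply, neg_neg]

theorem toMat_upper (n : Fin 3) (x : C.J) : C.toMat x (n + 1) (n + 2) = -C.conj (C.co n x) := by
  rw [C.toMat_mem x (n + 1) (n + 2), toMat_lower, map_neg]

theorem co_mkJ (n : Fin 3) (x) : C.co n (C.mkJ x) = x.2 n := by
  simp [co_apply, toMat_mkJ, coordMat, fin_three_add_one_one, fin_three_add_one_two]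

theorem co_mem {i : ZMod 2} {x : C.J} (hx : x ∈ part k C.J i) (n : Fin 3) :
    C.co n x ∈ part k A i :=
  neg_mem (matrix_mem_part.1 (C.toMat_mem_part hx) _ _)

theorem dg_odd {x : C.J} (hx : x ∈ part k C.J 1) (n : Fin 3) : C.dg n x = 0 := by
  rw [dg_apply, C.b_one_odd (matrix_mem_part.1 (C.toMat_mem_part hx) n n) (by decide), neg_zero]

theorem b_conj_mul_one (x y : A) : C.b (C.mul (C.conj x) y) C.one = C.b x y := by
  induction x using homogeneous_induction (k := k) (A := A) with
  | hadd x x' h h' => simp only [map_add, LinearMap.add_apply, h, h']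
  | h i x hx =>
  induction y using homogeneous_induction (k := k) (A := A) with
  | hadd y y' h h' => simp only [map_add, LinearMap.add_apply, h, h']
  | h j y hy =>
  rw [C.b_mul_left_adj (C.conj_mem hx) hy, C.conj_conj, C.mul_one, C.b_supersymm i j x hx y hy]

theorem b_mul_conj_one (x y : A) : C.b (C.mul x (C.conj y)) C.one = C.b x y := by
  rw [← C.conj_conj x, b_conj_mul_one, C.conj_conj, C.b_conj_conj]

variable [CharP k 3]

/-- A diagonal entry a is fixed by the involution, so 2a = b(a,1)1; as 2 = -1, the scalar is
-b(a,1), which is the sign in `dg`. -/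
theorem toMat_diag (n : Fin 3) (x : C.J) : C.toMat x n n = C.dg n x • C.one := by
  have h := C.toMat_mem x n n
  have h3 := three_eq_zero_of_char k
  rw [conj_apply] at h
  rw [dg_apply]
  have h' : (3 : k) • C.toMat x n n = 0 := by rw [h3, zero_smul]
  linear_combination (norm := module) h' - h

theorem dg_mkJ (n : Fin 3) (x) : C.dg n (C.mkJ x) = x.1 n := by
  have h3 := three_eq_zero_of_char k
  simp [dg_apply, toMat_mkJ, coordMat, C.b_one_one]
  linear_combination -(x.1 n) * h3

theorem J_ext {x y : C.J} (h : ∀ n, C.dg n x = C.dg n y) (h' : ∀ n, C.co n x = C.co n y) :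
    x = y := by
  apply C.toMat_injective
  ext p q
  rcases fin_three_cases p q with rfl | ⟨n, rfl, rfl⟩ | ⟨n, rfl, rfl⟩
  · rw [toMat_diag, toMat_diag, h]
  · rw [toMat_lower, toMat_lower, h']
  · rw [toMat_upper, toMat_upper, h']

theorem mem_part_J {i : ZMod 2} {x : C.J} (h : i ≠ 0 → ∀ n, C.dg n x = 0)
    (h' : ∀ n, C.co n x ∈ part k A i) : x ∈ part k C.J i := by
  apply C.toMat_injective
  rw [toMat_pr]
  apply mem_part.1
  rw [matrix_mem_part]
  intro p q
  rcases fin_three_cases p q with rfl | ⟨n, rfl, rfl⟩ | ⟨n, rfl, rfl⟩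
  · rw [toMat_diag]
    by_cases hi : i = 0
    · subst hi; exact Submodule.smul_mem _ _ C.one_mem
    · simp [h hi]
  · rw [toMat_lower]; exact neg_mem (h' n)
  · rw [toMat_upper]; exact neg_mem (C.conj_mem (h' n))

theorem matMul_diag (x y : C.J) (n : Fin 3) :
    C.b (C.matMul (C.toMat x) (C.toMat y) n n) C.one =
      -(C.dg n x * C.dg n y) + C.b (C.co (n + 1) x) (C.co (n + 1) y) +
        C.b (C.co (n + 2) x) (C.co (n + 2) y) := by
  have h3 := three_eq_zero_of_char k
  have u1 := fun x => C.toMat_upper (n + 1) x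
  have u2 := fun x => C.toMat_upper (n + 2) x
  have l1 := fun x => C.toMat_lower (n + 1) x
  have l2 := fun x => C.toMat_lower (n + 2) x
  simp only [fin_three_add_one_one, fin_three_add_one_two, fin_three_add_two_one,
    fin_three_add_two_two] at u1 u2 l1 l2
  rw [matMul_apply, sum_fin_three_rotate _ n, toMat_diag, toMat_diag, l1, u1, l2, u2]
  simp only [map_add, map_neg, LinearMap.add_apply, LinearMap.neg_apply, map_smul,
    LinearMap.smul_apply, C.one_mul, neg_neg, C.b_one_one, b_conj_mul_one, b_mul_conj_one,
    smul_eq_mul]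
  linear_combination C.dg n x * C.dg n y * h3

theorem matMul_lower (x y : C.J) (n : Fin 3) :
    C.matMul (C.toMat x) (C.toMat y) (n + 2) (n + 1) =
      C.paraHurwitz.mul (C.co (n + 1) x) (C.co (n + 2) y) -
        C.dg (n + 2) x • C.co n y - C.dg (n + 1) y • C.co n x := by
  have u1 := fun x => C.toMat_upper (n + 1) x
  have u2 := fun x => C.toMat_upper (n + 2) x
  simp only [fin_three_add_one_one, fin_three_add_one_two, fin_three_add_two_one,
    fin_three_add_two_two] at u1 u2
  rw [matMul_apply, sum_fin_three_rotate _ n, toMat_diag, toMat_diag, toMat_lower, toMat_lower, u1,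
    u2]
  change _ = C.mul (C.conj _) (C.conj _) - _ - _
  simp only [map_neg, LinearMap.neg_apply, map_smul, LinearMap.smul_apply, C.one_mul, C.mul_one]
  module

/-- By supersymmetry both orders of the matrix product have the same diagonal trace up to the sign
rule, so symmetrising doubles the value and ½ cancels it. The coefficients -1 of b come from 2 = -1.
-/
theorem dg_circ (x y : C.J) (n : Fin 3) : C.dg n (C.circ x y) = C.dg n x * C.dg n y -
    C.b (C.co (n + 1) x) (C.co (n + 1) y) - C.b (C.co (n + 2) x) (C.co (n + 2) y) := by
  induction x using homogeneous_induction (k := k) (A := C.J) with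
  | hadd x x' h h' => simp only [map_add, LinearMap.add_apply, h, h']; ring
  | h i x hx =>
  induction y using homogeneous_induction (k := k) (A := C.J) with
  | hadd y y' h h' => simp only [map_add, h, h']; ring
  | h j y hy =>
  have h3 := three_eq_zero_of_char k
  rw [dg_apply, toMat_circ, C.matCirc_apply (C.toMat_mem_part hx) (C.toMat_mem_part hy),
    inv_two_of_char]
  simp only [Matrix.smul_apply, Matrix.add_apply, map_smul, map_add, LinearMap.smul_apply,
    LinearMap.add_apply, matMul_diag, smul_eq_mul]
  have s1 := C.b_supersymm i j _ (C.co_mem hx (n + 1)) _ (C.co_mem hy (n + 1))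
  have s2 := C.b_supersymm i j _ (C.co_mem hx (n + 2)) _ (C.co_mem hy (n + 2))
  have hx0 := C.dg_odd (x := x)
  have hy0 := C.dg_odd (x := y)
  rcases parity_cases i with rfl | rfl <;> rcases parity_cases j with rfl | rfl <;>
    simp only [mul_zero, _root_.mul_one, sgn_zero, sgn_one, _root_.one_mul, neg_mul,
      neg_neg] at s1 s2 ⊢
  · rw [← s1, ← s2]
    linear_combination (-(C.dg n x * C.dg n y) + C.b (C.co (n + 1) x) (C.co (n + 1) y) +
        C.b (C.co (n + 2) x) (C.co (n + 2) y)) * h3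
  · rw [← s1, ← s2, hy0 hy]
    linear_combination (C.b (C.co (n + 1) x) (C.co (n + 1) y) +
        C.b (C.co (n + 2) x) (C.co (n + 2) y)) * h3
  · rw [← s1, ← s2, hx0 hx]
    linear_combination (C.b (C.co (n + 1) x) (C.co (n + 1) y) +
        C.b (C.co (n + 2) x) (C.co (n + 2) y)) * h3
  · rw [s1, s2, hx0 hx]
    linear_combination -(C.b (C.co (n + 1) y) (C.co (n + 1) x) +
        C.b (C.co (n + 2) y) (C.co (n + 2) x)) * h3

/-- The involutions of the hermitian entries turn the product of C into the para-Hurwitz product,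
cyclically in n. The factor ½ = -1 and the minus sign built into `co` cancel, which is the reason
for that sign. -/
theorem co_circ (x y : C.J) (n : Fin 3) : C.co n (C.circ x y) =
    C.paraHurwitz.mul (C.co (n + 1) x) (C.co (n + 2) y) +
      C.paraHurwitz.r (C.co (n + 2) x) (C.co (n + 1) y) -
      (C.dg (n + 1) x + C.dg (n + 2) x) • C.co n y -
      (C.dg (n + 1) y + C.dg (n + 2) y) • C.co n x := by
  induction x using homogeneous_induction (k := k) (A := C.J) with
  | hadd x x' h h' => simp only [map_add, LinearMap.add_apply, h, h']; module
  | h i x hx =>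
  induction y using homogeneous_induction (k := k) (A := C.J) with
  | hadd y y' h h' => simp only [map_add, h, h']; module
  | h j y hy =>
  rw [co_apply, toMat_circ, C.matCirc_apply (C.toMat_mem_part hx) (C.toMat_mem_part hy),
    inv_two_of_char, C.paraHurwitz.r_apply (C.co_mem hx (n + 2)) (C.co_mem hy (n + 1))]
  simp only [Matrix.smul_apply, Matrix.add_apply, matMul_lower]
  have hx0 := C.dg_odd (x := x)
  have hy0 := C.dg_odd (x := y)
  rcases parity_cases i with rfl | rfl <;> rcases parity_cases j with rfl | rfl <;>
    simp [hx0, hy0, hx, hy] <;> module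

theorem trace_eq (x : C.J) : C.trace x = C.dg 0 x + C.dg 1 x + C.dg 2 x := by
  change C.matTrace (C.toMat x) = _
  rw [matTrace_apply, inv_two_of_char, Fin.sum_univ_three]
  simp only [dg_apply]
  ring

end HurwitzSuperalgebra
end Supersquare
end

/-! ### Triality triples and elements of S³ give superderivations of J. -/

noncomputable section

namespace Supersquare

namespace CompositionSuperalgebra

variable {k : Type*} [Field k] {A : Type*} [AddCommGroup A] [Module k A] [Superspace k A]
variable {S : CompositionSuperalgebra k A}

theorem IsAssociative.b_mul_cyclic (hS : S.IsAssociative) {i j l : ZMod 2} {x y z : A}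
    (hx : x ∈ part k A i) (hy : y ∈ part k A j) (hz : z ∈ part k A l) :
    S.b x (S.mul y z) = sgn k (i * (j + l)) * S.b y (S.mul z x) := by
  rw [S.b_supersymm i _ x hx _ (S.mul_mem _ _ _ hy _ hz), hS]

end CompositionSuperalgebra

namespace HurwitzSuperalgebra

variable {k : Type*} [Field k] {A : Type*} [AddCommGroup A] [Module k A] [Superspace k A]
variable (C : HurwitzSuperalgebra k A)

theorem paraHurwitz_b : C.paraHurwitz.b = C.b := rfl

/-- The operator on `J` attached to `d₀, d₁, d₂ ∈ 𝔤𝔩(S)` and `s₀, s₁, s₂ ∈ S`. The superderivations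
of `J` are the operators of this form with `(d₀, d₁, d₂)` in `𝔱𝔯𝔦(S)`. -/
def opJ : ((Fin 3 → (A →ₗ[k] A)) × (Fin 3 → A)) →ₗ[k] C.J →ₗ[k] C.J :=
  LinearMap.mk₂ k
    (fun d x => C.mkJ
      (fun n => C.b (d.2 (n + 2)) (C.co (n + 2) x) - C.b (d.2 (n + 1)) (C.co (n + 1) x),
      fun n => (C.dg (n + 2) x - C.dg (n + 1) x) • d.2 n + d.1 n (C.co n x) -
        C.paraHurwitz.mul (d.2 (n + 1)) (C.co (n + 2) x) +
        C.paraHurwitz.r (d.2 (n + 2)) (C.co (n + 1) x)))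
    (fun d d' x => by
      rw [← map_add]
      congr 1
      refine Prod.ext (funext fun n => ?_) (funext fun n => ?_)
      · simp; ring
      · simp; module)
    (fun c d x => by
      rw [← map_smul]
      congr 1
      refine Prod.ext (funext fun n => ?_) (funext fun n => ?_)
      · simp; ring
      · simp; module)
    (fun d x x' => by
      rw [← map_add]
      congr 1
      refine Prod.ext (funext fun n => ?_) (funext fun n => ?_)
      · simp; ring
      · simp; module)
    (fun c d x => by
      rw [← map_smul]
      congr 1
      refine Prod.ext (funext fun n => ?_) (funext fun n => ?_)
      · simp; ring
      · simp; module)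

theorem co_opJ (d) (x : C.J) (n : Fin 3) : C.co n (C.opJ d x) =
    (C.dg (n + 2) x - C.dg (n + 1) x) • d.2 n + d.1 n (C.co n x) -
      C.paraHurwitz.mul (d.2 (n + 1)) (C.co (n + 2) x) +
      C.paraHurwitz.r (d.2 (n + 2)) (C.co (n + 1) x) := C.co_mkJ _ _

variable [CharP k 3]

theorem dg_opJ (d) (x : C.J) (n : Fin 3) : C.dg n (C.opJ d x) =
    C.b (d.2 (n + 2)) (C.co (n + 2) x) - C.b (d.2 (n + 1)) (C.co (n + 1) x) := C.dg_mkJ _ _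

omit [CharP k 3] in
theorem circ_mem_part {i j : ZMod 2} {x y : C.J} (hx : x ∈ part k C.J i)
    (hy : y ∈ part k C.J j) : C.circ x y ∈ part k C.J (i + j) := by
  rw [add_comm]
  exact hom_apply_mem (C.circ_mem hx) hy

/-- The only point beyond bookkeeping is the diagonal of an odd result: it must vanish, and it does
because b is even. -/
theorem opJ_mem {i : ZMod 2} {d : (Fin 3 → (A →ₗ[k] A)) × (Fin 3 → A)}
    (hd : ∀ n, d.1 n ∈ part k (A →ₗ[k] A) i) (hs : ∀ n, d.2 n ∈ part k A i) :
    C.opJ d ∈ part k (C.J →ₗ[k] C.J) i := by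
  refine hom_mem_part fun j x hx => C.mem_part_J (fun h n => ?_) fun n => ?_
  · have hij : i ≠ j := by
      rintro rfl; rcases parity_cases i with rfl | rfl <;> exact h (by decide)
    rw [dg_opJ, C.b_even i j hij _ (hs _) _ (C.co_mem hx _),
      C.b_even i j hij _ (hs _) _ (C.co_mem hx _), sub_zero]
  · rw [co_opJ]
    refine add_mem (sub_mem (add_mem ?_ (hom_apply_mem (hd n) (C.co_mem hx n)))
      (C.paraHurwitz.mul_mem' (hs _) (C.co_mem hx _) (add_comm i j)))
      (C.paraHurwitz.r_mem (hs _) (C.co_mem hx _) (add_comm i j))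
    rcases parity_cases j with rfl | rfl
    · rw [zero_add]; exact Submodule.smul_mem _ _ (hs n)
    · simp [C.dg_odd hx]

-- The Leibniz rule in coordinates. On the diagonal it is skewness of the d_n and cyclicity of b(x,
-- y • z). Off the diagonal the part linear in d is the triality relation rotated to position n, and
-- the part linear in s is a combination of the degree three identities of S. All remaining scalar
-- identities hold because 3 = 0.
set_option maxHeartbeats 4000000 in
theorem opJ_circ {p q r : ZMod 2} {d : (Fin 3 → (A →ₗ[k] A)) × (Fin 3 → A)}
    (hd : ∀ n, d.1 n ∈ part k (A →ₗ[k] A) p) (hs : ∀ n, d.2 n ∈ part k A p)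
    (ht : d.1 ∈ C.paraHurwitz.tri) {x y : C.J} (hx : x ∈ part k C.J q) (hy : y ∈ part k C.J r) :
    C.opJ d (C.circ x y) = C.circ (C.opJ d x) y + sgn k (p * q) • C.circ x (C.opJ d y) := by
  have h3 := three_eq_zero_of_char k
  have hS := C.paraHurwitz_isAssociative
  obtain ⟨osp, -⟩ := (CompositionSuperalgebra.mem_tri hd).1 ht
  have ha := fun n => C.co_mem hx n
  have hb := fun n => C.co_mem hy n
  have hα := C.dg_odd (x := x)
  have hβ := C.dg_odd (x := y)
  obtain ⟨D, s⟩ := d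
  simp only at *
  refine C.J_ext (fun n => ?_) (fun n => ?_)
  · have o1 := osp (n + 1) q _ (ha (n + 1)) (C.co (n + 1) y)
    have o2 := osp (n + 2) q _ (ha (n + 2)) (C.co (n + 2) y)
    have cyc := fun {i j l : ZMod 2} {x y z : A} (hx : x ∈ part k A i) (hy : y ∈ part k A j)
      (hz : z ∈ part k A l) => hS.b_mul_cyclic hx hy hz
    have sy := fun n => C.b_supersymm q p _ (ha n) _ (hs n)
    simp only [CompositionSuperalgebra.IsAssociative, paraHurwitz_b] at o1 o2 cyc hS
    simp only [map_add, map_smul, LinearMap.add_apply, LinearMap.smul_apply, dg_opJ, dg_circ,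
      co_circ, co_opJ, fin_three_add_one_one, fin_three_add_one_two, fin_three_add_two_one,
      fin_three_add_two_two, map_sub, LinearMap.sub_apply, smul_eq_mul,
      CompositionSuperalgebra.r_apply _ (ha _) (hb _),
      CompositionSuperalgebra.r_apply _ (hs _) (ha _),
      CompositionSuperalgebra.r_apply _ (hs _) (hb _), hS]
    -- The trilinear forms b(x, y • z) in one element of s, one coordinate of x and one of y are
    -- brought to common cyclic orders, so that equal ones are syntactically equal.
    rw [cyc (ha (n + 2)) (hs n) (hb (n + 1)), cyc (ha n) (hs (n + 1)) (hb (n + 2)),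
      cyc (ha (n + 1)) (hs (n + 2)) (hb n), cyc (ha (n + 1)) (hb (n + 2)) (hs n),
      cyc (hb (n + 2)) (hs n) (ha (n + 1)), cyc (ha (n + 2)) (hb n) (hs (n + 1)),
      cyc (hb n) (hs (n + 1)) (ha (n + 2)), sy, sy]
    rcases parity_cases p with rfl | rfl <;> rcases parity_cases q with rfl | rfl <;>
      rcases parity_cases r with rfl | rfl <;>
      simp [hα, hβ, hx, hy] at o1 o2 ⊢ <;>
      linear_combination (norm := (ring_nf <;> simp [h3])) o1 + o2
  · have tri := fun {j : ZMod 2} {x : A} (hx : x ∈ part k A j) (y : A) =>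
      hS.triality hd ht n hx y
    have t1 := tri (ha (n + 1)) (C.co (n + 2) y)
    have t2 := congrArg (sgn k (q * r) • ·) (tri (hb (n + 1)) (C.co (n + 2) x))
    -- Each of `m1` to `m4'` trades a product of three factors for the one with its outer factors
    -- exchanged plus a multiple of the middle factor. The prefactors are the signs with which these
    -- products occur in the expansion.
    have m1 := congrArg (sgn k (p * q) • ·)
      (hS.mul_mul_left (ha (n + 2)) (hs n) (hb (n + 2)))
    have m2 := congrArg (sgn k (r * (p + q)) • ·)
      (hS.mul_mul_right (hb (n + 1)) (hs n) (ha (n + 1)))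
    have m3 := hS.mul_mul_right (hs (n + 1)) (ha n) (hb (n + 1))
    have m3' := congrArg (sgn k (q * r) • ·)
      (hS.mul_mul_right (hs (n + 1)) (hb n) (ha (n + 1)))
    have m4 := congrArg (sgn k (p * (q + r)) • ·)
      (hS.mul_mul_left (ha (n + 2)) (hb n) (hs (n + 2)))
    have m4' := congrArg (sgn k (q * r + p * (q + r)) • ·)
      (hS.mul_mul_left (hb (n + 2)) (ha n) (hs (n + 2)))
    have sy1 := C.b_supersymm q p _ (ha (n + 2)) _ (hs (n + 2))
    have sy2 := C.b_supersymm r p _ (hb (n + 2)) _ (hs (n + 2))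
    have sy3 := C.b_supersymm r q _ (hb (n + 1)) _ (ha (n + 1))
    have e1 := C.b_even p q
    have e2 := C.b_even p r
    have e3 := C.b_even q r
    have r1 := fun m => C.paraHurwitz.r_apply (hs m) (C.co_mem (C.circ_mem_part hx hy) (n + 1))
    have r2 := fun m => C.paraHurwitz.r_apply
      (C.co_mem (hom_apply_mem (C.opJ_mem (d := (D, s)) hd hs) hx) m) (hb (n + 1))
    have r3 := fun m => C.paraHurwitz.r_apply (ha m)
      (C.co_mem (hom_apply_mem (C.opJ_mem (d := (D, s)) hd hs) hy) (n + 1))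
    simp only [paraHurwitz_b, sy1, sy2, sy3] at t1 t2 m1 m2 m3 m3' m4 m4'
    rw [co_opJ, r1]
    simp only [map_add, map_smul, co_circ]
    simp only [r2, r3, dg_opJ, dg_circ]
    simp only [co_opJ, map_add, map_smul, LinearMap.add_apply, LinearMap.smul_apply,
      fin_three_add_one_one, fin_three_add_one_two, fin_three_add_two_one,
      fin_three_add_two_two, map_sub, LinearMap.sub_apply,
      CompositionSuperalgebra.r_apply _ (ha _) (hb _),
      CompositionSuperalgebra.r_apply _ (hs _) (ha _),
      CompositionSuperalgebra.r_apply _ (hs _) (hb _)]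
    rcases parity_cases p with rfl | rfl <;> rcases parity_cases q with rfl | rfl <;>
      rcases parity_cases r with rfl | rfl <;>
      simp [hα, hβ, hx, hy, e1, e2, e3, ha _, hb _, hs _, -mul_eq_zero]
        at t1 t2 m1 m2 m3 m3' m4 m4' ⊢ <;>
      -- What is left is a linear relation between vectors whose scalar coefficients vanish only
      -- modulo 3; they are separated and compared one by one.
      linear_combination (norm := skip) t1 + t2 - m1 + m2 - m3 - m3' + m4 + m4' <;>
      match_scalars <;> ring_nf <;> simp [h3]

end HurwitzSuperalgebra
end Supersquare
end

/-! ### The operators [L_x, L_y] expressed by triality parameters. -/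

noncomputable section

namespace Supersquare

namespace HurwitzSuperalgebra

variable {k : Type*} [Field k] {A : Type*} [AddCommGroup A] [Module k A] [Superspace k A]
variable (C : HurwitzSuperalgebra k A)

/-- The parameters of the operator `[L_x, L_y]`, in the form of `opJ`. -/
def innerParam (x y : C.J) : (Fin 3 → (A →ₗ[k] A)) × (Fin 3 → A) :=
  (∑ i, CompositionSuperalgebra.theta k A i (C.paraHurwitz.t (C.co i x) (C.co i y)),
    fun n => (C.dg (n + 1) x - C.dg (n + 2) x) • C.co n y -
      (C.dg (n + 1) y - C.dg (n + 2) y) • C.co n x +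
      C.paraHurwitz.mul (C.co (n + 1) x) (C.co (n + 2) y) -
      C.paraHurwitz.r (C.co (n + 2) x) (C.co (n + 1) y))

theorem innerParam_fst (x y : C.J) (n : Fin 3) : (C.innerParam x y).1 n =
    C.paraHurwitz.t (C.co n x) (C.co n y) 0 +
      C.paraHurwitz.t (C.co (n + 1) x) (C.co (n + 1) y) 2 +
      C.paraHurwitz.t (C.co (n + 2) x) (C.co (n + 2) y) 1 := by
  have e0 : n - n = 0 := sub_self n
  have e1 : n - (n + 1) = 2 := by revert n; decide
  have e2 : n - (n + 2) = 1 := by revert n; decide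
  rw [innerParam, sum_fin_three_rotate _ n]
  simp only [Pi.add_apply, CompositionSuperalgebra.theta, LinearMap.funLeft_apply, e0, e1, e2]

theorem innerParam_snd (x y : C.J) (n : Fin 3) : (C.innerParam x y).2 n =
    (C.dg (n + 1) x - C.dg (n + 2) x) • C.co n y -
      (C.dg (n + 1) y - C.dg (n + 2) y) • C.co n x +
      C.paraHurwitz.mul (C.co (n + 1) x) (C.co (n + 2) y) -
      C.paraHurwitz.r (C.co (n + 2) x) (C.co (n + 1) y) := rfl

theorem innerParam_add_left (x x' y : C.J) :
    C.innerParam (x + x') y = C.innerParam x y + C.innerParam x' y := by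
  refine Prod.ext ?_ (funext fun n => ?_)
  · simp [innerParam, Finset.sum_add_distrib]
  · simp only [Prod.snd_add, Pi.add_apply, innerParam_snd, map_add, LinearMap.add_apply]
    module

theorem innerParam_add_right (x y y' : C.J) :
    C.innerParam x (y + y') = C.innerParam x y + C.innerParam x y' := by
  refine Prod.ext ?_ (funext fun n => ?_)
  · simp [innerParam, Finset.sum_add_distrib]
  · simp only [Prod.snd_add, Pi.add_apply, innerParam_snd, map_add]
    module

theorem innerParam_snd_mem {p q : ZMod 2} {x y : C.J} (hx : x ∈ part k C.J p)
    (hy : y ∈ part k C.J q) (n : Fin 3) : (C.innerParam x y).2 n ∈ part k A (p + q) := by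
  have ha := fun n => C.co_mem hx n
  have hb := fun n => C.co_mem hy n
  refine sub_mem (add_mem (sub_mem ?_ ?_) (C.paraHurwitz.mul_mem _ _ _ (ha _) _ (hb _)))
    (C.paraHurwitz.r_mem (ha _) (hb _) rfl)
  · rcases parity_cases p with rfl | rfl
    · rw [zero_add]; exact Submodule.smul_mem _ _ (hb n)
    · simp [C.dg_odd hx]
  · rcases parity_cases q with rfl | rfl
    · rw [add_zero]; exact Submodule.smul_mem _ _ (ha n)
    · simp [C.dg_odd hy]

theorem innerParam_fst_mem {p q : ZMod 2} {x y : C.J} (hx : x ∈ part k C.J p)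
    (hy : y ∈ part k C.J q) (n : Fin 3) :
    (C.innerParam x y).1 n ∈ part k (A →ₗ[k] A) (p + q) := by
  rw [innerParam_fst]
  exact add_mem (add_mem (C.paraHurwitz.t_mem_part (C.co_mem hx _) (C.co_mem hy _) _)
    (C.paraHurwitz.t_mem_part (C.co_mem hx _) (C.co_mem hy _) _))
    (C.paraHurwitz.t_mem_part (C.co_mem hx _) (C.co_mem hy _) _)

theorem innerParam_tri (h2 : (2 : k) ≠ 0) {p q : ZMod 2} {x y : C.J} (hx : x ∈ part k C.J p)
    (hy : y ∈ part k C.J q) : (C.innerParam x y).1 ∈ C.paraHurwitz.tri :=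
  sum_mem fun i _ => C.paraHurwitz_isAssociative.theta_mem_tri
    (C.paraHurwitz.t_mem_part (C.co_mem hx i) (C.co_mem hy i))
    (C.paraHurwitz_isAssociative.t_mem_tri_of_mem h2 (C.co_mem hx i) (C.co_mem hy i)) i

variable [CharP k 3]

-- On the diagonal coordinates both sides agree by supersymmetry and cyclicity of b(x, y • z). On
-- the off-diagonal ones, the double products with three factors from S are matched by six instances
-- of the degree three identities; the triples t_{x,y} absorb the terms where x and y contribute the
-- same position, and ½ = -1 and 3 = 0 settle the scalars.
set_option maxHeartbeats 4000000 in
theorem innerJ_eq_opJ_of_mem {p q r : ZMod 2} {x y z : C.J} (hx : x ∈ part k C.J p)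
    (hy : y ∈ part k C.J q) (hz : z ∈ part k C.J r) :
    C.innerJ x y z = C.opJ (C.innerParam x y) z := by
  have h3 := three_eq_zero_of_char k
  have hS := C.paraHurwitz_isAssociative
  have ha := fun n => C.co_mem hx n
  have hb := fun n => C.co_mem hy n
  have hc := fun n => C.co_mem hz n
  have hα := C.dg_odd (x := x)
  have hβ := C.dg_odd (x := y)
  have hγ := C.dg_odd (x := z)
  rw [C.innerJ_apply hx hy]
  refine C.J_ext (fun n => ?_) (fun n => ?_)
  · have cyc := fun {i j l : ZMod 2} {x y z : A} (hx : x ∈ part k A i) (hy : y ∈ part k A j)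
      (hz : z ∈ part k A l) => hS.b_mul_cyclic hx hy hz
    have sy := fun n => C.b_supersymm p q _ (ha n) _ (hb n)
    simp only [CompositionSuperalgebra.IsAssociative, paraHurwitz_b] at cyc hS
    simp only [map_sub, map_smul, LinearMap.sub_apply, LinearMap.smul_apply, dg_opJ, dg_circ,
      co_circ, innerParam_snd, fin_three_add_one_one, fin_three_add_one_two,
      fin_three_add_two_one, fin_three_add_two_two, map_add, LinearMap.add_apply, smul_eq_mul,
      CompositionSuperalgebra.r_apply _ (ha _) (hb _),
      CompositionSuperalgebra.r_apply _ (ha _) (hc _),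
      CompositionSuperalgebra.r_apply _ (hb _) (hc _), hS]
    rw [cyc (ha (n + 1)) (hc (n + 2)) (hb n), cyc (hc (n + 2)) (hb n) (ha (n + 1)),
      cyc (hb (n + 1)) (hc (n + 2)) (ha n), cyc (hc (n + 2)) (ha n) (hb (n + 1)),
      cyc (ha (n + 1)) (hb (n + 2)) (hc n), cyc (ha (n + 2)) (hc n) (hb (n + 1)),
      cyc (hc n) (hb (n + 1)) (ha (n + 2)), sy (n + 1), sy (n + 2)]
    clear cyc
    rcases parity_cases p with rfl | rfl <;> rcases parity_cases q with rfl | rfl <;>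
      rcases parity_cases r with rfl | rfl <;>
      simp [hα, hβ, hγ, hx, hy, hz] <;>
      linear_combination (norm := (ring_nf <;> simp [h3])) (0 : k) * h3
  · have m1 := congrArg (sgn k (q * r) • ·)
      (hS.mul_mul_right (ha (n + 1)) (hc n) (hb (n + 1)))
    have m2 := congrArg (sgn k (q * r) • ·)
      (hS.mul_mul_left (ha (n + 2)) (hc n) (hb (n + 2)))
    have m3 := congrArg (sgn k (r * (p + q)) • ·)
      (hS.mul_mul_right (hc (n + 1)) (ha n) (hb (n + 1)))
    have m3' := congrArg (sgn k (p * q + p * r + q * r) • ·)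
      (hS.mul_mul_right (hc (n + 1)) (hb n) (ha (n + 1)))
    have m4 := hS.mul_mul_left (ha (n + 2)) (hb n) (hc (n + 2))
    have m4' := congrArg (sgn k (p * q) • ·)
      (hS.mul_mul_left (hb (n + 2)) (ha n) (hc (n + 2)))
    have sy1 := C.b_supersymm r q _ (hc (n + 1)) _ (hb (n + 1))
    have sy2 := C.b_supersymm r p _ (hc (n + 1)) _ (ha (n + 1))
    have e1 := C.b_even p q
    have e2 := C.b_even p r
    have e3 := C.b_even q r
    have r1 := fun m => C.paraHurwitz.r_apply (ha m) (C.co_mem (C.circ_mem_part hy hz) (n + 1))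
    have r2 := fun m => C.paraHurwitz.r_apply (hb m) (C.co_mem (C.circ_mem_part hx hz) (n + 1))
    have r3 : ∀ m, C.paraHurwitz.r ((C.innerParam x y).2 m) (C.co (n + 1) z) =
        sgn k ((p + q) * r) • C.paraHurwitz.mul (C.co (n + 1) z) ((C.innerParam x y).2 m) := fun m =>
      C.paraHurwitz.r_apply (C.innerParam_snd_mem hx hy m) (hc (n + 1))
    simp only [paraHurwitz_b, sy1, sy2] at m1 m2 m3 m3' m4 m4'
    rw [co_opJ, r3]
    simp only [map_sub, map_smul]
    rw [C.co_circ x, C.co_circ y (C.circ x z), r1, r2]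
    simp only [innerParam_snd, innerParam_fst, dg_circ, LinearMap.add_apply,
      CompositionSuperalgebra.t_apply_zero, CompositionSuperalgebra.t_apply_one,
      CompositionSuperalgebra.t_apply_two,
      CompositionSuperalgebra.sigma_apply _ (ha _) (hb _) (hc _), inv_two_of_char]
    simp only [CompositionSuperalgebra.r_apply _ (ha _) (C.paraHurwitz.mul_mem _ _ _ (hb _) _ (hc _)),
      co_circ, map_add, LinearMap.add_apply,
      map_smul, LinearMap.smul_apply, fin_three_add_one_one, fin_three_add_one_two,
      fin_three_add_two_one, fin_three_add_two_two, map_sub, LinearMap.sub_apply,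
      CompositionSuperalgebra.r_apply _ (ha _) (hb _),
      CompositionSuperalgebra.r_apply _ (ha _) (hc _),
      CompositionSuperalgebra.r_apply _ (hb _) (hc _), paraHurwitz_b]
    rcases parity_cases p with rfl | rfl <;> rcases parity_cases q with rfl | rfl <;>
      rcases parity_cases r with rfl | rfl <;>
      simp [hα, hβ, hγ, hx, hy, hz, e1, e2, e3, ha _, hb _, hc _, -mul_eq_zero]
        at m1 m2 m3 m3' m4 m4' ⊢ <;>
      linear_combination (norm := skip) m3' + m4 - m1 - m2 - m3 - m4' <;>
      match_scalars <;> ring_nf <;> simp [h3]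

end HurwitzSuperalgebra
end Supersquare
end

/-! ### Every superderivation of J comes from a triality triple and an element of S³. -/

noncomputable section

namespace Supersquare

section

variable {k : Type*} [Field k] {A : Type*} [AddCommGroup A] [Module k A] [Superspace k A]

theorem CompositionSuperalgebra.pr_mem_tri {S : CompositionSuperalgebra k A}
    {d : Fin 3 → (A →ₗ[k] A)} (hd : d ∈ S.tri) (i : ZMod 2) : (fun n => pr k i (d n)) ∈ S.tri :=
  (CompositionSuperalgebra.mem_tri (i := i) fun n => pr_mem i (d n)).2
    ⟨fun n j x hx y => hd.1 n i j x hx y, fun j x hx y => hd.2 i j x hx y⟩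

end

namespace HurwitzSuperalgebra

variable {k : Type*} [Field k] {A : Type*} [AddCommGroup A] [Module k A] [Superspace k A]
variable (C : HurwitzSuperalgebra k A)

theorem mem_derJ {i : ZMod 2} {d : C.J →ₗ[k] C.J} (hd : d ∈ part k (C.J →ₗ[k] C.J) i) :
    d ∈ C.derJ ↔ ∀ j, ∀ x ∈ part k C.J j, ∀ y,
      d (C.circ x y) = C.circ (d x) y + sgn k (i * j) • C.circ x (d y) := by
  refine ⟨fun h j x hx y => by simpa only [pr_of_mem_self hd] using h i j x hx y,
    fun h i' j x hx y => ?_⟩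
  by_cases hi : i' = i
  · subst hi; simpa only [pr_of_mem_self hd] using h j x hx y
  · simp [pr_of_mem_ne hd hi]

theorem pr_mem_derJ {d : C.J →ₗ[k] C.J} (hd : d ∈ C.derJ) (i : ZMod 2) : pr k i d ∈ C.derJ :=
  (C.mem_derJ (pr_mem i d)).2 fun j x hx y => hd i j x hx y

/-- The idempotents `e_m` of `J`. -/
def eJ (m : Fin 3) : C.J := C.mkJ (Pi.single m 1, 0)

/-- The maps `ι_n : S → J`. -/
def ioJ (n : Fin 3) : A →ₗ[k] C.J :=
  C.mkJ ∘ₗ LinearMap.inr k _ _ ∘ₗ LinearMap.single k (fun _ => A) n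

variable [CharP k 3]

theorem innerJ_eq_opJ (x y : C.J) : C.innerJ x y = C.opJ (C.innerParam x y) := by
  ext z
  induction x using homogeneous_induction (k := k) (A := C.J) with
  | hadd x x' h h' => simp only [map_add, LinearMap.add_apply, h, h', innerParam_add_left]
  | h i x hx =>
  induction y using homogeneous_induction (k := k) (A := C.J) with
  | hadd y y' h h' => simp only [map_add, LinearMap.add_apply, h, h', innerParam_add_right]
  | h j y hy =>
  induction z using homogeneous_induction (k := k) (A := C.J) with
  | hadd z z' h h' => simp only [map_add, h, h']
  | h l z hz => exact C.innerJ_eq_opJ_of_mem hx hy hz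

theorem opJ_mem_derJ_of_mem {i : ZMod 2} {P : (Fin 3 → (A →ₗ[k] A)) × (Fin 3 → A)}
    (h1 : ∀ n, P.1 n ∈ part k (A →ₗ[k] A) i) (h2 : ∀ n, P.2 n ∈ part k A i)
    (hP : P.1 ∈ C.paraHurwitz.tri) : C.opJ P ∈ C.derJ := by
  refine (C.mem_derJ (C.opJ_mem h1 h2)).2 fun j x hx y => ?_
  induction y using homogeneous_induction (k := k) (A := C.J) with
  | hadd y y' h h' => simp only [map_add, h, h', smul_add]; abel
  | h l y hy => exact C.opJ_circ h1 h2 hP hx hy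

theorem opJ_mem_derJ {P : (Fin 3 → (A →ₗ[k] A)) × (Fin 3 → A)} (hP : P.1 ∈ C.paraHurwitz.tri) :
    C.opJ P ∈ C.derJ := by
  have key : ∀ i, C.opJ (fun n => pr k i (P.1 n), fun n => pr k i (P.2 n)) ∈ C.derJ := fun i =>
    C.opJ_mem_derJ_of_mem (i := i) (fun n => pr_mem i (P.1 n)) (fun n => pr_mem i (P.2 n))
      (CompositionSuperalgebra.pr_mem_tri hP i)
  have e : P = (fun n => pr k 0 (P.1 n), fun n => pr k 0 (P.2 n)) +
      (fun n => pr k 1 (P.1 n), fun n => pr k 1 (P.2 n)) :=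
    Prod.ext (funext fun n => (pr_add (k := k) _).symm) (funext fun n => (pr_add (k := k) _).symm)
  rw [e, map_add]
  exact add_mem (key 0) (key 1)

/-- No Jordan identity is invoked: [L_x, L_y] is an operator `opJ` whose triple is a sum of elements
θ^i(t_{x,y}) of 𝔱𝔯𝔦(S). -/
theorem innerJ_mem_derJ (x y : C.J) : C.innerJ x y ∈ C.derJ := by
  induction x using homogeneous_induction (k := k) (A := C.J) with
  | hadd x x' h h' => simp only [map_add, LinearMap.add_apply]; exact add_mem h h'
  | h i x hx =>
  induction y using homogeneous_induction (k := k) (A := C.J) with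
  | hadd y y' h h' => simp only [map_add]; exact add_mem h h'
  | h j y hy =>
    rw [innerJ_eq_opJ]
    exact C.opJ_mem_derJ (C.innerParam_tri (two_ne_zero_of_char k) hx hy)

theorem dg_eJ (n m : Fin 3) : C.dg n (C.eJ m) = if n = m then 1 else 0 := by
  simp [eJ, dg_mkJ, Pi.single_apply]

omit [CharP k 3] in
theorem co_eJ (n m : Fin 3) : C.co n (C.eJ m) = 0 := by simp [eJ, co_mkJ]

theorem dg_ioJ (n m : Fin 3) (a : A) : C.dg n (C.ioJ m a) = 0 := by simp [ioJ, dg_mkJ]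

omit [CharP k 3] in
theorem co_ioJ (n m : Fin 3) (a : A) : C.co n (C.ioJ m a) = if n = m then a else 0 := by
  simp [ioJ, co_mkJ, Pi.single_apply]

theorem eJ_mem (m : Fin 3) : C.eJ m ∈ part k C.J 0 :=
  C.mem_part_J (fun h => absurd rfl h) fun n => by rw [co_eJ]; exact zero_mem _

theorem ioJ_mem {i : ZMod 2} {a : A} (ha : a ∈ part k A i) (m : Fin 3) :
    C.ioJ m a ∈ part k C.J i :=
  C.mem_part_J (fun _ n => C.dg_ioJ n m a) fun n => by
    rw [co_ioJ]; split_ifs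
    · exact ha
    · exact zero_mem _

theorem J_eq_sum (x : C.J) :
    x = ∑ m, C.dg m x • C.eJ m + ∑ m, C.ioJ m (C.co m x) := by
  refine C.J_ext (fun n => ?_) fun n => ?_
  · simp [dg_eJ, dg_ioJ]
  · simp [co_eJ, co_ioJ]

theorem hom_J_ext {M : Type*} [AddCommGroup M] [Module k M] {f g : C.J →ₗ[k] M}
    (h : ∀ m, f (C.eJ m) = g (C.eJ m)) (h' : ∀ m a, f (C.ioJ m a) = g (C.ioJ m a)) : f = g := by
  ext x
  rw [C.J_eq_sum x]
  simp [h, h']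

theorem fin_three_ne (n : Fin 3) : n + 1 ≠ n ∧ n + 2 ≠ n ∧ n + 1 ≠ n + 2 ∧ n ≠ n + 1 ∧ n ≠ n + 2 ∧
    n + 2 ≠ n + 1 := by revert n; decide

theorem fin_three_eq (m n : Fin 3) : m = n ∨ m = n + 1 ∨ m = n + 2 := by revert m n; decide

theorem dg_eJ_circ (m n : Fin 3) (x : C.J) :
    C.dg n (C.circ (C.eJ m) x) = if n = m then C.dg n x else 0 := by
  rw [dg_circ, dg_eJ, co_eJ, co_eJ]; simp

theorem co_eJ_circ (m n : Fin 3) (x : C.J) :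
    C.co n (C.circ (C.eJ m) x) = if n = m then 0 else -C.co n x := by
  have h : (if n + 1 = m then (1 : k) else 0) + (if n + 2 = m then 1 else 0) =
      if n = m then 0 else 1 := by
    obtain ⟨h1, h2, h3, h4, h5, h6⟩ := fin_three_ne n
    rcases fin_three_eq m n with rfl | rfl | rfl <;>
      simp [*]
  rw [co_circ, dg_eJ, dg_eJ, h, co_eJ, co_eJ, co_eJ]
  split_ifs <;> simp

theorem circ_eJ (m : Fin 3) (x : C.J) : C.circ x (C.eJ m) = C.circ (C.eJ m) x := by
  induction x using homogeneous_induction (k := k) (A := C.J) with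
  | hadd x x' h h' => simp only [map_add, LinearMap.add_apply, h, h']
  | h i x hx => rw [C.circ_comm hx (C.eJ_mem m)]; simp

/-- Differentiating e_m ∘ e_m = e_m forces d(e_m) to have zero diagonal and no component in ι_m(S);
differentiating e_{n+1} ∘ e_{n+2} = 0 forces the ι_n components of d(e_{n+1}) and d(e_{n+2}) to be
opposite. So three elements of S determine d on the idempotents. -/
theorem derJ_apply_eJ {p : ZMod 2} {d : C.J →ₗ[k] C.J} (hd : d ∈ part k (C.J →ₗ[k] C.J) p)
    (h : d ∈ C.derJ) (m : Fin 3) :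
    d (C.eJ m) = C.opJ (0, fun n => C.co n (d (C.eJ (n + 2)))) (C.eJ m) := by
  have key : ∀ m l, C.circ (C.eJ l) (d (C.eJ m)) + C.circ (C.eJ m) (d (C.eJ l)) =
      if m = l then d (C.eJ m) else 0 := fun m l => by
    have := (C.mem_derJ hd).1 h 0 _ (C.eJ_mem m) (C.eJ l)
    rw [mul_zero, sgn_zero, one_smul] at this
    rw [← circ_eJ, ← this]
    have e : C.circ (C.eJ m) (C.eJ l) = if m = l then C.eJ m else 0 := by
      refine C.J_ext (fun n => ?_) fun n => ?_
      · rw [dg_eJ_circ, dg_eJ]; split_ifs <;> simp_all [dg_eJ]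
      · rw [co_eJ_circ, co_eJ]; split_ifs <;> simp [co_eJ]
    rw [e]; split_ifs <;> simp
  have h3 := three_eq_zero_of_char k
  refine C.J_ext (fun n => ?_) fun n => ?_
  · have := congrArg (C.dg n) (key m m)
    rw [if_pos rfl, map_add, dg_eJ_circ] at this
    rw [dg_opJ, co_eJ, co_eJ]
    split_ifs at this
    · simp; linear_combination this
    · simp; linear_combination -this
  · have h1 := congrArg (C.co m) (key m m)
    rw [if_pos rfl, map_add, co_eJ_circ, if_pos rfl, add_zero] at h1
    have h2 := congrArg (C.co n) (key (n + 1) (n + 2))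
    obtain ⟨n1, n2, n3, n4, n5, n6⟩ := fin_three_ne n
    rw [if_neg n3, map_add, co_eJ_circ, co_eJ_circ, if_neg n5, if_neg n4] at h2
    rw [co_opJ, co_eJ, co_eJ, co_eJ, dg_eJ, dg_eJ]
    rcases fin_three_eq m n with rfl | rfl | rfl
    · simp [n1, n2, h1.symm]
    · rw [map_zero] at h2
      simp only [n6, if_true, if_false, map_zero, Pi.zero_apply]
      linear_combination (norm := module) -h2
    · simp [n3]

/-- A superderivation that kills the idempotents commutes with every L_{e_l}, hence preserves their
common eigenspaces; ι_m(S) is the one where L_{e_m} is 0 and the other two are -1 (that is, ½). -/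
theorem derJ_apply_ioJ {p : ZMod 2} {d : C.J →ₗ[k] C.J} (hd : d ∈ part k (C.J →ₗ[k] C.J) p)
    (h : d ∈ C.derJ) (h0 : ∀ m, d (C.eJ m) = 0) (m : Fin 3) (a : A) :
    d (C.ioJ m a) = C.ioJ m (C.co m (d (C.ioJ m a))) := by
  have key : ∀ l, C.circ (C.eJ l) (d (C.ioJ m a)) = if m = l then 0 else -d (C.ioJ m a) :=
    fun l => by
    have := (C.mem_derJ hd).1 h 0 _ (C.eJ_mem l) (C.ioJ m a)
    rw [h0, map_zero, LinearMap.zero_apply, zero_add, mul_zero, sgn_zero, one_smul] at this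
    rw [← this]
    have e : C.circ (C.eJ l) (C.ioJ m a) = if m = l then 0 else -C.ioJ m a := by
      refine C.J_ext (fun n => ?_) fun n => ?_
      · rw [dg_eJ_circ, dg_ioJ]; split_ifs <;> simp [dg_ioJ]
      · rw [co_eJ_circ, co_ioJ]; split_ifs <;> simp_all [co_ioJ, eq_comm]
    rw [e]; split_ifs <;> simp
  obtain ⟨n1, n2, n3, n4, n5, n6⟩ := fin_three_ne m
  refine C.J_ext (fun n => ?_) fun n => ?_
  · rw [dg_ioJ]
    have e1 := congrArg (C.dg n) (key (m + 1))
    have e2 := congrArg (C.dg n) (key (m + 2))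
    rw [dg_eJ_circ, if_neg n4, map_neg] at e1
    rw [dg_eJ_circ, if_neg n5, map_neg] at e2
    -- To kill the diagonal entry at n, an idempotent e_l with l different from both m and n is
    -- needed: l = m + 2 when n = m + 1, and l = m + 1 otherwise.
    by_cases hn : n = m + 1
    · rw [if_neg (by rw [hn]; exact n3)] at e2
      linear_combination e2
    · rw [if_neg hn] at e1
      linear_combination e1
  · rw [co_ioJ]
    split_ifs with hn
    · rw [hn]
    · have e := congrArg (C.co n) (key m)
      rw [co_eJ_circ, if_neg hn, if_pos rfl, map_zero, neg_eq_zero] at e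
      exact e

theorem ioJ_circ_self (n : Fin 3) (a b : A) : C.dg (n + 1) (C.circ (C.ioJ n a) (C.ioJ n b)) =
    -C.b a b := by
  obtain ⟨n1, n2, n3, n4, n5, n6⟩ := fin_three_ne n
  rw [dg_circ, dg_ioJ, co_ioJ, co_ioJ, co_ioJ, co_ioJ, fin_three_add_one_one,
    fin_three_add_one_two, if_pos rfl, if_pos rfl, if_neg n2]
  simp

theorem ioJ_circ_succ (a b : A) :
    C.circ (C.ioJ 1 a) (C.ioJ 2 b) = C.ioJ 0 (C.paraHurwitz.mul a b) := by
  refine C.J_ext (fun n => ?_) fun n => ?_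
  · rw [dg_circ]
    simp only [dg_ioJ, co_ioJ]
    fin_cases n <;> simp
  · rw [co_circ]
    simp only [dg_ioJ, co_ioJ]
    fin_cases n <;> simp

/-- Subtracting `opJ (0, s)` makes d vanish on the idempotents, so it acts on each ι_n(S) by a map
D_n. The products ι_n(x) ∘ ι_n(y) make D_n skew, and ι_1(x) ∘ ι_2(y) = ι_0(x • y) is the triality
relation. -/
theorem exists_opJ_of_mem {p : ZMod 2} {d : C.J →ₗ[k] C.J} (hd : d ∈ part k (C.J →ₗ[k] C.J) p)
    (h : d ∈ C.derJ) : ∃ P : (Fin 3 → (A →ₗ[k] A)) × (Fin 3 → A),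
      P.1 ∈ C.paraHurwitz.tri ∧ C.opJ P = d := by
  set s : Fin 3 → A := fun n => C.co n (d (C.eJ (n + 2))) with hs
  have hsp : ∀ n, s n ∈ part k A p := fun n => by
    have := C.co_mem (hom_apply_mem hd (C.eJ_mem (n + 2))) n
    rwa [zero_add] at this
  have hop : C.opJ (0, s) ∈ part k (C.J →ₗ[k] C.J) p := C.opJ_mem (fun n => zero_mem _) hsp
  set d' := d - C.opJ (0, s) with hd'
  have hdp : d' ∈ part k (C.J →ₗ[k] C.J) p := sub_mem hd hop
  have hder : d' ∈ C.derJ := sub_mem h (C.opJ_mem_derJ (zero_mem _))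
  have h0 : ∀ m, d' (C.eJ m) = 0 := fun m => by
    rw [hd', LinearMap.sub_apply, sub_eq_zero]; exact C.derJ_apply_eJ hd h m
  set D : Fin 3 → (A →ₗ[k] A) := fun n => C.co n ∘ₗ d' ∘ₗ C.ioJ n with hD
  have hio : ∀ n a, d' (C.ioJ n a) = C.ioJ n (D n a) := fun n a => C.derJ_apply_ioJ hdp hder h0 n a
  have hDp : ∀ n, D n ∈ part k (A →ₗ[k] A) p := fun n => hom_mem_part fun j x hx =>
    C.co_mem (hom_apply_mem hdp (C.ioJ_mem hx n)) n
  refine ⟨(D, s), (CompositionSuperalgebra.mem_tri hDp).2 ⟨fun n j x hx y => ?_,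
    fun j x hx y => ?_⟩, ?_⟩
  · have e := (C.mem_derJ hdp).1 hder j _ (C.ioJ_mem hx n) (C.ioJ n y)
    rw [hio, hio] at e
    have e' := congrArg (C.dg (n + 1)) e
    rw [map_add, map_smul, ioJ_circ_self, ioJ_circ_self] at e'
    -- `d'` kills the e_m and maps each ι_m(S) to itself, so nothing in its image has a diagonal.
    have e0 : C.dg (n + 1) (d' (C.circ (C.ioJ n x) (C.ioJ n y))) = 0 := by
      rw [C.J_eq_sum (C.circ (C.ioJ n x) (C.ioJ n y))]
      simp [h0, hio, dg_ioJ]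
    rw [e0] at e'
    change C.b _ _ + _ * C.b _ _ = 0
    rw [smul_eq_mul] at e'
    linear_combination e'
  · have e := (C.mem_derJ hdp).1 hder j _ (C.ioJ_mem hx 1) (C.ioJ 2 y)
    rw [hio, hio, ioJ_circ_succ, hio, ioJ_circ_succ, ioJ_circ_succ, ← map_smul, ← map_add] at e
    have e' := congrArg (C.co 0) e
    rwa [co_ioJ, co_ioJ, if_pos rfl, if_pos rfl] at e'
  · have e : ((D, s) : (Fin 3 → (A →ₗ[k] A)) × (Fin 3 → A)) = (D, 0) + (0, s) := by simp
    suffices C.opJ (D, 0) = d' by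
      rw [e, map_add, this, hd', sub_add_cancel]
    refine C.hom_J_ext (fun m => ?_) fun m a => ?_
    · rw [h0]
      refine C.J_ext (fun n => ?_) fun n => ?_
      · simp [dg_opJ]
      · simp [co_opJ, co_eJ]
    · rw [hio]
      refine C.J_ext (fun n => ?_) fun n => ?_
      · simp [dg_opJ, dg_ioJ]
      · simp only [co_opJ, co_ioJ, dg_ioJ]
        by_cases hn : n = m
        · subst hn; simp
        · simp [hn]

theorem mem_derJ_iff {d : C.J →ₗ[k] C.J} : d ∈ C.derJ ↔
    ∃ P : (Fin 3 → (A →ₗ[k] A)) × (Fin 3 → A), P.1 ∈ C.paraHurwitz.tri ∧ C.opJ P = d := by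
  refine ⟨fun h => ?_, ?_⟩
  · obtain ⟨P, hP, e⟩ := C.exists_opJ_of_mem (pr_mem 0 d) (C.pr_mem_derJ h 0)
    obtain ⟨P', hP', e'⟩ := C.exists_opJ_of_mem (pr_mem 1 d) (C.pr_mem_derJ h 1)
    exact ⟨P + P', add_mem hP hP', by rw [map_add, e, e', pr_add]⟩
  · rintro ⟨P, hP, rfl⟩
    exact C.opJ_mem_derJ hP

/-- The diagonal entries are cyclic differences, so their sum telescopes. Thus a superderivation
maps all of J into J₀, which yields both its action on J₀ and the invariance of the trace form. -/
theorem trace_opJ (P) (x : C.J) : C.trace (C.opJ P x) = 0 := by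
  rw [trace_eq, dg_opJ, dg_opJ, dg_opJ]
  simp only [zero_add, show (1 + 1 : Fin 3) = 2 from rfl, show (1 + 2 : Fin 3) = 0 from rfl,
    show (2 + 1 : Fin 3) = 0 from rfl, show (2 + 2 : Fin 3) = 1 from rfl]
  ring

theorem dg_oneJ (n : Fin 3) : C.dg n C.oneJ = 1 := by
  have h3 := three_eq_zero_of_char k
  rw [dg_apply, toMat_oneJ, Matrix.diagonal_apply_eq, b_one_one]
  linear_combination -h3

omit [CharP k 3] in
theorem co_oneJ (n : Fin 3) : C.co n C.oneJ = 0 := by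
  obtain ⟨n1, n2, n3, n4, n5, n6⟩ := fin_three_ne n
  rw [co_apply, toMat_oneJ, Matrix.diagonal_apply_ne _ n6, neg_zero]

end HurwitzSuperalgebra
end Supersquare
end

/-! ### Coordinates on J₀/k1 = kε ⊕ ⨁ ι_n(S) and the action of 𝔡𝔢𝔯 J on it. -/

noncomputable section

namespace Supersquare

namespace HurwitzSuperalgebra

variable {k : Type*} [Field k] {A : Type*} [AddCommGroup A] [Module k A] [Superspace k A]
variable (C : HurwitzSuperalgebra k A) [CharP k 3]

theorem mem_J0 {x : C.J} : x ∈ C.J0 ↔ C.dg 0 x + C.dg 1 x + C.dg 2 x = 0 := by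
  rw [← trace_eq]; exact LinearMap.mem_ker

theorem dg_J0 (x : C.J0) : C.dg 0 (x : C.J) + C.dg 1 (x : C.J) + C.dg 2 (x : C.J) = 0 :=
  C.mem_J0.1 x.2

/-- If α₀ + α₁ + α₂ = 0, then for instance (α₀ - α₂) - (α₂ - α₁) = -3α₂ = 0. This independence of n
is what makes the coordinate of ε, and with it the whole description of J₀/k1, cyclically symmetric.
-/
theorem dg_sub_dg (x : C.J0) (n : Fin 3) : C.dg (n + 2) (x : C.J) - C.dg (n + 1) (x : C.J) =
    C.dg 2 (x : C.J) - C.dg 1 (x : C.J) := by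
  have h := C.dg_J0 x
  have h3 := three_eq_zero_of_char k
  fin_cases n
  · rfl
  · change C.dg 0 (x : C.J) - C.dg 2 (x : C.J) = _
    linear_combination h - C.dg 2 (x : C.J) * h3
  · change C.dg 1 (x : C.J) - C.dg 0 (x : C.J) = _
    linear_combination -h + C.dg 1 (x : C.J) * h3

/-- The coefficient of `ε` in an element of `J₀/k1 = kε ⊕ ⨁ ι_n(S)`. -/
def cT : C.TJ →ₗ[k] k := C.k1.liftQ ((C.dg 2 - C.dg 1) ∘ₗ C.J0.subtype) fun x hx => by
  obtain ⟨c, hc⟩ := C.mem_k1.1 hx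
  simp [← hc, dg_oneJ]

/-- The component in `ι_n(S)` of an element of `J₀/k1 = kε ⊕ ⨁ ι_n(S)`. -/
def coT (n : Fin 3) : C.TJ →ₗ[k] A := C.k1.liftQ (C.co n ∘ₗ C.J0.subtype) fun x hx => by
  obtain ⟨c, hc⟩ := C.mem_k1.1 hx
  simp [← hc, co_oneJ]

theorem cT_mk (x : C.J0) (n : Fin 3) :
    C.cT (C.k1.mkQ x) = C.dg (n + 2) (x : C.J) - C.dg (n + 1) (x : C.J) := by
  rw [dg_sub_dg]; rfl

omit [CharP k 3] in
theorem coT_mk (n : Fin 3) (x : C.J0) : C.coT n (C.k1.mkQ x) = C.co n (x : C.J) := rfl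

/-- A trace zero element whose consecutive diagonal differences and off-diagonal entries all vanish
is a multiple of 1; the multiple may be read from any diagonal entry, here the one at 1. -/
theorem TJ_ext {x y : C.TJ} (h : C.cT x = C.cT y) (h' : ∀ n, C.coT n x = C.coT n y) : x = y := by
  obtain ⟨x, rfl⟩ := C.k1.mkQ_surjective x
  obtain ⟨y, rfl⟩ := C.k1.mkQ_surjective y
  have h3 := three_eq_zero_of_char k
  rw [← sub_eq_zero, ← map_sub, Submodule.mkQ_apply, Submodule.Quotient.mk_eq_zero, mem_k1]
  refine ⟨C.dg 1 (x : C.J) - C.dg 1 (y : C.J), C.J_ext (fun n => ?_) fun n => ?_⟩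
  · have hx := C.dg_J0 x
    have hy := C.dg_J0 y
    have e : C.dg 2 (x : C.J) - C.dg 1 (x : C.J) = C.dg 2 (y : C.J) - C.dg 1 (y : C.J) := h
    rw [map_smul, dg_oneJ, smul_eq_mul, _root_.mul_one]
    change _ = C.dg n ((x : C.J) - (y : C.J))
    rw [map_sub]
    fin_cases n
    · change _ = C.dg 0 (x : C.J) - C.dg 0 (y : C.J)
      linear_combination hy - hx + e + (C.dg 1 (x : C.J) - C.dg 1 (y : C.J)) * h3
    · rfl
    · change _ = C.dg 2 (x : C.J) - C.dg 2 (y : C.J)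
      linear_combination -e
  · have := h' n
    rw [coT_mk, coT_mk] at this
    change _ = C.co n ((x : C.J) - (y : C.J))
    rw [map_smul, co_oneJ, map_sub, this, smul_zero, sub_self]

/-- The element `ε` of `J₀/k1`: the class of `e₀ - e₁`. -/
def epsT : C.TJ := C.k1.mkQ ⟨C.eJ 0 - C.eJ 1, C.mem_J0.2 (by simp [dg_eJ])⟩

/-- The maps `ι_n : S → J₀/k1`. -/
def ioT (n : Fin 3) : A →ₗ[k] C.TJ :=
  C.k1.mkQ ∘ₗ (C.ioJ n).codRestrict C.J0 fun a => C.mem_J0.2 (by simp [dg_ioJ])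

theorem cT_epsT : C.cT C.epsT = 1 := by
  change C.dg 2 (C.eJ 0 - C.eJ 1) - C.dg 1 (C.eJ 0 - C.eJ 1) = 1
  simp [dg_eJ]

theorem coT_epsT (n : Fin 3) : C.coT n C.epsT = 0 := by
  change C.co n (C.eJ 0 - C.eJ 1) = 0
  simp [co_eJ]

theorem cT_ioT (n : Fin 3) (a : A) : C.cT (C.ioT n a) = 0 := by
  change C.dg 2 (C.ioJ n a) - C.dg 1 (C.ioJ n a) = 0
  simp [dg_ioJ]

theorem coT_ioT (n m : Fin 3) (a : A) : C.coT n (C.ioT m a) = if n = m then a else 0 :=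
  C.co_ioJ n m a

/-- The element of `J₀/k1` with given coordinates. -/
def mkT : (k × (Fin 3 → A)) →ₗ[k] C.TJ :=
  (LinearMap.toSpanSingleton k C.TJ C.epsT).coprod (LinearMap.lsum k (fun _ => A) k C.ioT)

theorem mkT_apply (x) : C.mkT x = x.1 • C.epsT + ∑ n, C.ioT n (x.2 n) := by
  simp [mkT, LinearMap.lsum_apply]

theorem cT_mkT (x) : C.cT (C.mkT x) = x.1 := by
  simp [mkT_apply, cT_epsT, cT_ioT]

theorem coT_mkT (n : Fin 3) (x) : C.coT n (C.mkT x) = x.2 n := by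
  simp [mkT_apply, coT_epsT, coT_ioT]

theorem mkT_eta (x : C.TJ) : C.cT x • C.epsT + ∑ n, C.ioT n (C.coT n x) = x := by
  rw [← C.mkT_apply (C.cT x, fun n => C.coT n x)]
  exact C.TJ_ext (C.cT_mkT _) fun n => C.coT_mkT n _

theorem hom_TJ_ext' {M : Type*} [AddCommGroup M] [Module k M] {f g : C.TJ →ₗ[k] M}
    (h : f C.epsT = g C.epsT) (h' : ∀ n a, f (C.ioT n a) = g (C.ioT n a)) : f = g := by
  ext x
  change f (C.k1.mkQ x) = g (C.k1.mkQ x)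
  rw [← C.mkT_eta (C.k1.mkQ x)]
  simp only [map_add, map_smul, map_sum, h, h']

omit [CharP k 3] in
theorem mkQ_mem {i : ZMod 2} {x : C.J0} (hx : (x : C.J) ∈ part k C.J i) :
    C.k1.mkQ x ∈ part k C.TJ i := by
  change C.k1.mkQ (pr k i x) = C.k1.mkQ x
  congr 1
  exact Subtype.ext hx

theorem epsT_mem : C.epsT ∈ part k C.TJ 0 :=
  C.mkQ_mem (sub_mem (C.eJ_mem 0) (C.eJ_mem 1))

theorem ioT_mem {i : ZMod 2} {a : A} (ha : a ∈ part k A i) (n : Fin 3) :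
    C.ioT n a ∈ part k C.TJ i := C.mkQ_mem (C.ioJ_mem ha n)

omit [CharP k 3] in
theorem exists_rep {i : ZMod 2} {x : C.TJ} (hx : x ∈ part k C.TJ i) :
    ∃ y : C.J0, (y : C.J) ∈ part k C.J i ∧ C.k1.mkQ y = x := by
  obtain ⟨y, rfl⟩ := C.k1.mkQ_surjective x
  exact ⟨pr k i y, pr_mem i (y : C.J), hx⟩

omit [CharP k 3] in
theorem coT_mem {i : ZMod 2} {x : C.TJ} (hx : x ∈ part k C.TJ i) (n : Fin 3) :
    C.coT n x ∈ part k A i := by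
  obtain ⟨y, hy, rfl⟩ := C.exists_rep hx
  exact C.co_mem hy n

theorem cT_odd {x : C.TJ} (hx : x ∈ part k C.TJ 1) : C.cT x = 0 := by
  obtain ⟨y, hy, rfl⟩ := C.exists_rep hx
  rw [C.cT_mk y 0, C.dg_odd hy, C.dg_odd hy, sub_zero]

/-- For diagonals of trace zero, Σ α_n β_n equals -(α₂ - α₁)(β₂ - β₁) modulo 3, and the off-diagonal
part of the trace is -2 Σ b = Σ b. -/
theorem form_TJ (x y : C.TJ) : C.tripleTJ.form x y =
    -(C.cT x * C.cT y) + ∑ n, C.b (C.coT n x) (C.coT n y) := by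
  obtain ⟨x, rfl⟩ := C.k1.mkQ_surjective x
  obtain ⟨y, rfl⟩ := C.k1.mkQ_surjective y
  have h3 := three_eq_zero_of_char k
  rw [tripleTJ_form, trace_eq, dg_circ, dg_circ, dg_circ, C.cT_mk x 0, C.cT_mk y 0,
    Fin.sum_univ_three]
  simp only [coT_mk, zero_add, show (1 + 1 : Fin 3) = 2 from rfl,
    show (1 + 2 : Fin 3) = 0 from rfl, show (2 + 1 : Fin 3) = 0 from rfl,
    show (2 + 2 : Fin 3) = 1 from rfl]
  have hx := C.dg_J0 x
  have hy := C.dg_J0 y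
  linear_combination C.dg 0 (y : C.J) * hx - (C.dg 1 (x : C.J) + C.dg 2 (x : C.J)) * hy +
    (C.dg 1 (x : C.J) * C.dg 1 (y : C.J) + C.dg 2 (x : C.J) * C.dg 2 (y : C.J) -
      C.b (C.co 0 (x : C.J)) (C.co 0 (y : C.J)) - C.b (C.co 1 (x : C.J)) (C.co 1 (y : C.J)) -
      C.b (C.co 2 (x : C.J)) (C.co 2 (y : C.J))) * h3

/-- The operator on `J₀/k1` induced by `opJ`. -/
def opT : ((Fin 3 → (A →ₗ[k] A)) × (Fin 3 → A)) →ₗ[k] C.TJ →ₗ[k] C.TJ :=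
  LinearMap.mk₂ k
    (fun d x => C.mkT
      (∑ n, C.b (d.2 n) (C.coT n x),
      fun n => C.cT x • d.2 n + d.1 n (C.coT n x) -
        C.paraHurwitz.mul (d.2 (n + 1)) (C.coT (n + 2) x) +
        C.paraHurwitz.r (d.2 (n + 2)) (C.coT (n + 1) x)))
    (fun d d' x => by
      rw [← map_add]
      congr 1
      refine Prod.ext ?_ (funext fun n => ?_)
      · simp [Finset.sum_add_distrib]
      · simp; module)
    (fun c d x => by
      rw [← map_smul]
      congr 1
      refine Prod.ext ?_ (funext fun n => ?_)
      · simp [Finset.mul_sum]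
      · simp; module)
    (fun d x x' => by
      rw [← map_add]
      congr 1
      refine Prod.ext ?_ (funext fun n => ?_)
      · simp [Finset.sum_add_distrib]
      · simp; module)
    (fun c d x => by
      rw [← map_smul]
      congr 1
      refine Prod.ext ?_ (funext fun n => ?_)
      · simp [Finset.mul_sum]
      · simp; module)

theorem cT_opT (d) (x : C.TJ) : C.cT (C.opT d x) = ∑ n, C.b (d.2 n) (C.coT n x) := C.cT_mkT _

theorem coT_opT (d) (x : C.TJ) (n : Fin 3) : C.coT n (C.opT d x) =
    C.cT x • d.2 n + d.1 n (C.coT n x) -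
      C.paraHurwitz.mul (d.2 (n + 1)) (C.coT (n + 2) x) +
      C.paraHurwitz.r (d.2 (n + 2)) (C.coT (n + 1) x) := C.coT_mkT _ _

theorem opJ_mem_J0 (d) (x : C.J) : C.opJ d x ∈ C.J0 := C.trace_opJ d x

/-- `opT` is given in coordinates, so no descent to the quotient has to be justified; this identity
shows that it is the map induced by `opJ`. -/
theorem opT_mk (d) (x : C.J0) : C.opT d (C.k1.mkQ x) =
    C.k1.mkQ ⟨C.opJ d (x : C.J), C.opJ_mem_J0 d (x : C.J)⟩ := by
  have h3 := three_eq_zero_of_char k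
  refine C.TJ_ext ?_ fun n => ?_
  · rw [cT_opT, Fin.sum_univ_three, C.cT_mk _ 0]
    simp only [coT_mk, dg_opJ, zero_add, show (1 + 1 : Fin 3) = 2 from rfl,
      show (1 + 2 : Fin 3) = 0 from rfl, show (2 + 1 : Fin 3) = 0 from rfl,
      show (2 + 2 : Fin 3) = 1 from rfl]
    -- The difference of the two diagonal entries has coefficients 1, 1 and -2, and -2 = 1 makes it
    -- the full symmetric sum.
    linear_combination C.b (d.2 0) (C.co 0 (x : C.J)) * h3
  · rw [coT_opT, coT_mk, coT_mk, coT_mk, coT_mk, co_opJ, C.cT_mk x n]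

theorem induces_opT (d) : C.Induces (C.opJ d) (C.opT d) := fun x =>
  ⟨⟨C.opJ d (x : C.J), C.opJ_mem_J0 d (x : C.J)⟩, rfl, C.opT_mk d x⟩

omit [CharP k 3] in
theorem Induces.unique {d : C.J →ₗ[k] C.J} {δ δ' : C.TJ →ₗ[k] C.TJ} (h : C.Induces d δ)
    (h' : C.Induces d δ') : δ = δ' := C.hom_TJ_ext fun x => by
  obtain ⟨y, hy, e⟩ := h x
  obtain ⟨y', hy', e'⟩ := h' x
  rw [e, e', Subtype.ext (hy.trans hy'.symm)]

theorem mem_derTJ_iff {δ : C.TJ →ₗ[k] C.TJ} : δ ∈ C.derTJ ↔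
    ∃ P : (Fin 3 → (A →ₗ[k] A)) × (Fin 3 → A), P.1 ∈ C.paraHurwitz.tri ∧ C.opT P = δ := by
  constructor
  · rintro ⟨d, hd, h⟩
    obtain ⟨P, hP, rfl⟩ := C.mem_derJ_iff.1 hd
    exact ⟨P, hP, Induces.unique C (C.induces_opT P) h⟩
  · rintro ⟨P, hP, rfl⟩
    exact ⟨C.opJ P, C.opJ_mem_derJ hP, C.induces_opT P⟩

/-- The value at ε recovers s, and then the ι_n component of the value at ι_n(a) recovers d_n(a). So
𝔡𝔢𝔯 J is faithful on J₀/k1. -/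
theorem opT_injective : Function.Injective C.opT := by
  rw [injective_iff_map_eq_zero]
  intro P hP
  have hs : P.2 = 0 := funext fun n => by
    have := C.coT_opT P C.epsT n
    simpa [hP, cT_epsT, coT_epsT] using this.symm
  refine Prod.ext (funext fun n => LinearMap.ext fun a => ?_) hs
  have := C.coT_opT P (C.ioT n a) n
  simpa [hP, cT_ioT, coT_ioT, hs] using this.symm

theorem opJ_injective : Function.Injective C.opJ := by
  rw [injective_iff_map_eq_zero]
  intro P hP
  refine (injective_iff_map_eq_zero _).1 C.opT_injective P ?_
  refine C.hom_TJ_ext fun x => ?_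
  rw [opT_mk]
  have : (⟨C.opJ P (x : C.J), C.opJ_mem_J0 P (x : C.J)⟩ : C.J0) = 0 :=
    Subtype.ext (by simp [hP])
  rw [this, map_zero, LinearMap.zero_apply]

/-- The parameters of the operator `[xy·]` on `J₀/k1`, in the form of `opT`. -/
def innerParamT (x y : C.TJ) : (Fin 3 → (A →ₗ[k] A)) × (Fin 3 → A) :=
  (∑ i, CompositionSuperalgebra.theta k A i (C.paraHurwitz.t (C.coT i x) (C.coT i y)),
    fun n => C.cT y • C.coT n x - C.cT x • C.coT n y +
      C.paraHurwitz.mul (C.coT (n + 1) x) (C.coT (n + 2) y) -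
      C.paraHurwitz.r (C.coT (n + 2) x) (C.coT (n + 1) y))

theorem innerParamT_mk (x y : C.J0) :
    C.innerParamT (C.k1.mkQ x) (C.k1.mkQ y) = C.innerParam (x : C.J) (y : C.J) := by
  refine Prod.ext rfl (funext fun n => ?_)
  simp only [innerParamT, innerParam, coT_mk, C.cT_mk x n, C.cT_mk y n]
  module

theorem tripleTJ_d_eq (x y : C.TJ) : C.tripleTJ.d x y = C.opT (C.innerParamT x y) := by
  obtain ⟨x, rfl⟩ := C.k1.mkQ_surjective x
  obtain ⟨y, rfl⟩ := C.k1.mkQ_surjective y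
  refine C.hom_TJ_ext fun z => ?_
  rw [tripleTJ_d, innerParamT_mk, opT_mk]
  congr 1
  exact Subtype.ext (congrArg (fun f => f (z : C.J)) (C.innerJ_eq_opJ x y))

theorem innerParamT_fst (x y : C.TJ) (n : Fin 3) : (C.innerParamT x y).1 n =
    C.paraHurwitz.t (C.coT n x) (C.coT n y) 0 +
      C.paraHurwitz.t (C.coT (n + 1) x) (C.coT (n + 1) y) 2 +
      C.paraHurwitz.t (C.coT (n + 2) x) (C.coT (n + 2) y) 1 := by
  obtain ⟨x, rfl⟩ := C.k1.mkQ_surjective x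
  obtain ⟨y, rfl⟩ := C.k1.mkQ_surjective y
  rw [innerParamT_mk, innerParam_fst]
  rfl

theorem innerParamT_snd (x y : C.TJ) (n : Fin 3) : (C.innerParamT x y).2 n =
    C.cT y • C.coT n x - C.cT x • C.coT n y +
      C.paraHurwitz.mul (C.coT (n + 1) x) (C.coT (n + 2) y) -
      C.paraHurwitz.r (C.coT (n + 2) x) (C.coT (n + 1) y) := rfl

theorem innerParamT_mem {p q : ZMod 2} {x y : C.TJ} (hx : x ∈ part k C.TJ p)
    (hy : y ∈ part k C.TJ q) : (∀ n, (C.innerParamT x y).1 n ∈ part k (A →ₗ[k] A) (p + q)) ∧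
      (∀ n, (C.innerParamT x y).2 n ∈ part k A (p + q)) ∧
      (C.innerParamT x y).1 ∈ C.paraHurwitz.tri := by
  obtain ⟨x, hx', rfl⟩ := C.exists_rep hx
  obtain ⟨y, hy', rfl⟩ := C.exists_rep hy
  rw [innerParamT_mk]
  exact ⟨C.innerParam_fst_mem hx' hy', C.innerParam_snd_mem hx' hy',
    C.innerParam_tri (two_ne_zero_of_char k) hx' hy'⟩

end HurwitzSuperalgebra
end Supersquare
end

/-! ### The symmetry axiom of the triple product on J₀/k1. -/

noncomputable section

namespace Supersquare

namespace HurwitzSuperalgebra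

variable {k : Type*} [Field k] {A : Type*} [AddCommGroup A] [Module k A] [Superspace k A]
variable (C : HurwitzSuperalgebra k A) [CharP k 3]

-- This is the one axiom that does not follow from 𝔡𝔢𝔯 J acting by derivations, and it is checked in
-- coordinates. For the coefficient of ε, cyclicity of b(x, y • z) suffices; for the ι_n component,
-- six instances of the degree three identities reduce the products in S to multiples of x, y and z,
-- with scalars compared modulo 3.
set_option maxHeartbeats 4000000 in
theorem tripleTJ_symm_of_mem {p q r : ZMod 2} {x y z : C.TJ} (hx : x ∈ part k C.TJ p)
    (hy : y ∈ part k C.TJ q) (hz : z ∈ part k C.TJ r) :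
    C.tripleTJ.d x y z + sgn k (q * r) • C.tripleTJ.d x z y =
      C.tripleTJ.form x y • z + sgn k (q * r) • C.tripleTJ.form x z • y -
        (2 : k) • C.tripleTJ.form y z • x := by
  have h3 := three_eq_zero_of_char k
  have hS := C.paraHurwitz_isAssociative
  have ha := fun n => C.coT_mem hx n
  have hb := fun n => C.coT_mem hy n
  have hc := fun n => C.coT_mem hz n
  have hα := C.cT_odd (x := x)
  have hβ := C.cT_odd (x := y)
  have hγ := C.cT_odd (x := z)
  rw [tripleTJ_d_eq, tripleTJ_d_eq]
  refine C.TJ_ext ?_ (fun n => ?_)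
  · have cyc := fun {i j l : ZMod 2} {x y z : A} (hx : x ∈ part k A i) (hy : y ∈ part k A j)
      (hz : z ∈ part k A l) => hS.b_mul_cyclic hx hy hz
    have sy := fun n => C.b_supersymm q r _ (hb n) _ (hc n)
    simp only [CompositionSuperalgebra.IsAssociative, paraHurwitz_b] at cyc hS
    simp only [map_add, map_sub, map_smul, cT_opT, form_TJ, innerParamT_snd, Fin.sum_univ_three,
      zero_add, show (1 + 1 : Fin 3) = 2 from rfl,
      show (1 + 2 : Fin 3) = 0 from rfl, show (2 + 1 : Fin 3) = 0 from rfl,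
      show (2 + 2 : Fin 3) = 1 from rfl, LinearMap.add_apply, LinearMap.sub_apply,
      LinearMap.smul_apply, smul_eq_mul,
      CompositionSuperalgebra.r_apply _ (ha _) (hb _),
      CompositionSuperalgebra.r_apply _ (ha _) (hc _), hS]
    rw [cyc (hc 1) (ha 2) (hb 0), cyc (hc 2) (ha 0) (hb 1), cyc (hc 0) (ha 1) (hb 2),
      cyc (hb 1) (ha 2) (hc 0), cyc (hb 2) (ha 0) (hc 1), cyc (hb 0) (ha 1) (hc 2),
      sy 0, sy 1, sy 2]
    clear cyc hS
    rcases parity_cases p with rfl | rfl <;> rcases parity_cases q with rfl | rfl <;>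
      rcases parity_cases r with rfl | rfl <;>
      simp [hα, hβ, hγ, hx, hy, hz] <;>
      linear_combination (norm := ring_nf) (0 : k) * h3
  · have m1 := congrArg (sgn k (p * q) • ·)
      (hS.mul_mul_left (hb (n + 2)) (ha n) (hc (n + 2)))
    have m2 := congrArg (sgn k (r * (p + q)) • ·)
      (hS.mul_mul_right (hc (n + 1)) (ha n) (hb (n + 1)))
    have m3 := hS.mul_mul_right (ha (n + 1)) (hb n) (hc (n + 1))
    have m3' := hS.mul_mul_left (ha (n + 2)) (hb n) (hc (n + 2))
    have m4 := congrArg (sgn k (q * r) • ·)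
      (hS.mul_mul_right (ha (n + 1)) (hc n) (hb (n + 1)))
    have m4' := congrArg (sgn k (q * r) • ·)
      (hS.mul_mul_left (ha (n + 2)) (hc n) (hb (n + 2)))
    have sy := fun m => C.b_supersymm r q _ (hc m) _ (hb m)
    have e1 := C.b_even p q
    have e2 := C.b_even p r
    have e3 := C.b_even q r
    have r1 := fun m => C.paraHurwitz.r_apply ((C.innerParamT_mem hx hy).2.1 m) (hc (n + 1))
    have r2 := fun m => C.paraHurwitz.r_apply ((C.innerParamT_mem hx hz).2.1 m) (hb (n + 1))
    simp only [paraHurwitz_b, sy] at m1 m2 m3 m3' m4 m4'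
    simp only [map_add, map_sub, map_smul]
    rw [coT_opT, coT_opT, r1, r2]
    simp only [innerParamT_snd, innerParamT_fst, form_TJ, LinearMap.add_apply,
      sum_fin_three_rotate _ n,
      CompositionSuperalgebra.t_apply_zero, CompositionSuperalgebra.t_apply_one,
      CompositionSuperalgebra.t_apply_two,
      CompositionSuperalgebra.sigma_apply _ (ha _) (hb _) (hc _),
      CompositionSuperalgebra.sigma_apply _ (ha _) (hc _) (hb _), inv_two_of_char]
    simp only [
      CompositionSuperalgebra.r_apply _ (ha _) (C.paraHurwitz.mul_mem _ _ _ (hb _) _ (hc _)),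
      CompositionSuperalgebra.r_apply _ (ha _) (C.paraHurwitz.mul_mem _ _ _ (hc _) _ (hb _)),
      map_add, LinearMap.add_apply,
      map_smul, LinearMap.smul_apply, fin_three_add_one_one, fin_three_add_one_two,
      fin_three_add_two_one, fin_three_add_two_two, map_sub, LinearMap.sub_apply,
      CompositionSuperalgebra.r_apply _ (ha _) (hb _),
      CompositionSuperalgebra.r_apply _ (ha _) (hc _),
      CompositionSuperalgebra.r_apply _ (hb _) (hc _),
      CompositionSuperalgebra.r_apply _ (hc _) (hb _), paraHurwitz_b, sy]
    rcases parity_cases p with rfl | rfl <;> rcases parity_cases q with rfl | rfl <;>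
      rcases parity_cases r with rfl | rfl <;>
      simp [hα, hβ, hγ, hx, hy, hz, e1, e2, e3, ha _, hb _, hc _, -mul_eq_zero]
        at m1 m2 m3 m3' m4 m4' ⊢ <;>
      linear_combination (norm := skip) m1 + m2 - m3 - m3' - m4 - m4' <;>
      match_scalars <;> ring_nf <;> simp [h3]

end HurwitzSuperalgebra
end Supersquare
end

/-! ### J₀/k1 is a simple orthosymplectic triple system on which 𝔡𝔢𝔯 J acts by superderivations. -/

noncomputable section

namespace Supersquare

section

variable {k : Type*} [Field k] {A : Type*} [AddCommGroup A] [Module k A] [Superspace k A]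

theorem superComm_mem {i j : ZMod 2} {f g : A →ₗ[k] A} (hf : f ∈ part k (A →ₗ[k] A) i)
    (hg : g ∈ part k (A →ₗ[k] A) j) : superComm f g ∈ part k (A →ₗ[k] A) (i + j) := by
  refine hom_mem_part fun l x hx => ?_
  rw [superComm_apply hf hg]
  refine sub_mem ?_ (Submodule.smul_mem _ _ ?_)
  · have := hom_apply_mem hf (hom_apply_mem hg hx)
    rwa [add_assoc, add_comm j] at this
  · have := hom_apply_mem hg (hom_apply_mem hf hx)
    rwa [add_assoc] at this

theorem SuperTriple.mem_der {P : SuperTriple k A} {i : ZMod 2} {d : A →ₗ[k] A}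
    (hd : d ∈ part k (A →ₗ[k] A) i) :
    d ∈ P.der ↔ ∀ j l, ∀ x ∈ part k A j, ∀ y ∈ part k A l, ∀ z,
      d (P.d x y z) = P.d (d x) y z + sgn k (i * j) • P.d x (d y) z +
        sgn k (i * (j + l)) • P.d x y (d z) := by
  refine ⟨fun h j l x hx y hy z => by
    simpa only [pr_of_mem_self hd] using h i j l x hx y hy z, fun h i' j l x hx y hy z => ?_⟩
  by_cases hi : i' = i
  · subst hi; simpa only [pr_of_mem_self hd] using h j l x hx y hy z
  · simp [pr_of_mem_ne hd hi]

end

namespace HurwitzSuperalgebra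

variable {k : Type*} [Field k] {A : Type*} [AddCommGroup A] [Module k A] [Superspace k A]
variable (C : HurwitzSuperalgebra k A)

theorem superComm_mem_derJ {i j : ZMod 2} {d d' : C.J →ₗ[k] C.J}
    (hd : d ∈ part k (C.J →ₗ[k] C.J) i) (hd' : d' ∈ part k (C.J →ₗ[k] C.J) j)
    (h : d ∈ C.derJ) (h' : d' ∈ C.derJ) : superComm d d' ∈ C.derJ := by
  refine (C.mem_derJ (superComm_mem hd hd')).2 fun l x hx y => ?_
  have e := (C.mem_derJ hd).1 h
  have e' := (C.mem_derJ hd').1 h'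
  simp only [superComm_apply hd hd', e l x hx, e' l x hx, map_add, map_sub, map_smul,
    e _ _ (hom_apply_mem hd' hx), e' _ _ (hom_apply_mem hd hx), LinearMap.sub_apply,
    LinearMap.smul_apply]
  rcases parity_cases i with rfl | rfl <;> rcases parity_cases j with rfl | rfl <;>
    rcases parity_cases l with rfl | rfl <;> simp <;> module

/-- Since [d, L_x] = L_{d(x)}, a superderivation of J respects any expression built from
multiplication operators. -/
theorem derJ_innerJ {i j l : ZMod 2} {d : C.J →ₗ[k] C.J} (hd : d ∈ part k (C.J →ₗ[k] C.J) i)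
    (h : d ∈ C.derJ) {x y : C.J} (hx : x ∈ part k C.J j) (hy : y ∈ part k C.J l) (z : C.J) :
    d (C.innerJ x y z) = C.innerJ (d x) y z + sgn k (i * j) • C.innerJ x (d y) z +
      sgn k (i * (j + l)) • C.innerJ x y (d z) := by
  have e := (C.mem_derJ hd).1 h
  rw [C.innerJ_apply hx hy, C.innerJ_apply (hom_apply_mem hd hx) hy,
    C.innerJ_apply hx (hom_apply_mem hd hy), C.innerJ_apply hx hy]
  simp only [map_add, map_sub, map_smul, e _ _ hx, e _ _ hy]
  rcases parity_cases i with rfl | rfl <;> rcases parity_cases j with rfl | rfl <;>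
    rcases parity_cases l with rfl | rfl <;> simp <;> module

variable [CharP k 3]

theorem opT_mem {i : ZMod 2} {d : (Fin 3 → (A →ₗ[k] A)) × (Fin 3 → A)}
    (hd : ∀ n, d.1 n ∈ part k (A →ₗ[k] A) i) (hs : ∀ n, d.2 n ∈ part k A i) :
    C.opT d ∈ part k (C.TJ →ₗ[k] C.TJ) i := by
  refine hom_mem_part fun j x hx => ?_
  obtain ⟨x, hx', rfl⟩ := C.exists_rep hx
  rw [opT_mk]
  exact C.mkQ_mem (hom_apply_mem (C.opJ_mem hd hs) hx')

theorem pr_opT (i : ZMod 2) (P : (Fin 3 → (A →ₗ[k] A)) × (Fin 3 → A)) : pr k i (C.opT P) =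
    C.opT (fun n => pr k i (P.1 n), fun n => pr k i (P.2 n)) := by
  have h : ∀ i, C.opT (fun n => pr k i (P.1 n), fun n => pr k i (P.2 n)) ∈
      part k (C.TJ →ₗ[k] C.TJ) i := fun i =>
    C.opT_mem (fun n => pr_mem i (P.1 n)) fun n => pr_mem i (P.2 n)
  have e : P = (fun n => pr k 0 (P.1 n), fun n => pr k 0 (P.2 n)) +
      (fun n => pr k 1 (P.1 n), fun n => pr k 1 (P.2 n)) :=
    Prod.ext (funext fun n => (pr_add (k := k) _).symm) (funext fun n => (pr_add (k := k) _).symm)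
  conv_lhs => rw [e]
  rw [map_add, map_add, pr_of_mem (h 0), pr_of_mem (h 1)]
  rcases parity_cases i with rfl | rfl <;> simp

theorem pr_mem_derTJ {δ : C.TJ →ₗ[k] C.TJ} (h : δ ∈ C.derTJ) (i : ZMod 2) :
    pr k i δ ∈ C.derTJ := by
  obtain ⟨P, hP, rfl⟩ := C.mem_derTJ_iff.1 h
  rw [pr_opT]
  exact C.mem_derTJ_iff.2 ⟨(fun n => pr k i (P.1 n), fun n => pr k i (P.2 n)),
    CompositionSuperalgebra.pr_mem_tri hP i, rfl⟩

/-- A homogeneous element of `derTJ` is induced by a homogeneous superderivation of `J`. -/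
theorem exists_derJ_of_mem {i : ZMod 2} {δ : C.TJ →ₗ[k] C.TJ}
    (hδ : δ ∈ part k (C.TJ →ₗ[k] C.TJ) i) (h : δ ∈ C.derTJ) :
    ∃ d ∈ part k (C.J →ₗ[k] C.J) i, d ∈ C.derJ ∧ ∃ h0 : ∀ x, d x ∈ C.J0, 
      ∀ x : C.J0, δ (C.k1.mkQ x) = C.k1.mkQ ⟨d (x : C.J), h0 (x : C.J)⟩ := by
  obtain ⟨P, hP, rfl⟩ := C.mem_derTJ_iff.1 h
  have hδ' : pr k i (C.opT P) = C.opT P := hδ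
  rw [← hδ', pr_opT]
  exact ⟨C.opJ (fun n => pr k i (P.1 n), fun n => pr k i (P.2 n)),
    C.opJ_mem (fun n => pr_mem i (P.1 n)) (fun n => pr_mem i (P.2 n)),
    C.opJ_mem_derJ (CompositionSuperalgebra.pr_mem_tri hP i), C.opJ_mem_J0 _, C.opT_mk _⟩

theorem superComm_mem_derTJ {δ δ' : C.TJ →ₗ[k] C.TJ} (h : δ ∈ C.derTJ) (h' : δ' ∈ C.derTJ) :
    superComm δ δ' ∈ C.derTJ := by
  have key : ∀ i j, superComm (pr k i δ) (pr k j δ') ∈ C.derTJ := fun i j => by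
    obtain ⟨d, hd, hder, h0, e⟩ := C.exists_derJ_of_mem (pr_mem i δ) (C.pr_mem_derTJ h i)
    obtain ⟨d', hd', hder', h0', e'⟩ := C.exists_derJ_of_mem (pr_mem j δ') (C.pr_mem_derTJ h' j)
    refine ⟨superComm d d', C.superComm_mem_derJ hd hd' hder hder', fun x => ?_⟩
    refine ⟨⟨d (d' (x : C.J)), h0 _⟩ - sgn k (i * j) • ⟨d' (d (x : C.J)), h0' _⟩, ?_, ?_⟩
    · rw [superComm_apply hd hd']; rfl
    · rw [superComm_apply (pr_mem i δ) (pr_mem j δ'), e', e, e, e', map_sub, map_smul]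
  rw [← pr_add (k := k) δ, ← pr_add (k := k) δ']
  simp only [map_add, LinearMap.add_apply]
  exact add_mem (add_mem (key _ _) (key _ _)) (add_mem (key _ _) (key _ _))

/-- Each homogeneous component lifts to a homogeneous superderivation of J, where `derJ_innerJ`
gives the derivation rule for the triple product. -/
theorem derTJ_le_der : C.derTJ ≤ C.tripleTJ.der := by
  intro δ h
  rw [← pr_add (k := k) δ]
  have key : ∀ i, pr k i δ ∈ C.tripleTJ.der := fun i => by
    obtain ⟨d, hd, hder, h0, e⟩ := C.exists_derJ_of_mem (pr_mem i δ) (C.pr_mem_derTJ h i)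
    refine (SuperTriple.mem_der (pr_mem i δ)).2 fun j l x hx y hy z => ?_
    obtain ⟨x, hx', rfl⟩ := C.exists_rep hx
    obtain ⟨y, hy', rfl⟩ := C.exists_rep hy
    obtain ⟨z, rfl⟩ := C.k1.mkQ_surjective z
    rw [e x, e y, e z, tripleTJ_d, tripleTJ_d, tripleTJ_d, tripleTJ_d, e]
    have key : (⟨d (C.innerJ0 x y z : C.J), h0 _⟩ : C.J0) =
        C.innerJ0 ⟨d (x : C.J), h0 _⟩ y z + sgn k (i * j) • C.innerJ0 x ⟨d (y : C.J), h0 _⟩ z +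
          sgn k (i * (j + l)) • C.innerJ0 x y ⟨d (z : C.J), h0 _⟩ :=
      Subtype.ext (by
        simpa only [Submodule.coe_add, Submodule.coe_smul, innerJ0_apply] using
          C.derJ_innerJ hd hder hx' hy' (z : C.J))
    rw [key, map_add, map_add, map_smul, map_smul]
  exact Submodule.add_mem _ (key 0) (key 1)

/-- The left side is t(d(x ∘ y)), and superderivations of J have values of trace zero. -/
theorem derTJ_form {i j : ZMod 2} {δ : C.TJ →ₗ[k] C.TJ}
    (hδ : δ ∈ part k (C.TJ →ₗ[k] C.TJ) i) (h : δ ∈ C.derTJ) {x : C.TJ} (hx : x ∈ part k C.TJ j)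
    (y : C.TJ) :
    C.tripleTJ.form (δ x) y + sgn k (i * j) * C.tripleTJ.form x (δ y) = 0 := by
  obtain ⟨d, hd, hder, h0, e⟩ := C.exists_derJ_of_mem hδ h
  obtain ⟨x, hx', rfl⟩ := C.exists_rep hx
  obtain ⟨y, rfl⟩ := C.k1.mkQ_surjective y
  rw [e x, e y, tripleTJ_form, tripleTJ_form]
  have := congrArg C.trace ((C.mem_derJ hd).1 hder j _ hx' (y : C.J))
  rw [map_add, map_smul, smul_eq_mul] at this
  rw [← this]
  exact h0 _

theorem tripleTJ_d_mem_part {i j : ZMod 2} {x y : C.TJ} (hx : x ∈ part k C.TJ i)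
    (hy : y ∈ part k C.TJ j) : C.tripleTJ.d x y ∈ part k (C.TJ →ₗ[k] C.TJ) (i + j) := by
  rw [tripleTJ_d_eq]
  have h := C.innerParamT_mem hx hy
  exact C.opT_mem h.1 h.2.1

theorem tripleTJ_d_mem_derTJ (x y : C.TJ) : C.tripleTJ.d x y ∈ C.derTJ := by
  obtain ⟨x, rfl⟩ := C.k1.mkQ_surjective x
  obtain ⟨y, rfl⟩ := C.k1.mkQ_surjective y
  refine ⟨C.innerJ (x : C.J) (y : C.J), C.innerJ_mem_derJ _ _, fun z => ?_⟩
  exact ⟨C.innerJ0 x y z, C.innerJ0_apply x y z, C.tripleTJ_d x y z⟩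

theorem tripleTJ_isAdmissible : C.tripleTJ.IsAdmissible C.derTJ where
  graded i _ h := C.pr_mem_derTJ h i
  closed _ h _ h' := C.superComm_mem_derTJ h h'
  le_der := C.derTJ_le_der
  inder_le := C.tripleTJ_d_mem_derTJ

theorem form_epsT : C.tripleTJ.form C.epsT C.epsT = -1 := by
  simp [form_TJ, cT_epsT, coT_epsT]

theorem form_ioT (n : Fin 3) (x : C.TJ) (a : A) :
    C.tripleTJ.form x (C.ioT n a) = C.b (C.coT n x) a := by
  rw [form_TJ, cT_ioT, Finset.sum_eq_single n]
  · simp [coT_ioT]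
  · intro m _ hm; simp [coT_ioT, hm]
  · simp

theorem form_TJ_even (i j : ZMod 2) (hij : i ≠ j) (x : C.TJ) (hx : x ∈ part k C.TJ i) (y : C.TJ)
    (hy : y ∈ part k C.TJ j) : C.tripleTJ.form x y = 0 := by
  rw [form_TJ, Finset.sum_eq_zero fun n _ => C.b_even i j hij _ (C.coT_mem hx n) _ (C.coT_mem hy n),
    add_zero, neg_eq_zero]
  rcases parity_cases i with rfl | rfl
  · rcases parity_cases j with rfl | rfl
    · exact absurd rfl hij
    · rw [C.cT_odd hy, mul_zero]
  · rw [C.cT_odd hx, zero_mul]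

theorem form_TJ_supersymm {i j : ZMod 2} {x y : C.TJ} (hx : x ∈ part k C.TJ i)
    (hy : y ∈ part k C.TJ j) :
    C.tripleTJ.form x y = sgn k (i * j) * C.tripleTJ.form y x := by
  rw [form_TJ, form_TJ, mul_add, Finset.mul_sum]
  congr 1
  · have hx' := C.cT_odd (x := x)
    have hy' := C.cT_odd (x := y)
    rcases parity_cases i with rfl | rfl <;> rcases parity_cases j with rfl | rfl <;>
      simp [hx', hy', hx, hy, mul_comm]
  · exact Finset.sum_congr rfl fun n _ =>
      C.b_supersymm i j _ (C.coT_mem hx n) _ (C.coT_mem hy n)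

theorem tripleTJ_skew {i j : ZMod 2} {x y : C.TJ} (hx : x ∈ part k C.TJ i)
    (hy : y ∈ part k C.TJ j) :
    C.tripleTJ.d x y = -(sgn k (i * j) • C.tripleTJ.d y x) := by
  obtain ⟨x, hx', rfl⟩ := C.exists_rep hx
  obtain ⟨y, hy', rfl⟩ := C.exists_rep hy
  refine C.hom_TJ_ext fun z => ?_
  have key : C.innerJ0 x y z = -(sgn k (i * j) • C.innerJ0 y x z) := by
    refine Subtype.ext ?_
    rw [Submodule.coe_neg, Submodule.coe_smul, innerJ0_apply, innerJ0_apply,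
      C.innerJ_apply hx' hy', C.innerJ_apply hy' hx']
    rcases parity_cases i with rfl | rfl <;> rcases parity_cases j with rfl | rfl <;> simp
  rw [LinearMap.neg_apply, LinearMap.smul_apply, tripleTJ_d, tripleTJ_d, key, map_neg, map_smul]

/-- Since [xy·] itself belongs to 𝔡𝔢𝔯 J, the last two axioms are instances of `derTJ_le_der` and
`derTJ_form`. -/
theorem tripleTJ_isOrthosymplectic : C.tripleTJ.IsOrthosymplectic where
  form_ne_zero h := by
    have := C.form_epsT
    rw [h] at this
    simp at this
  form_even := C.form_TJ_even
  form_symm x hx y hy := by rw [C.form_TJ_supersymm hx hy]; simp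
  form_alt x hx := by
    have h := C.form_TJ_supersymm hx hx
    have h3 := three_eq_zero_of_char k
    rw [_root_.mul_one, sgn_one] at h
    linear_combination C.tripleTJ.form x x * h3 - h
  parity i j l x hx y hy z hz := by
    rw [add_comm]; exact hom_apply_mem (C.tripleTJ_d_mem_part hx hy) hz
  skew i j x hx y hy z := by
    rw [C.tripleTJ_skew hx hy]; simp
  symm j l x y hy z hz := by
    induction x using homogeneous_induction (k := k) (A := C.TJ) with
    | hadd x x' h h' =>
      simp only [map_add, LinearMap.add_apply]
      linear_combination (norm := module) h + h'
    | h i x hx => exact C.tripleTJ_symm_of_mem hx hy hz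
  derivation i j l m x hx y hy u hu v hv w :=
    (SuperTriple.mem_der (C.tripleTJ_d_mem_part hx hy)).1
      (C.derTJ_le_der (C.tripleTJ_d_mem_derTJ x y)) l m u hu v hv w
  form_d i j l x hx y hy u hu v :=
    C.derTJ_form (C.tripleTJ_d_mem_part hx hy) (C.tripleTJ_d_mem_derTJ x y) hu v

/-- Testing against ε and the ι_n(y) reduces this to (ε|ε) = -1 and the regularity of the norm of C.
-/
theorem form_TJ_nondegenerate {i : ZMod 2} {x : C.TJ} (hx : x ∈ part k C.TJ i)
    (h : ∀ y ∈ part k C.TJ i, C.tripleTJ.form x y = 0) : x = 0 := by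
  refine C.TJ_ext ?_ fun n => ?_
  · rcases parity_cases i with rfl | rfl
    · have := h _ C.epsT_mem
      rw [form_TJ] at this
      simpa [cT_epsT, coT_epsT] using this
    · rw [C.cT_odd hx, map_zero]
  · rw [map_zero]
    refine C.regular i _ (C.coT_mem hx n) fun y hy => ?_
    have := h _ (C.ioT_mem hy n)
    rwa [form_ioT] at this

/-- The symmetry axiom expresses (x|y)z ± (x|z)y by triple products starting with x and a multiple
of x. With a nondegenerate form this makes a nonzero graded ideal absorb everything. -/
theorem tripleTJ_isSimple : C.tripleTJ.IsSimple := by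
  have h3 := three_eq_zero_of_char k
  have h2 := two_ne_zero_of_char k
  constructor
  · intro h
    -- If the triple product vanished, the symmetry axiom at (ε, ε, ι_0(1)) would read (ε|ε) ι_0(1)
    -- = 0.
    have := C.tripleTJ_isOrthosymplectic.symm 0 0 C.epsT C.epsT C.epsT_mem (C.ioT 0 C.one)
      (C.ioT_mem C.one_mem 0)
    rw [h, form_epsT, form_ioT, coT_epsT] at this
    have e := congrArg (C.coT 0) this
    simp [coT_ioT] at e
    exact C.one_ne_zero e
  · intro I ⟨hgr, hI⟩
    rw [or_iff_not_imp_left]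
    intro hne
    have hfin : ∀ {i j l : ZMod 2} {x y z : C.TJ}, x ∈ I → x ∈ part k C.TJ i → y ∈ part k C.TJ j →
        z ∈ part k C.TJ l → C.tripleTJ.form x y • z + sgn k (j * l) • C.tripleTJ.form x z • y ∈ I := by
      intro i j l x y z hxI hx hy hz
      have := C.tripleTJ_isOrthosymplectic.symm j l x y hy z hz
      have e : C.tripleTJ.form x y • z + sgn k (j * l) • C.tripleTJ.form x z • y =
          (C.tripleTJ.d x y z + sgn k (j * l) • C.tripleTJ.d x z y) +
            ((2 : k) * C.tripleTJ.form y z) • x := by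
        rw [this]; module
      rw [e]
      exact add_mem (add_mem (hI x hxI y z).1 (Submodule.smul_mem _ _ (hI x hxI z y).1))
        (Submodule.smul_mem _ _ hxI)
    have heven : ∀ x ∈ I, x ∈ part k C.TJ 0 → x ≠ 0 → I = ⊤ := by
      intro x hxI hx hx0
      obtain ⟨y, hy, hxy⟩ : ∃ y ∈ part k C.TJ 0, C.tripleTJ.form x y ≠ 0 := by
        by_contra! hcon
        exact hx0 (C.form_TJ_nondegenerate hx hcon)
      -- Taking z = y gives 2(x|y)y in the ideal; evenness of y prevents the two terms from
      -- cancelling.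
      have hyI : y ∈ I := by
        have h := hfin hxI hx hy hy
        rw [mul_zero, sgn_zero, one_smul, ← two_smul k, smul_smul] at h
        exact (Submodule.smul_mem_iff _ (mul_ne_zero h2 hxy)).1 h
      rw [eq_top_iff]
      intro z _
      induction z using homogeneous_induction (k := k) (A := C.TJ) with
      | hadd z z' h h' => exact add_mem (h trivial) (h' trivial)
      | h l z hz =>
        have h := hfin hxI hx hy hz
        rw [zero_mul, sgn_zero, one_smul] at h
        exact (Submodule.smul_mem_iff _ hxy).1
          ((Submodule.add_mem_iff_left _ (Submodule.smul_mem _ _ hyI)).1 h)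
    obtain ⟨x, hxI, hx0⟩ := (Submodule.ne_bot_iff I).1 hne
    by_cases h0 : pr k 0 x = 0
    · have h1 : pr k 1 x ≠ 0 := fun h1 => hx0 (by rw [← pr_add (k := k) x, h0, h1, add_zero])
      obtain ⟨y, hy, hxy⟩ : ∃ y ∈ part k C.TJ 1, C.tripleTJ.form (pr k 1 x) y ≠ 0 := by
        by_contra! hcon
        exact h1 (C.form_TJ_nondegenerate (pr_mem 1 x) hcon)
      -- An odd element of the ideal produces ε, an even one: pairing it with an odd y and with ε
      -- leaves (x|y)ε, since odd elements are orthogonal to ε.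
      have h := hfin (hgr 1 x hxI) (pr_mem 1 x) hy C.epsT_mem
      rw [C.form_TJ_even 1 0 (by decide) _ (pr_mem 1 x) _ C.epsT_mem, zero_smul, smul_zero,
        add_zero] at h
      refine heven C.epsT ((Submodule.smul_mem_iff _ hxy).1 h) C.epsT_mem fun he => ?_
      have := C.cT_epsT
      rw [he, map_zero] at this
      exact zero_ne_one this
    · exact heven _ (hgr 0 x hxI) (pr_mem 0 x) h0

theorem derJ_eq_map : C.derJ = (C.paraHurwitz.tri.prod ⊤).map C.opJ := by
  ext d
  rw [mem_derJ_iff, Submodule.mem_map]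
  simp [Submodule.mem_prod]

theorem derTJ_eq_map : C.derTJ = (C.paraHurwitz.tri.prod ⊤).map C.opT := by
  ext d
  rw [mem_derTJ_iff, Submodule.mem_map]
  simp [Submodule.mem_prod]

/-- The identification of `𝔡𝔢𝔯 J` with `derTJ`. -/
theorem exists_derJ_equiv : ∃ ρ : C.derJ ≃ₗ[k] C.derTJ, ∀ d : C.derJ,
    C.Induces (d : C.J →ₗ[k] C.J) (ρ d : C.TJ →ₗ[k] C.TJ) := by
  -- Both algebras are injective images of the same parameter space 𝔱𝔯𝔦(S) × S³, and equal
  -- parameters correspond to a superderivation and the map that it induces.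
  let e1 := Submodule.equivMapOfInjective C.opJ C.opJ_injective (C.paraHurwitz.tri.prod ⊤)
  let e2 := Submodule.equivMapOfInjective C.opT C.opT_injective (C.paraHurwitz.tri.prod ⊤)
  refine ⟨(LinearEquiv.ofEq _ _ C.derJ_eq_map).trans (e1.symm.trans
    (e2.trans (LinearEquiv.ofEq _ _ C.derTJ_eq_map.symm))), fun d => ?_⟩
  have h : C.opJ (e1.symm (LinearEquiv.ofEq _ _ C.derJ_eq_map d) : _ × _) = d := by
    have := congrArg Subtype.val (e1.apply_symm_apply (LinearEquiv.ofEq _ _ C.derJ_eq_map d))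
    exact this
  rw [← h]
  have h' := C.induces_opT (e1.symm (LinearEquiv.ofEq _ _ C.derJ_eq_map d) : _ × _)
  convert h' using 1
  simp [e2]

end HurwitzSuperalgebra
end Supersquare
end

/-! ### Supercommutators, signed tensor actions, and verification of the Lie axioms on generators.
-/

noncomputable section

namespace Supersquare

section

variable {k : Type*} [Field k] {A : Type*} [AddCommGroup A] [Module k A] [Superspace k A]
variable {B : Type*} [AddCommGroup B] [Module k B] [Superspace k B]

theorem superComm_skew {i j : ZMod 2} {f g : A →ₗ[k] A} (hf : f ∈ part k (A →ₗ[k] A) i)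
    (hg : g ∈ part k (A →ₗ[k] A) j) : superComm f g = -(sgn k (i * j) • superComm g f) := by
  ext x
  simp only [LinearMap.neg_apply, LinearMap.smul_apply, superComm_apply hf hg,
    superComm_apply hg hf]
  rcases parity_cases i with rfl | rfl <;> rcases parity_cases j with rfl | rfl <;> simp

theorem superComm_jacobi {i j l : ZMod 2} {f g h : A →ₗ[k] A} (hf : f ∈ part k (A →ₗ[k] A) i)
    (hg : g ∈ part k (A →ₗ[k] A) j) (hh : h ∈ part k (A →ₗ[k] A) l) :
    superComm f (superComm g h) =
      superComm (superComm f g) h + sgn k (i * j) • superComm g (superComm f h) := by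
  ext x
  simp only [LinearMap.add_apply, LinearMap.smul_apply, superComm_apply hf (superComm_mem hg hh),
    superComm_apply (superComm_mem hf hg) hh, superComm_apply hg (superComm_mem hf hh),
    superComm_apply hf hg, superComm_apply hg hh, superComm_apply hf hh, map_sub, map_smul]
  rcases parity_cases i with rfl | rfl <;> rcases parity_cases j with rfl | rfl <;>
    rcases parity_cases l with rfl | rfl <;> simp <;> module

theorem superComm_cube {f : A →ₗ[k] A} (hf : f ∈ part k (A →ₗ[k] A) 1) :
    superComm f (superComm f f) = 0 := by
  ext x
  rw [superComm_apply hf (superComm_mem hf hf), superComm_apply hf hf, superComm_apply hf hf]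
  simp

theorem tmul_mem_part {i j : ZMod 2} {a : A} {b : B} (ha : a ∈ part k A i) (hb : b ∈ part k B j) :
    a ⊗ₜ[k] b ∈ part k (A ⊗[k] B) (i + j) := by
  change (∑ m : ZMod 2, TensorProduct.map (pr k m) (pr k (m + (i + j)))) (a ⊗ₜ[k] b) = _
  rcases parity_cases i with rfl | rfl <;> rcases parity_cases j with rfl | rfl <;>
    simp [sum_parity, pr_of_mem ha, pr_of_mem hb]

theorem tensor_part_le_span (i : ZMod 2) : part k (A ⊗[k] B) i ≤ Submodule.span k
    {w | ∃ m, ∃ a ∈ part k A m, ∃ b ∈ part k B (m + i), a ⊗ₜ[k] b = w} := by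
  intro w hw
  rw [← mem_part.1 hw]
  clear hw
  induction w using TensorProduct.induction_on with
  | zero => simp
  | add x y hx hy => rw [map_add]; exact add_mem hx hy
  | tmul a b =>
    change (∑ m : ZMod 2, TensorProduct.map (pr k m) (pr k (m + i))) (a ⊗ₜ[k] b) ∈ _
    rw [LinearMap.sum_apply]
    exact sum_mem fun m _ => Submodule.subset_span
      ⟨m, _, pr_mem m a, _, pr_mem (m + i) b, rfl⟩

theorem actRight_tmul {i j : ZMod 2} {d : B →ₗ[k] B} (hd : d ∈ part k (B →ₗ[k] B) i) {a : A}
    (ha : a ∈ part k A j) (b : B) :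
    actRight k A B d (a ⊗ₜ[k] b) = sgn k (i * j) • (a ⊗ₜ[k] d b) := by
  rcases parity_cases i with rfl | rfl <;> rcases parity_cases j with rfl | rfl <;>
    simp [actRight, sum_parity, pr_of_mem hd, pr_of_mem ha, -LinearMap.lTensor_tmul,
      LinearMap.coe_lTensorHom] <;> simp

omit [Superspace k A] [Superspace k B] in
theorem actLeft_tmul (d : A →ₗ[k] A) (a : A) (b : B) :
    actLeft k A B d (a ⊗ₜ[k] b) = d a ⊗ₜ[k] b := rfl

theorem actLeft_mem {i j : ZMod 2} {d : A →ₗ[k] A} (hd : d ∈ part k (A →ₗ[k] A) i)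
    {w : A ⊗[k] B} (hw : w ∈ part k (A ⊗[k] B) j) :
    actLeft k A B d w ∈ part k (A ⊗[k] B) (i + j) := by
  refine Submodule.span_induction (p := fun w _ => actLeft k A B d w ∈ part k (A ⊗[k] B) (i + j))
    ?_ (by simp) (fun x y _ _ hx hy => by rw [map_add]; exact add_mem hx hy)
    (fun c x _ hx => by rw [map_smul]; exact Submodule.smul_mem _ c hx) (tensor_part_le_span j hw)
  rintro _ ⟨m, a, ha, b, hb, rfl⟩
  have := tmul_mem_part (hom_apply_mem hd ha) hb
  rwa [(by decide : ∀ m i j : ZMod 2, m + i + (m + j) = i + j) m i j] at this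

theorem actRight_mem {i j : ZMod 2} {d : B →ₗ[k] B} (hd : d ∈ part k (B →ₗ[k] B) i)
    {w : A ⊗[k] B} (hw : w ∈ part k (A ⊗[k] B) j) :
    actRight k A B d w ∈ part k (A ⊗[k] B) (i + j) := by
  refine Submodule.span_induction (p := fun w _ => actRight k A B d w ∈ part k (A ⊗[k] B) (i + j))
    ?_ (by simp) (fun x y _ _ hx hy => by rw [map_add]; exact add_mem hx hy)
    (fun c x _ hx => by rw [map_smul]; exact Submodule.smul_mem _ c hx) (tensor_part_le_span j hw)
  rintro _ ⟨m, a, ha, b, hb, rfl⟩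
  rw [actRight_tmul hd ha]
  have := tmul_mem_part ha (hom_apply_mem hd hb)
  rw [(by decide : ∀ m i j : ZMod 2, m + (m + j + i) = i + j) m i j] at this
  exact Submodule.smul_mem _ _ this

theorem mem_part_prod {i : ZMod 2} {x : A × B} :
    x ∈ part k (A × B) i ↔ x.1 ∈ part k A i ∧ x.2 ∈ part k B i := Prod.ext_iff

theorem mem_part_pi {n : Type*} {i : ZMod 2} {x : n → A} :
    x ∈ part k (n → A) i ↔ ∀ m, x m ∈ part k A i := funext_iff

end

section Generators

variable {k : Type*} [Field k] {L : Type*} [AddCommGroup L] [Module k L] [Superspace k L]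
variable {br : L →ₗ[k] L →ₗ[k] L} {g : Submodule k L}

/-- The Jacobi identity, for elements `x` and `y` of parities `i` and `j`. -/
def Jacobi (br : L →ₗ[k] L →ₗ[k] L) (i j : ZMod 2) (x y z : L) : Prop :=
  br x (br y z) = br (br x y) z + sgn k (i * j) • br y (br x z)

omit [Superspace k L] in
-- Together with `Jacobi.swap_right`: under superanticommutativity the Jacobi identity for three
-- elements does not depend on their order, so each type of triple needs checking in one order only.
theorem Jacobi.swap_left {i j : ZMod 2} {x y z : L} (h : Jacobi br i j x y z)
    (hs : br x y = -(sgn k (i * j) • br y x)) : Jacobi br j i y x z := by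
  unfold Jacobi at *
  rw [h, hs]
  rcases parity_cases i with rfl | rfl <;> rcases parity_cases j with rfl | rfl <;> simp

omit [Superspace k L] in
theorem Jacobi.swap_right {i j l : ZMod 2} {x y z : L} (h : Jacobi br i j x y z)
    (h1 : br y z = -(sgn k (j * l) • br z y))
    (h2 : br (br x y) z = -(sgn k ((i + j) * l) • br z (br x y)))
    (h3 : br (br x z) y = -(sgn k ((i + l) * j) • br y (br x z))) : Jacobi br i l x z y := by
  unfold Jacobi at *
  rw [h1, h2] at h
  rw [h3]
  rcases parity_cases i with rfl | rfl <;> rcases parity_cases j with rfl | rfl <;>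
    rcases parity_cases l with rfl | rfl <;> simp at h ⊢ <;>
    first
    | linear_combination (norm := module) h
    | linear_combination (norm := module) -h

/-- The axioms of a Lie superalgebra need to be checked on homogeneous generators only. -/
theorem IsLieSuperalgebra.of_generators {G : ZMod 2 → Set L}
    (hg : ∀ i, g ⊓ part k L i = Submodule.span k (G i))
    (graded : ∀ i, ∀ x ∈ g, pr k i x ∈ g)
    (closed : ∀ x ∈ g, ∀ y ∈ g, br x y ∈ g)
    (parity : ∀ i j, ∀ x ∈ g ⊓ part k L i, ∀ y ∈ g ⊓ part k L j, br x y ∈ part k L (i + j))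
    (skew : ∀ i j, ∀ x ∈ G i, ∀ y ∈ G j, br x y = -(sgn k (i * j) • br y x))
    (jacobi : (∀ i j, ∀ x ∈ g ⊓ part k L i, ∀ y ∈ g ⊓ part k L j,
      br x y = -(sgn k (i * j) • br y x)) →
      ∀ i j l, ∀ x ∈ G i, ∀ y ∈ G j, ∀ z ∈ G l, Jacobi br i j x y z)
    (cube : ∀ x ∈ G 1, br x (br x x) = 0) : IsLieSuperalgebra br g := by
  have hskew : ∀ i j, ∀ x ∈ g ⊓ part k L i, ∀ y ∈ g ⊓ part k L j,
      br x y = -(sgn k (i * j) • br y x) := by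
    intro i j x hx y hy
    rw [hg] at hx hy
    induction hx, hy using Submodule.span_induction₂ with
    | mem_mem x y hx hy => exact skew i j x hx y hy
    | zero_left => simp
    | zero_right => simp
    | add_left x y z _ _ _ h h' => simp only [map_add, LinearMap.add_apply, h, h']; module
    | add_right x y z _ _ _ h h' => simp only [map_add, LinearMap.add_apply, h, h']; module
    | smul_left c x y _ _ h => simp only [map_smul, LinearMap.smul_apply, h]; module
    | smul_right c x y _ _ h => simp only [map_smul, LinearMap.smul_apply, h]; module
  have hjac : ∀ i j, ∀ x ∈ g ⊓ part k L i, ∀ y ∈ g ⊓ part k L j, ∀ z ∈ g, Jacobi br i j x y z := by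
    have key : ∀ i j l, ∀ x ∈ g ⊓ part k L i, ∀ y ∈ g ⊓ part k L j, ∀ z ∈ g ⊓ part k L l,
        Jacobi br i j x y z := by
      intro i j l x hx y hy z hz
      rw [hg] at hx hy hz
      induction hx using Submodule.span_induction with
      | zero => simp [Jacobi]
      | add x x' _ _ h h' =>
        simp only [Jacobi, map_add, LinearMap.add_apply] at *; rw [h, h']; module
      | smul c x _ h =>
        simp only [Jacobi, map_smul, LinearMap.smul_apply] at *; rw [h]; module
      | mem x hx =>
      induction hy using Submodule.span_induction with
      | zero => simp [Jacobi]
      | add y y' _ _ h h' =>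
        simp only [Jacobi, map_add, LinearMap.add_apply] at *; rw [h, h']; module
      | smul c y _ h =>
        simp only [Jacobi, map_smul, LinearMap.smul_apply] at *; rw [h]; module
      | mem y hy =>
      induction hz using Submodule.span_induction with
      | zero => simp [Jacobi]
      | add z z' _ _ h h' =>
        simp only [Jacobi, map_add] at *; rw [h, h']; module
      | smul c z _ h =>
        simp only [Jacobi, map_smul] at *; rw [h]; module
      | mem z hz => exact jacobi hskew i j l x hx y hy z hz
    intro i j x hx y hy z hz
    have h0 := key i j 0 x hx y hy _ ⟨graded 0 z hz, pr_mem 0 z⟩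
    have h1 := key i j 1 x hx y hy _ ⟨graded 1 z hz, pr_mem 1 z⟩
    have e := pr_add (k := k) z
    unfold Jacobi at *
    rw [← e]
    simp only [map_add, h0, h1]
    module
  refine ⟨graded, closed, parity, hskew, hjac, fun x hx => ?_⟩
  have hx' := hx
  rw [hg] at hx
  clear hx'
  induction hx using Submodule.span_induction with
  | zero => simp
  | smul c x _ h => simp [h]
  | mem x hx => exact cube x hx
  | add x y hx hy h h' =>
    rw [← hg] at hx hy
    -- The cube condition is not linear. For odd x the Jacobi identity on (x, x, y) says 2[x,[x,y]]
    -- + [y,[x,x]] = 0, and these, with x and y also exchanged, are the mixed terms in the cube of x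
    -- + y.
    have e1 := hjac 1 1 x hx x hx y hy.1
    have e2 := hjac 1 1 y hy y hy x hx.1
    have hxx : br x x ∈ g ⊓ part k L 0 := ⟨closed x hx.1 x hx.1, parity 1 1 x hx x hx⟩
    have hyy : br y y ∈ g ⊓ part k L 0 := ⟨closed y hy.1 y hy.1, parity 1 1 y hy y hy⟩
    rw [Jacobi, hskew 0 1 _ hxx y hy] at e1
    rw [Jacobi, hskew 0 1 _ hyy x hx] at e2
    have e3 := hskew 1 1 y hy x hx
    simp only [map_add, LinearMap.add_apply, h, h', e3]
    simp at e1 e2 e3 ⊢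
    rw [e3] at e2
    linear_combination (norm := module) e1 + e2

end Generators

end Supersquare
end

/-! ### The symplectic plane and the bracket of 𝔤(T, 𝔰): parity and superanticommutativity. -/

noncomputable section

namespace Supersquare

section Plane

variable {k : Type*} [Field k] {V : Type*} [AddCommGroup V] [Module k V]

theorem mem_part_odd (v : OddSpace V) : v ∈ part k (OddSpace V) 1 := rfl

/-- As V is purely odd, all of its endomorphisms are even. So 𝔰𝔭(V) contributes no signs, and an odd
generator has no component there. -/
theorem hom_odd_mem (f : OddSpace V →ₗ[k] OddSpace V) :
    f ∈ part k (OddSpace V →ₗ[k] OddSpace V) 0 := hom_mem_part fun j x hx => by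
  rcases parity_cases j with rfl | rfl
  · have : x = 0 := hx.symm
    rw [this, map_zero]
    exact zero_mem _
  · exact mem_part_odd _

theorem hom_odd_eq_zero {i : ZMod 2} (hi : i ≠ 0) {f : OddSpace V →ₗ[k] OddSpace V}
    (hf : f ∈ part k (OddSpace V →ₗ[k] OddSpace V) i) : f = 0 := by
  rw [← mem_part.1 hf, pr_of_mem_ne (hom_odd_mem f) hi]

theorem superComm_odd (f g : OddSpace V →ₗ[k] OddSpace V) (v : OddSpace V) :
    superComm f g v = f (g v) - g (f v) := by
  rw [superComm_apply (hom_odd_mem f) (hom_odd_mem g)]; simp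

theorem odd_tensor_part_le_span {T : Type*} [AddCommGroup T] [Module k T] [Superspace k T]
    (i : ZMod 2) : part k (OddSpace V ⊗[k] T) i ≤ Submodule.span k
    {w | ∃ v : OddSpace V, ∃ x ∈ part k T (i + 1), v ⊗ₜ[k] x = w} := by
  refine (tensor_part_le_span i).trans (Submodule.span_le.2 ?_)
  rintro _ ⟨m, v, hv, x, hx, rfl⟩
  rcases parity_cases m with rfl | rfl
  · have : v = 0 := hv.symm
    rw [this, TensorProduct.zero_tmul]
    exact zero_mem _
  · exact Submodule.subset_span ⟨v, x, add_comm 1 i ▸ hx, rfl⟩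

theorem odd_tmul_mem {T : Type*} [AddCommGroup T] [Module k T] [Superspace k T]
    {i : ZMod 2} (v : OddSpace V) {x : T} (hx : x ∈ part k T (i + 1)) :
    v ⊗ₜ[k] x ∈ part k (OddSpace V ⊗[k] T) i := by
  have := tmul_mem_part (mem_part_odd (k := k) v) hx
  rwa [(by decide : ∀ i : ZMod 2, 1 + (i + 1) = i) i] at this

namespace SymplecticPlane

variable (ω : SymplecticPlane k V)

theorem gamma_apply (u v w : OddSpace V) :
    ω.gamma u v w = ω.form u w • v + ω.form v w • u := rfl

theorem gamma_comm (u v : OddSpace V) : ω.gamma u v = ω.gamma v u := by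
  ext w; rw [gamma_apply, gamma_apply, add_comm]

theorem gamma_mem_sp (u v : OddSpace V) : ω.gamma u v ∈ ω.sp := fun w z => by
  simp only [gamma_apply, map_add, map_smul, LinearMap.add_apply, LinearMap.smul_apply,
    smul_eq_mul, ω.neg w u, ω.neg w v]
  ring

theorem superComm_gamma {f : OddSpace V →ₗ[k] OddSpace V} (hf : f ∈ ω.sp) (u v : OddSpace V) :
    superComm f (ω.gamma u v) = ω.gamma (f u) v + ω.gamma u (f v) := by
  ext w
  have h1 : ω.form (f u) w + ω.form u (f w) = 0 := hf u w
  have h2 : ω.form (f v) w + ω.form v (f w) = 0 := hf v w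
  rw [superComm_odd, LinearMap.add_apply]
  simp only [gamma_apply, map_add, map_smul]
  linear_combination (norm := module) (-h1) • v - h2 • u

theorem superComm_mem_sp {f g : OddSpace V →ₗ[k] OddSpace V} (hf : f ∈ ω.sp) (hg : g ∈ ω.sp) :
    superComm f g ∈ ω.sp := fun u v => by
  have e1 : ω.form (f (g u)) v + ω.form (g u) (f v) = 0 := hf (g u) v
  have e2 : ω.form (g (f u)) v + ω.form (f u) (g v) = 0 := hg (f u) v
  have e3 : ω.form (f u) (g v) + ω.form u (f (g v)) = 0 := hf u (g v)
  have e4 : ω.form (g u) (f v) + ω.form u (g (f v)) = 0 := hg u (f v)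
  rw [superComm_odd, superComm_odd, map_sub, map_sub, LinearMap.sub_apply]
  linear_combination e1 - e2 + e3 - e4

/-- Pairing with z gives the Plücker relation of the plane. This is where two-dimensionality of V
enters the Jacobi identity of 𝔤(T, 𝔰). -/
theorem cyclic (u v w : OddSpace V) :
    ω.form v w • u + ω.form w u • v + ω.form u v • w = 0 := by
  refine ω.nondegenerate fun z => ?_
  have := ω.pluecker u v w z
  simp only [map_add, map_smul, LinearMap.add_apply, LinearMap.smul_apply, smul_eq_mul,
    ω.neg w u]
  linear_combination this

/-- The three second factors are allowed to be different expressions for one element of T: in the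
Jacobi identity their equality is the symmetry axiom. -/
theorem cyclic_tmul {T : Type*} [AddCommGroup T] [Module k T] (u v w : OddSpace V) {x y z : T}
    (h : x = y) (h' : y = z) : ω.form v w • u ⊗ₜ[k] x + ω.form w u • v ⊗ₜ[k] y +
      ω.form u v • w ⊗ₜ[k] z = 0 := by
  subst h h'
  have := congrArg (· ⊗ₜ[k] x) (ω.cyclic u v w)
  simpa only [TensorProduct.add_tmul, TensorProduct.smul_tmul', TensorProduct.zero_tmul] using this

end SymplecticPlane

end Plane

namespace SuperTriple

variable {k : Type*} [Field k] {T : Type*} [AddCommGroup T] [Module k T] [Superspace k T]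
variable {V : Type*} [AddCommGroup V] [Module k V] (ω : SymplecticPlane k V)
variable {P : SuperTriple k T}

theorem IsOrthosymplectic.form_supersymm (hP : P.IsOrthosymplectic) {i j : ZMod 2} {x y : T}
    (hx : x ∈ part k T i) (hy : y ∈ part k T j) :
    P.form x y = sgn k (i * j) * P.form y x := by
  rcases parity_cases i with rfl | rfl <;> rcases parity_cases j with rfl | rfl
  · simp [hP.form_symm x hx y hy]
  · simp [hP.form_even 0 1 (by decide) x hx y hy, hP.form_even 1 0 (by decide) y hy x hx]
  · simp [hP.form_even 0 1 (by decide) y hy x hx, hP.form_even 1 0 (by decide) x hx y hy]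
  · have h := hP.form_alt _ (add_mem hx hy)
    simp only [map_add, LinearMap.add_apply, hP.form_alt x hx, hP.form_alt y hy] at h
    simp
    linear_combination h

theorem IsOrthosymplectic.d_mem_part (hP : P.IsOrthosymplectic) {i j : ZMod 2} {x y : T}
    (hx : x ∈ part k T i) (hy : y ∈ part k T j) : P.d x y ∈ part k (T →ₗ[k] T) (i + j) :=
  hom_mem_part fun l z hz => by rw [add_comm]; exact hP.parity i j l x hx y hy z hz

theorem tensorGamma_tmul {i : ZMod 2} {x : T} (hx : x ∈ part k T i) (u v : OddSpace V) (y : T) :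
    tensorGamma P ω (u ⊗ₜ[k] x) (v ⊗ₜ[k] y) = sgn k i • P.form x y • ω.gamma u v := by
  rcases parity_cases i with rfl | rfl <;>
    simp [tensorGamma, sum_parity, pr_of_mem hx]

theorem tensorD_tmul {i : ZMod 2} {x : T} (hx : x ∈ part k T i) (u v : OddSpace V) (y : T) :
    tensorD P ω (u ⊗ₜ[k] x) (v ⊗ₜ[k] y) = sgn k i • ω.form u v • P.d x y := by
  rcases parity_cases i with rfl | rfl <;>
    simp [tensorD, sum_parity, pr_of_mem hx]

theorem bracket_apply (X Y : Ambient k V T) : bracket P ω X Y =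
    (superComm X.1 Y.1 - tensorGamma P ω X.2.2 Y.2.2,
    superComm X.2.1 Y.2.1 + tensorD P ω X.2.2 Y.2.2,
    actLeft k (OddSpace V) T X.1 Y.2.2 + actRight k (OddSpace V) T X.2.1 Y.2.2 -
      sflip (actLeft k (OddSpace V) T) X.2.2 Y.1 - sflip (actRight k (OddSpace V) T) X.2.2 Y.2.1) :=
  rfl

theorem bracket_op_op (f f' : OddSpace V →ₗ[k] OddSpace V) (d d' : T →ₗ[k] T) :
    bracket P ω (f, d, 0) (f', d', 0) = (superComm f f', superComm d d', 0) := by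
  simp [bracket_apply]

theorem bracket_op_tmul {i : ZMod 2} (f : OddSpace V →ₗ[k] OddSpace V) {d : T →ₗ[k] T}
    (hd : d ∈ part k (T →ₗ[k] T) i) (u : OddSpace V) (x : T) :
    bracket P ω (f, d, 0) (0, 0, u ⊗ₜ[k] x) =
      (0, 0, f u ⊗ₜ[k] x + sgn k i • u ⊗ₜ[k] d x) := by
  simp [bracket_apply, actLeft_tmul, actRight_tmul hd (mem_part_odd (k := k) u)]

theorem bracket_tmul_op {i j : ZMod 2} {f : OddSpace V →ₗ[k] OddSpace V} {d : T →ₗ[k] T}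
    (hf : f ∈ part k (OddSpace V →ₗ[k] OddSpace V) i) (hd : d ∈ part k (T →ₗ[k] T) i)
    (u : OddSpace V) {x : T} (hx : x ∈ part k T (j + 1)) :
    bracket P ω (0, 0, u ⊗ₜ[k] x) (f, d, 0) =
      (0, 0, -(sgn k (j * i) • (f u ⊗ₜ[k] x + sgn k i • u ⊗ₜ[k] d x))) := by
  have hw := odd_tmul_mem (k := k) u hx
  simp only [bracket_apply, sflip_apply _ hf hw, sflip_apply _ hd hw, actLeft_tmul,
    actRight_tmul hd (mem_part_odd (k := k) u)]
  refine Prod.ext (by simp) (Prod.ext (by simp) ?_)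
  simp [mul_comm i j]
  abel

theorem bracket_tmul_tmul {i : ZMod 2} (u v : OddSpace V) {x : T} (hx : x ∈ part k T i) (y : T) :
    bracket P ω (0, 0, u ⊗ₜ[k] x) (0, 0, v ⊗ₜ[k] y) =
      (-(sgn k i • P.form x y • ω.gamma u v), sgn k i • ω.form u v • P.d x y, 0) := by
  simp [bracket_apply, tensorGamma_tmul ω hx, tensorD_tmul ω hx]

/-- Homogeneous generators of `𝔤(T, 𝔰)`. -/
def generators (s : Submodule k (T →ₗ[k] T)) (i : ZMod 2) : Set (Ambient k V T) :=
  {X | (∃ f ∈ ω.sp ⊓ part k (OddSpace V →ₗ[k] OddSpace V) i, ∃ d ∈ s ⊓ part k (T →ₗ[k] T) i,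
    X = (f, d, 0)) ∨ ∃ u : OddSpace V, ∃ x ∈ part k T (i + 1), X = (0, 0, u ⊗ₜ[k] x)}

variable {s : Submodule k (T →ₗ[k] T)}

/-- The generators keep 𝔰𝔭(V) ⊕ 𝔰 whole and split only V ⊗ T into pure tensors; the shift i + 1
accounts for the odd parity of V. -/
theorem g_part_eq_span (i : ZMod 2) :
    g ω s ⊓ part k (Ambient k V T) i = Submodule.span k (generators ω s i) := by
  refine le_antisymm ?_ (Submodule.span_le.2 ?_)
  · rintro ⟨f, d, w⟩ ⟨⟨hf, hd, -⟩, hX⟩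
    rw [SetLike.mem_coe, mem_part_prod, mem_part_prod] at hX
    have e : ((f, d, w) : Ambient k V T) = (f, d, 0) + (0, 0, w) := by simp
    rw [e]
    refine add_mem (Submodule.subset_span (Or.inl ⟨f, ⟨hf, hX.1⟩, d, ⟨hd, hX.2.1⟩, rfl⟩)) ?_
    have h := Submodule.mem_map_of_mem (f := (LinearMap.inr k (OddSpace V →ₗ[k] OddSpace V)
      ((T →ₗ[k] T) × (OddSpace V ⊗[k] T))).comp (LinearMap.inr k (T →ₗ[k] T) (OddSpace V ⊗[k] T)))
      (odd_tensor_part_le_span i hX.2.2)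
    rw [Submodule.map_span] at h
    refine Submodule.span_mono ?_ h
    rintro _ ⟨_, ⟨v, x, hx, rfl⟩, rfl⟩
    exact Or.inr ⟨v, x, hx, rfl⟩
  · rintro _ (⟨f, hf, d, hd, rfl⟩ | ⟨u, x, hx, rfl⟩)
    · exact ⟨⟨hf.1, hd.1, trivial⟩, mem_part_prod.2 ⟨hf.2, mem_part_prod.2 ⟨hd.2, zero_mem _⟩⟩⟩
    · exact ⟨⟨zero_mem _, zero_mem _, trivial⟩, mem_part_prod.2 ⟨zero_mem _, mem_part_prod.2
        ⟨zero_mem _, odd_tmul_mem u hx⟩⟩⟩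

theorem tensorGamma_mem_sp (w w' : OddSpace V ⊗[k] T) : tensorGamma P ω w w' ∈ ω.sp := by
  induction w using TensorProduct.induction_on with
  | zero => simp
  | add x y hx hy => simpa using add_mem hx hy
  | tmul u x =>
  induction w' using TensorProduct.induction_on with
  | zero => simp
  | add x y hx hy => simpa using add_mem hx hy
  | tmul v y =>
  rw [← pr_add (k := k) x, TensorProduct.tmul_add, map_add, LinearMap.add_apply,
    tensorGamma_tmul ω (pr_mem 0 x), tensorGamma_tmul ω (pr_mem 1 x)]
  exact add_mem (Submodule.smul_mem _ _ (Submodule.smul_mem _ _ (ω.gamma_mem_sp u v)))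
    (Submodule.smul_mem _ _ (Submodule.smul_mem _ _ (ω.gamma_mem_sp u v)))

theorem tensorD_mem (hs : ∀ x y, P.d x y ∈ s) (w w' : OddSpace V ⊗[k] T) :
    tensorD P ω w w' ∈ s := by
  induction w using TensorProduct.induction_on with
  | zero => simp
  | add x y hx hy => simpa using add_mem hx hy
  | tmul u x =>
  induction w' using TensorProduct.induction_on with
  | zero => simp
  | add x y hx hy => simpa using add_mem hx hy
  | tmul v y =>
  rw [← pr_add (k := k) x, TensorProduct.tmul_add, map_add, LinearMap.add_apply,
    tensorD_tmul ω (pr_mem 0 x), tensorD_tmul ω (pr_mem 1 x)]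
  exact add_mem (Submodule.smul_mem _ _ (Submodule.smul_mem _ _ (hs _ _)))
    (Submodule.smul_mem _ _ (Submodule.smul_mem _ _ (hs _ _)))

theorem pr_mem_sp (i : ZMod 2) {f : OddSpace V →ₗ[k] OddSpace V} (hf : f ∈ ω.sp) :
    pr k i f ∈ ω.sp := by
  rw [pr_of_mem (hom_odd_mem f)]
  split_ifs
  exacts [hf, zero_mem _]

theorem bracket_mem_part (hP : P.IsOrthosymplectic) {i j : ZMod 2} {X Y : Ambient k V T}
    (hX : X ∈ g ω s ⊓ part k (Ambient k V T) i) (hY : Y ∈ g ω s ⊓ part k (Ambient k V T) j) :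
    bracket P ω X Y ∈ part k (Ambient k V T) (i + j) := by
  rw [g_part_eq_span] at hX hY
  induction hX, hY using Submodule.span_induction₂ with
  | zero_left => simp
  | zero_right => simp
  | add_left x y z _ _ _ h h' => simpa using add_mem h h'
  | add_right x y z _ _ _ h h' => simpa using add_mem h h'
  | smul_left c x y _ _ h => simpa using Submodule.smul_mem _ c h
  | smul_right c x y _ _ h => simpa using Submodule.smul_mem _ c h
  | mem_mem X Y hX hY =>
  rcases hX with ⟨f, hf, d, hd, rfl⟩ | ⟨u, x, hx, rfl⟩ <;>
    rcases hY with ⟨f', hf', d', hd', rfl⟩ | ⟨v, y, hy, rfl⟩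
  · rw [bracket_op_op]
    exact mem_part_prod.2 ⟨superComm_mem hf.2 hf'.2, mem_part_prod.2
      ⟨superComm_mem hd.2 hd'.2, zero_mem _⟩⟩
  · rw [bracket_op_tmul ω f hd.2]
    refine mem_part_prod.2 ⟨zero_mem _, mem_part_prod.2 ⟨zero_mem _, ?_⟩⟩
    refine add_mem (actLeft_mem hf.2 (odd_tmul_mem v hy)) ?_
    have := actRight_mem hd.2 (odd_tmul_mem v hy)
    rwa [actRight_tmul hd.2 (mem_part_odd (k := k) v), mul_one] at this
  · rw [bracket_tmul_op ω hf'.2 hd'.2 u hx, add_comm i j]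
    refine mem_part_prod.2 ⟨zero_mem _, mem_part_prod.2 ⟨zero_mem _, neg_mem
      (Submodule.smul_mem _ _ ?_)⟩⟩
    refine add_mem (actLeft_mem hf'.2 (odd_tmul_mem u hx)) ?_
    have := actRight_mem hd'.2 (odd_tmul_mem u hx)
    rwa [actRight_tmul hd'.2 (mem_part_odd (k := k) u), mul_one] at this
  · rw [bracket_tmul_tmul ω u v hx]
    refine mem_part_prod.2 ⟨neg_mem (Submodule.smul_mem _ _ ?_), mem_part_prod.2
      ⟨Submodule.smul_mem _ _ (Submodule.smul_mem _ _ ?_), zero_mem _⟩⟩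
    -- The γ component is an even endomorphism of V, so it has the right parity only because (x|y)
    -- vanishes when the parities differ.
    · by_cases hij : i = j
      · subst hij
        rw [(by decide : ∀ i : ZMod 2, i + i = 0) i]
        exact hom_odd_mem _
      · rw [hP.form_even _ _ (fun h => hij (add_right_cancel h)) x hx y hy, zero_smul]
        exact zero_mem _
    · have := hP.d_mem_part hx hy
      rwa [(by decide : ∀ i j : ZMod 2, i + 1 + (j + 1) = i + j) i j] at this

theorem bracket_skew (hP : P.IsOrthosymplectic) {i j : ZMod 2} {X Y : Ambient k V T}
    (hX : X ∈ generators ω s i) (hY : Y ∈ generators ω s j) :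
    bracket P ω X Y = -(sgn k (i * j) • bracket P ω Y X) := by
  rcases hX with ⟨f, hf, d, hd, rfl⟩ | ⟨u, x, hx, rfl⟩ <;>
    rcases hY with ⟨f', hf', d', hd', rfl⟩ | ⟨v, y, hy, rfl⟩
  · rw [bracket_op_op, bracket_op_op, superComm_skew hf.2 hf'.2, superComm_skew hd.2 hd'.2]
    simp
  · rw [bracket_op_tmul ω f hd.2, bracket_tmul_op ω hf.2 hd.2 v hy, mul_comm j i]
    rcases parity_cases i with rfl | rfl <;> rcases parity_cases j with rfl | rfl <;>
      simp [add_comm]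
  · rw [bracket_op_tmul ω f' hd'.2, bracket_tmul_op ω hf'.2 hd'.2 u hx]
    rcases parity_cases i with rfl | rfl <;> rcases parity_cases j with rfl | rfl <;>
      simp [add_comm]
  · have hd : P.d x y = -(sgn k ((i + 1) * (j + 1)) • P.d y x) :=
      LinearMap.ext fun z => eq_neg_of_add_eq_zero_left (hP.skew _ _ x hx y hy z)
    rw [bracket_tmul_tmul ω u v hx, bracket_tmul_tmul ω v u hy, ω.gamma_comm v u, ω.neg v u, hd,
      hP.form_supersymm hx hy]
    by_cases hij : i = j
    · subst hij
      rcases parity_cases i with rfl | rfl <;> simp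
    · rw [hP.form_even _ _ (fun h => hij (add_right_cancel h).symm) y hy x hx]
      rcases parity_cases i with rfl | rfl <;> rcases parity_cases j with rfl | rfl <;> simp

end SuperTriple

end Supersquare
end

/-! ### The Jacobi identity for 𝔤(T, 𝔰). -/

noncomputable section

namespace Supersquare

namespace SuperTriple

variable {k : Type*} [Field k] {T : Type*} [AddCommGroup T] [Module k T] [Superspace k T]
variable {V : Type*} [AddCommGroup V] [Module k V] (ω : SymplecticPlane k V)
variable {P : SuperTriple k T} {s : Submodule k (T →ₗ[k] T)}

theorem jacobi_op_op_op {i j l : ZMod 2} {f f' f'' : OddSpace V →ₗ[k] OddSpace V}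
    {d d' d'' : T →ₗ[k] T} (hf : f ∈ part k (OddSpace V →ₗ[k] OddSpace V) i)
    (hf' : f' ∈ part k (OddSpace V →ₗ[k] OddSpace V) j)
    (hf'' : f'' ∈ part k (OddSpace V →ₗ[k] OddSpace V) l)
    (hd : d ∈ part k (T →ₗ[k] T) i) (hd' : d' ∈ part k (T →ₗ[k] T) j)
    (hd'' : d'' ∈ part k (T →ₗ[k] T) l) :
    Jacobi (bracket P ω) i j (f, d, 0) (f', d', 0) (f'', d'', 0) := by
  simp only [Jacobi, bracket_op_op]
  rw [superComm_jacobi hf hf' hf'', superComm_jacobi hd hd' hd'']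
  simp

theorem jacobi_op_op_tmul {i j : ZMod 2} {f f' : OddSpace V →ₗ[k] OddSpace V}
    {d d' : T →ₗ[k] T} (hf : f ∈ part k (OddSpace V →ₗ[k] OddSpace V) i)
    (hf' : f' ∈ part k (OddSpace V →ₗ[k] OddSpace V) j)
    (hd : d ∈ part k (T →ₗ[k] T) i) (hd' : d' ∈ part k (T →ₗ[k] T) j)
    (u : OddSpace V) (x : T) :
    Jacobi (bracket P ω) i j (f, d, 0) (f', d', 0) (0, 0, u ⊗ₜ[k] x) := by
  have hadd : ∀ w w' : OddSpace V ⊗[k] T, ((0, 0, w + w') : Ambient k V T) =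
    (0, 0, w) + (0, 0, w') := fun w w' => by simp
  have hsmul : ∀ (c : k) (w : OddSpace V ⊗[k] T), ((0, 0, c • w) : Ambient k V T) =
    c • (0, 0, w) := fun c w => by simp
  simp only [Jacobi, bracket_op_op, bracket_op_tmul ω _ hd, bracket_op_tmul ω _ hd',
    bracket_op_tmul ω _ (superComm_mem hd hd'), hadd, hsmul, map_add, map_smul, superComm_odd,
    superComm_apply hd hd', TensorProduct.sub_tmul, TensorProduct.tmul_sub,
    TensorProduct.tmul_smul]
  simp only [← hadd, ← hsmul]
  refine Prod.ext (by simp) (Prod.ext (by simp) ?_)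
  rcases parity_cases i with rfl | rfl
  · rcases parity_cases j with rfl | rfl
    · simp; abel
    · rw [hom_odd_eq_zero one_ne_zero hf']; simp; abel
  · rw [hom_odd_eq_zero one_ne_zero hf]
    rcases parity_cases j with rfl | rfl
    · simp; abel
    · rw [hom_odd_eq_zero one_ne_zero hf']; simp

/-- In the 𝔰𝔭(V) component, γ is equivariant under f and the terms with d cancel by invariance of
the form on T. In the 𝔰 component the roles are reversed: the derivation rule handles d, and
invariance of ⟨·|·⟩ cancels f. -/
theorem jacobi_op_tmul_tmul (hP : P.IsOrthosymplectic)
    {i j l : ZMod 2} {f : OddSpace V →ₗ[k] OddSpace V}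
    {d : T →ₗ[k] T} (hf : f ∈ part k (OddSpace V →ₗ[k] OddSpace V) i) (hfsp : f ∈ ω.sp)
    (hd : d ∈ part k (T →ₗ[k] T) i) (hder : d ∈ P.der)
    (hform : ∀ j, ∀ x ∈ part k T j, ∀ y, P.form (d x) y + sgn k (i * j) * P.form x (d y) = 0)
    (u v : OddSpace V) {x y : T} (hx : x ∈ part k T (j + 1)) (hy : y ∈ part k T (l + 1)) :
    Jacobi (bracket P ω) i j (f, d, 0) (0, 0, u ⊗ₜ[k] x) (0, 0, v ⊗ₜ[k] y) := by
  have hadd : ∀ w w' : OddSpace V ⊗[k] T, ((0, 0, w + w') : Ambient k V T) =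
    (0, 0, w) + (0, 0, w') := fun w w' => by simp
  have hsmul : ∀ (c : k) (w : OddSpace V ⊗[k] T), ((0, 0, c • w) : Ambient k V T) =
    c • (0, 0, w) := fun c w => by simp
  have hD := fun z => (mem_der hd).1 hder _ _ x hx y hy z
  have hF := hform _ x hx y
  have hdx := hom_apply_mem hd hx
  have hsp : ω.form (f u) v + ω.form u (f v) = 0 := hfsp u v
  simp only [Jacobi, bracket_tmul_tmul ω u v hx, bracket_op_op, bracket_op_tmul ω _ hd,
    hadd, hsmul, map_add, map_smul, LinearMap.add_apply, LinearMap.smul_apply,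
    bracket_tmul_tmul ω _ v hx, bracket_tmul_tmul ω u _ hx, bracket_tmul_tmul ω _ v hdx,
    map_neg, ω.superComm_gamma hfsp]
  have hD' : superComm d (P.d x y) = P.d (d x) y + sgn k (i * (j + 1)) • P.d x (d y) :=
    LinearMap.ext fun z => by
      rw [superComm_apply hd (hP.d_mem_part hx hy), hD]
      simp
  rw [hD']
  refine Prod.ext ?_ (Prod.ext ?_ ?_)
  · simp only [Prod.fst_add, Prod.smul_fst]
    rcases parity_cases i with rfl | rfl
    · simp at hF ⊢
      linear_combination (norm := module) (sgn k (j + 1) * hF) • ω.gamma u v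
    · rw [hom_odd_eq_zero one_ne_zero hf]
      rcases parity_cases j with rfl | rfl <;> simp at hF ⊢ <;>
      first
      | linear_combination (norm := module) hF • ω.gamma u v
      | linear_combination (norm := module) (-hF) • ω.gamma u v
  · simp only [Prod.snd_add, Prod.smul_snd, Prod.fst_add, Prod.smul_fst]
    rcases parity_cases i with rfl | rfl
    · simp at hsp ⊢
      linear_combination (norm := module) (-sgn k (j + 1) * hsp) • P.d x y
    · rw [hom_odd_eq_zero one_ne_zero hf]
      rcases parity_cases j with rfl | rfl <;> simp
  · simp

/-- All terms lie in V ⊗ T and collect as ⟨v|w⟩ u ⊗ a + ⟨w|u⟩ v ⊗ b + ⟨u|v⟩ w ⊗ c with a, b, c in T.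
The symmetry axiom and the skewness of the triple product give a = b = c, and the cyclic identity of
the plane finishes. -/
theorem jacobi_tmul_tmul_tmul [CharP k 3] (hP : P.IsOrthosymplectic) {p q r : ZMod 2}
    (u v w : OddSpace V) {x y z : T} (hx : x ∈ part k T p) (hy : y ∈ part k T q)
    (hz : z ∈ part k T r) :
    Jacobi (bracket P ω) (p + 1) (q + 1) (0, 0, u ⊗ₜ[k] x) (0, 0, v ⊗ₜ[k] y)
      (0, 0, w ⊗ₜ[k] z) := by
  have h3 := three_eq_zero_of_char k
  have hx' : x ∈ part k T (p + 1 + 1) := by rwa [add_assoc, one_add_one, add_zero]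
  have hy' : y ∈ part k T (q + 1 + 1) := by rwa [add_assoc, one_add_one, add_zero]
  have hop : ∀ {p q : ZMod 2} (u v : OddSpace V) {x y : T}, x ∈ part k T p → y ∈ part k T q →
      (-(sgn k p • P.form x y • ω.gamma u v)) ∈ part k (OddSpace V →ₗ[k] OddSpace V) (p + q) := by
    intro p q u v x y hx hy
    by_cases hpq : p = q
    · subst hpq
      rw [(by decide : ∀ i : ZMod 2, i + i = 0) p]
      exact hom_odd_mem _
    · rw [hP.form_even _ _ hpq x hx y hy, zero_smul, smul_zero, neg_zero]
      exact zero_mem _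
  have hd : ∀ {p q : ZMod 2} (u v : OddSpace V) {x y : T}, x ∈ part k T p → y ∈ part k T q →
      sgn k p • ω.form u v • P.d x y ∈ part k (T →ₗ[k] T) (p + q) := fun u v _ _ hx hy =>
    Submodule.smul_mem _ _ (Submodule.smul_mem _ _ (hP.d_mem_part hx hy))
  simp only [Jacobi, bracket_tmul_tmul ω _ _ hx, bracket_tmul_tmul ω _ _ hy,
    bracket_tmul_op ω (hop v w hy hz) (hd v w hy hz) u hx',
    bracket_tmul_op ω (hop u w hx hz) (hd u w hx hz) v hy',
    bracket_op_tmul ω _ (hd u v hx hy)]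
  refine Prod.ext (by simp) (Prod.ext (by simp) ?_)
  simp only [LinearMap.neg_apply, LinearMap.smul_apply, SymplecticPlane.gamma_apply,
    TensorProduct.neg_tmul, TensorProduct.tmul_smul, Prod.snd_add, Prod.smul_snd,
    TensorProduct.add_tmul, ← TensorProduct.smul_tmul']
  have s1 := hP.symm q r x y hy z hz
  have s3 := hP.symm p q z x hx y hy
  have k2 := eq_neg_of_add_eq_zero_left (hP.skew r p z hz x hx y)
  have k3 := eq_neg_of_add_eq_zero_left (hP.skew r q z hz y hy x)
  -- Recording that the form vanishes on elements of different parity as an equation lets each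
  -- parity case below substitute 0 for the corresponding scalar.
  have hF : ∀ {p q : ZMod 2} {x y : T}, x ∈ part k T p → y ∈ part k T q →
      P.form x y = if p = q then P.form x y else 0 := by
    intro p q x y hx hy
    split_ifs with h
    exacts [rfl, hP.form_even _ _ h x hx y hy]
  rw [k2, k3, hP.form_supersymm hz hx, hP.form_supersymm hz hy] at s3
  rw [ω.neg v u, ω.neg w v, ω.neg u w]
  have f1 := hF hx hy
  have f2 := hF hx hz
  have f3 := hF hy hz
  generalize P.form x y = c1 at *
  generalize P.form x z = c2 at *
  generalize P.form y z = c3 at *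
  -- `A0` is the total sign of [x,[y,z]], and `C0` that of [y,[x,z]] including the prefactor of the
  -- Jacobi identity.
  set A0 : k := -(sgn k ((p + 1) * (q + r)) * sgn k q) with hA
  set C0 : k := -(sgn k ((p + 1) * (q + 1) + (q + 1) * (p + r)) * sgn k p) with hC
  have main := ω.cyclic_tmul u v w
    (x := (A0 * sgn k (q + r)) • P.d y z x + (sgn k p * c1) • z - (C0 * c2) • y)
    (y := -(A0 * c3) • x - (sgn k p * c1) • z + (C0 * sgn k (p + r)) • P.d x z y)
    (z := (A0 * c3) • x - (sgn k p * sgn k (p + q)) • P.d x y z + (C0 * c2) • y)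
    (by
      rw [hA, hC]
      clear hA hC
      rcases parity_cases p with rfl | rfl <;> rcases parity_cases q with rfl | rfl <;>
        rcases parity_cases r with rfl | rfl <;> simp at s3 f1 f2 f3 ⊢ <;>
        (try subst f1) <;> (try subst f2) <;> (try subst f3) <;>
        first
        | linear_combination (norm := module) s3
        | linear_combination (norm := module) -s3)
    (by
      rw [hA, hC]
      clear hA hC
      rcases parity_cases p with rfl | rfl <;> rcases parity_cases q with rfl | rfl <;>
        rcases parity_cases r with rfl | rfl <;> simp at s1 f1 f2 f3 ⊢ <;>
        (try subst f1) <;> (try subst f2) <;> (try subst f3) <;>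
        first
        | linear_combination (norm := module) s1
        | linear_combination (norm := module) -s1)
  simp only [TensorProduct.tmul_add, TensorProduct.tmul_sub, TensorProduct.tmul_smul] at main
  rw [hA, hC] at main
  clear hA hC s1 s3 k2 k3
  rcases parity_cases p with rfl | rfl <;> rcases parity_cases q with rfl | rfl <;>
    rcases parity_cases r with rfl | rfl <;> simp at f1 f2 f3 main ⊢ <;>
    (try subst f1) <;> (try subst f2) <;> (try subst f3) <;>
    linear_combination (norm := module) main

theorem generators_subset {i : ZMod 2} {X : Ambient k V T} (hX : X ∈ generators ω s i) :
    X ∈ g ω s ⊓ part k (Ambient k V T) i := by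
  rw [g_part_eq_span]; exact Submodule.subset_span hX

theorem bracket_mem (hs : P.IsAdmissible s) {X Y : Ambient k V T} (hX : X ∈ g ω s)
    (hY : Y ∈ g ω s) : bracket P ω X Y ∈ g ω s :=
  ⟨sub_mem (ω.superComm_mem_sp hX.1 hY.1) (tensorGamma_mem_sp ω _ _),
    add_mem (hs.closed _ hX.2.1 _ hY.2.1) (tensorD_mem ω hs.inder_le _ _), trivial⟩

/-- `𝔤(T, 𝔰)` is a Lie superalgebra if the elements of `𝔰` are skew relative to the form. -/
theorem isLieSuperalgebra_g [CharP k 3] (hP : P.IsOrthosymplectic) (hs : P.IsAdmissible s)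
    (hform : ∀ i j, ∀ d ∈ s ⊓ part k (T →ₗ[k] T) i, ∀ x ∈ part k T j, ∀ y,
      P.form (d x) y + sgn k (i * j) * P.form x (d y) = 0) :
    IsLieSuperalgebra (bracket P ω) (g ω s) := by
  refine IsLieSuperalgebra.of_generators (G := generators ω s) (g_part_eq_span ω)
    (fun i X hX => ⟨pr_mem_sp ω i hX.1, hs.graded i _ hX.2.1, trivial⟩)
    (fun X hX Y hY => bracket_mem ω hs hX hY) (fun i j X hX Y hY => bracket_mem_part ω hP hX hY)
    (fun i j X hX Y hY => bracket_skew ω hP hX hY) ?_ ?_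
  · intro hskew
    have hbr : ∀ {i j} {X Y : Ambient k V T}, X ∈ g ω s ⊓ part k (Ambient k V T) i →
        Y ∈ g ω s ⊓ part k (Ambient k V T) j →
        bracket P ω X Y ∈ g ω s ⊓ part k (Ambient k V T) (i + j) := fun hX hY =>
      ⟨bracket_mem ω hs hX.1 hY.1, bracket_mem_part ω hP hX hY⟩
    have hl : ∀ {i j} {X Y Z : Ambient k V T}, X ∈ g ω s ⊓ part k (Ambient k V T) i →
        Y ∈ g ω s ⊓ part k (Ambient k V T) j → Jacobi (bracket P ω) i j X Y Z →
        Jacobi (bracket P ω) j i Y X Z := fun hX hY h => h.swap_left (hskew _ _ _ hX _ hY)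
    have hr : ∀ {i j l} {X Y Z : Ambient k V T}, X ∈ g ω s ⊓ part k (Ambient k V T) i →
        Y ∈ g ω s ⊓ part k (Ambient k V T) j → Z ∈ g ω s ⊓ part k (Ambient k V T) l →
        Jacobi (bracket P ω) i j X Y Z → Jacobi (bracket P ω) i l X Z Y := fun hX hY hZ h =>
      h.swap_right (hskew _ _ _ hY _ hZ) (hskew _ _ _ (hbr hX hY) _ hZ)
        (hskew _ _ _ (hbr hX hZ) _ hY)
    intro i j l X hX Y hY Z hZ
    have hX' := generators_subset ω hX
    have hY' := generators_subset ω hY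
    have hZ' := generators_subset ω hZ
    rcases hX with ⟨f, hf, d, hd, rfl⟩ | ⟨u, x, hx, rfl⟩ <;>
      rcases hY with ⟨f', hf', d', hd', rfl⟩ | ⟨v, y, hy, rfl⟩ <;>
      rcases hZ with ⟨f'', hf'', d'', hd'', rfl⟩ | ⟨w, z, hz, rfl⟩
    · exact jacobi_op_op_op ω hf.2 hf'.2 hf''.2 hd.2 hd'.2 hd''.2
    · exact jacobi_op_op_tmul ω hf.2 hf'.2 hd.2 hd'.2 w z
    · exact hr hX' hZ' hY' (jacobi_op_op_tmul ω hf.2 hf''.2 hd.2 hd''.2 v y)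
    · exact jacobi_op_tmul_tmul ω hP hf.2 hf.1 hd.2 (hs.le_der hd.1)
        (fun m => hform i m d hd) v w hy hz
    · exact hl hY' hX' (hr hY' hZ' hX' (jacobi_op_op_tmul ω hf'.2 hf''.2 hd'.2 hd''.2 u x))
    · exact hl hY' hX' (jacobi_op_tmul_tmul ω hP hf'.2 hf'.1 hd'.2 (hs.le_der hd'.1)
        (fun m => hform j m d' hd') u w hx hz)
    · exact hr hX' hZ' hY' (hl hZ' hX' (jacobi_op_tmul_tmul ω hP hf''.2 hf''.1 hd''.2
        (hs.le_der hd''.1) (fun m => hform l m d'' hd'') u v hx hy))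
    · have := jacobi_tmul_tmul_tmul ω hP u v w hx hy hz
      rwa [(by decide : ∀ i : ZMod 2, i + 1 + 1 = i) i,
        (by decide : ∀ i : ZMod 2, i + 1 + 1 = i) j] at this
  · rintro _ (⟨f, hf, d, hd, rfl⟩ | ⟨u, x, hx, rfl⟩)
    · rw [bracket_op_op, bracket_op_op, superComm_cube hf.2, superComm_cube hd.2]; rfl
    -- Here [u ⊗ x, u ⊗ x] is a multiple of γ_{u,u}, because ⟨u|u⟩ = 0, and γ_{u,u}(u) = 2⟨u|u⟩u =
    -- 0.
    · have h0 : (0 : T →ₗ[k] T) ∈ part k (T →ₗ[k] T) 0 := zero_mem _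
      rw [bracket_tmul_tmul ω u u hx, ω.alt, zero_smul, smul_zero,
        bracket_tmul_op ω (hom_odd_mem _) h0 u hx, LinearMap.neg_apply, LinearMap.smul_apply,
        LinearMap.smul_apply, ω.gamma_apply, ω.alt]
      simp

theorem isZ2GradedLieSuperalgebra_g [CharP k 3] (hP : P.IsOrthosymplectic)
    (hs : P.IsAdmissible s)
    (hform : ∀ i j, ∀ d ∈ s ⊓ part k (T →ₗ[k] T) i, ∀ x ∈ part k T j, ∀ y,
      P.form (d x) y + sgn k (i * j) * P.form x (d y) = 0) :
    IsZ2GradedLieSuperalgebra (bracket P ω) (g ω s) (gZero ω s) (gOne k V T) where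
  toIsLieSuperalgebra := isLieSuperalgebra_g ω hP hs hform
  sup_eq := by
    refine le_antisymm (sup_le (fun X hX => ⟨hX.1, hX.2.1, trivial⟩) ?_) ?_
    · rintro ⟨f, d, w⟩ ⟨hf, hd, -⟩
      obtain rfl : f = 0 := hf
      obtain rfl : d = 0 := hd
      exact ⟨zero_mem _, zero_mem _, trivial⟩
    · rintro ⟨f, d, w⟩ ⟨hf, hd, -⟩
      have e : ((f, d, w) : Ambient k V T) = (f, d, 0) + (0, 0, w) := by simp
      rw [e]
      exact Submodule.add_mem_sup ⟨hf, hd, rfl⟩ ⟨rfl, rfl, trivial⟩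
  disjoint := by
    rw [Submodule.disjoint_def]
    rintro X ⟨-, -, hw⟩ ⟨hf, hd, -⟩
    exact Prod.ext hf (Prod.ext hd hw)
  graded_zero i X hX := by
    refine ⟨pr_mem_sp ω i hX.1, hs.graded i _ hX.2.1, ?_⟩
    have : X.2.2 = 0 := hX.2.2
    change pr k i X.2.2 = 0
    rw [this, map_zero]
  graded_one i X hX := by
    have hf : X.1 = 0 := hX.1
    have hd : X.2.1 = 0 := hX.2.1
    refine ⟨?_, ?_, trivial⟩
    · change pr k i X.1 = 0
      rw [hf, map_zero]
    · change pr k i X.2.1 = 0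
      rw [hd, map_zero]
  zero_zero X hX Y hY := by
    have hX0 : X.2.2 = 0 := hX.2.2
    have hY0 : Y.2.2 = 0 := hY.2.2
    have h := bracket_mem (s := s) ω hs (X := X) (Y := Y) ⟨hX.1, hX.2.1, trivial⟩
      ⟨hY.1, hY.2.1, trivial⟩
    refine ⟨h.1, h.2.1, ?_⟩
    change (bracket P ω X Y).2.2 = 0
    simp [bracket_apply, hX0, hY0]
  zero_one X hX Y hY := by
    have hX0 : X.2.2 = 0 := hX.2.2
    have hY0 : Y.1 = 0 := hY.1
    have hY1 : Y.2.1 = 0 := hY.2.1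
    refine ⟨?_, ?_, trivial⟩
    · change (bracket P ω X Y).1 = 0
      simp [bracket_apply, hX0, hY0]
    · change (bracket P ω X Y).2.1 = 0
      simp [bracket_apply, hX0, hY1]
  one_one X hX Y hY := by
    have hX0 : X.1 = 0 := hX.1
    have hX1 : X.2.1 = 0 := hX.2.1
    have hY0 : Y.1 = 0 := hY.1
    have hY1 : Y.2.1 = 0 := hY.2.1
    have h := bracket_mem (s := s) ω hs (X := X) (Y := Y)
      ⟨hX0 ▸ zero_mem _, hX1 ▸ zero_mem _, trivial⟩ ⟨hY0 ▸ zero_mem _, hY1 ▸ zero_mem _, trivial⟩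
    refine ⟨h.1, h.2.1, ?_⟩
    change (bracket P ω X Y).2.2 = 0
    simp [bracket_apply, hX0, hY0, hX1, hY1]

end SuperTriple

end Supersquare
end

/-! ### Commutation relations of 𝔡𝔢𝔯 J = 𝔱𝔯𝔦(S) ⊕ S³ acting on J₀/k1. -/

noncomputable section

namespace Supersquare

namespace SuperTriple

variable {k : Type*} [Field k] {T : Type*} [AddCommGroup T] [Module k T] [Superspace k T]
variable {P : SuperTriple k T}

theorem IsOrthosymplectic.superComm_d (hP : P.IsOrthosymplectic) {i j l : ZMod 2} {d : T →ₗ[k] T}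
    (hd : d ∈ part k (T →ₗ[k] T) i) (hder : d ∈ P.der) {x y : T} (hx : x ∈ part k T j)
    (hy : y ∈ part k T l) :
    superComm d (P.d x y) = P.d (d x) y + sgn k (i * j) • P.d x (d y) :=
  LinearMap.ext fun z => by
    rw [superComm_apply hd (hP.d_mem_part hx hy), (mem_der hd).1 hder j l x hx y hy z]
    simp

end SuperTriple

namespace HurwitzSuperalgebra

variable {k : Type*} [Field k] [CharP k 3] {A : Type*} [AddCommGroup A] [Module k A]
  [Superspace k A]
variable (C : HurwitzSuperalgebra k A)

/-- The action of a triple of linear maps on `J₀/k1 = kε ⊕ ⨁ ι_n(S)`. -/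
def opD : (Fin 3 → (A →ₗ[k] A)) →ₗ[k] (C.TJ →ₗ[k] C.TJ) := C.opT ∘ₗ LinearMap.inl k _ _

/-- The operators `-[ε, ι_n(a), ·]` on `J₀/k1`. -/
def opN (n : Fin 3) : A →ₗ[k] (C.TJ →ₗ[k] C.TJ) :=
  C.opT ∘ₗ LinearMap.inr k _ _ ∘ₗ LinearMap.single k (fun _ => A) n

theorem opD_apply (d) : C.opD d = C.opT (d, 0) := rfl

theorem opN_apply (n : Fin 3) (a : A) : C.opN n a = C.opT (0, Pi.single n a) := rfl

theorem opD_mem {i : ZMod 2} {d : Fin 3 → (A →ₗ[k] A)} (hd : ∀ n, d n ∈ part k (A →ₗ[k] A) i) :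
    C.opD d ∈ part k (C.TJ →ₗ[k] C.TJ) i := C.opT_mem hd fun _ => zero_mem _

theorem opN_mem {i : ZMod 2} {a : A} (ha : a ∈ part k A i) (n : Fin 3) :
    C.opN n a ∈ part k (C.TJ →ₗ[k] C.TJ) i := by
  refine C.opT_mem (fun _ => zero_mem _) fun m => ?_
  by_cases h : m = n
  · subst h; simpa using ha
  · simp [h]

theorem opD_mem_derTJ {d : Fin 3 → (A →ₗ[k] A)} (hd : d ∈ C.paraHurwitz.tri) :
    C.opD d ∈ C.derTJ := C.mem_derTJ_iff.2 ⟨(d, 0), hd, rfl⟩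

theorem opN_mem_derTJ (n : Fin 3) (a : A) : C.opN n a ∈ C.derTJ :=
  C.mem_derTJ_iff.2 ⟨(0, Pi.single n a), zero_mem _, rfl⟩

theorem opD_epsT (d) : C.opD d C.epsT = 0 := by
  refine C.TJ_ext ?_ fun n => ?_
  · simp [opD_apply, cT_opT]
  · simp [opD_apply, coT_opT, coT_epsT]

theorem opD_ioT (d) (n : Fin 3) (a : A) : C.opD d (C.ioT n a) = C.ioT n (d n a) := by
  refine C.TJ_ext ?_ fun m => ?_
  · simp [opD_apply, cT_opT, cT_ioT]
  · by_cases h : m = n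
    · subst h; simp [opD_apply, coT_opT, coT_ioT]
    · simp [opD_apply, coT_opT, coT_ioT, h]

theorem opN_epsT (n : Fin 3) (a : A) : C.opN n a C.epsT = C.ioT n a := by
  refine C.TJ_ext ?_ fun m => ?_
  · simp [opN_apply, cT_opT, cT_ioT, coT_epsT]
  · simp [opN_apply, coT_opT, coT_ioT, cT_epsT, coT_epsT, Pi.single_apply]

theorem opN_ioT_self (n : Fin 3) (a c : A) :
    C.opN n a (C.ioT n c) = C.b a c • C.epsT := by
  refine C.TJ_ext ?_ fun m => ?_
  · rw [opN_apply, cT_opT, Finset.sum_eq_single n]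
    · simp [coT_ioT, cT_epsT]
    · intro m _ hm; simp [hm]
    · simp
  · have h : ¬(m + 2 = n ∧ m + 1 = n) := by revert m n; decide
    by_cases h2 : m + 2 = n
    · have h1 : m + 1 ≠ n := fun h1 => h ⟨h2, h1⟩
      simp [opN_apply, coT_opT, coT_ioT, cT_ioT, coT_epsT, h1, Pi.single_apply]
    · simp [opN_apply, coT_opT, coT_ioT, cT_ioT, coT_epsT, h2, Pi.single_apply]

theorem opN_ioT_succ (n : Fin 3) (a c : A) :
    C.opN n a (C.ioT (n + 1) c) = -C.ioT (n + 2) (C.paraHurwitz.mul a c) := by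
  refine C.TJ_ext ?_ fun m => ?_
  · rw [opN_apply, cT_opT, Finset.sum_eq_single n]
    · simp [coT_ioT, cT_ioT]
    · intro m _ hm; simp [hm]
    · simp
  · obtain rfl | rfl | rfl := (by decide : ∀ m n : Fin 3, m = n ∨ m = n + 1 ∨ m = n + 2) m n <;>
      simp [opN_apply, coT_opT, coT_ioT, cT_ioT, fin_three_add_one_one,
        fin_three_add_one_two, fin_three_add_two_one, fin_three_add_two_two]

theorem opN_succ_ioT (n : Fin 3) (a c : A) :
    C.opN (n + 1) a (C.ioT n c) = C.ioT (n + 2) (C.paraHurwitz.r a c) := by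
  refine C.TJ_ext ?_ fun m => ?_
  · rw [opN_apply, cT_opT, Finset.sum_eq_single n]
    · simp [coT_ioT, cT_ioT]
    · intro m _ hm; simp [coT_ioT, hm]
    · simp
  · obtain rfl | rfl | rfl := (by decide : ∀ m n : Fin 3, m = n ∨ m = n + 1 ∨ m = n + 2) m n <;>
      simp [opN_apply, coT_opT, coT_ioT, cT_ioT, fin_three_add_one_one,
        fin_three_add_one_two, fin_three_add_two_one, fin_three_add_two_two]

theorem opT_ext {d d'} (h : d.1 = d'.1) (h' : d.2 = d'.2) : C.opT d = C.opT d' :=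
  congrArg C.opT (Prod.ext h h')

theorem d_epsT_ioT (n : Fin 3) (a : A) : C.tripleTJ.d C.epsT (C.ioT n a) = -C.opN n a := by
  rw [tripleTJ_d_eq, opN_apply, ← map_neg]
  refine C.opT_ext ?_ (funext fun m => ?_)
  · simp [innerParamT, coT_epsT]
  · simp [innerParamT_snd, coT_epsT, cT_epsT, cT_ioT, coT_ioT, Pi.single_apply]

theorem d_epsT_epsT : C.tripleTJ.d C.epsT C.epsT = 0 := by
  rw [tripleTJ_d_eq, ← map_zero C.opT]
  refine C.opT_ext ?_ (funext fun m => ?_)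
  · simp [innerParamT, coT_epsT]
  · simp [innerParamT_snd, coT_epsT]

theorem d_ioT_self (n : Fin 3) (a c : A) : C.tripleTJ.d (C.ioT n a) (C.ioT n c) =
    C.opD (CompositionSuperalgebra.theta k A n (C.paraHurwitz.t a c)) := by
  rw [tripleTJ_d_eq, opD_apply]
  refine C.opT_ext ?_ (funext fun m => ?_)
  · rw [innerParamT, Finset.sum_eq_single n]
    · simp [coT_ioT]
    · intro m _ hm; simp [coT_ioT, hm]
    · simp
  · have h : ¬(m + 1 = n ∧ m + 2 = n) := by revert m n; decide
    by_cases h2 : m + 2 = n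
    · have h1 : m + 1 ≠ n := fun h1 => h ⟨h1, h2⟩
      simp [innerParamT_snd, coT_ioT, cT_ioT, h1]
    · simp [innerParamT_snd, coT_ioT, cT_ioT, h2]

theorem d_ioT_succ (n : Fin 3) (a c : A) : C.tripleTJ.d (C.ioT n a) (C.ioT (n + 1) c) =
    C.opN (n + 2) (C.paraHurwitz.mul a c) := by
  rw [tripleTJ_d_eq, opN_apply]
  refine C.opT_ext ?_ (funext fun m => ?_)
  · rw [innerParamT]
    change ∑ i : Fin 3, CompositionSuperalgebra.theta k A i (C.paraHurwitz.t (C.coT i (C.ioT n a))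
      (C.coT i (C.ioT (n + 1) c))) = 0
    refine Finset.sum_eq_zero fun m _ => ?_
    have h : ¬(m = n ∧ m = n + 1) := by revert m n; decide
    by_cases h2 : m = n
    · have h1 : m ≠ n + 1 := fun h1 => h ⟨h2, h1⟩
      simp [coT_ioT, h1]
    · simp [coT_ioT, h2]
  · obtain rfl | rfl | rfl := (by decide : ∀ m n : Fin 3, m = n ∨ m = n + 1 ∨ m = n + 2) m n <;>
      simp [innerParamT_snd, coT_ioT, cT_ioT, fin_three_add_one_one,
        fin_three_add_one_two, fin_three_add_two_one, fin_three_add_two_two]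

/-- Because `opN n a` is the inner operator -[ε, ι_n(a), ·], its commutator with any superderivation
δ follows from the values of δ on ε and ι_n(a). All brackets involving the S³ part are obtained in
this way. -/
theorem superComm_opN {i j : ZMod 2} {δ : C.TJ →ₗ[k] C.TJ}
    (hδ : δ ∈ part k (C.TJ →ₗ[k] C.TJ) i) (h : δ ∈ C.derTJ) {a : A} (ha : a ∈ part k A j)
    (n : Fin 3) : superComm δ (C.opN n a) =
      -(C.tripleTJ.d (δ C.epsT) (C.ioT n a) + C.tripleTJ.d C.epsT (δ (C.ioT n a))) := by
  have h := C.tripleTJ_isOrthosymplectic.superComm_d hδ (C.derTJ_le_der h) C.epsT_mem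
    (C.ioT_mem ha n)
  rw [d_epsT_ioT, mul_zero, sgn_zero, one_smul, map_neg] at h
  rw [← h, neg_neg]

theorem superComm_opD_opN {i j : ZMod 2} {d : Fin 3 → (A →ₗ[k] A)}
    (hd : ∀ n, d n ∈ part k (A →ₗ[k] A) i) (h : d ∈ C.paraHurwitz.tri) {a : A}
    (ha : a ∈ part k A j) (n : Fin 3) :
    superComm (C.opD d) (C.opN n a) = C.opN n (d n a) := by
  rw [C.superComm_opN (C.opD_mem hd) (C.opD_mem_derTJ h) ha, opD_epsT, opD_ioT, d_epsT_ioT]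
  simp

theorem superComm_opN_self {i j : ZMod 2} {a c : A} (ha : a ∈ part k A i) (hc : c ∈ part k A j)
    (n : Fin 3) : superComm (C.opN n a) (C.opN n c) =
      -C.opD (CompositionSuperalgebra.theta k A n (C.paraHurwitz.t a c)) := by
  rw [C.superComm_opN (C.opN_mem ha n) (C.opN_mem_derTJ n a) hc, opN_epsT, opN_ioT_self,
    d_ioT_self, map_smul, d_epsT_epsT, smul_zero, add_zero]

theorem superComm_opN_succ {i j : ZMod 2} {a c : A} (ha : a ∈ part k A i) (hc : c ∈ part k A j)
    (n : Fin 3) : superComm (C.opN n a) (C.opN (n + 1) c) =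
      C.opN (n + 2) (C.paraHurwitz.mul a c) := by
  have h3 := three_eq_zero_of_char k
  rw [C.superComm_opN (C.opN_mem ha n) (C.opN_mem_derTJ n a) hc, opN_epsT, opN_ioT_succ,
    d_ioT_succ, map_neg, d_epsT_ioT]
  -- The terms from ι_n(a), ι_{n+1}(c) and from ε, ι_{n+2}(a • c) agree, so the total coefficient is
  -- -2 = 1.
  linear_combination (norm := module) (-h3) • C.opN (n + 2) (C.paraHurwitz.mul a c)

theorem superComm_opD {i j : ZMod 2} {d d' : Fin 3 → (A →ₗ[k] A)}
    (hd : ∀ n, d n ∈ part k (A →ₗ[k] A) i) (hd' : ∀ n, d' n ∈ part k (A →ₗ[k] A) j) :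
    superComm (C.opD d) (C.opD d') = C.opD fun n => superComm (d n) (d' n) := by
  refine C.hom_TJ_ext' ?_ fun n a => ?_
  · simp [superComm_apply (C.opD_mem hd) (C.opD_mem hd'), opD_epsT]
  · simp [superComm_apply (C.opD_mem hd) (C.opD_mem hd'), opD_ioT,
      superComm_apply (hd n) (hd' n)]

end HurwitzSuperalgebra

end Supersquare
end

/-! ### The triality superalgebra of S_{1,2}: constant triples. -/

noncomputable section

namespace Supersquare

namespace SymplecticPlane

variable {k : Type*} [Field k] [CharP k 3] {V : Type*} [AddCommGroup V] [Module k V]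
variable (ω : SymplecticPlane k V)

theorem S12_mul (x y : k × OddSpace V) : ω.S12.mul x y =
    (x.1 * y.1 + ω.form x.2 y.2, -(x.1 • y.2 + y.1 • x.2)) := by
  have hc : ∀ x : k × OddSpace V, ω.B12.conj x = (x.1, -x.2) := fun x => by
    rw [HurwitzSuperalgebra.conj_apply]
    change (2 * (x.1 * 1) + ω.form x.2 0) • ((1 : k), (0 : OddSpace V)) - x = _
    ext
    · simp; ring
    · simp
  change ω.mulB12 (ω.B12.conj x) (ω.B12.conj y) = _
  rw [mulB12_apply, hc, hc]
  ext
  · simp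
  · simp; abel

theorem S12_b (x y : k × OddSpace V) : ω.S12.b x y = 2 * (x.1 * y.1) + ω.form x.2 y.2 := rfl

/-- The superderivations `1 ↦ p`, `v ↦ σ(v) + ⟨p|v⟩ 1` of `B(1,2)`. -/
def delta : ((OddSpace V →ₗ[k] OddSpace V) × OddSpace V) →ₗ[k]
    ((k × OddSpace V) →ₗ[k] (k × OddSpace V)) :=
  LinearMap.mk₂ k (fun q x => (ω.form q.2 x.2, q.1 x.2 + x.1 • q.2))
    (fun q q' x => by ext <;> simp; abel) (fun c q x => by ext <;> simp [smul_comm c])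
    (fun q x x' => by ext <;> simp [add_smul]; abel) (fun c q x => by ext <;> simp [mul_smul])

omit [CharP k 3] in
theorem delta_apply (q) (x : k × OddSpace V) :
    ω.delta q x = (ω.form q.2 x.2, q.1 x.2 + x.1 • q.2) := rfl

omit [CharP k 3] in
theorem delta_even_mem (σ : OddSpace V →ₗ[k] OddSpace V) :
    ω.delta (σ, 0) ∈ part k ((k × OddSpace V) →ₗ[k] (k × OddSpace V)) 0 :=
  hom_mem_part fun j x hx => by
    rcases parity_cases j with rfl | rfl
    · rw [mem_part_zero] at hx
      exact mem_part_zero.2 (by simp [delta_apply, hx])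
    · rw [mem_part_one] at hx
      exact mem_part_one.2 (by simp [delta_apply])

omit [CharP k 3] in
theorem delta_odd_mem (p : OddSpace V) :
    ω.delta (0, p) ∈ part k ((k × OddSpace V) →ₗ[k] (k × OddSpace V)) 1 :=
  hom_mem_part fun j x hx => by
    rcases parity_cases j with rfl | rfl
    · rw [mem_part_zero] at hx
      exact mem_part_one.2 (by simp [delta_apply, hx])
    · rw [mem_part_one] at hx
      exact mem_part_zero.2 (by simp [delta_apply, hx])

omit [CharP k 3] in
theorem delta_split (q) : ω.delta q = ω.delta (q.1, 0) + ω.delta (0, q.2) := by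
  rw [← map_add]; simp

/-- Each δ_{σ,p} is a skew superderivation of the para-Hurwitz product. There 1 is an idempotent but
not a unit, so it may be moved: δ(1 • 1) = p while p • 1 + 1 • p = -2p, equal because 3 = 0. For two
vectors of V the rule is the cyclic identity of the plane. -/
theorem delta_mem_tri {q} (hq : q.1 ∈ ω.sp) : (fun _ => ω.delta q) ∈ ω.S12.tri := by
  have h3 := three_eq_zero_of_char k
  obtain ⟨σ, p⟩ := q
  have hσ : ∀ u v, ω.form (σ u) v + ω.form u (σ v) = 0 := hq
  have h0 : (fun _ => ω.delta (σ, 0)) ∈ ω.S12.tri := by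
    refine (CompositionSuperalgebra.mem_tri fun _ => ω.delta_even_mem σ).2
      ⟨fun _ j x _ y => ?_, fun j x _ y => ?_⟩
    · simp [S12_b, delta_apply, hσ]
    · simp only [S12_mul, delta_apply]
      ext
      · simp [hσ]
      · simp
  have h1 : (fun _ => ω.delta (0, p)) ∈ ω.S12.tri := by
    refine (CompositionSuperalgebra.mem_tri fun _ => ω.delta_odd_mem p).2
      ⟨fun _ j x hx y => ?_, fun j x hx y => ?_⟩
    · rcases parity_cases j with rfl | rfl
      · rw [mem_part_zero] at hx
        simp [S12_b, delta_apply, hx]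
        linear_combination x.1 * ω.form p y.2 * h3
      · rw [mem_part_one] at hx
        simp [S12_b, delta_apply, hx]
        linear_combination y.1 * ω.form p x.2 * h3 - y.1 * ω.neg x.2 p
    · have hc := ω.cyclic p x.2 y.2
      simp only [S12_mul, delta_apply]
      rcases parity_cases j with rfl | rfl
      · rw [mem_part_zero] at hx
        ext
        · simp [hx]
          linear_combination -(x.1 * ω.form p y.2) * h3
        · simp [hx]
          linear_combination (norm := module) (x.1 * y.1 * h3) • p
      · rw [mem_part_one] at hx
        ext
        · simp [hx]
          linear_combination -(y.1 * ω.form p x.2) * h3 + y.1 * ω.neg x.2 p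
        · simp [hx]
          rw [ω.neg y.2 p] at hc
          linear_combination (norm := module) hc
  have e : (fun _ => ω.delta (σ, p) : Fin 3 → _) =
      (fun _ => ω.delta (σ, 0)) + fun _ => ω.delta (0, p) :=
    funext fun _ => ω.delta_split (σ, p)
  rw [e]
  exact add_mem h0 h1

/-- Skewness kills E_n(1), since 4 = 1. So each E_n is given by an element of 𝔰𝔭(V), and the
triality relation with one factor equal to 1, where 1 • v = v • 1 = -v, makes the three equal. -/
theorem exists_delta_even {E : Fin 3 → ((k × OddSpace V) →ₗ[k] (k × OddSpace V))}
    (hp : ∀ n, E n ∈ part k ((k × OddSpace V) →ₗ[k] (k × OddSpace V)) 0) (hE : E ∈ ω.S12.tri) :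
    ∃ σ ∈ ω.sp, ∀ n, E n = ω.delta (σ, 0) := by
  have h3 := three_eq_zero_of_char k
  obtain ⟨h1, h2⟩ := (CompositionSuperalgebra.mem_tri hp).1 hE
  have mo : ∀ v : OddSpace V, ((0, v) : k × OddSpace V) ∈ part k (k × OddSpace V) 1 := fun v =>
    mem_part_one.2 rfl
  have me : ((1, 0) : k × OddSpace V) ∈ part k (k × OddSpace V) 0 := mem_part_zero.2 rfl
  have ev : ∀ n v, (E n (0, v)).1 = 0 := fun n v => mem_part_one.1 (by
    simpa using hom_apply_mem (hp n) (mo v))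
  have e1 : ∀ n, E n (1, 0) = 0 := fun n => by
    have a1 : (E n (1, 0)).2 = 0 := mem_part_zero.1 (by
      simpa using hom_apply_mem (hp n) me)
    have := h1 n 0 (1, 0) me (1, 0)
    simp [S12_b] at this
    refine Prod.ext ?_ a1
    change (E n (1, 0)).1 = 0
    linear_combination this - (E n (1, 0)).1 * h3
  have hσ : ∀ n, LinearMap.snd k k (OddSpace V) ∘ₗ E n ∘ₗ LinearMap.inr k k (OddSpace V) ∈ ω.sp :=
    fun n u v => by
      have := h1 n 1 (0, u) (mo u) (0, v)
      simpa [S12_b] using this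
  have hE' : ∀ n, E n = ω.delta (LinearMap.snd k k (OddSpace V) ∘ₗ E n ∘ₗ
      LinearMap.inr k k (OddSpace V), 0) := fun n => by
    refine LinearMap.prod_ext (LinearMap.ext_ring ?_) (LinearMap.ext fun v => ?_)
    · have e0 : E n (0, 0) = 0 := map_zero (E n)
      simp [delta_apply, e1, e0]
      rfl
    · exact Prod.ext (by simp [delta_apply, ev]) (by simp [delta_apply])
  have hv : ∀ n m, (∀ v, (E n (0, v)).2 = (E m (0, v)).2) → E n = E m := fun n m h => by
    rw [hE' n, hE' m]
    refine congrArg (fun σ => ω.delta (σ, 0)) (LinearMap.ext fun v => ?_)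
    simpa using h v
  have t1 : E 0 = E 1 := hv 0 1 fun v => by
    have := congrArg Prod.snd (h2 1 (0, v) (mo v) (1, 0))
    have e : ((0, -v) : k × OddSpace V) = -(0, v) := by simp
    simp [S12_mul, e1] at this
    rw [e, map_neg] at this
    simpa using this
  have t2 : E 0 = E 2 := hv 0 2 fun v => by
    have := congrArg Prod.snd (h2 0 (1, 0) me (0, v))
    have e : ((0, -v) : k × OddSpace V) = -(0, v) := by simp
    simp [S12_mul, e1] at this
    rw [e, map_neg] at this
    simpa using this
  refine ⟨_, hσ 0, fun n => ?_⟩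
  rw [← hE']
  obtain rfl | rfl | rfl := (by decide : ∀ n : Fin 3, n = 0 ∨ n = 1 ∨ n = 2) n
  exacts [rfl, t1.symm, t2.symm]

/-- Skewness determines E_n from p_n = E_n(1). The relation at u • u = 0 gives (⟨p₁|u⟩ - ⟨p₂|u⟩)u =
0 for all u, hence p₁ = p₂; the relation at 1 • 1 = 1 gives p₀ = -(p₁ + p₂) = -2p₁ = p₁. -/
theorem exists_delta_odd {E : Fin 3 → ((k × OddSpace V) →ₗ[k] (k × OddSpace V))}
    (hp : ∀ n, E n ∈ part k ((k × OddSpace V) →ₗ[k] (k × OddSpace V)) 1) (hE : E ∈ ω.S12.tri) :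
    ∃ p, ∀ n, E n = ω.delta (0, p) := by
  have h3 := three_eq_zero_of_char k
  obtain ⟨h1, h2⟩ := (CompositionSuperalgebra.mem_tri hp).1 hE
  have mo : ∀ v : OddSpace V, ((0, v) : k × OddSpace V) ∈ part k (k × OddSpace V) 1 := fun v =>
    mem_part_one.2 rfl
  have me : ((1, 0) : k × OddSpace V) ∈ part k (k × OddSpace V) 0 := mem_part_zero.2 rfl
  have e1 : ∀ n, (E n (1, 0)).1 = 0 := fun n => mem_part_one.1 (by
    simpa using hom_apply_mem (hp n) me)
  have ev : ∀ n v, (E n (0, v)).2 = 0 := fun n v => mem_part_zero.1 (by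
    simpa using hom_apply_mem (hp n) (mo v))
  have ev1 : ∀ n v, (E n (0, v)).1 = ω.form (E n (1, 0)).2 v := fun n v => by
    have := h1 n 0 (1, 0) me (0, v)
    simp [S12_b] at this
    linear_combination (E n (0, v)).1 * h3 - this
  have hE' : ∀ n, E n = ω.delta (0, (E n (1, 0)).2) := fun n => by
    refine LinearMap.prod_ext (LinearMap.ext_ring ?_) (LinearMap.ext fun v => ?_)
    · exact Prod.ext (by simp [delta_apply, e1]) (by simp [delta_apply])
    · exact Prod.ext (by simp [delta_apply, ev1]) (by simp [delta_apply, ev])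
  have t1 : (E 1 (1, 0)).2 = (E 2 (1, 0)).2 := by
    rw [← sub_eq_zero]
    refine ω.nondegenerate fun u => ?_
    have := congrArg Prod.snd (h2 1 (0, u) (mo u) (0, u))
    simp [S12_mul, ω.alt, ev, ev1] at this
    by_cases hu : u = 0
    · simp [hu]
    · have h : (ω.form (E 1 (1, 0)).2 u - ω.form (E 2 (1, 0)).2 u) • u = 0 := by
        linear_combination (norm := module) this
      rw [map_sub, LinearMap.sub_apply]
      exact (smul_eq_zero.1 h).resolve_right hu
  have t0 : (E 0 (1, 0)).2 = (E 1 (1, 0)).2 := by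
    have := congrArg Prod.snd (h2 0 (1, 0) me (1, 0))
    simp [S12_mul, e1] at this
    rw [this, ← t1]
    linear_combination (norm := module) (-h3) • (E 1 (1, 0)).2
  refine ⟨(E 0 (1, 0)).2, fun n => ?_⟩
  rw [hE' n]
  obtain rfl | rfl | rfl := (by decide : ∀ n : Fin 3, n = 0 ∨ n = 1 ∨ n = 2) n
  exacts [rfl, by rw [t0], by rw [t0, t1]]

theorem exists_delta_of_mem_tri {D : Fin 3 → ((k × OddSpace V) →ₗ[k] (k × OddSpace V))}
    (hD : D ∈ ω.S12.tri) : ∃ q, q.1 ∈ ω.sp ∧ D = fun _ => ω.delta q := by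
  obtain ⟨σ, hσ, e0⟩ := ω.exists_delta_even (fun n => pr_mem 0 (D n))
    (CompositionSuperalgebra.pr_mem_tri hD 0)
  obtain ⟨p, e1⟩ := ω.exists_delta_odd (fun n => pr_mem 1 (D n))
    (CompositionSuperalgebra.pr_mem_tri hD 1)
  refine ⟨(σ, p), hσ, funext fun n => ?_⟩
  rw [← pr_add (k := k) (D n), e0, e1, ω.delta_split (σ, p)]

end SymplecticPlane

end Supersquare
end

/-! ### The elements t_{x,y} of S_{1,2}, and the bracket of 𝔤(S, S') on its summands. -/

noncomputable section

namespace Supersquare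

namespace SymplecticPlane

variable {k : Type*} [Field k] [CharP k 3] {V : Type*} [AddCommGroup V] [Module k V]
variable (ω : SymplecticPlane k V)

/-- As t_{x,y} belongs to 𝔱𝔯𝔦(S_{1,2}), it is a constant triple δ_q, so its component σ_{x,y}
determines it; the values on 1 and on V give q, and the other two components are never computed. -/
theorem S12_t_eq {i j : ZMod 2} {x y : k × OddSpace V} (hx : x ∈ part k (k × OddSpace V) i)
    (hy : y ∈ part k (k × OddSpace V) j) {q : (OddSpace V →ₗ[k] OddSpace V) × OddSpace V}
    (h1 : (ω.S12.sigma x y (1, 0)).2 = q.2) (h2 : ∀ v, (ω.S12.sigma x y (0, v)).2 = q.1 v) :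
    ω.S12.t x y = fun _ => ω.delta q := by
  obtain ⟨q', -, e⟩ := ω.exists_delta_of_mem_tri
    (ω.B12.paraHurwitz_isAssociative.t_mem_tri_of_mem (S := ω.S12)
      (HurwitzSuperalgebra.two_ne_zero_of_char k) hx hy)
  have e0 : ω.S12.sigma x y = ω.delta q' := by
    rw [← CompositionSuperalgebra.t_apply_zero, e]
  rw [e]
  rw [e0] at h1
  simp only [e0] at h2
  have : q' = q := Prod.ext (LinearMap.ext fun v => by simpa [delta_apply] using h2 v)
    (by simpa [delta_apply] using h1)
  rw [this]

omit [CharP k 3] in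
theorem odd_mem_part (v : OddSpace V) : ((0, v) : k × OddSpace V) ∈ part k (k × OddSpace V) 1 :=
  mem_part_one.2 rfl

omit [CharP k 3] in
theorem one_mem_part : ((1, 0) : k × OddSpace V) ∈ part k (k × OddSpace V) 0 :=
  mem_part_zero.2 rfl

theorem S12_t_one_one : ω.S12.t (1, 0) (1, 0) = 0 := by
  rw [ω.S12_t_eq one_mem_part one_mem_part (q := 0)]
  · simp; rfl
  · rw [ω.S12.sigma_apply one_mem_part one_mem_part one_mem_part]; simp
  · intro v
    rw [ω.S12.sigma_apply one_mem_part one_mem_part (odd_mem_part v)]; simp [S12_b]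

theorem S12_t_one_odd (v : OddSpace V) :
    ω.S12.t (1, 0) (0, v) = fun _ => ω.delta (0, -v) := by
  have h3 := three_eq_zero_of_char k
  refine ω.S12_t_eq one_mem_part (odd_mem_part v) ?_ fun w => ?_
  · rw [ω.S12.sigma_apply one_mem_part (odd_mem_part v) one_mem_part]
    simp [S12_b]
    linear_combination (norm := module) h3 • v
  · rw [ω.S12.sigma_apply one_mem_part (odd_mem_part v) (odd_mem_part w)]; simp [S12_b]

theorem S12_t_odd_one (v : OddSpace V) :
    ω.S12.t (0, v) (1, 0) = fun _ => ω.delta (0, v) := by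
  have h3 := three_eq_zero_of_char k
  refine ω.S12_t_eq (odd_mem_part v) one_mem_part ?_ fun w => ?_
  · rw [ω.S12.sigma_apply (odd_mem_part v) one_mem_part one_mem_part]
    simp [S12_b]
    linear_combination (norm := module) (-h3) • v
  · rw [ω.S12.sigma_apply (odd_mem_part v) one_mem_part (odd_mem_part w)]; simp [S12_b]

theorem S12_t_odd_odd (u v : OddSpace V) :
    ω.S12.t (0, u) (0, v) = fun _ => ω.delta (-ω.gamma u v, 0) := by
  refine ω.S12_t_eq (odd_mem_part u) (odd_mem_part v) ?_ fun w => ?_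
  · rw [ω.S12.sigma_apply (odd_mem_part u) (odd_mem_part v) one_mem_part]; simp [S12_b]
  · rw [ω.S12.sigma_apply (odd_mem_part u) (odd_mem_part v) (odd_mem_part w)]
    simp [S12_b, gamma_apply]
    abel

end SymplecticPlane

namespace CompositionSuperalgebra

variable {k : Type*} [Field k]
variable {A : Type*} [AddCommGroup A] [Module k A] [Superspace k A]
variable {A' : Type*} [AddCommGroup A'] [Module k A'] [Superspace k A']
variable (S : CompositionSuperalgebra k A) (S' : CompositionSuperalgebra k A')

theorem tensorMul_tmul {i j : ZMod 2} {a' : A'} {c : A} (ha' : a' ∈ part k A' i)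
    (hc : c ∈ part k A j) (a : A) (c' : A') :
    tensorMul S S' (a ⊗ₜ[k] a') (c ⊗ₜ[k] c') =
      sgn k (i * j) • S.mul a c ⊗ₜ[k] S'.mul a' c' := by
  rcases parity_cases i with rfl | rfl <;> rcases parity_cases j with rfl | rfl <;>
    simp [tensorMul, sum_parity, pr_of_mem ha', pr_of_mem hc]

theorem tensorT'_tmul {i j : ZMod 2} {a' : A'} {c : A} (ha' : a' ∈ part k A' i)
    (hc : c ∈ part k A j) (a : A) (c' : A') :
    tensorT' S S' (a ⊗ₜ[k] a') (c ⊗ₜ[k] c') =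
      sgn k (j * i) • S.b a c • S'.t a' c' := by
  rcases parity_cases i with rfl | rfl <;> rcases parity_cases j with rfl | rfl <;>
    simp [tensorT', sum_parity, pr_of_mem ha', pr_of_mem hc]

theorem tensorT_tmul {i i' j j' : ZMod 2} {a c : A} {a' c' : A'} (ha : a ∈ part k A i)
    (ha' : a' ∈ part k A' i') (hc : c ∈ part k A j) (hc' : c' ∈ part k A' j') :
    tensorT S S' (a ⊗ₜ[k] a') (c ⊗ₜ[k] c') =
      sgn k (i * i' + i * j' + j * j') • S'.b a' c' • S.t a c := by
  have h : tensorT S S' (a ⊗ₜ[k] a') (c ⊗ₜ[k] c') =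
      ∑ p : ZMod 2, ∑ p' : ZMod 2, ∑ q : ZMod 2, ∑ q' : ZMod 2,
        sgn k (p * p' + p * q' + q * q') •
          S'.b (pr k p' a') (pr k q' c') • S.t (pr k p a) (pr k q c) := by
    simp only [tensorT, LinearMap.sum_apply, LinearMap.smul_apply, LinearMap.compl₁₂_apply,
      TensorProduct.map_tmul, LinearMap.compr₂_apply, TensorProduct.map₂_apply_tmul,
      LinearEquiv.coe_coe, TensorProduct.rid_tmul]
  rw [h, Finset.sum_eq_single i, Finset.sum_eq_single i', Finset.sum_eq_single j,
    Finset.sum_eq_single j', pr_of_mem_self ha, pr_of_mem_self ha', pr_of_mem_self hc,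
    pr_of_mem_self hc']
  · intro p _ hp; simp only [pr_of_mem_ne hc' hp, map_zero, zero_smul, smul_zero]
  · intro h; exact absurd (Finset.mem_univ _) h
  · intro p _ hp
    simp only [pr_of_mem_ne hc hp, map_zero, smul_zero, Finset.sum_const_zero]
  · intro h; exact absurd (Finset.mem_univ _) h
  · intro p _ hp
    simp only [pr_of_mem_ne ha' hp, map_zero, LinearMap.zero_apply, zero_smul, smul_zero,
      Finset.sum_const_zero]
  · intro h; exact absurd (Finset.mem_univ _) h
  · intro p _ hp
    simp only [pr_of_mem_ne ha hp, map_zero, LinearMap.zero_apply, smul_zero,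
      Finset.sum_const_zero]
  · intro h; exact absurd (Finset.mem_univ _) h

theorem bracket_apply (X Y : Ambient k A A') : bracket S S' X Y =
    (fun n => superComm (X.1 n) (Y.1 n) +
      (∑ i, theta k A i (tensorT S S' (X.2.2 i) (Y.2.2 i))) n,
    fun n => superComm (X.2.1 n) (Y.2.1 n) +
      (∑ i, theta k A' i (tensorT' S S' (X.2.2 i) (Y.2.2 i))) n,
    fun i =>
      actLeft k A A' (X.1 i) (Y.2.2 i) + actRight k A A' (X.2.1 i) (Y.2.2 i) -
      sflip (actLeft k A A') (X.2.2 i) (Y.1 i) - sflip (actRight k A A') (X.2.2 i) (Y.2.1 i) +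
      tensorMul S S' (X.2.2 (i + 1)) (Y.2.2 (i + 2)) -
      sflip (tensorMul S S') (X.2.2 (i + 2)) (Y.2.2 (i + 1))) := rfl

theorem bracket_op_op (d d') (e e') : bracket S S' (d, e, 0) (d', e', 0) =
    (fun n => superComm (d n) (d' n), fun n => superComm (e n) (e' n), 0) := by
  rw [bracket_apply]
  refine Prod.ext (funext fun n => ?_) (Prod.ext (funext fun n => ?_) (funext fun n => ?_)) <;>
    simp

theorem bracket_op_single (d) (e) (n : Fin 3) (w : A ⊗[k] A') :
    bracket S S' (d, e, 0) (0, 0, Pi.single n w) =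
      (0, 0, Pi.single n (actLeft k A A' (d n) w + actRight k A A' (e n) w)) := by
  rw [bracket_apply]
  refine Prod.ext (funext fun m => ?_) (Prod.ext (funext fun m => ?_) (funext fun m => ?_))
  · simp
  · simp
  · by_cases h : m = n
    · subst h; simp
    · simp [h]

theorem bracket_single_op (d) (e) (n : Fin 3) (w : A ⊗[k] A') :
    bracket S S' (0, 0, Pi.single n w) (d, e, 0) =
      (0, 0, Pi.single n (-(sflip (actLeft k A A') w (d n)) -
        sflip (actRight k A A') w (e n))) := by
  rw [bracket_apply]
  refine Prod.ext (funext fun m => ?_) (Prod.ext (funext fun m => ?_) (funext fun m => ?_))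
  · simp
  · simp
  · by_cases h : m = n
    · subst h; simp
    · simp [h]

theorem bracket_single_self (n : Fin 3) (w w' : A ⊗[k] A') :
    bracket S S' (0, 0, Pi.single n w) (0, 0, Pi.single n w') =
      (theta k A n (tensorT S S' w w'), theta k A' n (tensorT' S S' w w'), 0) := by
  rw [bracket_apply]
  refine Prod.ext (funext fun m => ?_) (Prod.ext (funext fun m => ?_) (funext fun m => ?_))
  · dsimp only
    rw [Finset.sum_eq_single n]
    · simp
    · intro l _ hl; simp [hl]
    · simp
  · dsimp only
    rw [Finset.sum_eq_single n]
    · simp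
    · intro l _ hl; simp [hl]
    · simp
  · have h : ¬(m + 1 = n ∧ m + 2 = n) := by revert m n; decide
    by_cases h1 : m + 1 = n
    · have h2 : m + 2 ≠ n := fun h2 => h ⟨h1, h2⟩
      simp [Pi.single_apply, h2]
    · simp [Pi.single_apply, h1]

omit [Superspace k A] [Superspace k A'] in
theorem sum_theta_single {B : Type*} [AddCommGroup B] [Module k B]
    (β : (A ⊗[k] A') →ₗ[k] (A ⊗[k] A') →ₗ[k] (Fin 3 → (B →ₗ[k] B))) {n m : Fin 3} (h : n ≠ m)
    (w w' : A ⊗[k] A') :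
    ∑ i, theta k B i (β ((Pi.single n w : Fin 3 → A ⊗[k] A') i)
      ((Pi.single m w' : Fin 3 → A ⊗[k] A') i)) = 0 := by
  refine Finset.sum_eq_zero fun i _ => ?_
  by_cases hi : i = n
  · have hm : i ≠ m := fun hm => h (hi.symm.trans hm)
    simp [hm]
  · simp [hi]

theorem bracket_single_succ (n : Fin 3) (w w' : A ⊗[k] A') :
    bracket S S' (0, 0, Pi.single n w) (0, 0, Pi.single (n + 1) w') =
      (0, 0, Pi.single (n + 2) (tensorMul S S' w w')) := by
  have hn : n ≠ n + 1 := by revert n; decide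
  rw [bracket_apply]
  refine Prod.ext (funext fun m => ?_) (Prod.ext (funext fun m => ?_) (funext fun m => ?_))
  · dsimp only
    rw [sum_theta_single (tensorT S S') hn]
    simp
  · dsimp only
    rw [sum_theta_single (tensorT' S S') hn]
    simp
  · obtain rfl | rfl | rfl := (by decide : ∀ m n : Fin 3, m = n ∨ m = n + 1 ∨ m = n + 2) m n <;>
      simp [fin_three_add_one_one, fin_three_add_one_two, fin_three_add_two_one,
        fin_three_add_two_two]

theorem bracket_succ_single (n : Fin 3) (w w' : A ⊗[k] A') :
    bracket S S' (0, 0, Pi.single (n + 1) w) (0, 0, Pi.single n w') =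
      (0, 0, -Pi.single (n + 2) (sflip (tensorMul S S') w w')) := by
  have hn : n + 1 ≠ n := by revert n; decide
  rw [bracket_apply]
  refine Prod.ext (funext fun m => ?_) (Prod.ext (funext fun m => ?_) (funext fun m => ?_))
  · dsimp only
    rw [sum_theta_single (tensorT S S') hn]
    simp
  · dsimp only
    rw [sum_theta_single (tensorT' S S') hn]
    simp
  · obtain rfl | rfl | rfl := (by decide : ∀ m n : Fin 3, m = n ∨ m = n + 1 ∨ m = n + 2) m n <;>
      simp [fin_three_add_one_one, fin_three_add_one_two, fin_three_add_two_one,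
        fin_three_add_two_two]

end CompositionSuperalgebra

end Supersquare
end

/-! ### The map from 𝔤(S_{1,2}, S) to 𝔤(J) on homogeneous generators. -/

noncomputable section

namespace Supersquare

namespace SymplecticPlane

variable {k : Type*} [Field k] {V : Type*} [AddCommGroup V] [Module k V]
variable (ω : SymplecticPlane k V)

theorem superComm_delta_even_even (σ σ' : OddSpace V →ₗ[k] OddSpace V) :
    superComm (ω.delta (σ, 0)) (ω.delta (σ', 0)) = ω.delta (superComm σ σ', 0) := by
  refine LinearMap.ext fun x => ?_
  rw [superComm_apply (ω.delta_even_mem σ) (ω.delta_even_mem σ')]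
  ext <;> simp [delta_apply, superComm_odd]

theorem superComm_delta_even_odd {σ : OddSpace V →ₗ[k] OddSpace V} (hσ : σ ∈ ω.sp)
    (p : OddSpace V) :
    superComm (ω.delta (σ, 0)) (ω.delta (0, p)) = ω.delta (0, σ p) := by
  refine LinearMap.ext fun x => ?_
  have h : ω.form (σ p) x.2 + ω.form p (σ x.2) = 0 := hσ p x.2
  rw [superComm_apply (ω.delta_even_mem σ) (ω.delta_odd_mem p)]
  ext
  · simp [delta_apply]; linear_combination -h
  · simp [delta_apply]

theorem superComm_delta_odd_odd (p p' : OddSpace V) :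
    superComm (ω.delta (0, p)) (ω.delta (0, p')) = ω.delta (ω.gamma p p', 0) := by
  refine LinearMap.ext fun x => ?_
  rw [superComm_apply (ω.delta_odd_mem p) (ω.delta_odd_mem p')]
  ext
  · simp [delta_apply, ω.neg p' p]
  · simp [delta_apply, gamma_apply]; abel

end SymplecticPlane

namespace HurwitzSuperalgebra

variable {k : Type*} [Field k] [CharP k 3] {V : Type*} [AddCommGroup V] [Module k V]
variable (ω : SymplecticPlane k V)
variable {A : Type*} [AddCommGroup A] [Module k A] [Superspace k A]
variable (C : HurwitzSuperalgebra k A)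

/-- The linear map from the space containing `𝔤(S_{1,2}, S)` to the space containing `𝔤(J)`. -/
def isoMap : CompositionSuperalgebra.Ambient k (k × OddSpace V) A →ₗ[k]
    SuperTriple.Ambient k V C.TJ where
  toFun X :=
    (LinearMap.snd k k (OddSpace V) ∘ₗ X.1 0 ∘ₗ LinearMap.inr k k (OddSpace V),
    C.opD X.2.1 + ∑ n, C.opN n
      (TensorProduct.lid k A (LinearMap.rTensor A (LinearMap.fst k k (OddSpace V)) (X.2.2 n))),
    -((X.1 0 (1, 0)).2 ⊗ₜ[k] C.epsT) +
      ∑ n, TensorProduct.map (LinearMap.snd k k (OddSpace V)) (C.ioT n) (X.2.2 n))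
  map_add' X Y := by
    refine Prod.ext ?_ (Prod.ext ?_ ?_)
    · ext; simp
    · simp [Finset.sum_add_distrib]; abel
    · simp [Finset.sum_add_distrib, TensorProduct.add_tmul]; abel
  map_smul' c X := by
    refine Prod.ext ?_ (Prod.ext ?_ ?_)
    · ext; simp
    · simp [Finset.smul_sum]
    · simp [Finset.smul_sum, TensorProduct.smul_tmul']

theorem isoMap_apply (X : CompositionSuperalgebra.Ambient k (k × OddSpace V) A) : C.isoMap X =
    (LinearMap.snd k k (OddSpace V) ∘ₗ X.1 0 ∘ₗ LinearMap.inr k k (OddSpace V),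
    C.opD X.2.1 + ∑ n, C.opN n
      (TensorProduct.lid k A (LinearMap.rTensor A (LinearMap.fst k k (OddSpace V)) (X.2.2 n))),
    -((X.1 0 (1, 0)).2 ⊗ₜ[k] C.epsT) +
      ∑ n, TensorProduct.map (LinearMap.snd k k (OddSpace V)) (C.ioT n) (X.2.2 n)) := rfl

/-- `isoMap` reads only component 0 of the triple on S_{1,2}; on 𝔱𝔯𝔦(S_{1,2}) this loses nothing, as
the triples there are constant. -/
theorem isoMap_op (q) (e : Fin 3 → (A →ₗ[k] A)) :
    C.isoMap (fun _ => ω.delta q, e, 0) = (q.1, C.opD e, -(q.2 ⊗ₜ[k] C.epsT)) := by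
  rw [isoMap_apply]
  refine Prod.ext ?_ (Prod.ext ?_ ?_)
  · ext v; simp [SymplecticPlane.delta_apply]
  · simp
  · simp [SymplecticPlane.delta_apply]

theorem isoMap_zero_op (e : Fin 3 → (A →ₗ[k] A)) :
    C.isoMap (V := V) (0, e, 0) = (0, C.opD e, 0) := by
  rw [isoMap_apply]
  refine Prod.ext ?_ (Prod.ext ?_ ?_) <;> simp

theorem isoMap_single (n : Fin 3) (x : k × OddSpace V) (a : A) :
    C.isoMap (0, 0, Pi.single n (x ⊗ₜ[k] a)) =
      (0, x.1 • C.opN n a, x.2 ⊗ₜ[k] C.ioT n a) := by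
  rw [isoMap_apply]
  refine Prod.ext ?_ (Prod.ext ?_ ?_)
  · simp
  · dsimp only
    rw [Finset.sum_eq_single n]
    · simp
    · intro m _ hm; simp [hm]
    · simp
  · dsimp only
    rw [Finset.sum_eq_single n]
    · simp
    · intro m _ hm; simp [hm]
    · simp

/-- Homogeneous generators of `𝔤(S_{1,2}, S)`. -/
inductive IsGenerator : ZMod 2 → CompositionSuperalgebra.Ambient k (k × OddSpace V) A → Prop
  | even (σ : OddSpace V →ₗ[k] OddSpace V) (hσ : σ ∈ ω.sp) :
    IsGenerator 0 (fun _ => ω.delta (σ, 0), 0, 0)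
  | odd (p : OddSpace V) : IsGenerator 1 (fun _ => ω.delta (0, p), 0, 0)
  | op {i : ZMod 2} (e : Fin 3 → (A →ₗ[k] A)) (he : ∀ n, e n ∈ part k (A →ₗ[k] A) i)
    (h : e ∈ C.paraHurwitz.tri) : IsGenerator i (0, e, 0)
  | one {i : ZMod 2} (n : Fin 3) (a : A) (ha : a ∈ part k A i) :
    IsGenerator i (0, 0, Pi.single n ((1, 0) ⊗ₜ[k] a))
  | vec {i : ZMod 2} (n : Fin 3) (v : OddSpace V) (a : A) (ha : a ∈ part k A (i + 1)) :
    IsGenerator i (0, 0, Pi.single n ((0, v) ⊗ₜ[k] a))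

theorem isoMap_even (σ : OddSpace V →ₗ[k] OddSpace V) :
    C.isoMap (fun _ => ω.delta (σ, 0), 0, 0) = (σ, 0, 0) := by
  rw [isoMap_op]; simp

/-- The minus sign is forced by `mapsBracket_odd_one`: [δ_p, ι_n(1 ⊗ a)] = ι_n(p ⊗ a), whereas [p ⊗
ε, `opN n a`] = -p ⊗ ι_n(a). -/
theorem isoMap_odd (p : OddSpace V) :
    C.isoMap (fun _ => ω.delta (0, p), 0, 0) = (0, 0, (-p) ⊗ₜ[k] C.epsT) := by
  rw [isoMap_op]; simp [TensorProduct.neg_tmul]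

theorem isoMap_one (n : Fin 3) (a : A) :
    C.isoMap (V := V) (0, 0, Pi.single n ((1, 0) ⊗ₜ[k] a)) = (0, C.opN n a, 0) := by
  rw [isoMap_single]; simp

theorem isoMap_vec (n : Fin 3) (v : OddSpace V) (a : A) :
    C.isoMap (0, 0, Pi.single n ((0, v) ⊗ₜ[k] a)) = (0, 0, v ⊗ₜ[k] C.ioT n a) := by
  rw [isoMap_single]; simp

variable {ω C}

omit [CharP k 3] in
theorem IsGenerator.mem_part {i : ZMod 2} {X} (hX : C.IsGenerator ω i X) :
    X ∈ part k (CompositionSuperalgebra.Ambient k (k × OddSpace V) A) i := by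
  cases hX with
  | even σ hσ =>
    exact mem_part_prod.2 ⟨mem_part_pi.2 fun _ => ω.delta_even_mem σ, zero_mem _⟩
  | odd p => exact mem_part_prod.2 ⟨mem_part_pi.2 fun _ => ω.delta_odd_mem p, zero_mem _⟩
  | op e he h =>
    exact mem_part_prod.2 ⟨zero_mem _, mem_part_prod.2 ⟨mem_part_pi.2 he, zero_mem _⟩⟩
  | one n a ha =>
    refine mem_part_prod.2 ⟨zero_mem _, mem_part_prod.2 ⟨zero_mem _, mem_part_pi.2 fun m => ?_⟩⟩
    by_cases h : m = n
    · subst h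
      simpa using tmul_mem_part (SymplecticPlane.one_mem_part (k := k) (V := V)) ha
    · simp [h]
  | vec n v a ha =>
    refine mem_part_prod.2 ⟨zero_mem _, mem_part_prod.2 ⟨zero_mem _, mem_part_pi.2 fun m => ?_⟩⟩
    by_cases h : m = n
    · subst h
      have := tmul_mem_part (SymplecticPlane.odd_mem_part (k := k) v) ha
      rw [(by decide : ∀ i : ZMod 2, 1 + (i + 1) = i) i] at this
      simpa using this
    · simp [h]

theorem IsGenerator.isoMap_mem {i : ZMod 2} {X} (hX : C.IsGenerator ω i X) :
    C.isoMap X ∈ SuperTriple.g ω C.derTJ ⊓ part k (SuperTriple.Ambient k V C.TJ) i := by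
  cases hX with
  | even σ hσ =>
    rw [isoMap_even]
    exact ⟨⟨hσ, zero_mem _, trivial⟩, mem_part_prod.2 ⟨hom_odd_mem σ, zero_mem _⟩⟩
  | odd p =>
    rw [isoMap_odd]
    exact ⟨⟨zero_mem _, zero_mem _, trivial⟩, mem_part_prod.2 ⟨zero_mem _, mem_part_prod.2
      ⟨zero_mem _, odd_tmul_mem _ (C.epsT_mem)⟩⟩⟩
  | op e he h =>
    rw [isoMap_zero_op]
    exact ⟨⟨zero_mem _, C.opD_mem_derTJ h, trivial⟩, mem_part_prod.2 ⟨zero_mem _, mem_part_prod.2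
      ⟨C.opD_mem he, zero_mem _⟩⟩⟩
  | one n a ha =>
    rw [isoMap_one]
    exact ⟨⟨zero_mem _, C.opN_mem_derTJ n a, trivial⟩, mem_part_prod.2 ⟨zero_mem _,
      mem_part_prod.2 ⟨C.opN_mem ha n, zero_mem _⟩⟩⟩
  | vec n v a ha =>
    rw [isoMap_vec]
    exact ⟨⟨zero_mem _, zero_mem _, trivial⟩, mem_part_prod.2 ⟨zero_mem _, mem_part_prod.2
      ⟨zero_mem _, odd_tmul_mem v (C.ioT_mem ha n)⟩⟩⟩

end HurwitzSuperalgebra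

namespace CompositionSuperalgebra

variable {k : Type*} [Field k]
variable {A : Type*} [AddCommGroup A] [Module k A] [Superspace k A]
variable {A' : Type*} [AddCommGroup A'] [Module k A'] [Superspace k A']
variable (S : CompositionSuperalgebra k A) (S' : CompositionSuperalgebra k A')

/-- This and the next two skewness statements are used before the Lie axioms of the source are
known. No such statement is needed inside a single ι_n, where both orders of mixed generators are
treated directly. -/
theorem bracket_op_skew {i j : ZMod 2} {d d' : Fin 3 → (A →ₗ[k] A)}
    {e e' : Fin 3 → (A' →ₗ[k] A')} (hd : ∀ n, d n ∈ part k (A →ₗ[k] A) i)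
    (he : ∀ n, e n ∈ part k (A' →ₗ[k] A') i) (hd' : ∀ n, d' n ∈ part k (A →ₗ[k] A) j)
    (he' : ∀ n, e' n ∈ part k (A' →ₗ[k] A') j) : bracket S S' (d, e, 0) (d', e', 0) =
      -(sgn k (i * j) • bracket S S' (d', e', 0) (d, e, 0)) := by
  rw [bracket_op_op, bracket_op_op]
  refine Prod.ext (funext fun n => ?_) (Prod.ext (funext fun n => ?_) ?_)
  · exact superComm_skew (hd n) (hd' n)
  · exact superComm_skew (he n) (he' n)
  · simp

theorem bracket_single_op_skew {i j : ZMod 2} {d : Fin 3 → (A →ₗ[k] A)}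
    {e : Fin 3 → (A' →ₗ[k] A')} (hd : ∀ n, d n ∈ part k (A →ₗ[k] A) i)
    (he : ∀ n, e n ∈ part k (A' →ₗ[k] A') i) {w : A ⊗[k] A'} (hw : w ∈ part k (A ⊗[k] A') j)
    (n : Fin 3) : bracket S S' (0, 0, Pi.single n w) (d, e, 0) =
      -(sgn k (j * i) • bracket S S' (d, e, 0) (0, 0, Pi.single n w)) := by
  rw [bracket_single_op, bracket_op_single, sflip_apply _ (hd n) hw, sflip_apply _ (he n) hw,
    mul_comm i j]
  refine Prod.ext (by simp) (Prod.ext (by simp) ?_)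
  simp only [Prod.smul_snd, Prod.snd_neg, ← Pi.single_smul', ← Pi.single_neg]
  congr 1
  module

theorem bracket_single_skew {i j : ZMod 2} {w w' : A ⊗[k] A'} (hw : w ∈ part k (A ⊗[k] A') i)
    (hw' : w' ∈ part k (A ⊗[k] A') j) (n : Fin 3) :
    bracket S S' (0, 0, Pi.single (n + 1) w) (0, 0, Pi.single n w') =
      -(sgn k (i * j) • bracket S S' (0, 0, Pi.single n w') (0, 0, Pi.single (n + 1) w)) := by
  rw [bracket_succ_single, bracket_single_succ, sflip_apply _ hw' hw, mul_comm j i]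
  refine Prod.ext (by simp) (Prod.ext (by simp) ?_)
  simp only [Prod.smul_snd, Prod.snd_neg, ← Pi.single_smul', ← Pi.single_neg]

end CompositionSuperalgebra

end Supersquare
end

/-! ### Compatibility with the bracket, for each type of pair of generators. -/

noncomputable section

namespace Supersquare

namespace HurwitzSuperalgebra

variable {k : Type*} [Field k] [CharP k 3] {V : Type*} [AddCommGroup V] [Module k V]
variable (ω : SymplecticPlane k V)
variable {A : Type*} [AddCommGroup A] [Module k A] [Superspace k A]
variable (C : HurwitzSuperalgebra k A)

theorem isZ2GradedLieSuperalgebra_gJ : IsZ2GradedLieSuperalgebra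
    (SuperTriple.bracket C.tripleTJ ω) (SuperTriple.g ω C.derTJ) (SuperTriple.gZero ω C.derTJ)
    (SuperTriple.gOne k V C.TJ) :=
  SuperTriple.isZ2GradedLieSuperalgebra_g ω C.tripleTJ_isOrthosymplectic C.tripleTJ_isAdmissible
    fun _ _ _ hd _ hx y => C.derTJ_form hd.2 hd.1 hx y

/-- `isoMap` preserves the bracket of `X` and `Y`. -/
def MapsBracket (X Y : CompositionSuperalgebra.Ambient k (k × OddSpace V) A) : Prop :=
  C.isoMap (CompositionSuperalgebra.bracket ω.S12 C.paraHurwitz X Y) =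
    SuperTriple.bracket C.tripleTJ ω (C.isoMap X) (C.isoMap Y)

variable {ω C} in
-- The target bracket is already known to be superanticommutative on 𝔤(J); for the source this is an
-- assumption on the given pair, as its Lie axioms are deduced only later.
theorem MapsBracket.swap {i j : ZMod 2} {X Y} (hX : C.IsGenerator ω i X)
    (hY : C.IsGenerator ω j Y) (h : C.MapsBracket ω Y X)
    (hs : CompositionSuperalgebra.bracket ω.S12 C.paraHurwitz X Y =
      -(sgn k (i * j) • CompositionSuperalgebra.bracket ω.S12 C.paraHurwitz Y X)) :
    C.MapsBracket ω X Y := by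
  have h' : C.isoMap (CompositionSuperalgebra.bracket ω.S12 C.paraHurwitz Y X) =
    SuperTriple.bracket C.tripleTJ ω (C.isoMap Y) (C.isoMap X) := h
  rw [MapsBracket, hs, map_neg, map_smul, h']
  exact ((C.isZ2GradedLieSuperalgebra_gJ ω).skew i j _ hX.isoMap_mem _ hY.isoMap_mem).symm

theorem isoMap_single_smul (n : Fin 3) (c : k) (x : k × OddSpace V) (a : A) :
    C.isoMap (0, 0, Pi.single n (c • x ⊗ₜ[k] a)) =
      c • (0, x.1 • C.opN n a, x.2 ⊗ₜ[k] C.ioT n a) := by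
  rw [← isoMap_single, ← map_smul]
  congr 1
  refine Prod.ext (by simp) (Prod.ext (by simp) ?_)
  exact Pi.single_smul' n c (x ⊗ₜ[k] a)

theorem mapsBracket_even_even (σ σ' : OddSpace V →ₗ[k] OddSpace V) :
    C.MapsBracket ω (fun _ => ω.delta (σ, 0), 0, 0) (fun _ => ω.delta (σ', 0), 0, 0) := by
  rw [MapsBracket, CompositionSuperalgebra.bracket_op_op]
  simp only [ω.superComm_delta_even_even, Pi.zero_apply, map_zero]
  rw [isoMap_even, isoMap_even, SuperTriple.bracket_op_op]
  refine (C.isoMap_even ω _).trans ?_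
  simp

theorem mapsBracket_even_odd {σ : OddSpace V →ₗ[k] OddSpace V} (hσ : σ ∈ ω.sp) (p : OddSpace V) :
    C.MapsBracket ω (fun _ => ω.delta (σ, 0), 0, 0) (fun _ => ω.delta (0, p), 0, 0) := by
  rw [MapsBracket, CompositionSuperalgebra.bracket_op_op]
  simp only [ω.superComm_delta_even_odd hσ, Pi.zero_apply, map_zero]
  rw [isoMap_even, isoMap_odd, SuperTriple.bracket_op_tmul ω σ (i := 0) (zero_mem _)]
  refine (C.isoMap_odd ω _).trans ?_
  simp

theorem mapsBracket_odd_odd (p p' : OddSpace V) :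
    C.MapsBracket ω (fun _ => ω.delta (0, p), 0, 0) (fun _ => ω.delta (0, p'), 0, 0) := by
  rw [MapsBracket, CompositionSuperalgebra.bracket_op_op]
  simp only [ω.superComm_delta_odd_odd, Pi.zero_apply, map_zero]
  rw [isoMap_odd, isoMap_odd, SuperTriple.bracket_tmul_tmul ω _ _ C.epsT_mem, form_epsT,
    d_epsT_epsT]
  refine (C.isoMap_even ω _).trans ?_
  simp

theorem bracket_delta_op (q) (e : Fin 3 → (A →ₗ[k] A)) :
    CompositionSuperalgebra.bracket ω.S12 C.paraHurwitz (fun _ => ω.delta q, 0, 0) (0, e, 0) =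
      0 := by
  rw [CompositionSuperalgebra.bracket_op_op]
  refine Prod.ext (funext fun n => ?_) (Prod.ext (funext fun n => ?_) rfl) <;> simp

theorem mapsBracket_even_op (σ : OddSpace V →ₗ[k] OddSpace V) (e : Fin 3 → (A →ₗ[k] A)) :
    C.MapsBracket ω (fun _ => ω.delta (σ, 0), 0, 0) (0, e, 0) := by
  rw [MapsBracket, bracket_delta_op, isoMap_even, isoMap_zero_op, SuperTriple.bracket_op_op]
  simp
  rfl

theorem mapsBracket_odd_op {i : ZMod 2} (p : OddSpace V) {e : Fin 3 → (A →ₗ[k] A)}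
    (he : ∀ n, e n ∈ part k (A →ₗ[k] A) i) :
    C.MapsBracket ω (fun _ => ω.delta (0, p), 0, 0) (0, e, 0) := by
  rw [MapsBracket, bracket_delta_op, isoMap_odd, isoMap_zero_op,
    SuperTriple.bracket_tmul_op ω (j := 1) (zero_mem _) (C.opD_mem he) _ C.epsT_mem, opD_epsT]
  simp
  rfl

theorem mapsBracket_op_op {i j : ZMod 2} {e e' : Fin 3 → (A →ₗ[k] A)}
    (he : ∀ n, e n ∈ part k (A →ₗ[k] A) i) (he' : ∀ n, e' n ∈ part k (A →ₗ[k] A) j) :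
    C.MapsBracket (V := V) ω (0, e, 0) (0, e', 0) := by
  rw [MapsBracket, CompositionSuperalgebra.bracket_op_op, isoMap_zero_op, isoMap_zero_op,
    SuperTriple.bracket_op_op, C.superComm_opD he he']
  simp only [Pi.zero_apply, map_zero]
  exact C.isoMap_zero_op _

theorem mapsBracket_even_one (σ : OddSpace V →ₗ[k] OddSpace V) (n : Fin 3) (a : A) :
    C.MapsBracket ω (fun _ => ω.delta (σ, 0), 0, 0) (0, 0, Pi.single n ((1, 0) ⊗ₜ[k] a)) := by
  rw [MapsBracket, CompositionSuperalgebra.bracket_op_single, isoMap_even, isoMap_one,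
    SuperTriple.bracket_op_op, actLeft_tmul, Pi.zero_apply, map_zero, LinearMap.zero_apply,
    add_zero, isoMap_single]
  simp [SymplecticPlane.delta_apply]

theorem mapsBracket_even_vec (σ : OddSpace V →ₗ[k] OddSpace V) (n : Fin 3) (v : OddSpace V)
    (a : A) :
    C.MapsBracket ω (fun _ => ω.delta (σ, 0), 0, 0) (0, 0, Pi.single n ((0, v) ⊗ₜ[k] a)) := by
  rw [MapsBracket, CompositionSuperalgebra.bracket_op_single, isoMap_even, isoMap_vec,
    SuperTriple.bracket_op_tmul ω σ (i := 0) (zero_mem _), actLeft_tmul, Pi.zero_apply, map_zero,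
    LinearMap.zero_apply, add_zero, isoMap_single]
  simp [SymplecticPlane.delta_apply]

theorem mapsBracket_odd_one {i : ZMod 2} (p : OddSpace V) (n : Fin 3) {a : A}
    (ha : a ∈ part k A i) :
    C.MapsBracket ω (fun _ => ω.delta (0, p), 0, 0) (0, 0, Pi.single n ((1, 0) ⊗ₜ[k] a)) := by
  rw [MapsBracket, CompositionSuperalgebra.bracket_op_single, isoMap_odd, isoMap_one,
    SuperTriple.bracket_tmul_op ω (j := 1) (zero_mem _) (C.opN_mem ha n) _ C.epsT_mem, opN_epsT,
    actLeft_tmul, Pi.zero_apply, map_zero, LinearMap.zero_apply, add_zero, isoMap_single]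
  rcases parity_cases i with rfl | rfl <;>
    simp [SymplecticPlane.delta_apply, TensorProduct.neg_tmul]

theorem mapsBracket_odd_vec (p : OddSpace V) (n : Fin 3) (v : OddSpace V) (a : A) :
    C.MapsBracket ω (fun _ => ω.delta (0, p), 0, 0) (0, 0, Pi.single n ((0, v) ⊗ₜ[k] a)) := by
  rw [MapsBracket, CompositionSuperalgebra.bracket_op_single, isoMap_odd, isoMap_vec,
    SuperTriple.bracket_tmul_tmul ω _ _ C.epsT_mem, form_ioT, d_epsT_ioT, coT_epsT,
    actLeft_tmul, Pi.zero_apply, map_zero, LinearMap.zero_apply, add_zero, isoMap_single]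
  simp [SymplecticPlane.delta_apply]

theorem mapsBracket_op_one {i j : ZMod 2} {e : Fin 3 → (A →ₗ[k] A)}
    (he : ∀ n, e n ∈ part k (A →ₗ[k] A) i) (h : e ∈ C.paraHurwitz.tri) (n : Fin 3) {a : A}
    (ha : a ∈ part k A j) :
    C.MapsBracket (V := V) ω (0, e, 0) (0, 0, Pi.single n ((1, 0) ⊗ₜ[k] a)) := by
  rw [MapsBracket, CompositionSuperalgebra.bracket_op_single, isoMap_zero_op, isoMap_one,
    SuperTriple.bracket_op_op, C.superComm_opD_opN he h ha,
    actRight_tmul (he n) (SymplecticPlane.one_mem_part (k := k) (V := V)), Pi.zero_apply, map_zero,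
    LinearMap.zero_apply, zero_add, isoMap_single_smul]
  simp

theorem mapsBracket_op_vec {i : ZMod 2} {e : Fin 3 → (A →ₗ[k] A)}
    (he : ∀ n, e n ∈ part k (A →ₗ[k] A) i) (n : Fin 3) (v : OddSpace V) (a : A) :
    C.MapsBracket ω (0, e, 0) (0, 0, Pi.single n ((0, v) ⊗ₜ[k] a)) := by
  rw [MapsBracket, CompositionSuperalgebra.bracket_op_single, isoMap_zero_op, isoMap_vec,
    SuperTriple.bracket_op_tmul ω _ (C.opD_mem he), opD_ioT,
    actRight_tmul (he n) (SymplecticPlane.odd_mem_part v), Pi.zero_apply, map_zero,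
    LinearMap.zero_apply, zero_add, isoMap_single_smul]
  simp

-- A constant triple is fixed by θ, so the powers of θ disappear from the 𝔱𝔯𝔦(S_{1,2}) component of
-- the brackets.
omit [CharP k 3] in
theorem theta_smul_delta (n : Fin 3) (c c' : k) (q) :
    CompositionSuperalgebra.theta k (k × OddSpace V) n (c • c' • fun _ => ω.delta q) =
      fun _ => ω.delta ((c * c') • q) := by
  funext m
  rw [map_smul (ω.delta), mul_smul]
  rfl

theorem mapsBracket_one_one {i j : ZMod 2} (n : Fin 3) {a c : A} (ha : a ∈ part k A i)
    (hc : c ∈ part k A j) :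
    C.MapsBracket (V := V) ω (0, 0, Pi.single n ((1, 0) ⊗ₜ[k] a))
      (0, 0, Pi.single n ((1, 0) ⊗ₜ[k] c)) := by
  have h3 := three_eq_zero_of_char k
  have h1 := SymplecticPlane.one_mem_part (k := k) (V := V)
  rw [MapsBracket, CompositionSuperalgebra.bracket_single_self,
    CompositionSuperalgebra.tensorT_tmul _ _ h1 ha h1 hc, ω.S12_t_one_one, smul_zero, smul_zero,
    map_zero, isoMap_zero_op, isoMap_one, isoMap_one, SuperTriple.bracket_op_op,
    C.superComm_opN_self ha hc, CompositionSuperalgebra.tensorT'_tmul _ _ ha h1, ω.S12_b]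
  refine Prod.ext (by simp) (Prod.ext ?_ rfl)
  simp
  -- In S_{1,2} one has b(1,1) = 2, which equals the coefficient -1 of `superComm_opN_self`.
  linear_combination (norm := module) h3 • C.opD
    (CompositionSuperalgebra.theta k A n (C.paraHurwitz.t a c))

theorem mapsBracket_one_vec {i j : ZMod 2} (n : Fin 3) (v : OddSpace V) {a c : A}
    (ha : a ∈ part k A i) (hc : c ∈ part k A j) :
    C.MapsBracket ω (0, 0, Pi.single n ((1, 0) ⊗ₜ[k] a))
      (0, 0, Pi.single n ((0, v) ⊗ₜ[k] c)) := by
  have h1 := SymplecticPlane.one_mem_part (k := k) (V := V)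
  have hv := SymplecticPlane.odd_mem_part (k := k) v
  have hb := C.b_even i j
  rw [MapsBracket, CompositionSuperalgebra.bracket_single_self,
    CompositionSuperalgebra.tensorT_tmul _ _ h1 ha hv hc, ω.S12_t_one_odd, theta_smul_delta,
    isoMap_op, isoMap_one, isoMap_vec, SuperTriple.bracket_op_tmul ω _ (C.opN_mem ha n),
    opN_ioT_self, CompositionSuperalgebra.tensorT'_tmul _ _ ha hv, ω.S12_b, paraHurwitz_b]
  refine Prod.ext (by simp) (Prod.ext (by simp) ?_)
  rcases parity_cases i with rfl | rfl <;> rcases parity_cases j with rfl | rfl <;>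
    simp [hb, ha, hc, TensorProduct.neg_tmul, TensorProduct.smul_tmul']

theorem mapsBracket_vec_one {i j : ZMod 2} (n : Fin 3) (v : OddSpace V) {a c : A}
    (ha : a ∈ part k A i) (hc : c ∈ part k A j) :
    C.MapsBracket ω (0, 0, Pi.single n ((0, v) ⊗ₜ[k] a))
      (0, 0, Pi.single n ((1, 0) ⊗ₜ[k] c)) := by
  have h1 := SymplecticPlane.one_mem_part (k := k) (V := V)
  have hv := SymplecticPlane.odd_mem_part (k := k) v
  have ha' : C.ioT n a ∈ part k C.TJ (i + 1 + 1) := by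
    rw [add_assoc, one_add_one, add_zero]; exact C.ioT_mem ha n
  have hb := C.b_even i j
  have hs := C.b_supersymm j i c hc a ha
  rw [MapsBracket, CompositionSuperalgebra.bracket_single_self,
    CompositionSuperalgebra.tensorT_tmul _ _ hv ha h1 hc, ω.S12_t_odd_one, theta_smul_delta,
    isoMap_op, isoMap_one, isoMap_vec, SuperTriple.bracket_tmul_op ω (zero_mem _)
      (C.opN_mem hc n) v ha',
    opN_ioT_self, CompositionSuperalgebra.tensorT'_tmul _ _ ha h1, ω.S12_b, paraHurwitz_b, hs]
  refine Prod.ext (by simp) (Prod.ext (by simp) ?_)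
  rcases parity_cases i with rfl | rfl <;> rcases parity_cases j with rfl | rfl <;>
    simp [hb, ha, hc, TensorProduct.tmul_neg, TensorProduct.tmul_smul, TensorProduct.smul_tmul']

/-- The two parts of the bracket correspond separately: t_{u,v} = δ_{-γ_{u,v},0} gives the 𝔰𝔭(V)
term with (ι_n(a)|ι_n(c)) = b(a,c), and ⟨u|v⟩ θ^n(t_{a,c}) gives the inner operator [ι_n(a), ι_n(c),
·]. -/
theorem mapsBracket_vec_vec {i j : ZMod 2} (n : Fin 3) (u v : OddSpace V) {a c : A}
    (ha : a ∈ part k A i) (hc : c ∈ part k A j) :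
    C.MapsBracket ω (0, 0, Pi.single n ((0, u) ⊗ₜ[k] a))
      (0, 0, Pi.single n ((0, v) ⊗ₜ[k] c)) := by
  have hu := SymplecticPlane.odd_mem_part (k := k) u
  have hv := SymplecticPlane.odd_mem_part (k := k) v
  rw [MapsBracket, CompositionSuperalgebra.bracket_single_self,
    CompositionSuperalgebra.tensorT_tmul _ _ hu ha hv hc, ω.S12_t_odd_odd, theta_smul_delta,
    isoMap_op, isoMap_vec, isoMap_vec, SuperTriple.bracket_tmul_tmul ω u v (C.ioT_mem ha n),
    form_ioT, d_ioT_self, coT_ioT, if_pos rfl, CompositionSuperalgebra.tensorT'_tmul _ _ ha hv,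
    ω.S12_b, paraHurwitz_b]
  refine Prod.ext ?_ (Prod.ext ?_ ?_)
  · rcases parity_cases i with rfl | rfl <;> rcases parity_cases j with rfl | rfl <;> simp
  · simp
  · simp

theorem mapsBracket_one_succ_one {i j : ZMod 2} (n : Fin 3) {a c : A} (ha : a ∈ part k A i)
    (hc : c ∈ part k A j) :
    C.MapsBracket (V := V) ω (0, 0, Pi.single n ((1, 0) ⊗ₜ[k] a))
      (0, 0, Pi.single (n + 1) ((1, 0) ⊗ₜ[k] c)) := by
  rw [MapsBracket, CompositionSuperalgebra.bracket_single_succ,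
    CompositionSuperalgebra.tensorMul_tmul _ _ ha (SymplecticPlane.one_mem_part (k := k) (V := V)),
    isoMap_single_smul, isoMap_one, isoMap_one, SuperTriple.bracket_op_op,
    C.superComm_opN_succ ha hc, ω.S12_mul]
  simp

theorem mapsBracket_one_succ_vec {i : ZMod 2} (n : Fin 3) (v : OddSpace V) {a : A}
    (ha : a ∈ part k A i) (c : A) :
    C.MapsBracket ω (0, 0, Pi.single n ((1, 0) ⊗ₜ[k] a))
      (0, 0, Pi.single (n + 1) ((0, v) ⊗ₜ[k] c)) := by
  rw [MapsBracket, CompositionSuperalgebra.bracket_single_succ,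
    CompositionSuperalgebra.tensorMul_tmul _ _ ha (SymplecticPlane.odd_mem_part v),
    isoMap_single_smul, isoMap_one, isoMap_vec, SuperTriple.bracket_op_tmul ω _ (C.opN_mem ha n),
    opN_ioT_succ, ω.S12_mul]
  simp [TensorProduct.neg_tmul, TensorProduct.tmul_neg]

theorem mapsBracket_vec_succ_one {i j : ZMod 2} (n : Fin 3) (v : OddSpace V) {a c : A}
    (ha : a ∈ part k A i) (hc : c ∈ part k A j) :
    C.MapsBracket ω (0, 0, Pi.single n ((0, v) ⊗ₜ[k] a))
      (0, 0, Pi.single (n + 1) ((1, 0) ⊗ₜ[k] c)) := by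
  have ha' : C.ioT n a ∈ part k C.TJ (i + 1 + 1) := by
    rw [add_assoc, one_add_one, add_zero]; exact C.ioT_mem ha n
  rw [MapsBracket, CompositionSuperalgebra.bracket_single_succ,
    CompositionSuperalgebra.tensorMul_tmul _ _ ha (SymplecticPlane.one_mem_part (k := k) (V := V)),
    isoMap_single_smul, isoMap_one, isoMap_vec, SuperTriple.bracket_tmul_op ω (zero_mem _)
      (C.opN_mem hc _) v ha', opN_succ_ioT, C.paraHurwitz.r_apply hc ha, ω.S12_mul]
  refine Prod.ext (by simp) (Prod.ext (by simp) ?_)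
  rcases parity_cases i with rfl | rfl <;> rcases parity_cases j with rfl | rfl <;>
    simp [TensorProduct.neg_tmul, TensorProduct.tmul_neg]

theorem mapsBracket_vec_succ_vec {i : ZMod 2} (n : Fin 3) (u v : OddSpace V) {a : A}
    (ha : a ∈ part k A i) (c : A) :
    C.MapsBracket ω (0, 0, Pi.single n ((0, u) ⊗ₜ[k] a))
      (0, 0, Pi.single (n + 1) ((0, v) ⊗ₜ[k] c)) := by
  rw [MapsBracket, CompositionSuperalgebra.bracket_single_succ,
    CompositionSuperalgebra.tensorMul_tmul _ _ ha (SymplecticPlane.odd_mem_part v),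
    isoMap_single_smul, isoMap_vec, isoMap_vec,
    SuperTriple.bracket_tmul_tmul ω u v (C.ioT_mem ha n), form_ioT, coT_ioT, d_ioT_succ,
    if_neg (by revert n; decide), ω.S12_mul]
  simp

end HurwitzSuperalgebra

end Supersquare
end

/-! ### All pairs of generators, by symmetry. -/

noncomputable section

namespace Supersquare

namespace HurwitzSuperalgebra

variable {k : Type*} [Field k] [CharP k 3] {V : Type*} [AddCommGroup V] [Module k V]
variable {ω : SymplecticPlane k V}
variable {A : Type*} [AddCommGroup A] [Module k A] [Superspace k A]
variable {C : HurwitzSuperalgebra k A}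

omit [CharP k 3] in
theorem IsGenerator.op_mem {i : ZMod 2} {d : Fin 3 → ((k × OddSpace V) →ₗ[k] (k × OddSpace V))}
    {e : Fin 3 → (A →ₗ[k] A)} {w : Fin 3 → ((k × OddSpace V) ⊗[k] A)}
    (h : C.IsGenerator ω i (d, e, w)) :
    (∀ n, d n ∈ part k ((k × OddSpace V) →ₗ[k] (k × OddSpace V)) i) ∧
      (∀ n, e n ∈ part k (A →ₗ[k] A) i) ∧ ∀ n, w n ∈ part k ((k × OddSpace V) ⊗[k] A) i := by
  have h := h.mem_part
  rw [mem_part_prod, mem_part_prod, mem_part_pi, mem_part_pi, mem_part_pi] at h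
  exact h

omit [CharP k 3] in
theorem IsGenerator.single_mem {i : ZMod 2} {n : Fin 3} {w : (k × OddSpace V) ⊗[k] A}
    (h : C.IsGenerator ω i (0, 0, Pi.single n w)) : w ∈ part k ((k × OddSpace V) ⊗[k] A) i := by
  have h := h.op_mem.2.2 n
  rwa [Pi.single_eq_same] at h

theorem mapsBracket_op_of_swap {i j : ZMod 2}
    {d d' : Fin 3 → ((k × OddSpace V) →ₗ[k] (k × OddSpace V))} {e e' : Fin 3 → (A →ₗ[k] A)}
    (h : C.IsGenerator ω i (d, e, 0)) (h' : C.IsGenerator ω j (d', e', 0))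
    (H : C.MapsBracket ω (d', e', 0) (d, e, 0)) : C.MapsBracket ω (d, e, 0) (d', e', 0) := by
  refine MapsBracket.swap h h' H ?_
  rw [CompositionSuperalgebra.bracket_op_skew _ _ h.op_mem.1 h.op_mem.2.1 h'.op_mem.1
    h'.op_mem.2.1]

theorem mapsBracket_single_op_of_swap {i j : ZMod 2} {n : Fin 3} {w : (k × OddSpace V) ⊗[k] A}
    {d : Fin 3 → ((k × OddSpace V) →ₗ[k] (k × OddSpace V))} {e : Fin 3 → (A →ₗ[k] A)}
    (hw : C.IsGenerator ω i (0, 0, Pi.single n w)) (h : C.IsGenerator ω j (d, e, 0))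
    (H : C.MapsBracket ω (d, e, 0) (0, 0, Pi.single n w)) :
    C.MapsBracket ω (0, 0, Pi.single n w) (d, e, 0) := by
  refine MapsBracket.swap hw h H ?_
  rw [CompositionSuperalgebra.bracket_single_op_skew _ _ h.op_mem.1 h.op_mem.2.1 hw.single_mem]

theorem mapsBracket_single_of_swap {i j : ZMod 2} {n : Fin 3} {w w' : (k × OddSpace V) ⊗[k] A}
    (hw : C.IsGenerator ω i (0, 0, Pi.single (n + 1) w))
    (hw' : C.IsGenerator ω j (0, 0, Pi.single n w'))
    (H : C.MapsBracket ω (0, 0, Pi.single n w') (0, 0, Pi.single (n + 1) w)) :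
    C.MapsBracket ω (0, 0, Pi.single (n + 1) w) (0, 0, Pi.single n w') := by
  refine MapsBracket.swap hw hw' H ?_
  rw [CompositionSuperalgebra.bracket_single_skew _ _ hw.single_mem hw'.single_mem]

theorem fin_three_cases (m n : Fin 3) : n = m ∨ n = m + 1 ∨ m = n + 1 := by
  revert m n; decide

/-- `isoMap` preserves the brackets of the generators. -/
theorem IsGenerator.mapsBracket {i j : ZMod 2} {X Y} (hX : C.IsGenerator ω i X)
    (hY : C.IsGenerator ω j Y) : C.MapsBracket ω X Y := by
  cases hX with
  | even σ hσ =>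
    have hX : C.IsGenerator ω 0 _ := .even σ hσ
    cases hY with
    | even σ' hσ' => exact C.mapsBracket_even_even ω σ σ'
    | odd p => exact C.mapsBracket_even_odd ω hσ p
    | op e he h => exact C.mapsBracket_even_op ω σ e
    | one n a ha => exact C.mapsBracket_even_one ω σ n a
    | vec n v a ha => exact C.mapsBracket_even_vec ω σ n v a
  | odd p =>
    have hX : C.IsGenerator ω 1 _ := .odd p
    cases hY with
    | even σ' hσ' =>
      exact mapsBracket_op_of_swap hX (.even σ' hσ') (C.mapsBracket_even_odd ω hσ' p)
    | odd p' => exact C.mapsBracket_odd_odd ω p p'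
    | op e he h => exact C.mapsBracket_odd_op ω p he
    | one n a ha => exact C.mapsBracket_odd_one ω p n ha
    | vec n v a ha => exact C.mapsBracket_odd_vec ω p n v a
  | op e he h =>
    have hX : C.IsGenerator ω _ _ := .op e he h
    cases hY with
    | even σ' hσ' =>
      exact mapsBracket_op_of_swap hX (.even σ' hσ') (C.mapsBracket_even_op ω σ' e)
    | odd p' => exact mapsBracket_op_of_swap hX (.odd p') (C.mapsBracket_odd_op ω p' he)
    | op e' he' h' => exact C.mapsBracket_op_op ω he he'
    | one n a ha => exact C.mapsBracket_op_one ω he h n ha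
    | vec n v a ha => exact C.mapsBracket_op_vec ω he n v a
  | one n a ha =>
    have hX : C.IsGenerator ω _ _ := .one n a ha
    cases hY with
    | even σ' hσ' =>
      exact mapsBracket_single_op_of_swap hX (.even σ' hσ') (C.mapsBracket_even_one ω σ' n a)
    | odd p' =>
      exact mapsBracket_single_op_of_swap hX (.odd p') (C.mapsBracket_odd_one ω p' n ha)
    | op e' he' h' =>
      exact mapsBracket_single_op_of_swap hX (.op e' he' h') (C.mapsBracket_op_one ω he' h' n ha)
    | one m c hc =>
      obtain rfl | rfl | rfl := fin_three_cases n m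
      · exact C.mapsBracket_one_one ω _ ha hc
      · exact C.mapsBracket_one_succ_one ω _ ha hc
      · exact mapsBracket_single_of_swap hX (.one m c hc) (C.mapsBracket_one_succ_one ω _ hc ha)
    | vec m v c hc =>
      obtain rfl | rfl | rfl := fin_three_cases n m
      · exact C.mapsBracket_one_vec ω _ v ha hc
      · exact C.mapsBracket_one_succ_vec ω _ v ha c
      · exact mapsBracket_single_of_swap hX (.vec m v c hc) (C.mapsBracket_vec_succ_one ω _ v hc ha)
  | vec n u a ha =>
    have hX : C.IsGenerator ω _ _ := .vec n u a ha
    cases hY with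
    | even σ' hσ' =>
      exact mapsBracket_single_op_of_swap hX (.even σ' hσ') (C.mapsBracket_even_vec ω σ' n u a)
    | odd p' =>
      exact mapsBracket_single_op_of_swap hX (.odd p') (C.mapsBracket_odd_vec ω p' n u a)
    | op e' he' h' =>
      exact mapsBracket_single_op_of_swap hX (.op e' he' h') (C.mapsBracket_op_vec ω he' n u a)
    | one m c hc =>
      obtain rfl | rfl | rfl := fin_three_cases n m
      · exact C.mapsBracket_vec_one ω _ u ha hc
      · exact C.mapsBracket_vec_succ_one ω _ u ha hc
      · exact mapsBracket_single_of_swap hX (.one m c hc) (C.mapsBracket_one_succ_vec ω _ u hc a)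
    | vec m v c hc =>
      obtain rfl | rfl | rfl := fin_three_cases n m
      · exact C.mapsBracket_vec_vec ω _ u v ha hc
      · exact C.mapsBracket_vec_succ_vec ω _ u v ha c
      · exact mapsBracket_single_of_swap hX (.vec m v c hc) (C.mapsBracket_vec_succ_vec ω _ v u hc a)

end HurwitzSuperalgebra

end Supersquare
end

/-! ### Transport along an injective map, closure of 𝔤(S_{1,2}, S), and extension from generators.
-/

noncomputable section

namespace Supersquare

section

variable {k : Type*} [Field k]
variable {L : Type*} [AddCommGroup L] [Module k L] [Superspace k L]
variable {L' : Type*} [AddCommGroup L'] [Module k L'] [Superspace k L']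

/-- Lie superalgebras pull back along injective even linear maps that preserve the brackets. -/
theorem IsLieSuperalgebra.of_injective {br : L →ₗ[k] L →ₗ[k] L} {g : Submodule k L}
    {br' : L' →ₗ[k] L' →ₗ[k] L'} {g' : Submodule k L'} (h : IsLieSuperalgebra br' g')
    (Φ : L →ₗ[k] L') (hm : ∀ x ∈ g, Φ x ∈ g') (hi : ∀ x ∈ g, Φ x = 0 → x = 0)
    (hp : ∀ i, ∀ x ∈ g, Φ (pr k i x) = pr k i (Φ x))
    (hb : ∀ x ∈ g, ∀ y ∈ g, Φ (br x y) = br' (Φ x) (Φ y))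
    (graded : ∀ i, ∀ x ∈ g, pr k i x ∈ g) (closed : ∀ x ∈ g, ∀ y ∈ g, br x y ∈ g) :
    IsLieSuperalgebra br g := by
  have eq : ∀ x ∈ g, ∀ y ∈ g, Φ x = Φ y → x = y := fun x hx y hy e =>
    sub_eq_zero.1 (hi _ (sub_mem hx hy) (by rw [map_sub, e, sub_self]))
  have part_mem : ∀ i, ∀ x ∈ g ⊓ part k L i, Φ x ∈ g' ⊓ part k L' i := fun i x hx =>
    ⟨hm x hx.1, mem_part.2 ((hp i x hx.1).symm.trans (congrArg Φ (mem_part.1 hx.2)))⟩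
  refine ⟨graded, closed, fun i j x hx y hy => ?_, fun i j x hx y hy => ?_,
    fun i j x hx y hy z hz => ?_, fun x hx => ?_⟩
  · have hxy := closed x hx.1 y hy.1
    refine eq _ (graded _ _ hxy) _ hxy ?_
    rw [LinearMap.id_apply, hp _ _ hxy, hb x hx.1 y hy.1]
    exact h.parity i j _ (part_mem i x hx) _ (part_mem j y hy)
  · refine eq _ (closed x hx.1 y hy.1) _
      (neg_mem (Submodule.smul_mem _ _ (closed y hy.1 x hx.1))) ?_
    rw [map_neg, map_smul, hb x hx.1 y hy.1, hb y hy.1 x hx.1]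
    exact h.skew i j _ (part_mem i x hx) _ (part_mem j y hy)
  · have hx' := hx.1
    have hy' := hy.1
    refine eq _ (closed x hx' _ (closed y hy' z hz)) _ (add_mem (closed _ (closed x hx' y hy') z hz)
      (Submodule.smul_mem _ _ (closed y hy' _ (closed x hx' z hz)))) ?_
    rw [map_add, map_smul, hb x hx' _ (closed y hy' z hz), hb y hy' z hz,
      hb _ (closed x hx' y hy') z hz, hb x hx' y hy', hb y hy' _ (closed x hx' z hz),
      hb x hx' z hz]
    exact h.jacobi i j _ (part_mem i x hx) _ (part_mem j y hy) _ (hm z hz)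
  · have hx' := hx.1
    refine hi _ (closed x hx' _ (closed x hx' x hx')) ?_
    rw [hb x hx' _ (closed x hx' x hx'), hb x hx' x hx']
    exact h.cube _ (part_mem 1 x hx)

omit [Superspace k L] [Superspace k L'] in
/-- A linear map preserves brackets on the span of a set if it preserves them on that set. -/
theorem map_bracket_of_mem_span {br : L →ₗ[k] L →ₗ[k] L} {br' : L' →ₗ[k] L' →ₗ[k] L'}
    {Φ : L →ₗ[k] L'} {s : Set L} (h : ∀ x ∈ s, ∀ y ∈ s, Φ (br x y) = br' (Φ x) (Φ y)) {x y : L}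
    (hx : x ∈ Submodule.span k s) (hy : y ∈ Submodule.span k s) :
    Φ (br x y) = br' (Φ x) (Φ y) := by
  induction hx, hy using Submodule.span_induction₂ with
  | mem_mem x y hx hy => exact h x hx y hy
  | zero_left => simp
  | zero_right => simp
  | add_left x x' y _ _ _ h h' => simp only [map_add, LinearMap.add_apply, h, h']
  | add_right x y y' _ _ _ h h' => simp only [map_add, h, h']
  | smul_left c x y _ _ h => simp only [map_smul, LinearMap.smul_apply, h]
  | smul_right c x y _ _ h => simp only [map_smul, h]

/-- A linear map commutes with the projections on the span of a set if it does so on that set. -/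
theorem map_pr_of_mem_span {Φ : L →ₗ[k] L'} {s : Set L} {i : ZMod 2}
    (h : ∀ x ∈ s, Φ (pr k i x) = pr k i (Φ x)) {x : L} (hx : x ∈ Submodule.span k s) :
    Φ (pr k i x) = pr k i (Φ x) :=
  (Submodule.span_le (p := LinearMap.eqLocus (Φ ∘ₗ pr k i) (pr k i ∘ₗ Φ))).2 h hx

theorem map_pr_of_mem_part {Φ : L →ₗ[k] L'} {x : L} {j : ZMod 2} (h : x ∈ part k L j)
    (h' : Φ x ∈ part k L' j) (i : ZMod 2) : Φ (pr k i x) = pr k i (Φ x) := by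
  rw [pr_of_mem h, pr_of_mem h']
  split_ifs <;> simp

/-- Linear maps that are bijective on subspaces, even, and preserve the brackets. -/
def LieSuperIso.ofBijOn {br : L →ₗ[k] L →ₗ[k] L} {g : Submodule k L} {br' : L' →ₗ[k] L' →ₗ[k] L'}
    {g' : Submodule k L'} (Φ : L →ₗ[k] L') (hm : ∀ x ∈ g, Φ x ∈ g')
    (hi : ∀ x ∈ g, Φ x = 0 → x = 0) (hs : ∀ y ∈ g', ∃ x ∈ g, Φ x = y)
    (hp : ∀ i, ∀ x ∈ g, Φ (pr k i x) = pr k i (Φ x))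
    (hb : ∀ x ∈ g, ∀ y ∈ g, Φ (br x y) = br' (Φ x) (Φ y)) : LieSuperIso br g br' g' where
  toEquiv := LinearEquiv.ofBijective (Φ.restrict hm)
    ⟨(injective_iff_map_eq_zero _).2 fun x h =>
      Subtype.ext (hi x x.2 (congrArg Subtype.val h)), fun y =>
      let ⟨x, hx, e⟩ := hs y y.2
      ⟨⟨x, hx⟩, Subtype.ext e⟩⟩
  map_pr i x y h := by
    change Φ y = pr k i (Φ x)
    rw [h, hp i x x.2]
  map_br x y z h := by
    change Φ z = br' (Φ x) (Φ y)
    rw [h, hb x x.2 y y.2]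

end

namespace CompositionSuperalgebra

variable {k : Type*} [Field k]
variable {A : Type*} [AddCommGroup A] [Module k A] [Superspace k A]
variable {A' : Type*} [AddCommGroup A'] [Module k A'] [Superspace k A']
variable {S : CompositionSuperalgebra k A} {S' : CompositionSuperalgebra k A'}

/-- Bilinearity removes the homogeneity assumption, as needed for closure of the bracket on
arbitrary tensors. -/
theorem IsAssociative.t_mem_tri (hS : S.IsAssociative) (h2 : (2 : k) ≠ 0) (x y : A) (m : Fin 3) :
    theta k A m (S.t x y) ∈ S.tri := by
  induction x using homogeneous_induction (k := k) (A := A) with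
  | hadd x x' h h' => rw [map_add, LinearMap.add_apply, map_add]; exact add_mem h h'
  | h i x hx =>
  induction y using homogeneous_induction (k := k) (A := A) with
  | hadd y y' h h' => rw [map_add, map_add]; exact add_mem h h'
  | h j y hy =>
  exact hS.theta_mem_tri (S.t_mem_part hx hy) (hS.t_mem_tri_of_mem h2 hx hy) m

theorem IsAssociative.tensorT_mem_tri (hS : S.IsAssociative) (h2 : (2 : k) ≠ 0)
    (w w' : A ⊗[k] A') (m : Fin 3) : theta k A m (tensorT S S' w w') ∈ S.tri := by
  induction w with
  | zero => simp
  | add w v hw hv => rw [map_add, LinearMap.add_apply, map_add]; exact add_mem hw hv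
  | tmul a a' =>
  induction w' with
  | zero => simp
  | add w v hw hv => rw [map_add, map_add]; exact add_mem hw hv
  | tmul c c' =>
  have h : tensorT S S' (a ⊗ₜ[k] a') (c ⊗ₜ[k] c') =
      ∑ p : ZMod 2, ∑ p' : ZMod 2, ∑ q : ZMod 2, ∑ q' : ZMod 2,
        sgn k (p * p' + p * q' + q * q') •
          S'.b (pr k p' a') (pr k q' c') • S.t (pr k p a) (pr k q c) := by
    simp only [tensorT, LinearMap.sum_apply, LinearMap.smul_apply, LinearMap.compl₁₂_apply,
      TensorProduct.map_tmul, LinearMap.compr₂_apply, TensorProduct.map₂_apply_tmul,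
      LinearEquiv.coe_coe, TensorProduct.rid_tmul]
  rw [h]
  simp only [map_sum, map_smul]
  exact sum_mem fun _ _ => sum_mem fun _ _ => sum_mem fun _ _ => sum_mem fun _ _ =>
    Submodule.smul_mem _ _ (Submodule.smul_mem _ _ (hS.t_mem_tri h2 _ _ m))

theorem IsAssociative.tensorT'_mem_tri (hS' : S'.IsAssociative) (h2 : (2 : k) ≠ 0)
    (w w' : A ⊗[k] A') (m : Fin 3) : theta k A' m (tensorT' S S' w w') ∈ S'.tri := by
  induction w with
  | zero => simp
  | add w v hw hv => rw [map_add, LinearMap.add_apply, map_add]; exact add_mem hw hv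
  | tmul a a' =>
  induction w' with
  | zero => simp
  | add w v hw hv => rw [map_add, map_add]; exact add_mem hw hv
  | tmul c c' =>
  simp only [tensorT', LinearMap.sum_apply, LinearMap.smul_apply, LinearMap.compl₁₂_apply,
    LinearMap.lTensor_tmul, LinearMap.rTensor_tmul, LinearMap.compr₂_apply,
    TensorProduct.map₂_apply_tmul, LinearEquiv.coe_coe, map_sum, map_smul]
  exact sum_mem fun _ _ => sum_mem fun _ _ =>
    Submodule.smul_mem _ _ (Submodule.smul_mem _ _ (hS'.t_mem_tri h2 _ _ m))

theorem pr_mem_g (i : ZMod 2) {X : Ambient k A A'} (hX : X ∈ g S S') : pr k i X ∈ g S S' :=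
  ⟨pr_mem_tri hX.1 i, pr_mem_tri hX.2.1 i, trivial⟩

theorem superComm_mem_of_homogeneous {U : Submodule k (Fin 3 → (A →ₗ[k] A))}
    (hU : ∀ i, ∀ d ∈ U, (fun n => pr k i (d n)) ∈ U)
    (h : ∀ i j, ∀ d ∈ U, ∀ d' ∈ U, (∀ n, d n ∈ part k (A →ₗ[k] A) i) →
      (∀ n, d' n ∈ part k (A →ₗ[k] A) j) → (fun n => superComm (d n) (d' n)) ∈ U)
    {d d'} (hd : d ∈ U) (hd' : d' ∈ U) : (fun n => superComm (d n) (d' n)) ∈ U := by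
  have e : (fun n => superComm (d n) (d' n)) = ∑ i : ZMod 2, ∑ j : ZMod 2,
      fun n => superComm (pr k i (d n)) (pr k j (d' n)) := by
    funext n
    conv_lhs => rw [← pr_add (k := k) (d n), ← pr_add (k := k) (d' n)]
    simp only [sum_parity, map_add, LinearMap.add_apply, Pi.add_apply]
    abel
  rw [e]
  exact sum_mem fun i _ => sum_mem fun j _ => h i j _ (hU i d hd) _ (hU j d' hd')
    (fun n => pr_mem i (d n)) fun n => pr_mem j (d' n)

theorem bracket_mem_g (hS : S.IsAssociative) (hS' : S'.IsAssociative) (h2 : (2 : k) ≠ 0)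
    (hs : ∀ d ∈ S.tri, ∀ d' ∈ S.tri, (fun n => superComm (d n) (d' n)) ∈ S.tri)
    (hs' : ∀ d ∈ S'.tri, ∀ d' ∈ S'.tri, (fun n => superComm (d n) (d' n)) ∈ S'.tri)
    {X Y : Ambient k A A'} (hX : X ∈ g S S') (hY : Y ∈ g S S') : bracket S S' X Y ∈ g S S' :=
  ⟨add_mem (hs _ hX.1 _ hY.1) (sum_mem fun i _ => hS.tensorT_mem_tri h2 _ _ i),
    add_mem (hs' _ hX.2.1 _ hY.2.1) (sum_mem fun i _ => hS'.tensorT'_mem_tri h2 _ _ i), trivial⟩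

end CompositionSuperalgebra

namespace HurwitzSuperalgebra

variable {k : Type*} [Field k] [CharP k 3]
variable {A : Type*} [AddCommGroup A] [Module k A] [Superspace k A]
variable (C : HurwitzSuperalgebra k A)

/-- Closure is inherited from 𝔡𝔢𝔯 J: the supercommutator of `opD d` and `opD d'` is induced by a
superderivation, hence equals `opT P` with a triality triple in P, and injectivity of `opT`
identifies that triple. The statement is applied both to C and to B(1,2). -/
theorem superComm_mem_tri (d) (hd : d ∈ C.paraHurwitz.tri) (d') (hd' : d' ∈ C.paraHurwitz.tri) :
    (fun n => superComm (d n) (d' n)) ∈ C.paraHurwitz.tri := by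
  refine CompositionSuperalgebra.superComm_mem_of_homogeneous
    (fun i d hd => CompositionSuperalgebra.pr_mem_tri hd i) (fun i j d hd d' hd' h h' => ?_) hd hd'
  have := C.superComm_mem_derTJ (C.opD_mem_derTJ hd) (C.opD_mem_derTJ hd')
  rw [C.superComm_opD h h', mem_derTJ_iff] at this
  obtain ⟨P, hP, e⟩ := this
  have e := C.opT_injective (e.trans (C.opD_apply _))
  rwa [e] at hP

variable {V : Type*} [AddCommGroup V] [Module k V] (ω : SymplecticPlane k V)

theorem bracket_mem_g {X Y} (hX : X ∈ CompositionSuperalgebra.g ω.S12 C.paraHurwitz)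
    (hY : Y ∈ CompositionSuperalgebra.g ω.S12 C.paraHurwitz) :
    CompositionSuperalgebra.bracket ω.S12 C.paraHurwitz X Y ∈
      CompositionSuperalgebra.g ω.S12 C.paraHurwitz :=
  CompositionSuperalgebra.bracket_mem_g ω.B12.paraHurwitz_isAssociative C.paraHurwitz_isAssociative
    (two_ne_zero_of_char k) ω.B12.superComm_mem_tri C.superComm_mem_tri hX hY

omit [CharP k 3] in
theorem single_mem_span (n : Fin 3) (w : (k × OddSpace V) ⊗[k] A) :
    ((0, 0, Pi.single n w) : CompositionSuperalgebra.Ambient k (k × OddSpace V) A) ∈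
      Submodule.span k {X | ∃ i, C.IsGenerator ω i X} := by
  let f : ((k × OddSpace V) ⊗[k] A) →ₗ[k] CompositionSuperalgebra.Ambient k (k × OddSpace V) A :=
    LinearMap.inr k _ _ ∘ₗ LinearMap.inr k _ _ ∘ₗ LinearMap.single k (fun _ => (k × OddSpace V) ⊗[k] A) n
  change f w ∈ _
  induction w with
  | zero => rw [map_zero]; exact zero_mem _
  | add w v hw hv => rw [map_add]; exact add_mem hw hv
  | tmul x a =>
  induction a using homogeneous_induction (k := k) (A := A) with
  | hadd a b h h' => rw [TensorProduct.tmul_add, map_add]; exact add_mem h h'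
  | h i a ha =>
  have e : x = x.1 • (1, 0) + (0, x.2) := by ext <;> simp
  rw [e, TensorProduct.add_tmul, ← TensorProduct.smul_tmul', map_add, map_smul]
  exact add_mem (Submodule.smul_mem _ _ (Submodule.subset_span ⟨i, .one n a ha⟩))
    (Submodule.subset_span ⟨i + 1, .vec n x.2 a (by rwa [add_assoc, one_add_one, add_zero])⟩)

/-- This rests on `exists_delta_of_mem_tri`: the first triple is a constant δ_{σ,p}, and it splits
into its even part δ_{σ,0} and its odd part δ_{0,p}. -/
theorem g_le_span : CompositionSuperalgebra.g ω.S12 C.paraHurwitz ≤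
    Submodule.span k {X | ∃ i, C.IsGenerator ω i X} := by
  rintro ⟨D, E, w⟩ ⟨hD, hE, -⟩
  obtain ⟨q, hq, rfl⟩ := ω.exists_delta_of_mem_tri hD
  have e : ((fun _ => ω.delta q, E, w) : CompositionSuperalgebra.Ambient k (k × OddSpace V) A) =
      (fun _ => ω.delta (q.1, 0), 0, 0) + (fun _ => ω.delta (0, q.2), 0, 0) +
        (0, fun n => pr k 0 (E n), 0) + (0, fun n => pr k 1 (E n), 0) +
        ∑ n, (0, 0, Pi.single n (w n)) := by
    rw [show ∑ n, ((0, 0, Pi.single n (w n)) :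
        CompositionSuperalgebra.Ambient k (k × OddSpace V) A) = (0, 0, w) from ?_]
    · refine Prod.ext (funext fun n => ?_) (Prod.ext (funext fun n => ?_) ?_)
      · simpa using ω.delta_split q
      · simpa using (pr_add (k := k) (E n)).symm
      · simp
    · rw [Prod.ext_iff, Prod.ext_iff]
      simp [Prod.fst_sum, Prod.snd_sum, Finset.univ_sum_single]
  rw [e]
  refine add_mem (add_mem (add_mem (add_mem ?_ ?_) ?_) ?_) (sum_mem fun n _ =>
    C.single_mem_span ω n (w n))
  · exact Submodule.subset_span ⟨0, .even q.1 hq⟩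
  · exact Submodule.subset_span ⟨1, .odd q.2⟩
  · exact Submodule.subset_span ⟨0, .op _ (fun n => pr_mem 0 (E n))
      (CompositionSuperalgebra.pr_mem_tri hE 0)⟩
  · exact Submodule.subset_span ⟨1, .op _ (fun n => pr_mem 1 (E n))
      (CompositionSuperalgebra.pr_mem_tri hE 1)⟩

theorem isoMap_mem_g {X} (hX : X ∈ CompositionSuperalgebra.g ω.S12 C.paraHurwitz) :
    C.isoMap X ∈ SuperTriple.g ω C.derTJ := by
  have h : Submodule.span k {X | ∃ i, C.IsGenerator ω i X} ≤
      (SuperTriple.g ω C.derTJ).comap C.isoMap :=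
    Submodule.span_le.2 fun X ⟨i, hX⟩ => hX.isoMap_mem.1
  exact h (C.g_le_span ω hX)

theorem isoMap_pr (i : ZMod 2) {X : CompositionSuperalgebra.Ambient k (k × OddSpace V) A}
    (hX : X ∈ CompositionSuperalgebra.g ω.S12 C.paraHurwitz) :
    C.isoMap (pr k i X) = pr k i (C.isoMap X) :=
  map_pr_of_mem_span (s := {X | ∃ i, C.IsGenerator ω i X})
    (fun _ ⟨_, hX⟩ => map_pr_of_mem_part hX.mem_part hX.isoMap_mem.2 i)
    (C.g_le_span ω hX)

theorem isoMap_bracket {X Y : CompositionSuperalgebra.Ambient k (k × OddSpace V) A}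
    (hX : X ∈ CompositionSuperalgebra.g ω.S12 C.paraHurwitz)
    (hY : Y ∈ CompositionSuperalgebra.g ω.S12 C.paraHurwitz) :
    C.isoMap (CompositionSuperalgebra.bracket ω.S12 C.paraHurwitz X Y) =
      SuperTriple.bracket C.tripleTJ ω (C.isoMap X) (C.isoMap Y) :=
  map_bracket_of_mem_span (s := {X | ∃ i, C.IsGenerator ω i X})
    (fun _ ⟨_, hX⟩ _ ⟨_, hY⟩ => hX.mapsBracket hY) (C.g_le_span ω hX) (C.g_le_span ω hY)

end HurwitzSuperalgebra

end Supersquare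
end

/-! ### Bijectivity of the map and the two conclusions about 𝔤(S_{1,2}, S). -/

noncomputable section

namespace Supersquare

namespace HurwitzSuperalgebra

variable {k : Type*} [Field k] [CharP k 3]
variable {A : Type*} [AddCommGroup A] [Module k A] [Superspace k A]
variable (C : HurwitzSuperalgebra k A)
variable {V : Type*} [AddCommGroup V] [Module k V] (ω : SymplecticPlane k V)

omit [CharP k 3] [Superspace k A] in
-- The splitting (k1 ⊕ V) ⊗ S = S ⊕ V ⊗ S: the first part goes into 𝔡𝔢𝔯 J and the second into V ⊗ T.
theorem tensor_eta (w : (k × OddSpace V) ⊗[k] A) :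
    (1, 0) ⊗ₜ[k] TensorProduct.lid k A (LinearMap.rTensor A (LinearMap.fst k k (OddSpace V)) w) +
      LinearMap.rTensor A (LinearMap.inr k k (OddSpace V))
        (LinearMap.rTensor A (LinearMap.snd k k (OddSpace V)) w) = w := by
  induction w with
  | zero => simp
  | add w w' h h' =>
    simp only [map_add, TensorProduct.tmul_add]
    rw [add_add_add_comm, h, h']
  | tmul x a =>
    have e : (x.1 • (1, 0) + (0, x.2) : k × OddSpace V) = x := by ext <;> simp
    simp only [LinearMap.rTensor_tmul, LinearMap.fst_apply, LinearMap.snd_apply,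
      LinearMap.inr_apply, TensorProduct.lid_tmul]
    rw [← TensorProduct.smul_tmul, ← TensorProduct.add_tmul, e]

theorem tensor_TJ_eta (z : OddSpace V ⊗[k] C.TJ) :
    TensorProduct.rid k (OddSpace V) (LinearMap.lTensor (OddSpace V) C.cT z) ⊗ₜ[k] C.epsT +
      ∑ n, LinearMap.lTensor (OddSpace V) (C.ioT n)
        (LinearMap.lTensor (OddSpace V) (C.coT n) z) = z := by
  induction z with
  | zero => simp
  | add z z' h h' =>
    simp only [map_add, TensorProduct.add_tmul, Finset.sum_add_distrib]
    rw [add_add_add_comm, h, h']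
  | tmul v x =>
    simp only [LinearMap.lTensor_tmul, TensorProduct.rid_tmul, TensorProduct.smul_tmul,
      ← TensorProduct.tmul_sum, ← TensorProduct.tmul_add, mkT_eta]

theorem lTensor_cT_map (n : Fin 3) (w : (k × OddSpace V) ⊗[k] A) :
    LinearMap.lTensor (OddSpace V) C.cT
      (TensorProduct.map (LinearMap.snd k k (OddSpace V)) (C.ioT n) w) = 0 := by
  induction w with
  | zero => simp
  | add w w' h h' => rw [map_add, map_add, h, h', add_zero]
  | tmul x a => simp [cT_ioT]

theorem lTensor_coT_map (m n : Fin 3) (w : (k × OddSpace V) ⊗[k] A) :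
    LinearMap.lTensor (OddSpace V) (C.coT m)
      (TensorProduct.map (LinearMap.snd k k (OddSpace V)) (C.ioT n) w) =
      if m = n then LinearMap.rTensor A (LinearMap.snd k k (OddSpace V)) w else 0 := by
  induction w with
  | zero => simp
  | add w w' h h' => rw [map_add, map_add, h, h']; split_ifs <;> simp
  | tmul x a =>
    rw [TensorProduct.map_tmul, LinearMap.lTensor_tmul, coT_ioT]
    split_ifs <;> simp

theorem opT_eq (P) : C.opT P = C.opD P.1 + ∑ n, C.opN n (P.2 n) := by
  simp only [opD_apply, opN_apply, ← map_sum, ← map_add]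
  refine C.opT_ext ?_ ?_
  · simp [Prod.fst_sum]
  · simp [Prod.snd_sum, Finset.univ_sum_single]

/-- The three components of the image separate the data: the first is σ; the second is `opT` of the
triple on S and of the 1 ⊗ S parts, and `opT` is injective; the third yields p through the
coefficient of ε and the V ⊗ S parts through the ι_n components. -/
theorem isoMap_injective {X} (hX : X ∈ CompositionSuperalgebra.g ω.S12 C.paraHurwitz)
    (h : C.isoMap X = 0) : X = 0 := by
  obtain ⟨D, E, w⟩ := X
  obtain ⟨q, -, rfl⟩ := ω.exists_delta_of_mem_tri hX.1
  rw [isoMap_apply] at h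
  have h1 := congrArg (fun Y => Y.1) h
  have h2 := congrArg (fun Y => Y.2.1) h
  have h3 := congrArg (fun Y => Y.2.2) h
  dsimp only at h1 h2 h3
  have hσ : q.1 = 0 := LinearMap.ext fun v => by
    simpa [SymplecticPlane.delta_apply] using congrArg (fun f => f v) h1
  have hP := C.opT_injective (((C.opT_eq (E, fun n => TensorProduct.lid k A
    (LinearMap.rTensor A (LinearMap.fst k k (OddSpace V)) (w n)))).trans h2).trans
      (map_zero C.opT).symm)
  have hp : q.2 = 0 := by
    have := congrArg (fun z => TensorProduct.rid k _ (LinearMap.lTensor (OddSpace V) C.cT z)) h3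
    simp only [map_add, map_neg, map_sum, lTensor_cT_map, LinearMap.lTensor_tmul, cT_epsT,
      TensorProduct.rid_tmul, Finset.sum_const_zero, add_zero, one_smul] at this
    simpa [SymplecticPlane.delta_apply] using this
  have hw : w = 0 := funext fun n => by
    have e1 := congrFun (congrArg Prod.snd hP) n
    have e2 := congrArg (LinearMap.lTensor (OddSpace V) (C.coT n)) h3
    simp only [map_add, map_neg, map_sum, lTensor_coT_map, LinearMap.lTensor_tmul, coT_epsT,
      TensorProduct.tmul_zero, neg_zero, zero_add, Finset.sum_ite_eq, Finset.mem_univ, if_true,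
      Prod.snd_zero, map_zero] at e2
    dsimp only at e1
    rw [← tensor_eta (w n), e1, e2]
    simp
  have hq : q = 0 := Prod.ext hσ hp
  have hE : E = 0 := congrArg Prod.fst hP
  rw [hq, hw, hE, map_zero]
  rfl

theorem isoMap_surjective {Y} (hY : Y ∈ SuperTriple.g ω C.derTJ) :
    ∃ X ∈ CompositionSuperalgebra.g ω.S12 C.paraHurwitz, C.isoMap X = Y := by
  obtain ⟨σ, δ, z⟩ := Y
  obtain ⟨hσ, hδ, -⟩ := hY
  obtain ⟨P, hP, rfl⟩ := C.mem_derTJ_iff.1 hδ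
  set p := TensorProduct.rid k (OddSpace V) (LinearMap.lTensor (OddSpace V) C.cT z) with hp
  -- The preimage reverses the splitting: `p` is the coefficient of ε in z, with the sign built into
  -- the map, the S³ parameters of the derivation fill 1 ⊗ S, and the ι_n components of z fill V ⊗
  -- S.
  refine ⟨(fun _ => ω.delta (σ, -p), P.1, fun n => (1, 0) ⊗ₜ[k] P.2 n +
    LinearMap.rTensor A (LinearMap.inr k k (OddSpace V))
      (LinearMap.lTensor (OddSpace V) (C.coT n) z)),
    ⟨ω.delta_mem_tri (q := (σ, -p)) hσ, hP, trivial⟩, ?_⟩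
  have e1 : ∀ u : OddSpace V ⊗[k] A, LinearMap.rTensor A (LinearMap.fst k k (OddSpace V))
      (LinearMap.rTensor A (LinearMap.inr k k (OddSpace V)) u) = 0 := fun u => by
    rw [← LinearMap.rTensor_comp_apply, LinearMap.fst_comp_inr, LinearMap.rTensor_zero,
      LinearMap.zero_apply]
  have e2 : ∀ n, ∀ u : OddSpace V ⊗[k] A,
      TensorProduct.map (LinearMap.snd k k (OddSpace V)) (C.ioT n)
      (LinearMap.rTensor A (LinearMap.inr k k (OddSpace V)) u) =
        LinearMap.lTensor (OddSpace V) (C.ioT n) u := fun n u => by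
    rw [LinearMap.map_rTensor, LinearMap.snd_comp_inr]
    rfl
  rw [isoMap_apply]
  refine Prod.ext ?_ (Prod.ext ?_ ?_)
  · ext v; simp [SymplecticPlane.delta_apply]
  · dsimp only
    rw [opT_eq]
    simp [e1]
  · dsimp only
    conv_rhs => rw [← C.tensor_TJ_eta z]
    simp [e2, SymplecticPlane.delta_apply, TensorProduct.neg_tmul, hp]

/-- The Jacobi identity of 𝔤(S_{1,2}, S) is not computed: it is pulled back from 𝔤(J) along an
injective even map that preserves the brackets. -/
theorem isLieSuperalgebra_g : IsLieSuperalgebra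
    (CompositionSuperalgebra.bracket ω.S12 C.paraHurwitz)
    (CompositionSuperalgebra.g ω.S12 C.paraHurwitz) :=
  IsLieSuperalgebra.of_injective (C.isZ2GradedLieSuperalgebra_gJ ω).toIsLieSuperalgebra
    (C.isoMap (V := V)) (fun _ => C.isoMap_mem_g ω) (fun _ => C.isoMap_injective ω)
    (fun i _ => C.isoMap_pr ω i) (fun _ hX _ => C.isoMap_bracket ω hX)
    (fun i _ => CompositionSuperalgebra.pr_mem_g i) fun _ hX _ => C.bracket_mem_g ω hX

/-- The isomorphism `𝔤(S_{1,2}, S) ≅ 𝔤(J)`. -/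
def iso : LieSuperIso (CompositionSuperalgebra.bracket ω.S12 C.paraHurwitz)
    (CompositionSuperalgebra.g ω.S12 C.paraHurwitz) (SuperTriple.bracket C.tripleTJ ω)
    (SuperTriple.g ω C.derTJ) :=
  LieSuperIso.ofBijOn (C.isoMap (V := V)) (fun _ => C.isoMap_mem_g ω)
    (fun _ => C.isoMap_injective ω) (fun _ => C.isoMap_surjective ω)
    (fun i _ => C.isoMap_pr ω i) fun _ hX _ => C.isoMap_bracket ω hX

end HurwitzSuperalgebra

end Supersquare
end

theorem mainTheorem3 {k : Type*} [Field k] [CharP k 3]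
    {V : Type*} [AddCommGroup V] [Module k V] (ω : Supersquare.SymplecticPlane k V)
    {A : Type*} [AddCommGroup A] [Module k A] [Supersquare.Superspace k A]
    (C : Supersquare.HurwitzSuperalgebra k A) :
    C.tripleTJ.IsOrthosymplectic ∧
    C.tripleTJ.IsSimple ∧
    (∃ ρ : C.derJ ≃ₗ[k] C.derTJ, ∀ d : C.derJ,
      C.Induces (d : C.J →ₗ[k] C.J) (ρ d : C.TJ →ₗ[k] C.TJ)) ∧
    C.tripleTJ.IsAdmissible C.derTJ ∧
    Supersquare.IsLieSuperalgebra
      (Supersquare.CompositionSuperalgebra.bracket ω.S12 C.paraHurwitz)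
      (Supersquare.CompositionSuperalgebra.g ω.S12 C.paraHurwitz) ∧
    Supersquare.IsZ2GradedLieSuperalgebra
      (Supersquare.SuperTriple.bracket C.tripleTJ ω)
      (Supersquare.SuperTriple.g ω C.derTJ)
      (Supersquare.SuperTriple.gZero ω C.derTJ)
      (Supersquare.SuperTriple.gOne k V C.TJ) ∧
    Nonempty (Supersquare.LieSuperIso
      (Supersquare.CompositionSuperalgebra.bracket ω.S12 C.paraHurwitz)
      (Supersquare.CompositionSuperalgebra.g ω.S12 C.paraHurwitz)
      (Supersquare.SuperTriple.bracket C.tripleTJ ω)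
      (Supersquare.SuperTriple.g ω C.derTJ)) :=
  ⟨C.tripleTJ_isOrthosymplectic, C.tripleTJ_isSimple, C.exists_derJ_equiv,
    C.tripleTJ_isAdmissible, C.isLieSuperalgebra_g ω, C.isZ2GradedLieSuperalgebra_gJ ω,
    ⟨C.iso ω⟩⟩
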